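/- Identify the plane with coordinates $(x,y)$, let $B_r$ be the disc of radius $r$ about $0$, $B_r^-=\{(x,y)\in B_r: y<0\}$ and $T=\{y=0\}\cap\overline{B_1^-}$. Let $\rho_+\neq\rho_-$ be nonnegative constants (the densities of the two fluids; typically $\rho_+<\rho_-$). For a function $v$ on a domain $U$ put $\Omega^+(v)=\operatorname{int}\{v\ge 0\}$, $\Omega^-(v)=\{v<0\}$, and let $\chi^\pm(v)$ be the characteristic functions of these sets. Let $u\in H^1_{\rm loc}(B_1^-\cup T)\cap C^0(B_1^-\cup T)$ be a variational solution of the gravity current problem with Bernoulli constant $Q=0$, i.e. $u\le 0$ in $B_1^-$, $u=0$ on $T$, $u\in C^2(\Omega^-(u))$, and $$\int_{B_1^-}\Big(|\nabla u|^2\,\nabla\cdot\phi-2D\phi[\nabla u,\nabla u]-(\rho_+\chi^+(u)+\rho_-\chi^-(u))\,\nabla\cdot(y\phi)\Big)\,dx\,dy=0$$ for every compactly supported $C^1$ vector field $\phi$ on $B_1^-\cup T$ that is tangential to $T$ on $T$. Let $\Gamma(u)=\partial\Omega^+(u)\setminus\partial B_1$, and assume that * $0\in\Gamma(u)$, and in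 a neighborhood of $0$ the set $\Gamma(u)$ is a union of finitely many Lipschitz curves (bi-Lipschitz images of compact intervals); * the two phases $\Omega^\pm(u)$ fill $B_\delta^-$ up to a Lebesgue null set, for some $\delta>0$; * the Lipschitz seminorm of $u$ on $B_r^-$ is $O(r^{1/2})$ as $r\searrow0$. For $r>0$ small let $$\mathcal M_{\rm gc}(u;r)=\frac1{r^3}\int_{B_r^-}\big(|\nabla u|^2-y(\rho_+\chi^+(u)+\rho_-\chi^-(u))\big)\,dx\,dy-\frac{3}{2r^4}\int_{\partial B_r^-}u^2\,d\mathcal H^1 .$$ For a sequence $r_m\to0$ of positive radii let $u_m=r_m^{-3/2}u(r_m\,\cdot)$. A blowup limit of $u$ along $(r_m)$ is a triple $(u_0,\chi_0^+,\chi_0^-)$ such that $u_m\to u_0$ in $H^1_{\rm loc}$ and in $C^{\varepsilon}_{\rm loc}$ for all $\varepsilon\in(0,1)$, and $\chi^\pm(u_m)\to\chi_0^\pm$ in $L^1_{\rm loc}$, on the closed lower half-plane. Let $u_*$ be the Stokes corner, which in polar coordinates is $u_*=-\frac{\sqrt2}{3}r^{3/2}\cos\big(\frac32(\theta-\frac{3\pi}2)\big)$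 for $\frac{7\pi}6<\theta<\frac{11\pi}6$ and $u_*=0$ otherwise, and let $A_\alpha$ be the counterclockwise rotation by $\alpha$. Every sequence of positive radii $r_m\to0$ has a subsequence along which a blowup limit exists, and for every blowup limit exactly one of the following four alternatives holds, where $\mathcal M_{\rm gc}(u;0+)=\lim_{r\searrow0}\mathcal M_{\rm gc}(u;r)$ exists and its four values below are pairwise distinct: * (A1) the fluid of density $\rho_-$ has full density: $\mathcal M_{\rm gc}(u;0+)=\frac{2\rho_-}3$, $u_0=0$, $\chi_0^+\equiv0$, $\chi_0^-\equiv1$; * (A2) the fluid of density $\rho_+$ has full density: $\mathcal M_{\rm gc}(u;0+)=\frac{2\rho_+}3$, $u_0=0$, $\chi_0^+\equiv1$, $\chi_0^-\equiv0$; * (A3) Stokes corner: $\mathcal M_{\rm gc}(u;0+)=\big(\frac23-\frac1{\sqrt3}\big)\rho_++\frac{\rho_-}{\sqrt3}$, $u_0=\sqrt{|\rho_+-\rho_-|}\;u_*$, $\chi_0^\pm=\chi^\pm(u_0)$; * (A4) Stokes corner rotated by $30^\circ$: $\mathcal M_{\rm gc}(u;0+)=\frac{\rho_+}6+\frac{\rho_-}2$,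 $u_0=3^{1/4}\sqrt{|\rho_+-\rho_-|}\;u_*\circ A_{\pi/6}$ or $u_0=3^{1/4}\sqrt{|\rho_+-\rho_-|}\;u_*\circ A_{\pi/6}^{-1}$, $\chi_0^\pm=\chi^\pm(u_0)$. Moreover, if $\Omega^+(u)\cap N$ is connected for some neighborhood $N$ of $0$, then (A3) does not occur for any blowup limit. -/

import Mathlib

open Set Filter Topology MeasureTheory
open scoped ContDiff

noncomputable section

namespace GravityCurrent

/-! The plane is modelled by `ℂ`, with `x = z.re`, `y = z.im`, the Euclidean norm and inner product,
and Lebesgue measure. -/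

/-- The open lower half-ball of radius `r` centred at the origin. -/
def halfBall (r : ℝ) : Set ℂ := {z | ‖z‖ < r ∧ z.im < 0}

/-- The rigid lid: the flat part of the boundary of the unit lower half-ball. -/
def lid : Set ℂ := {z | ‖z‖ ≤ 1 ∧ z.im = 0}

/-- The open lower half-plane. -/
def lowerHalf : Set ℂ := {z | z.im < 0}

/-- The phase `Ω⁺(v)` of a function `v` on the domain `U`: the interior of `{v ≥ 0}`. -/
def phasePlus (U : Set ℂ) (v : ℂ → ℝ) : Set ℂ := interior {z | z ∈ U ∧ 0 ≤ v z}

/-- The phase `Ω⁻(v)` of a function `v` on the domain `U`: the set `{v < 0}`. -/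
def phaseMinus (U : Set ℂ) (v : ℂ → ℝ) : Set ℂ := {z | z ∈ U ∧ v z < 0}

/-- The characteristic function `χ⁺(v)` of `Ω⁺(v)`. -/
def chiPlus (U : Set ℂ) (v : ℂ → ℝ) : ℂ → ℝ := (phasePlus U v).indicator (fun _ => 1)

/-- The characteristic function `χ⁻(v)` of `Ω⁻(v)`. -/
def chiMinus (U : Set ℂ) (v : ℂ → ℝ) : ℂ → ℝ := (phaseMinus U v).indicator (fun _ => 1)

/-- The free boundary `Γ(u) = ∂Ω⁺(u) \ ∂B₁` of a function `u` on the unit lower half-ball. -/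
def freeBoundary (u : ℂ → ℝ) : Set ℂ :=
  frontier (phasePlus (halfBall 1) u) \ Metric.sphere (0 : ℂ) 1

/-- The vector field `g` is the weak (distributional) gradient of `u` on the open set `U`. -/
def HasWeakGradient (U : Set ℂ) (u : ℂ → ℝ) (g : ℂ → ℂ) : Prop :=
  LocallyIntegrableOn u U ∧ LocallyIntegrableOn g U ∧
    ∀ ζ : ℂ → ℝ, ContDiff ℝ ∞ ζ → HasCompactSupport ζ → tsupport ζ ⊆ U →
      ∀ v : ℂ, ∫ z in U, u z * fderiv ℝ ζ z v = - ∫ z in U, inner ℝ (g z) v * ζ z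

/-- The divergence of a planar vector field. -/
def divergence (φ : ℂ → ℂ) (z : ℂ) : ℝ :=
  (fderiv ℝ φ z 1).re + (fderiv ℝ φ z Complex.I).im

/-- `(u, Q)`, with weak gradient `g = ∇u`, is a domain variational solution of the gravity current
problem `Δu = 0` in `Ω⁻(u)`, `|∇u|² = (ρ₊ - ρ₋)(y + Q)` on the free boundary, `u = 0` on the lid,
in the unit lower half-ball, with densities `ρ₊ = ρp` and `ρ₋ = ρm`. -/
structure IsVariationalSolution (ρp ρm Q : ℝ) (u : ℂ → ℝ) (g : ℂ → ℂ) : Prop where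
  Q_nonpos : Q ≤ 0
  continuousOn : ContinuousOn u (halfBall 1 ∪ lid)
  weakGradient : HasWeakGradient (halfBall 1) u g
  /-- The gradient is square integrable on compact sets, up to the lid. -/
  gradient_memLp : ∀ K : Set ℂ, IsCompact K → K ⊆ {z | ‖z‖ < 1 ∧ z.im ≤ 0} →
    MemLp g 2 (volume.restrict K)
  nonpos : ∀ z ∈ halfBall 1, u z ≤ 0
  contDiffOn : ContDiffOn ℝ 2 u (phaseMinus (halfBall 1) u)
  eq_zero_on_lid : ∀ z ∈ lid, u z = 0
  /-- Criticality with respect to domain variations tangential to the lid. -/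
  critical : ∀ φ : ℂ → ℂ, ContDiff ℝ 1 φ → HasCompactSupport φ → tsupport φ ⊆ Metric.ball 0 1 →
    (∀ z : ℂ, z.im = 0 → (φ z).im = 0) →
    ∫ z in halfBall 1,
      (‖g z‖ ^ 2 * divergence φ z - 2 * inner ℝ (g z) (fderiv ℝ φ z (g z))
        - (ρp * chiPlus (halfBall 1) u z + ρm * chiMinus (halfBall 1) u z)
            * divergence (fun w => (w.im + Q) • φ w) z) = 0

/-- The decay `[u]_{Lip; B_r⁻} = O(r^{1/2})` as `r ↘ 0`. -/
def LipschitzDecay (u : ℂ → ℝ) : Prop :=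
  ∃ C r₀ : ℝ, 0 < r₀ ∧ ∀ r : ℝ, 0 < r → r < r₀ → ∀ z ∈ halfBall r, ∀ w ∈ halfBall r,
    |u z - u w| ≤ C * r ^ (1 / 2 : ℝ) * ‖z - w‖

/-- A Lipschitz curve: a bi-Lipschitz image of a compact interval. Every (rotated) Lipschitz graph
over a compact interval is of this kind. -/
def IsLipschitzCurve (S : Set ℂ) : Prop :=
  ∃ (γ : ℝ → ℂ) (c C : ℝ), 0 < c ∧
    (∀ s ∈ Icc (0 : ℝ) 1, ∀ t ∈ Icc (0 : ℝ) 1,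
      c * |s - t| ≤ ‖γ s - γ t‖ ∧ ‖γ s - γ t‖ ≤ C * |s - t|) ∧
    S = γ '' Icc (0 : ℝ) 1

/-- Near the origin, the free boundary is a union of finitely many Lipschitz curves. -/
def FreeBoundaryLipschitzNearZero (u : ℂ → ℝ) : Prop :=
  ∃ δ : ℝ, 0 < δ ∧ ∃ (n : ℕ) (S : Fin n → Set ℂ), (∀ i, IsLipschitzCurve (S i)) ∧
    freeBoundary u ∩ Metric.ball 0 δ = (⋃ i, S i) ∩ Metric.ball 0 δ

/-- Near the origin, the two phases fill the domain up to a Lebesgue null set. -/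
def PhasesFillNearZero (u : ℂ → ℝ) : Prop :=
  ∃ δ : ℝ, 0 < δ ∧
    volume (halfBall δ \ (phasePlus (halfBall 1) u ∪ phaseMinus (halfBall 1) u)) = 0

/-- The boundary adjusted energy `M_gc(u; r)` in the stagnation case `Q = 0`, where `g = ∇u`:
`r⁻³ ∫_{B_r⁻} (|∇u|² - y (ρ₊ χ⁺ + ρ₋ χ⁻)) - (3/2) r⁻⁴ ∫_{∂B_r⁻} u² dℋ¹`.
The boundary integral is written by arc length on the circular part `{r e^{iθ} : -π ≤ θ ≤ 0}`;
the flat part of the boundary does not contribute, because `u` vanishes there. -/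
def energyM (ρp ρm : ℝ) (u : ℂ → ℝ) (g : ℂ → ℂ) (r : ℝ) : ℝ :=
  (1 / r ^ 3) * (∫ z in halfBall r,
      (‖g z‖ ^ 2 - z.im * (ρp * chiPlus (halfBall 1) u z + ρm * chiMinus (halfBall 1) u z)))
    - (3 / 2) * ((1 / r ^ 4) *
      ∫ θ in (-Real.pi)..0, u ((r : ℂ) * Complex.exp (θ * Complex.I)) ^ 2 * r)

/-- The blowup rescaling `u_r = u(r ·) / r^{3/2}`, defined on the half-ball of radius `1 / r`. -/
def rescale (u : ℂ → ℝ) (r : ℝ) (z : ℂ) : ℝ := u ((r : ℂ) * z) / r ^ (3 / 2 : ℝ)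

/-- The gradient `∇u_r = ∇u(r ·) / r^{1/2}` of the rescaling, where `g = ∇u`. -/
def rescaleGrad (g : ℂ → ℂ) (r : ℝ) (z : ℂ) : ℂ := (r ^ (-(1 / 2) : ℝ)) • g ((r : ℂ) * z)

/-- `(u₀, χ₀⁺, χ₀⁻)` is the blowup limit of `u` (with `g = ∇u`) along the radii `r_m → 0+`: on
compact subsets of the closed lower half-plane, `u_m → u₀` in `H¹` and in `C^ε` for all
`0 < ε < 1`, and `χ^±(u_m) → χ₀^±` in `L¹`. -/
structure IsBlowupLimit (u : ℂ → ℝ) (g : ℂ → ℂ) (r : ℕ → ℝ) (u₀ χp χm : ℂ → ℝ) : Prop where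
  r_pos : ∀ m, 0 < r m
  r_tendsto : Tendsto r atTop (𝓝 0)
  holder : ∀ ε : ℝ, 0 < ε → ε < 1 → ∀ K : Set ℂ, IsCompact K → K ⊆ {z | z.im ≤ 0} →
    ∀ δ : ℝ, 0 < δ → ∀ᶠ m in atTop,
      (∀ z ∈ K, |rescale u (r m) z - u₀ z| ≤ δ) ∧
      (∀ z ∈ K, ∀ w ∈ K,
        |(rescale u (r m) z - u₀ z) - (rescale u (r m) w - u₀ w)| ≤ δ * ‖z - w‖ ^ ε)
  /-- The `L²` convergence of `u_m` itself is contained in the uniform convergence. -/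
  gradient : ∃ g₀ : ℂ → ℂ, HasWeakGradient lowerHalf u₀ g₀ ∧
    ∀ K : Set ℂ, IsCompact K → K ⊆ {z | z.im ≤ 0} →
      Tendsto (fun m => ∫⁻ z in K, ‖rescaleGrad g (r m) z - g₀ z‖ₑ ^ 2) atTop (𝓝 0)
  plus_integrable : LocallyIntegrableOn χp {z | z.im ≤ 0}
  minus_integrable : LocallyIntegrableOn χm {z | z.im ≤ 0}
  plus : ∀ K : Set ℂ, IsCompact K → K ⊆ {z | z.im ≤ 0} →
    Tendsto (fun m => ∫⁻ z in K,
      ‖chiPlus (halfBall (1 / r m)) (rescale u (r m)) z - χp z‖ₑ) atTop (𝓝 0)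
  minus : ∀ K : Set ℂ, IsCompact K → K ⊆ {z | z.im ≤ 0} →
    Tendsto (fun m => ∫⁻ z in K,
      ‖chiMinus (halfBall (1 / r m)) (rescale u (r m)) z - χm z‖ₑ) atTop (𝓝 0)

/-- The Stokes corner stream function: `-(√2/3) |z|^{3/2} cos((3/2)(θ - 3π/2))` in the sector
`7π/6 < θ < 11π/6`, and zero elsewhere. Here `Complex.arg z = θ - 2π` in that sector. -/
def stokesCorner (z : ℂ) : ℝ :=
  if -(5 * Real.pi / 6) < z.arg ∧ z.arg < -(Real.pi / 6) then
    -(Real.sqrt 2 / 3) * ‖z‖ ^ (3 / 2 : ℝ) * Real.cos (3 / 2 * (z.arg + Real.pi / 2))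
  else 0

/-- Counterclockwise rotation of the plane about the origin by the angle `α`. -/
def rotation (α : ℝ) (z : ℂ) : ℂ := Complex.exp (α * Complex.I) * z

/-- The four densities. -/
def density (ρp ρm : ℝ) : Fin 4 → ℝ :=
  ![2 * ρm / 3,
    2 * ρp / 3,
    (2 / 3 - 1 / Real.sqrt 3) * ρp + ρm / Real.sqrt 3,
    ρp / 6 + ρm / 2]

/-- `u₀` is the function `v` on the closed lower half-plane, and `χ₀^± = χ^±(v)` almost everywhere
in the lower half-plane. -/
def IsProfile (v u₀ χp χm : ℂ → ℝ) : Prop :=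
  (∀ z : ℂ, z.im ≤ 0 → u₀ z = v z) ∧
    ∀ᵐ z ∂(volume.restrict lowerHalf), χp z = chiPlus lowerHalf v z ∧ χm z = chiMinus lowerHalf v z

/-- The shape of the blowup limit in each of the four alternatives. -/
def limitShape (ρp ρm : ℝ) (u₀ χp χm : ℂ → ℝ) : Fin 4 → Prop :=
  ![(∀ z : ℂ, z.im ≤ 0 → u₀ z = 0) ∧
      ∀ᵐ z ∂(volume.restrict lowerHalf), χp z = 0 ∧ χm z = 1,
    (∀ z : ℂ, z.im ≤ 0 → u₀ z = 0) ∧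
      ∀ᵐ z ∂(volume.restrict lowerHalf), χp z = 1 ∧ χm z = 0,
    IsProfile (fun z => Real.sqrt |ρp - ρm| * stokesCorner z) u₀ χp χm,
    IsProfile (fun z => (3 : ℝ) ^ (1 / 4 : ℝ) * Real.sqrt |ρp - ρm| *
        stokesCorner (rotation (Real.pi / 6) z)) u₀ χp χm ∨
      IsProfile (fun z => (3 : ℝ) ^ (1 / 4 : ℝ) * Real.sqrt |ρp - ρm| *
        stokesCorner (rotation (-(Real.pi / 6)) z)) u₀ χp χm]

/-- The alternative with index `i` (in the order: `Ω⁻` has full density, `Ω⁺` has full density,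
Stokes corner, rotated Stokes corner): the right limit `M_gc(u; 0+)` exists and is the `i`-th
density, and the blowup limit has the `i`-th shape. -/
def BlowupAlternative (ρp ρm : ℝ) (u : ℂ → ℝ) (g : ℂ → ℂ) (u₀ χp χm : ℂ → ℝ) (i : Fin 4) : Prop :=
  Tendsto (energyM ρp ρm u g) (𝓝[>] 0) (𝓝 (density ρp ρm i)) ∧ limitShape ρp ρm u₀ χp χm i

end GravityCurrent

end

open GravityCurrent

/-! The proof follows the solution `u` under the scaling `u ↦ u(r ·) / r^{3/2}`. The class `HalfSol`
of nonpositive functions on half-discs that vanish on the lid, are harmonic where they are negative,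
and satisfy the Lipschitz bound with a fixed constant is invariant under this scaling, and so is
criticality for domain variations (`IsCritical`).

**Monotonicity.** The boundary adjusted energy is used in the averaged form `smoothEnergy`, in which
no traces on circles appear. Its derivative is a combination of the first variation along the radial
field `κ(|z|² / l²) z`, the energy identity, and the divergence theorem for `w² ψ z`; these three
integrals vanish, and what remains is the integral of a weight times `(∇w · z - (3/2) w)²`
(`HalfSol.integral_smoothEnergy'`). Hence the averaged energy has a limit at the origin, and blowup
limits are homogeneous of degree `3/2` (`inner_gradient_of_isHalfLimit`).

**Compactness.** A sequence of rescalings converges locally uniformly along a subsequence. The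
gradients converge strongly in `L²`, since by the energy identity the Dirichlet integrals are
continuous (`IsHalfLimit.tendsto_integral_norm_sub`). The free boundary is a union of Lipschitz
curves, so in the disc of radius `ρ` it is covered by `O(n)` discs of radius `O(ρ / n)`, with
constants that do not depend on `ρ`; this forces the phases to converge almost everywhere along a
subsequence (`exists_subseq_isOpen`). Thus blowup limits exist (`IsLocalSol.exists_isBlowupLimit`),
and they are critical points for their own densities (`IsBlowupLimit.isConeSol`).

**Classification.** On the unit circle, a homogeneous limit solves `h'' = -(9/4) h` where it is
negative, so each component of its negativity set is a sector of opening `2π/3`, and the half-plane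
has room for only one (`eq_zero_or_eq_sectorFun`). On a convex open set where the limit vanishes,
criticality says that the density has vanishing distributional derivatives, so a single fluid is
present (`IsConeSol.ae_const`). Angular domain variations give the jump condition
`(9/4) β² |z| = (ρ - ρ₋) y` on each side of the sector that is interior to the half-plane
(`IsSectorial.jump`). It determines the position of the sector, the amplitude and the density
beyond the sides (`IsSectorial.classify`): if both sides are interior, the corner is symmetric; otherwise one
of them lies on the lid, and the corner is rotated by `30°`.

**Uniqueness of the alternative.** For each of the four shapes both energies are multiples of the
same number `density ρ₊ ρ₋ i`, because the gradient and the boundary term cancel by homogeneity, and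
the four numbers are distinct. As the averaged energy has a limit, all blowup limits have the same
index, and then the boundary adjusted energy itself converges, since it converges along a
subsequence of every sequence of radii (`IsLocalSol.exists_limitShape`).

**Connected upper phase.** If the blowup limits were the symmetric corner, then `Ω⁺` would have points
on both sides of the corner. If `Ω⁺` is connected, these are joined by a curve in `Ω⁺`, which
together with two vertical segments separates a part of `{u < 0}` near the origin from the circular
boundary; the separation is proved with continuous logarithms (`not_disjoint_of_separating`). The
minimum principle forbids this (`IsVariationalSolution.exists_mem_component`,
`IsVariationalSolution.not_forall_stokesCorner`). -/


noncomputable section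

namespace GravityCurrent

open scoped ComplexConjugate

/-! ### Divergence and compactly supported fields -/

theorem map_eq_re_im (L : ℂ →L[ℝ] ℝ) (w : ℂ) : L w = w.re * L 1 + w.im * L Complex.I := by
  have h : w = w.re • (1 : ℂ) + w.im • Complex.I := by
    simp [Complex.re_add_im]
  conv_lhs => rw [h, map_add, map_smul, map_smul]
  rfl

theorem divergence_smul {a : ℂ → ℝ} {X : ℂ → ℂ} {z : ℂ} (ha : DifferentiableAt ℝ a z)
    (hX : DifferentiableAt ℝ X z) :
    divergence (fun w => a w • X w) z = fderiv ℝ a z (X z) + a z * divergence X z := by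
  have h := (ha.hasFDerivAt.smul hX.hasFDerivAt).fderiv
  have h' : fderiv ℝ (fun w => a w • X w) z = _ := h
  unfold divergence
  rw [h', map_eq_re_im (fderiv ℝ a z) (X z)]
  simp
  ring

theorem divergence_eq_zero_of_notMem_tsupport {X : ℂ → ℂ} {z : ℂ} (hz : z ∉ tsupport X) :
    divergence X z = 0 := by
  have : fderiv ℝ X z = 0 := by
    by_contra h
    exact hz (support_fderiv_subset ℝ h)
  simp [divergence, this]

theorem contDiff_of_tsupport {E F : Type*} [NormedAddCommGroup E] [NormedSpace ℝ E]
    [NormedAddCommGroup F] [NormedSpace ℝ F] {n : WithTop ℕ∞} {f : E → F}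
    (h : ∀ z ∈ tsupport f, ContDiffAt ℝ n f z) : ContDiff ℝ n f := by
  refine contDiff_iff_contDiffAt.2 fun z => ?_
  by_cases hz : z ∈ tsupport f
  · exact h z hz
  · have : f =ᶠ[𝓝 z] fun _ => 0 := notMem_tsupport_iff_eventuallyEq.1 hz
    exact contDiffAt_const.congr_of_eventuallyEq this

theorem integral_fderiv_eq_zero {f : ℂ → ℝ} (hf : ContDiff ℝ 1 f) (hc : HasCompactSupport f)
    (v : ℂ) : ∫ z, fderiv ℝ f z v = 0 := by
  have hd : Continuous fun z => fderiv ℝ f z v :=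
    (hf.continuous_fderiv (by simp)).clm_apply continuous_const
  have h := integral_mul_fderiv_eq_neg_fderiv_mul_of_integrable (μ := (volume : Measure ℂ))
    (f := fun _ : ℂ => (1 : ℝ)) (g := f) (v := v) (by simp)
    (by simpa using hd.integrable_of_hasCompactSupport (hc.fderiv_apply ℝ v))
    (by simpa using hf.continuous.integrable_of_hasCompactSupport hc)
    (fun _ _ => by fun_prop) (fun x _ => hf.differentiable (by simp) x)
  simpa using h

theorem integral_divergence_eq_zero {X : ℂ → ℂ} (hX : ContDiff ℝ 1 X)
    (hc : HasCompactSupport X) : ∫ z, divergence X z = 0 := by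
  have hre : ContDiff ℝ 1 fun z => (X z).re := Complex.reCLM.contDiff.comp hX
  have him : ContDiff ℝ 1 fun z => (X z).im := Complex.imCLM.contDiff.comp hX
  have cre : HasCompactSupport fun z => (X z).re := hc.comp_left (g := Complex.re) rfl
  have cim : HasCompactSupport fun z => (X z).im := hc.comp_left (g := Complex.im) rfl
  have e : ∀ z, divergence X z =
      fderiv ℝ (fun z => (X z).re) z 1 + fderiv ℝ (fun z => (X z).im) z Complex.I := by
    intro z
    have hd := (hX.differentiable (by simp)) z
    have h1 : fderiv ℝ (fun z => (X z).re) z = Complex.reCLM.comp (fderiv ℝ X z) :=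
      (Complex.reCLM.hasFDerivAt.comp z hd.hasFDerivAt).fderiv
    have h2 : fderiv ℝ (fun z => (X z).im) z = Complex.imCLM.comp (fderiv ℝ X z) :=
      (Complex.imCLM.hasFDerivAt.comp z hd.hasFDerivAt).fderiv
    simp [divergence, h1, h2]
  have i1 : Integrable fun z => fderiv ℝ (fun z => (X z).re) z 1 :=
    ((hre.continuous_fderiv (by simp)).clm_apply continuous_const).integrable_of_hasCompactSupport
      (cre.fderiv_apply ℝ 1)
  have i2 : Integrable fun z => fderiv ℝ (fun z => (X z).im) z Complex.I :=
    ((him.continuous_fderiv (by simp)).clm_apply continuous_const).integrable_of_hasCompactSupport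
      (cim.fderiv_apply ℝ Complex.I)
  simp_rw [e]
  rw [integral_add i1 i2, integral_fderiv_eq_zero hre cre, integral_fderiv_eq_zero him cim, add_zero]

/-! ### Functions with holomorphic gradient -/

/-- `u` is differentiable on `U` and its gradient, conjugated, is holomorphic there. On an open set
this says that `u` is harmonic. -/
def HolGrad (u : ℂ → ℝ) (U : Set ℂ) : Prop :=
  DifferentiableOn ℝ u U ∧ DifferentiableOn ℂ (fun z => conj (gradient u z)) U

theorem HolGrad.mono {u : ℂ → ℝ} {U V : Set ℂ} (h : HolGrad u U) (hV : V ⊆ U) : HolGrad u V :=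
  ⟨h.1.mono hV, h.2.mono hV⟩

theorem hasGradientAt_iff_innerSL {u : ℂ → ℝ} {p z : ℂ} :
    HasGradientAt u p z ↔ HasFDerivAt u (innerSL ℝ p) z := hasGradientAt_iff_hasFDerivAt

theorem hasGradientAt_re {F : ℂ → ℂ} {f z : ℂ} (h : HasDerivAt F f z) :
    HasGradientAt (fun z => (F z).re) (conj f) z := by
  rw [hasGradientAt_iff_innerSL]
  have h1 : HasFDerivAt F _ z := h.hasFDerivAt.restrictScalars ℝ
  have h2 := Complex.reCLM.hasFDerivAt.comp z h1
  refine h2.congr_fderiv ?_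
  ext; simp

/-- On a disc, a function with holomorphic gradient is the real part of a holomorphic function. -/
theorem HolGrad.exists_primitive {u : ℂ → ℝ} {c : ℂ} {ρ : ℝ} (h : HolGrad u (Metric.ball c ρ)) :
    ∃ F : ℂ → ℂ, (∀ z ∈ Metric.ball c ρ, HasDerivAt F (conj (gradient u z)) z) ∧
      ∀ z ∈ Metric.ball c ρ, u z = (F z).re := by
  obtain ⟨F, hF⟩ := h.2.isExactOn_ball
  rcases lt_or_ge 0 ρ with hρ | hρ
  swap
  · exact ⟨F, hF, fun z hz => by simp [Metric.ball_eq_empty.2 hρ] at hz⟩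
  have hc : c ∈ Metric.ball c ρ := Metric.mem_ball_self hρ
  refine ⟨fun z => F z + ((u c - (F c).re : ℝ) : ℂ), fun z hz => (hF z hz).add_const _, ?_⟩
  intro z hz
  have hd : ∀ w ∈ Metric.ball c ρ,
      HasFDerivWithinAt (fun w => u w - (F w).re) (0 : ℂ →L[ℝ] ℝ) (Metric.ball c ρ) w := by
    intro w hw
    have h1 := (h.1.differentiableAt (Metric.isOpen_ball.mem_nhds hw)).hasGradientAt
    have h2 := hasGradientAt_re (hF w hw)
    rw [hasGradientAt_iff_innerSL] at h1 h2
    rw [Complex.conj_conj] at h2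
    exact ((h1.sub h2).congr_fderiv (sub_self _)).hasFDerivWithinAt
  have := (convex_ball c ρ).is_const_of_fderivWithin_eq_zero (𝕜 := ℝ)
    (f := fun w => u w - (F w).re) (fun w hw => (hd w hw).differentiableWithinAt)
    (fun w hw => (hd w hw).fderivWithin (Metric.isOpen_ball.uniqueDiffWithinAt hw)) hz hc
  simp only [Complex.add_re, Complex.ofReal_re]
  linarith

theorem HolGrad.sub {u v : ℂ → ℝ} {U : Set ℂ} (hU : IsOpen U) (hu : HolGrad u U)
    (hv : HolGrad v U) : HolGrad (fun z => u z - v z) U ∧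
      ∀ z ∈ U, gradient (fun z => u z - v z) z = gradient u z - gradient v z := by
  have hg : ∀ z ∈ U, HasGradientAt (fun z => u z - v z) (gradient u z - gradient v z) z := by
    intro z hz
    have h1 := (hu.1.differentiableAt (hU.mem_nhds hz)).hasGradientAt
    have h2 := (hv.1.differentiableAt (hU.mem_nhds hz)).hasGradientAt
    rw [hasGradientAt_iff_innerSL] at h1 h2 ⊢
    exact (h1.sub h2).congr_fderiv (map_sub _ _ _).symm
  refine ⟨⟨fun z hz => (hg z hz).differentiableAt.differentiableWithinAt, ?_⟩,
    fun z hz => (hg z hz).gradient⟩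
  refine (hu.2.sub hv.2).congr fun z hz => ?_
  rw [(hg z hz).gradient]; simp

/-- Interior gradient estimate: Cauchy's estimate for `exp (F / ε)`, where `u = Re F`. -/
theorem HolGrad.norm_gradient_le {u : ℂ → ℝ} {c : ℂ} {ρ ε : ℝ} (hρ : 0 < ρ) (hε : 0 < ε)
    (h : HolGrad u (Metric.ball c ρ)) (hb : ∀ z ∈ Metric.ball c ρ, |u z| ≤ ε) :
    ‖gradient u c‖ ≤ 2 * Real.exp 2 * ε / ρ := by
  obtain ⟨F, hF, hre⟩ := h.exists_primitive
  have hc : c ∈ Metric.ball c ρ := Metric.mem_ball_self hρ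
  have hsub : Metric.closedBall c (ρ / 2) ⊆ Metric.ball c ρ :=
    Metric.closedBall_subset_ball (by linarith)
  have hE : ∀ z ∈ Metric.ball c ρ, HasDerivAt (fun z => Complex.exp (F z / ε))
      (Complex.exp (F z / ε) * (conj (gradient u z) / ε)) z := fun z hz =>
    ((hF z hz).div_const _).cexp
  have hn : ∀ z, ‖Complex.exp (F z / ε)‖ = Real.exp ((F z).re / ε) := by
    intro z
    rw [Complex.norm_exp, Complex.div_ofReal_re]
  have key : ‖deriv (fun z => Complex.exp (F z / ε)) c‖ ≤ Real.exp 1 / (ρ / 2) := by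
    apply Complex.norm_deriv_le_of_forall_mem_sphere_norm_le (by positivity)
    · refine DifferentiableOn.diffContOnCl_ball ?_ hsub
      exact fun z hz => (hE z hz).differentiableAt.differentiableWithinAt
    · intro z hz
      have hz' := hsub (Metric.sphere_subset_closedBall hz)
      rw [hn, ← hre z hz']
      apply Real.exp_le_exp.2
      rw [div_le_one hε]
      exact (abs_le.1 (hb z hz')).2
  rw [(hE c hc).deriv, norm_mul, hn, ← hre c hc] at key
  have h1 : Real.exp (-1) ≤ Real.exp (u c / ε) := by
    apply Real.exp_le_exp.2
    rw [le_div_iff₀ hε]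
    linarith [(abs_le.1 (hb c hc)).1]
  have h2 : ‖conj (gradient u c) / (ε : ℂ)‖ = ‖gradient u c‖ / ε := by
    rw [norm_div, RCLike.norm_conj]; simp [abs_of_pos hε]
  rw [h2] at key
  have h3 : Real.exp (-1) * (‖gradient u c‖ / ε) ≤ Real.exp 1 / (ρ / 2) :=
    (mul_le_mul_of_nonneg_right h1 (by positivity)).trans key
  have h4 : ‖gradient u c‖ / ε ≤ Real.exp 1 * (Real.exp 1 / (ρ / 2)) := by
    have := mul_le_mul_of_nonneg_left h3 (Real.exp_pos 1).le
    rwa [← mul_assoc, ← Real.exp_add, add_neg_cancel, Real.exp_zero, one_mul] at this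
  rw [div_le_iff₀ hε] at h4
  refine h4.trans (le_of_eq ?_)
  rw [show (2 : ℝ) = 1 + 1 by norm_num, Real.exp_add]
  field_simp

/-- A locally uniform limit of functions with holomorphic gradient has a holomorphic gradient, and
the gradients converge. -/
theorem HolGrad.of_tendstoUniformlyOn {w : ℕ → ℂ → ℝ} {u : ℂ → ℝ} {c : ℂ} {ρ : ℝ} (hρ : 0 < ρ)
    (h : ∀ᶠ m in atTop, HolGrad (w m) (Metric.ball c ρ))
    (hu : TendstoUniformlyOn w u atTop (Metric.ball c ρ)) :
    HolGrad u (Metric.ball c (ρ / 2)) ∧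
      Tendsto (fun m => gradient (w m) c) atTop (𝓝 (gradient u c)) := by
  set B := Metric.ball c (ρ / 2) with hB
  set f : ℕ → ℂ → ℂ := fun m z => conj (gradient (w m) z) with hf
  have hBs : B ⊆ Metric.ball c ρ := Metric.ball_subset_ball (by linarith)
  have hcau : UniformCauchySeqOn f atTop B := by
    rw [Metric.uniformCauchySeqOn_iff]
    intro ε hε
    set η := ε * ρ / (8 * Real.exp 2) with hη
    have hηpos : 0 < η := by positivity
    obtain ⟨N1, hN1⟩ := (Metric.uniformCauchySeqOn_iff.1 hu.uniformCauchySeqOn) η hηpos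
    obtain ⟨N2, hN2⟩ := eventually_atTop.1 h
    refine ⟨max N1 N2, fun m hm n hn z hz => ?_⟩
    have hzb : Metric.ball z (ρ / 2) ⊆ Metric.ball c ρ := by
      apply Metric.ball_subset_ball'
      have := Metric.mem_ball.1 hz
      linarith
    have hsub := HolGrad.sub Metric.isOpen_ball ((hN2 m (le_of_max_le_right hm)).mono hzb)
      ((hN2 n (le_of_max_le_right hn)).mono hzb)
    have hle := HolGrad.norm_gradient_le (half_pos hρ) hηpos hsub.1 (fun y hy => by
      have := hN1 m (le_of_max_le_left hm) n (le_of_max_le_left hn) y (hzb hy)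
      rw [Real.dist_eq] at this
      exact this.le)
    rw [hsub.2 z (Metric.mem_ball_self (half_pos hρ))] at hle
    rw [dist_eq_norm, hf]
    simp only
    rw [← map_sub, RCLike.norm_conj]
    refine hle.trans_lt ?_
    rw [hη]
    have : 2 * Real.exp 2 * (ε * ρ / (8 * Real.exp 2)) / (ρ / 2) = ε / 2 := by field_simp; norm_num
    rw [this]; linarith
  have hlim : ∀ z ∈ B, ∃ y, Tendsto (fun m => f m z) atTop (𝓝 y) := fun z hz =>
    cauchySeq_tendsto_of_complete (hcau.cauchySeq hz)
  choose! f0 hf0 using hlim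
  have hunif : TendstoUniformlyOn f f0 atTop B := hcau.tendstoUniformlyOn_of_tendsto hf0
  have hdiff : ∀ᶠ m in atTop, DifferentiableOn ℂ (f m) B := h.mono fun m hm => hm.2.mono hBs
  have hf0d : DifferentiableOn ℂ f0 B :=
    hunif.tendstoLocallyUniformlyOn.differentiableOn hdiff Metric.isOpen_ball
  have hgrad : ∀ z ∈ B, HasGradientAt u (conj (f0 z)) z := by
    intro z hz
    rw [hasGradientAt_iff_innerSL]
    have hu' : TendstoUniformlyOn (fun m z => innerSL ℝ (gradient (w m) z))
        (fun z => innerSL ℝ (conj (f0 z))) atTop B := by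
      rw [Metric.tendstoUniformlyOn_iff] at hunif ⊢
      intro ε hε
      filter_upwards [hunif ε hε] with m hm y hy
      have := hm y hy
      rw [dist_eq_norm, ← map_sub, innerSL_apply_norm]
      rw [dist_eq_norm, ← RCLike.norm_conj, map_sub, hf] at this
      simpa using this
    refine hasFDerivAt_of_tendstoUniformlyOnFilter (l := atTop)
      (f := w) (f' := fun m z => innerSL ℝ (gradient (w m) z))
      (g' := fun z => innerSL ℝ (conj (f0 z))) (x := z) ?_ ?_ ?_
    · exact (tendstoUniformlyOn_iff_tendstoUniformlyOnFilter.1 hu').mono_right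
        (by simpa using Metric.isOpen_ball.mem_nhds hz)
    · have h1 : ∀ᶠ x in 𝓝 z, x ∈ B := Metric.isOpen_ball.mem_nhds hz
      filter_upwards [h.prod_mk h1] with p hp
      exact hasGradientAt_iff_innerSL.1
        ((hp.1.1.differentiableAt (Metric.isOpen_ball.mem_nhds (hBs hp.2))).hasGradientAt)
    · filter_upwards [Metric.isOpen_ball.mem_nhds hz] with y hy
      exact hu.tendsto_at (hBs hy)
  refine ⟨⟨fun z hz => (hgrad z hz).differentiableAt.differentiableWithinAt,
    hf0d.congr fun z hz => by rw [(hgrad z hz).gradient, Complex.conj_conj]⟩, ?_⟩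
  have hcB : c ∈ B := Metric.mem_ball_self (half_pos hρ)
  rw [(hgrad c hcB).gradient]
  have := (Complex.continuous_conj.tendsto _).comp (hf0 c hcB)
  refine this.congr fun m => ?_
  simp [hf]

/-- Minimum principle, by the strong maximum principle applied to `exp (-F)`, `u = Re F`. -/
theorem HolGrad.le_of_frontier {D : Set ℂ} {u : ℂ → ℝ} {a : ℝ} (hD : IsOpen D)
    (hb : Bornology.IsBounded D) (hcont : ContinuousOn u (closure D)) (h : HolGrad u D)
    (hf : ∀ z ∈ frontier D, a ≤ u z) : ∀ z ∈ D, a ≤ u z := by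
  intro z hz
  have hK : IsCompact (closure D) := hb.isCompact_closure
  obtain ⟨z0, hz0, hmin⟩ := hK.exists_isMinOn ⟨z, subset_closure hz⟩ hcont
  refine le_trans ?_ (hmin (subset_closure hz))
  by_contra hlt
  push Not at hlt
  set A := {y ∈ closure D | u y = u z0} with hA
  have hAD : A ⊆ D := by
    intro y hy
    by_contra hyD
    have : y ∈ frontier D := by
      rw [hD.frontier_eq]; exact ⟨hy.1, hyD⟩
    have h1 := hf y this
    rw [hy.2] at h1
    linarith
  have hAc : IsClosed A := by
    have := hcont.preimage_isClosed_of_isClosed isClosed_closure (isClosed_singleton (x := u z0))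
    exact this
  have hAo : IsOpen A := by
    rw [isOpen_iff_mem_nhds]
    intro y hy
    have hyD := hAD hy
    obtain ⟨ρ, hρ, hball⟩ := Metric.isOpen_iff.1 hD y hyD
    obtain ⟨F, hF, hre⟩ := (h.mono hball).exists_primitive
    have hn : ∀ x ∈ Metric.ball y ρ, ‖Complex.exp (-F x)‖ = Real.exp (-u x) := by
      intro x hx
      rw [Complex.norm_exp, hre x hx, Complex.neg_re]
    have hyb := Metric.mem_ball_self (x := y) hρ
    have hmax : IsLocalMax (norm ∘ fun x => Complex.exp (-F x)) y := by
      filter_upwards [Metric.ball_mem_nhds y hρ] with x hx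
      simp only [Function.comp]
      rw [hn x hx, hn y hyb, hy.2]
      exact Real.exp_le_exp.2 (neg_le_neg (hmin (subset_closure (hball hx))))
    have hd : ∀ᶠ x in 𝓝 y, DifferentiableAt ℂ (fun x => Complex.exp (-F x)) x := by
      filter_upwards [Metric.ball_mem_nhds y hρ] with x hx
      exact (hF x hx).neg.cexp.differentiableAt
    have := Complex.norm_eventually_eq_of_isLocalMax hd hmax
    filter_upwards [this, Metric.ball_mem_nhds y hρ] with x hx hxb
    refine ⟨subset_closure (hball hxb), ?_⟩
    rw [hn x hxb, hn y hyb, Real.exp_eq_exp, neg_inj] at hx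
    rw [hx, hy.2]
  have hAu : A = univ := IsClopen.eq_univ ⟨hAc, hAo⟩ ⟨z0, hz0, rfl⟩
  have hcomp : IsCompact (univ : Set ℂ) := by
    rw [← hAu]; exact hK.of_isClosed_subset hAc fun y hy => hy.1
  exact noncompact_univ ℂ hcomp

/-! ### Solutions on half-discs and the truncation identity -/

/-- The lower half-disc of radius `R` together with its flat boundary. -/
def lidBall (R : ℝ) : Set ℂ := {z | ‖z‖ < R ∧ z.im ≤ 0}

/-- The function `w` is a nonpositive solution on the half-disc of radius `R`: it vanishes on the
lid, it is harmonic where it is negative, and its Lipschitz constant on the half-disc of radius `s`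
is at most `C √s`. This notion is invariant under the blowup scaling, with the same `C`. -/
structure HalfSol (R C : ℝ) (w : ℂ → ℝ) : Prop where
  const_nonneg : 0 ≤ C
  nonpos : ∀ z ∈ lidBall R, w z ≤ 0
  lid : ∀ z ∈ lidBall R, z.im = 0 → w z = 0
  lip : ∀ s ≤ R, ∀ z ∈ lidBall s, ∀ z' ∈ lidBall s, |w z - w z'| ≤ C * √s * ‖z - z'‖
  hol : HolGrad w (phaseMinus (halfBall R) w)

/-- The gradient of `w` where `w` is negative in the open lower half-plane, and zero elsewhere. -/
def negGrad (w : ℂ → ℝ) (z : ℂ) : ℂ :=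
  open Classical in if z.im < 0 ∧ w z < 0 then gradient w z else 0

theorem isOpen_halfBall (R : ℝ) : IsOpen (halfBall R) :=
  (isOpen_lt continuous_norm continuous_const).inter
    (isOpen_lt Complex.continuous_im continuous_const)

theorem halfBall_subset_lidBall (R : ℝ) : halfBall R ⊆ lidBall R := fun _ hz => ⟨hz.1, hz.2.le⟩

theorem lidBall_mono {r R : ℝ} (h : r ≤ R) : lidBall r ⊆ lidBall R :=
  fun _ hz => ⟨hz.1.trans_le h, hz.2⟩

theorem halfBall_mono {r R : ℝ} (h : r ≤ R) : halfBall r ⊆ halfBall R :=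
  fun _ hz => ⟨hz.1.trans_le h, hz.2⟩

theorem halfBall_subset_ball (R : ℝ) : halfBall R ⊆ Metric.ball 0 R :=
  fun z hz => by simpa using hz.1

theorem volume_halfBall_lt_top (R : ℝ) : volume (halfBall R) < ⊤ :=
  (measure_mono (halfBall_subset_ball R)).trans_lt measure_ball_lt_top

theorem negGrad_of_neg {w : ℂ → ℝ} {z : ℂ} (h : z.im < 0) (h' : w z < 0) :
    negGrad w z = gradient w z := if_pos ⟨h, h'⟩

theorem negGrad_of_nonneg {w : ℂ → ℝ} {z : ℂ} (h : 0 ≤ w z) : negGrad w z = 0 :=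
  if_neg fun h' => absurd h'.2 (not_lt.2 h)

theorem norm_gradient_le_of_lip {w : ℂ → ℝ} {z : ℂ} {K : ℝ} (hK : 0 ≤ K)
    (h : ∀ᶠ y in 𝓝 z, |w y - w z| ≤ K * ‖y - z‖) : ‖gradient w z‖ ≤ K := by
  by_cases hd : DifferentiableAt ℝ w z
  · have h1 := hasGradientAt_iff_innerSL.1 hd.hasGradientAt
    have := h1.le_of_lip' hK h
    rwa [innerSL_apply_norm] at this
  · rw [gradient_eq_zero_of_not_differentiableAt hd]; simpa

namespace HalfSol

variable {R C : ℝ} {w : ℂ → ℝ}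

theorem mono {r : ℝ} (hw : HalfSol R C w) (h : r ≤ R) : HalfSol r C w where
  const_nonneg := hw.const_nonneg
  nonpos z hz := hw.nonpos z (lidBall_mono h hz)
  lid z hz := hw.lid z (lidBall_mono h hz)
  lip s hs := hw.lip s (hs.trans h)
  hol := hw.hol.mono fun _ hz => ⟨halfBall_mono h hz.1, hz.2⟩

theorem continuousOn (hw : HalfSol R C w) : ContinuousOn w (lidBall R) := by
  have : LipschitzOnWith (C * √R).toNNReal w (lidBall R) := by
    refine LipschitzOnWith.of_dist_le_mul fun z hz z' hz' => ?_
    rw [Real.dist_eq, dist_eq_norm, Real.coe_toNNReal _ (mul_nonneg hw.const_nonneg (by positivity))]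
    exact hw.lip R le_rfl z hz z' hz'
  exact this.continuousOn

theorem abs_le (hw : HalfSol R C w) {s : ℝ} (hs : s ≤ R) {z : ℂ} (hz : z ∈ lidBall s) :
    |w z| ≤ C * √s * ‖z‖ := by
  have h0 : (0 : ℂ) ∈ lidBall s := ⟨by simpa using (norm_nonneg z).trans_lt hz.1, by simp⟩
  have := hw.lip s hs z hz 0 h0
  rwa [hw.lid 0 (lidBall_mono hs h0) rfl, sub_zero, sub_zero] at this

theorem isOpen_phaseMinus (hw : HalfSol R C w) : IsOpen (phaseMinus (halfBall R) w) :=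
  (hw.continuousOn.mono (halfBall_subset_lidBall R)).isOpen_inter_preimage (isOpen_halfBall R)
    isOpen_Iio

theorem norm_gradient_le (hw : HalfSol R C w) {s : ℝ} (hs : s ≤ R) {z : ℂ} (hz : z ∈ halfBall s) :
    ‖gradient w z‖ ≤ C * √s := by
  refine norm_gradient_le_of_lip (mul_nonneg hw.const_nonneg (by positivity)) ?_
  filter_upwards [(isOpen_halfBall s).mem_nhds hz] with y hy
  exact hw.lip s hs y (halfBall_subset_lidBall s hy) z (halfBall_subset_lidBall s hz)

theorem norm_negGrad_le (hw : HalfSol R C w) {s : ℝ} (hs : s ≤ R) {z : ℂ} (hz : z ∈ halfBall s) :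
    ‖negGrad w z‖ ≤ C * √s := by
  unfold negGrad
  split_ifs
  · exact hw.norm_gradient_le hs hz
  · simpa using mul_nonneg hw.const_nonneg (Real.sqrt_nonneg s)

theorem hasFDerivAt (hw : HalfSol R C w) {z : ℂ} (hz : z ∈ phaseMinus (halfBall R) w) :
    HasFDerivAt w (innerSL ℝ (gradient w z)) z :=
  hasGradientAt_iff_innerSL.1
    (hw.hol.1.differentiableAt (hw.isOpen_phaseMinus.mem_nhds hz)).hasGradientAt

theorem contDiffOn_gradient (hw : HalfSol R C w) :
    ContDiffOn ℝ 1 (gradient w) (phaseMinus (halfBall R) w) := by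
  have h1 : ContDiffOn ℝ 1 (fun z => conj (gradient w z)) (phaseMinus (halfBall R) w) :=
    (hw.hol.2.contDiffOn hw.isOpen_phaseMinus).restrict_scalars ℝ
  have h2 := Complex.conjCLE.contDiff.comp_contDiffOn (n := 1) h1
  exact h2.congr fun z _ => by simp

theorem contDiffOn (hw : HalfSol R C w) : ContDiffOn ℝ 1 w (phaseMinus (halfBall R) w) := by
  intro z hz
  refine (contDiffAt_one_iff.2 ⟨fun y => innerSL ℝ (gradient w y), phaseMinus (halfBall R) w,
    hw.isOpen_phaseMinus.mem_nhds hz, ?_, fun y hy => hw.hasFDerivAt hy⟩).contDiffWithinAt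
  exact (innerSL ℝ).continuous.comp_continuousOn hw.contDiffOn_gradient.continuousOn

theorem divergence_gradient (hw : HalfSol R C w) {z : ℂ} (hz : z ∈ phaseMinus (halfBall R) w) :
    divergence (gradient w) z = 0 := by
  set f := fun z => conj (gradient w z) with hf
  have h1 : HasFDerivAt f _ z :=
    (hw.hol.2.differentiableAt (hw.isOpen_phaseMinus.mem_nhds hz)).hasDerivAt.hasFDerivAt.restrictScalars ℝ
  have h2 := Complex.conjCLE.toContinuousLinearMap.hasFDerivAt.comp z h1
  have h3 : HasFDerivAt (gradient w) _ z := h2.congr_of_eventuallyEq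
    (Eventually.of_forall fun y => by simp [hf])
  unfold divergence
  rw [h3.fderiv]
  simp

end HalfSol

/-- A smooth truncation of the identity on the negative axis: it vanishes on `[-ε, ∞)` and is the
identity on `(-∞, -2ε]`. -/
def softCut (ε s : ℝ) : ℝ := s * Real.smoothTransition (-s / ε - 1)

theorem softCut_eq_zero {ε s : ℝ} (hε : 0 < ε) (h : -ε ≤ s) : softCut ε s = 0 := by
  unfold softCut
  rw [Real.smoothTransition.zero_of_nonpos, mul_zero]
  rw [sub_nonpos, div_le_one hε]; linarith

theorem softCut_eq_self {ε s : ℝ} (hε : 0 < ε) (h : s ≤ -2 * ε) : softCut ε s = s := by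
  unfold softCut
  rw [Real.smoothTransition.one_of_one_le, mul_one]
  rw [le_sub_iff_add_le, le_div_iff₀ hε]; linarith

theorem abs_softCut_le (ε s : ℝ) : |softCut ε s| ≤ |s| := by
  unfold softCut
  rw [abs_mul, abs_of_nonneg (Real.smoothTransition.nonneg _)]
  exact mul_le_of_le_one_right (abs_nonneg _) (Real.smoothTransition.le_one _)

theorem contDiff_softCut (ε : ℝ) : ContDiff ℝ 1 (softCut ε) :=
  contDiff_id.mul (Real.smoothTransition.contDiff.comp
    ((contDiff_id.neg.div_const ε).sub contDiff_const))

theorem deriv_softCut_eq_one {ε s : ℝ} (hε : 0 < ε) (h : s < -2 * ε) :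
    deriv (softCut ε) s = 1 := by
  have : softCut ε =ᶠ[𝓝 s] id := by
    filter_upwards [Iio_mem_nhds h] with t ht using softCut_eq_self hε (le_of_lt ht)
  rw [this.deriv_eq, deriv_id]

theorem exists_deriv_softCut_bound : ∃ A : ℝ, ∀ ε > 0, ∀ s, |deriv (softCut ε) s| ≤ A := by
  have hc : Continuous (deriv (softCut 1)) := (contDiff_softCut 1).continuous_deriv (by simp)
  obtain ⟨A, hA⟩ := (isCompact_Icc (a := (-2 : ℝ)) (b := -1)).exists_bound_of_continuousOn
    hc.continuousOn
  refine ⟨max A 1, fun ε hε s => ?_⟩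
  have hsc : softCut ε = fun s => ε * softCut 1 (s / ε) := by
    funext t
    unfold softCut
    field_simp
  have hd : deriv (softCut ε) s = deriv (softCut 1) (s / ε) := by
    have h1 : HasDerivAt (softCut 1) (deriv (softCut 1) (s / ε)) (s / ε) :=
      ((contDiff_softCut 1).differentiable (by simp) _).hasDerivAt
    have h2 := (h1.comp s ((hasDerivAt_id s).div_const ε)).const_mul ε
    rw [hsc]
    have h3 : HasDerivAt (fun s => ε * softCut 1 (s / ε)) _ s := h2
    rw [h3.deriv]
    field_simp
  rw [hd]
  set t := s / ε
  rcases lt_or_ge t (-2) with h | h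
  · rw [deriv_softCut_eq_one one_pos (by linarith)]; simp
  rcases le_or_gt t (-1) with h' | h'
  · exact (hA t ⟨h, h'⟩).trans (le_max_left _ _)
  · have : softCut 1 =ᶠ[𝓝 t] fun _ => 0 := by
      filter_upwards [Ioi_mem_nhds h'] with y hy using softCut_eq_zero one_pos (le_of_lt hy)
    rw [this.deriv_eq]; simp

/-- The divergence theorem for the field `softCut ε (w) ψ Y`. It is of class `C¹` with compact
support in `{w < 0}`, because the truncation removes the set where `w ≥ -ε`. -/
theorem HalfSol.integral_softCut {R C : ℝ} {w : ℂ → ℝ} (hw : HalfSol R C w) {ψ : ℂ → ℝ}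
    (hψ : ContDiff ℝ 1 ψ) (hψs : tsupport ψ ⊆ Metric.ball 0 R) {Y : ℂ → ℂ}
    (hY : ContDiffOn ℝ 1 Y (phaseMinus (halfBall R) w)) {ε : ℝ} (hε : 0 < ε) :
    ∫ z in phaseMinus (halfBall R) w,
      (deriv (softCut ε) (w z) * (ψ z * inner ℝ (gradient w z) (Y z))
        + softCut ε (w z) * (fderiv ℝ ψ z (Y z) + ψ z * divergence Y z)) = 0 := by
  classical
  set Ω := phaseMinus (halfBall R) w with hΩ
  have hΩo : IsOpen Ω := hw.isOpen_phaseMinus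
  set a : ℂ → ℝ := fun z => softCut ε (w z) * ψ z with ha
  set X : ℂ → ℂ := fun z => if z ∈ Ω then a z • Y z else 0 with hX
  have hcomp : IsCompact (tsupport ψ) :=
    Metric.isCompact_of_isClosed_isBounded (isClosed_tsupport ψ) (Metric.isBounded_ball.subset hψs)
  set S := tsupport ψ ∩ {z : ℂ | z.im ≤ 0} with hS
  have hSl : S ⊆ lidBall R := fun z hz => ⟨by simpa using hψs hz.1, hz.2⟩
  have hSc : IsClosed S :=
    (isClosed_tsupport ψ).inter (isClosed_le Complex.continuous_im continuous_const)
  have hKc : IsClosed (S ∩ w ⁻¹' Iic (-ε)) :=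
    (hw.continuousOn.mono hSl).preimage_isClosed_of_isClosed hSc isClosed_Iic
  have hKΩ : S ∩ w ⁻¹' Iic (-ε) ⊆ Ω := by
    intro z hz
    have hneg : w z < 0 := lt_of_le_of_lt hz.2 (by linarith)
    refine ⟨⟨(hSl hz.1).1, lt_of_le_of_ne hz.1.2 fun h => ?_⟩, hneg⟩
    rw [hw.lid z (hSl hz.1) h] at hneg
    exact lt_irrefl _ hneg
  have htsX : tsupport X ⊆ S ∩ w ⁻¹' Iic (-ε) := by
    refine closure_minimal (fun z hz => ?_) hKc
    have hzΩ : z ∈ Ω := by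
      by_contra h
      exact hz (if_neg h)
    have hza : a z ≠ 0 := by
      intro h
      apply hz
      simp [hX, h]
    refine ⟨⟨subset_tsupport _ (right_ne_zero_of_mul hza), hzΩ.1.2.le⟩, ?_⟩
    by_contra h
    simp only [mem_preimage, mem_Iic, not_le] at h
    exact left_ne_zero_of_mul hza (softCut_eq_zero hε h.le)
  have hXeq : ∀ z ∈ Ω, X =ᶠ[𝓝 z] fun y => a y • Y y := by
    intro z hz
    filter_upwards [hΩo.mem_nhds hz] with y hy using if_pos hy
  have haC : ContDiffOn ℝ 1 a Ω :=
    ((contDiff_softCut ε).comp_contDiffOn hw.contDiffOn).mul hψ.contDiffOn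
  have hXC : ContDiff ℝ 1 X := by
    refine contDiff_of_tsupport fun z hz => ?_
    have hzΩ := hKΩ (htsX hz)
    exact ((haC.smul hY).contDiffAt (hΩo.mem_nhds hzΩ)).congr_of_eventuallyEq (hXeq z hzΩ)
  have hXc : HasCompactSupport X :=
    hcomp.of_isClosed_subset (isClosed_tsupport X) fun z hz => (htsX hz).1.1
  have hint := integral_divergence_eq_zero hXC hXc
  rw [← setIntegral_eq_integral_of_forall_compl_eq_zero (s := Ω) (fun z hz =>
    divergence_eq_zero_of_notMem_tsupport fun h => hz (hKΩ (htsX h)))] at hint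
  rw [← hint]
  refine setIntegral_congr_fun hΩo.measurableSet fun z hz => ?_
  have hYd : DifferentiableAt ℝ Y z := (hY.contDiffAt (hΩo.mem_nhds hz)).differentiableAt (by simp)
  have hsd : HasDerivAt (softCut ε) (deriv (softCut ε) (w z)) (w z) :=
    ((contDiff_softCut ε).differentiable (by simp) _).hasDerivAt
  have had : HasFDerivAt a _ z :=
    (hsd.comp_hasFDerivAt z (hw.hasFDerivAt hz)).mul (hψ.differentiable (by simp) z).hasFDerivAt
  have e1 : divergence X z = divergence (fun y => a y • Y y) z := by
    unfold divergence; rw [(hXeq z hz).fderiv_eq]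
  rw [e1, divergence_smul had.differentiableAt hYd, had.fderiv]
  simp [ha]
  ring

/-- The weak form of the equation: fields that are `C¹` in `{w < 0}` may be tested, without any
condition on the test function at the free boundary or at the lid, because `w` vanishes there. -/
theorem HalfSol.integral_eq_zero {R C : ℝ} {w : ℂ → ℝ} (hw : HalfSol R C w) {ψ : ℂ → ℝ}
    (hψ : ContDiff ℝ 1 ψ) (hψs : tsupport ψ ⊆ Metric.ball 0 R) {Y : ℂ → ℂ}
    (hY : ContDiffOn ℝ 1 Y (phaseMinus (halfBall R) w)) {B : ℝ}
    (hB : ∀ z ∈ phaseMinus (halfBall R) w, ‖Y z‖ ≤ B ∧ |divergence Y z| ≤ B) :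
    ∫ z in phaseMinus (halfBall R) w,
      (ψ z * inner ℝ (gradient w z) (Y z)
        + w z * (fderiv ℝ ψ z (Y z) + ψ z * divergence Y z)) = 0 := by
  set Ω := phaseMinus (halfBall R) w with hΩ
  have hΩo : IsOpen Ω := hw.isOpen_phaseMinus
  have hcomp : HasCompactSupport ψ :=
    Metric.isCompact_of_isClosed_isBounded (isClosed_tsupport ψ) (Metric.isBounded_ball.subset hψs)
  obtain ⟨A, hA⟩ := exists_deriv_softCut_bound
  obtain ⟨M, hM⟩ := hψ.continuous.bounded_above_of_compact_support hcomp
  obtain ⟨M', hM'⟩ :=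
    (hψ.continuous_fderiv (by simp)).bounded_above_of_compact_support (hcomp.fderiv ℝ)
  set εs : ℕ → ℝ := fun n => 1 / ((n : ℝ) + 1) with hεs
  have hεpos : ∀ n, 0 < εs n := fun n => by positivity
  have hε0 : Tendsto εs atTop (𝓝 0) := tendsto_one_div_add_atTop_nhds_zero_nat
  have hYc := hY.continuousOn
  have hdiv : ContinuousOn (divergence Y) Ω := by
    have h1 := hY.continuousOn_fderiv_of_isOpen hΩo (by simp)
    exact (Complex.continuous_re.comp_continuousOn (h1.clm_apply continuousOn_const)).add
      (Complex.continuous_im.comp_continuousOn (h1.clm_apply continuousOn_const))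
  have hg : ContinuousOn (gradient w) Ω := hw.contDiffOn_gradient.continuousOn
  have hwc : ContinuousOn w Ω := hw.contDiffOn.continuousOn
  have hΩm : volume Ω < ⊤ := (measure_mono fun z hz => hz.1).trans_lt (volume_halfBall_lt_top R)
  have : IsFiniteMeasure (volume.restrict Ω) := ⟨by simpa using hΩm⟩
  have hlim : Tendsto (fun n => ∫ z in Ω,
      (deriv (softCut (εs n)) (w z) * (ψ z * inner ℝ (gradient w z) (Y z))
        + softCut (εs n) (w z) * (fderiv ℝ ψ z (Y z) + ψ z * divergence Y z))) atTop
      (𝓝 (∫ z in Ω, (ψ z * inner ℝ (gradient w z) (Y z)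
        + w z * (fderiv ℝ ψ z (Y z) + ψ z * divergence Y z)))) := by
    refine tendsto_integral_of_dominated_convergence
      (fun _ => A * (M * (C * √R * B)) + (C * √R * R) * (M' * B + M * B)) ?_
      (integrable_const _) ?_ ?_
    · intro n
      refine ContinuousOn.aestronglyMeasurable ?_ hΩo.measurableSet
      refine ContinuousOn.add (ContinuousOn.mul ?_ (hψ.continuous.continuousOn.mul (hg.inner hYc)))
        (ContinuousOn.mul ?_ (ContinuousOn.add ?_ (hψ.continuous.continuousOn.mul hdiv)))
      · exact ((contDiff_softCut _).continuous_deriv (by simp)).comp_continuousOn hwc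
      · exact (contDiff_softCut _).continuous.comp_continuousOn hwc
      · exact (hψ.continuous_fderiv (by simp)).continuousOn.clm_apply hYc
    · intro n
      filter_upwards [ae_restrict_mem hΩo.measurableSet] with z hz
      have hY1 := (hB z hz).1
      have hY2 := (hB z hz).2
      have hB0 : 0 ≤ B := (norm_nonneg _).trans hY1
      have hp := hw.norm_gradient_le le_rfl hz.1
      have hCR : 0 ≤ C * √R := (norm_nonneg _).trans hp
      have hR : 0 ≤ R := (norm_nonneg z).trans hz.1.1.le
      have hM0 : 0 ≤ M := (norm_nonneg _).trans (hM z)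
      have hw1 : |w z| ≤ C * √R * R :=
        (hw.abs_le le_rfl (halfBall_subset_lidBall R hz.1)).trans
          (mul_le_mul_of_nonneg_left hz.1.1.le hCR)
      refine (norm_add_le _ _).trans (add_le_add ?_ ?_)
      · rw [norm_mul, norm_mul]
        refine mul_le_mul (hA _ (hεpos n) _) (mul_le_mul (hM z) ?_ (norm_nonneg _) hM0)
          (by positivity) ((abs_nonneg _).trans (hA _ (hεpos n) 0))
        exact (norm_inner_le_norm _ _).trans (mul_le_mul hp hY1 (norm_nonneg _) hCR)
      · rw [norm_mul]
        refine mul_le_mul ((abs_softCut_le _ _).trans hw1) ((norm_add_le _ _).trans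
          (add_le_add ?_ ?_)) (norm_nonneg _) (by positivity)
        · exact ((fderiv ℝ ψ z).le_opNorm _).trans
            (mul_le_mul (hM' z) hY1 (norm_nonneg _) ((norm_nonneg _).trans (hM' z)))
        · rw [norm_mul]
          exact mul_le_mul (hM z) hY2 (norm_nonneg _) hM0
    -- once `2 ε < -w z`, the truncation is the identity near `w z`
    · filter_upwards [ae_restrict_mem hΩo.measurableSet] with z hz
      refine tendsto_const_nhds.congr' ?_
      have hneg : w z < 0 := hz.2
      filter_upwards [hε0.eventually (gt_mem_nhds (show (0 : ℝ) < -w z / 2 by linarith))] with n hn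
      rw [deriv_softCut_eq_one (hεpos n) (by linarith), softCut_eq_self (hεpos n) (by linarith),
        one_mul]
  refine tendsto_nhds_unique hlim ?_
  refine tendsto_const_nhds.congr fun n => ?_
  exact (hw.integral_softCut hψ hψs hY (hεpos n)).symm

/-! ### Weak gradients and harmonicity of variational solutions -/

theorem hasFDerivAt_innerSL_gradient {u : ℂ → ℝ} {z : ℂ} (h : DifferentiableAt ℝ u z) :
    HasFDerivAt u (innerSL ℝ (gradient u z)) z :=
  hasGradientAt_iff_innerSL.1 h.hasGradientAt

theorem integrable_smul_of_locallyIntegrableOn {E : Type*} [NormedAddCommGroup E]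
    [NormedSpace ℝ E] {f : ℂ → E} {V : Set ℂ} (hf : LocallyIntegrableOn f V) {ζ : ℂ → ℝ}
    (hζ : Continuous ζ) (hc : HasCompactSupport ζ) (hs : tsupport ζ ⊆ V) :
    Integrable fun z => ζ z • f z := by
  have h1 : IntegrableOn f (tsupport ζ) := hf.integrableOn_compact_subset hs hc
  have h2 : IntegrableOn (fun z => ζ z • f z) (tsupport ζ) :=
    h1.continuousOn_smul hζ.continuousOn hc
  refine (integrableOn_iff_integrable_of_support_subset fun z hz => ?_).1 h2
  refine subset_tsupport ζ fun h => hz ?_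
  simp only [h, zero_smul]

/-- Where the function is of class `C¹`, its weak gradient is the gradient. -/
theorem ae_eq_gradient_of_hasWeakGradient {U V : Set ℂ} {u : ℂ → ℝ} {g : ℂ → ℂ}
    (h : HasWeakGradient U u g) (hV : IsOpen V) (hVU : V ⊆ U) (hu : ContDiffOn ℝ 1 u V) :
    ∀ᵐ z, z ∈ V → g z = gradient u z := by
  have hgc : ContinuousOn (fun z => fderiv ℝ u z) V := hu.continuousOn_fderiv_of_isOpen hV (by simp)
  have key : ∀ v : ℂ, ∀ᵐ z, z ∈ V → inner ℝ (g z) v - fderiv ℝ u z v = 0 := by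
    intro v
    have hgl : LocallyIntegrableOn (fun z => (inner ℝ (g z) v : ℝ)) V := by
      intro z hz
      obtain ⟨s, hs, hi⟩ := (h.2.1.mono_set hVU) z hz
      exact ⟨s, hs, hi.inner_const v⟩
    have hpl : LocallyIntegrableOn (fun z => fderiv ℝ u z v) V :=
      (hgc.clm_apply continuousOn_const).locallyIntegrableOn hV.measurableSet
    refine hV.ae_eq_zero_of_integral_contDiff_smul_eq_zero (hgl.sub hpl) fun ζ hζ hc hs => ?_
    have i1 := integrable_smul_of_locallyIntegrableOn hgl hζ.continuous hc hs
    have i2 := integrable_smul_of_locallyIntegrableOn hpl hζ.continuous hc hs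
    have i3 : Integrable fun z => u z * fderiv ℝ ζ z v := by
      have := integrable_smul_of_locallyIntegrableOn
        (hu.continuousOn.locallyIntegrableOn hV.measurableSet)
        ((hζ.continuous_fderiv (by simp)).clm_apply continuous_const)
        (hc.fderiv_apply ℝ v) ((tsupport_fderiv_apply_subset ℝ v).trans hs)
      refine this.congr (Eventually.of_forall fun z => ?_)
      simp [mul_comm]
    have e1 := h.2.2 ζ hζ hc (hs.trans hVU) v
    rw [setIntegral_eq_integral_of_forall_compl_eq_zero, setIntegral_eq_integral_of_forall_compl_eq_zero] at e1
    rotate_left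
    · intro z hz
      rw [image_eq_zero_of_notMem_tsupport fun h => hz (hVU (hs h)), mul_zero]
    · intro z hz
      have : fderiv ℝ ζ z v = 0 :=
        image_eq_zero_of_notMem_tsupport (f := fun z => fderiv ℝ ζ z v)
          fun h => hz (hVU (hs (tsupport_fderiv_apply_subset ℝ v h)))
      rw [this, mul_zero]
    have hC : ContDiff ℝ 1 fun z => ζ z * u z := by
      refine contDiff_of_tsupport fun z hz => ?_
      have hz' : z ∈ V := hs (tsupport_mul_subset_left hz)
      exact (hζ.of_le (by simp)).contDiffAt.mul (hu.contDiffAt (hV.mem_nhds hz'))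
    have e2 := integral_fderiv_eq_zero hC hc.mul_right v
    have e3 : ∀ z, fderiv ℝ (fun z => ζ z * u z) z v = ζ z • fderiv ℝ u z v + u z * fderiv ℝ ζ z v := by
      intro z
      by_cases hz : z ∈ V
      · have := ((hζ.differentiable (by simp) z).hasFDerivAt.mul
          ((hu.contDiffAt (hV.mem_nhds hz)).differentiableAt (by simp)).hasFDerivAt).fderiv
        have h' : fderiv ℝ (fun z => ζ z * u z) z = _ := this
        rw [h']
        simp
      · have h0 : z ∉ tsupport ζ := fun h => hz (hs h)
        have h1 : ζ =ᶠ[𝓝 z] fun _ => 0 := notMem_tsupport_iff_eventuallyEq.1 h0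
        have h2 : (fun z => ζ z * u z) =ᶠ[𝓝 z] fun _ => 0 := by
          filter_upwards [h1] with y hy
          rw [hy, zero_mul]
        rw [h2.fderiv_eq, h1.fderiv_eq, h1.eq_of_nhds]
        simp
    rw [integral_congr_ae (Eventually.of_forall e3)] at e2
    rw [integral_add i2 i3, e1] at e2
    have e5 : ∀ z, ζ z • ((fun z => (inner ℝ (g z) v : ℝ)) - fun z => fderiv ℝ u z v) z =
        ζ z • (inner ℝ (g z) v : ℝ) - ζ z • fderiv ℝ u z v := fun z => smul_sub _ _ _
    refine (integral_congr_ae (Eventually.of_forall e5)).trans ?_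
    rw [integral_sub i1 i2]
    have e4 : ∫ z, ζ z • (inner ℝ (g z) v : ℝ) = ∫ z, inner ℝ (g z) v * ζ z := by
      simp_rw [smul_eq_mul, mul_comm]
    rw [e4]
    linarith
  filter_upwards [key 1, key Complex.I] with z h1 h2 hz
  have hd : DifferentiableAt ℝ u z := (hu.contDiffAt (hV.mem_nhds hz)).differentiableAt (by simp)
  have h1 := h1 hz
  have h2 := h2 hz
  rw [(hasFDerivAt_innerSL_gradient hd).fderiv, innerSL_apply_apply, ← inner_sub_left] at h1 h2
  rw [← sub_eq_zero]
  simp [Complex.inner] at h1 h2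
  exact Complex.ext (by simpa using h1) (by simp; linarith)

theorem phasePlus_disjoint_phaseMinus (U : Set ℂ) (u : ℂ → ℝ) :
    Disjoint (phasePlus U u) (phaseMinus U u) :=
  disjoint_left.2 fun _ hp hm => not_lt.2 (interior_subset hp).2 hm.2

theorem divergence_const (v : ℂ) (z : ℂ) : divergence (fun _ => v) z = 0 := by
  simp [divergence]

theorem divergence_sub {X Y : ℂ → ℂ} {z : ℂ} (hX : DifferentiableAt ℝ X z)
    (hY : DifferentiableAt ℝ Y z) :
    divergence (fun w => X w - Y w) z = divergence X z - divergence Y z := by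
  unfold divergence
  rw [fderiv_fun_sub hX hY]
  simp
  ring

theorem contDiff_im {n : WithTop ℕ∞} : ContDiff ℝ n Complex.im := Complex.imCLM.contDiff

theorem continuous_divergence {X : ℂ → ℂ} (hX : ContDiff ℝ 1 X) : Continuous (divergence X) := by
  have h1 := hX.continuous_fderiv (by simp)
  exact (Complex.continuous_re.comp (h1.clm_apply continuous_const)).add
    (Complex.continuous_im.comp (h1.clm_apply continuous_const))

theorem integrable_divergence {X : ℂ → ℂ} (hX : ContDiff ℝ 1 X) (hc : HasCompactSupport X) :
    Integrable (divergence X) := by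
  refine (continuous_divergence hX).integrable_of_hasCompactSupport ?_
  refine hc.mono' fun z hz => ?_
  by_contra h
  exact hz (divergence_eq_zero_of_notMem_tsupport h)

theorem gradient_contDiffOn {u : ℂ → ℝ} {U : Set ℂ} (hU : IsOpen U) (hu : ContDiffOn ℝ 2 u U) :
    ContDiffOn ℝ 1 (gradient u) U := by
  have h1 : ContDiffOn ℝ 1 (fderiv ℝ u) U := hu.fderiv_of_isOpen hU (by norm_num)
  exact ((InnerProductSpace.toDual ℝ ℂ).symm.contDiff.comp_contDiffOn h1)

/-- The derivative of a gradient is symmetric. -/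
theorem inner_fderiv_gradient_comm {u : ℂ → ℝ} {U : Set ℂ} (hU : IsOpen U)
    (hu : ContDiffOn ℝ 2 u U) {z : ℂ} (hz : z ∈ U) (a b : ℂ) :
    inner ℝ (fderiv ℝ (gradient u) z a) b = inner ℝ (fderiv ℝ (gradient u) z b) a := by
  have hs := (hu.contDiffAt (hU.mem_nhds hz)).isSymmSndFDerivAt (by simp)
  have hp := ((gradient_contDiffOn hU hu).contDiffAt (hU.mem_nhds hz)).differentiableAt (by simp)
  have key : fderiv ℝ (fderiv ℝ u) z = (innerSL ℝ).comp (fderiv ℝ (gradient u) z) := by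
    have h1 : fderiv ℝ u =ᶠ[𝓝 z] fun y => innerSL ℝ (gradient u y) := by
      filter_upwards [hU.mem_nhds hz] with y hy
      exact (hasFDerivAt_innerSL_gradient
        ((hu.contDiffAt (hU.mem_nhds hy)).differentiableAt (by simp))).fderiv
    rw [h1.fderiv_eq]
    exact (((innerSL ℝ (E := ℂ)).hasFDerivAt).comp z hp.hasFDerivAt).fderiv
  have := hs a b
  rw [key] at this
  simpa using this

/-- The stress tensor `|p|² v - 2 (p · v) p` of a curl-free field `p`. -/
theorem divergence_stress {p : ℂ → ℂ} {z : ℂ} (hp : DifferentiableAt ℝ p z)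
    (hs : ∀ a b, inner ℝ (fderiv ℝ p z a) b = inner ℝ (fderiv ℝ p z b) a) (v : ℂ) :
    divergence (fun z => ‖p z‖ ^ 2 • v - (2 * inner ℝ (p z) v) • p z) z =
      -2 * (inner ℝ (p z) v * divergence p z) := by
  have d1 := hp.hasFDerivAt.norm_sq
  have d2 := (hp.hasFDerivAt.inner ℝ (hasFDerivAt_const v z)).const_mul 2
  rw [divergence_sub (d1.differentiableAt.fun_smul (differentiableAt_const v))
    (d2.differentiableAt.fun_smul hp), divergence_smul d1.differentiableAt (differentiableAt_const v),
    divergence_smul d2.differentiableAt hp, d1.fderiv, d2.fderiv, divergence_const]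
  have := hs v (p z)
  rw [real_inner_comm] at this
  simp only [_root_.smul_apply, ContinuousLinearMap.comp_apply, innerSL_apply_apply,
    ContinuousLinearMap.prod_apply, fderivInnerCLM_apply, _root_.zero_apply,
    inner_zero_right, this]
  simp only [nsmul_eq_mul, smul_eq_mul, Nat.cast_ofNat]
  ring

/-- For domain variations `ζ v` supported in `{u < 0}`, criticality says that `(∇u · v) Δu = 0`;
as this holds for every `v`, `Δu = 0` wherever `∇u ≠ 0`, hence everywhere by density. -/
theorem divergence_gradient_eq_zero {ρp ρm Q : ℝ} {u : ℂ → ℝ} {g : ℂ → ℂ}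
    (hu : IsVariationalSolution ρp ρm Q u g) :
    ∀ z ∈ phaseMinus (halfBall 1) u, divergence (gradient u) z = 0 := by
  set Ω := phaseMinus (halfBall 1) u with hΩ
  have hΩo : IsOpen Ω := (hu.continuousOn.mono subset_union_left).isOpen_inter_preimage
    (isOpen_halfBall 1) isOpen_Iio
  have hΩb : Ω ⊆ halfBall 1 := fun z hz => hz.1
  have hpC := gradient_contDiffOn hΩo hu.contDiffOn
  have hga := ae_eq_gradient_of_hasWeakGradient hu.weakGradient hΩo hΩb
    (hu.contDiffOn.of_le (by norm_num))
  have hpd : ∀ z ∈ Ω, DifferentiableAt ℝ (gradient u) z := fun z hz =>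
    (hpC.contDiffAt (hΩo.mem_nhds hz)).differentiableAt (by simp)
  have hdivc : ContinuousOn (divergence (gradient u)) Ω := by
    have h1 := hpC.continuousOn_fderiv_of_isOpen hΩo (by simp)
    exact (Complex.continuous_re.comp_continuousOn (h1.clm_apply continuousOn_const)).add
      (Complex.continuous_im.comp_continuousOn (h1.clm_apply continuousOn_const))
  have main : ∀ v : ℂ, ∀ z ∈ Ω, inner ℝ (gradient u z) v * divergence (gradient u) z = 0 := by
    intro v
    set q : ℂ → ℝ := fun z => inner ℝ (gradient u z) v * divergence (gradient u) z with hq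
    have hqc : ContinuousOn q Ω := (hpC.continuousOn.inner continuousOn_const).mul hdivc
    set Y : ℂ → ℂ := fun z => ‖gradient u z‖ ^ 2 • v - (2 * inner ℝ (gradient u z) v) • gradient u z
      with hY
    have hYC : ContDiffOn ℝ 1 Y Ω := by
      have c1 : ContDiffOn ℝ 1 (fun z => ‖gradient u z‖ ^ 2 • v) Ω :=
        (hpC.norm_sq ℝ).smul contDiffOn_const
      have c2 : ContDiffOn ℝ 1 (fun z => (2 * inner ℝ (gradient u z) v) • gradient u z) Ω :=
        (contDiffOn_const.mul (hpC.inner ℝ contDiffOn_const)).smul hpC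
      exact c1.sub c2
    have hYdiv : ∀ z ∈ Ω, divergence Y z = -2 * q z := by
      intro z hz
      exact divergence_stress (hpd z hz) (inner_fderiv_gradient_comm hΩo hu.contDiffOn hz) v
    have hae : ∀ᵐ z, z ∈ Ω → q z = 0 := by
      refine hΩo.ae_eq_zero_of_integral_contDiff_smul_eq_zero
        (hqc.locallyIntegrableOn hΩo.measurableSet) fun ζ hζ hc hs => ?_
      have hζ1 : ContDiff ℝ 1 ζ := hζ.of_le (by simp)
      set φ : ℂ → ℂ := fun z => ζ z • v with hφ
      have hφC : ContDiff ℝ 1 φ := hζ1.smul contDiff_const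
      have hφs : tsupport φ ⊆ tsupport ζ := tsupport_smul_subset_left ζ _
      have hφc : HasCompactSupport φ := hc.smul_right
      have hφ0 : ∀ z : ℂ, z.im = 0 → (φ z).im = 0 := by
        intro z hz
        have : z ∉ tsupport ζ := fun h => (hΩb (hs h)).2.ne hz
        simp [hφ, image_eq_zero_of_notMem_tsupport this]
      have hcrit := hu.critical φ hφC hφc
        ((hφs.trans hs).trans (hΩb.trans (halfBall_subset_ball 1))) hφ0
      set X : ℂ → ℂ := fun z => ζ z • Y z with hX
      have hXs : tsupport X ⊆ tsupport ζ := tsupport_smul_subset_left ζ _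
      have hXC : ContDiff ℝ 1 X := contDiff_of_tsupport fun z hz =>
        hζ1.contDiffAt.smul (hYC.contDiffAt (hΩo.mem_nhds (hs (hXs hz))))
      have hXc : HasCompactSupport X := hc.smul_right
      set Z : ℂ → ℂ := fun z => (z.im + Q) • φ z with hZ
      have hZa : ContDiff ℝ 1 fun z : ℂ => z.im + Q := contDiff_im.add contDiff_const
      have hZC : ContDiff ℝ 1 Z := hZa.smul hφC
      have hZs : tsupport Z ⊆ tsupport ζ :=
        (tsupport_smul_subset_right (fun z : ℂ => z.im + Q) φ).trans hφs
      have hZc : HasCompactSupport Z := hc.of_isClosed_subset (isClosed_tsupport Z) hZs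
      have e : ∀ᵐ z ∂(volume.restrict (halfBall 1)),
          (‖g z‖ ^ 2 * divergence φ z - 2 * inner ℝ (g z) (fderiv ℝ φ z (g z))
        - (ρp * chiPlus (halfBall 1) u z + ρm * chiMinus (halfBall 1) u z)
            * divergence (fun w => (w.im + Q) • φ w) z) =
          divergence X z + 2 * (ζ z • q z) - ρm * divergence Z z := by
        refine ae_restrict_of_ae ?_
        filter_upwards [hga] with z hz
        by_cases hzΩ : z ∈ Ω
        · have hYd := (hYC.contDiffAt (hΩo.mem_nhds hzΩ)).differentiableAt (n := 1) (by simp)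
          have hζd := hζ1.differentiable (by simp) z
          have c1 : chiPlus (halfBall 1) u z = 0 := indicator_of_notMem
            (disjoint_right.1 (phasePlus_disjoint_phaseMinus (halfBall 1) u) hzΩ) _
          have c2 : chiMinus (halfBall 1) u z = 1 := indicator_of_mem hzΩ _
          have dφ : fderiv ℝ φ z = (fderiv ℝ ζ z).smulRight v :=
            (hζd.hasFDerivAt.smul_const v).fderiv
          rw [hz hzΩ, c1, c2, hX, divergence_smul hζd hYd, hYdiv z hzΩ, hφ,
            divergence_smul hζd (differentiableAt_const v), divergence_const, ← hφ, dφ]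
          simp only [hY, map_sub, map_smul, ContinuousLinearMap.smulRight_apply, smul_eq_mul,
            real_inner_smul_right, hZ]
          ring
        · have hzζ : z ∉ tsupport ζ := fun h => hzΩ (hs h)
          have dφ : fderiv ℝ φ z = 0 := by
            by_contra h
            exact hzζ (hφs (support_fderiv_subset ℝ h))
          rw [divergence_eq_zero_of_notMem_tsupport fun h => hzζ (hφs h),
            divergence_eq_zero_of_notMem_tsupport fun h => hzζ (hZs h),
            divergence_eq_zero_of_notMem_tsupport fun h => hzζ (hXs h), dφ,
            image_eq_zero_of_notMem_tsupport hzζ]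
          simp
      rw [integral_congr_ae e, setIntegral_eq_integral_of_forall_compl_eq_zero] at hcrit
      rotate_left
      · intro z hz
        have hzζ : z ∉ tsupport ζ := fun h => hz (hΩb (hs h))
        rw [divergence_eq_zero_of_notMem_tsupport fun h => hzζ (hZs h),
            divergence_eq_zero_of_notMem_tsupport fun h => hzζ (hXs h),
            image_eq_zero_of_notMem_tsupport hzζ]
        simp
      have iq := integrable_smul_of_locallyIntegrableOn
        (hqc.locallyIntegrableOn hΩo.measurableSet) hζ.continuous hc hs
      have i12 : Integrable fun z => divergence X z + 2 * ζ z • q z :=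
        (integrable_divergence hXC hXc).add (iq.const_mul 2)
      rw [integral_sub i12 ((integrable_divergence hZC hZc).const_mul ρm),
        integral_add (integrable_divergence hXC hXc) (iq.const_mul 2), integral_const_mul, integral_const_mul,
        integral_divergence_eq_zero hXC hXc, integral_divergence_eq_zero hZC hZc] at hcrit
      linarith
    exact Measure.eqOn_open_of_ae_eq ((ae_restrict_iff' hΩo.measurableSet).2 hae) hΩo hqc
      continuousOn_const
  intro z hz
  by_contra hne
  have hev : ∀ᶠ y in 𝓝 z, gradient u y = 0 := by
    have h1 : ∀ᶠ y in 𝓝 z, divergence (gradient u) y ≠ 0 :=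
      (hdivc.continuousAt (hΩo.mem_nhds hz)).eventually_ne hne
    filter_upwards [h1, hΩo.mem_nhds hz] with y hy hyΩ
    have := main (gradient u y) y hyΩ
    rcases mul_eq_zero.1 this with h | h
    · exact inner_self_eq_zero.1 h
    · exact absurd h hy
  have : gradient u =ᶠ[𝓝 z] fun _ => 0 := hev
  apply hne
  unfold divergence
  rw [this.fderiv_eq]
  simp

/-- The conjugate gradient of a harmonic function satisfies the Cauchy-Riemann equations. -/
theorem HolGrad.of_divergence_eq_zero {u : ℂ → ℝ} {U : Set ℂ} (hU : IsOpen U)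
    (hu : ContDiffOn ℝ 2 u U) (h : ∀ z ∈ U, divergence (gradient u) z = 0) : HolGrad u U := by
  refine ⟨hu.differentiableOn (by simp), fun z hz => ?_⟩
  have hp := ((gradient_contDiffOn hU hu).contDiffAt (hU.mem_nhds hz)).differentiableAt (by simp)
  have h1 : HasFDerivAt (fun z => conj (gradient u z)) _ z :=
    Complex.conjCLE.toContinuousLinearMap.hasFDerivAt.comp z hp.hasFDerivAt
  refine (differentiableAt_complex_iff_differentiableAt_real.2
    ⟨h1.differentiableAt, ?_⟩).differentiableWithinAt
  rw [h1.fderiv]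
  have hd := h z hz
  have hs := inner_fderiv_gradient_comm hU hu hz 1 Complex.I
  simp [Complex.inner] at hs
  unfold divergence at hd
  apply Complex.ext
  · simp [hs]
  · simp; linarith

theorem IsVariationalSolution.holGrad {ρp ρm Q : ℝ} {u : ℂ → ℝ} {g : ℂ → ℂ}
    (hu : IsVariationalSolution ρp ρm Q u g) : HolGrad u (phaseMinus (halfBall 1) u) :=
  HolGrad.of_divergence_eq_zero ((hu.continuousOn.mono subset_union_left).isOpen_inter_preimage
    (isOpen_halfBall 1) isOpen_Iio) hu.contDiffOn (divergence_gradient_eq_zero hu)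

/-! ### The smoothed monotonicity formula -/

section Identities

variable {R C : ℝ} {w : ℂ → ℝ}

theorem HalfSol.negGrad_of_mem (_hw : HalfSol R C w) {z : ℂ}
    (hz : z ∈ phaseMinus (halfBall R) w) : negGrad w z = gradient w z :=
  negGrad_of_neg hz.1.2 hz.2

theorem HalfSol.eq_zero_of_notMem (hw : HalfSol R C w) {z : ℂ} (hz : z ∈ halfBall R)
    (h : z ∉ phaseMinus (halfBall R) w) : w z = 0 ∧ negGrad w z = 0 := by
  have h0 : 0 ≤ w z := by
    by_contra hlt
    exact h ⟨hz, not_le.1 hlt⟩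
  exact ⟨le_antisymm (hw.nonpos z (halfBall_subset_lidBall R hz)) h0, negGrad_of_nonneg h0⟩

theorem HalfSol.setIntegral_phaseMinus (hw : HalfSol R C w) {F F' : ℂ → ℝ}
    (h1 : ∀ z ∈ phaseMinus (halfBall R) w, F z = F' z)
    (h2 : ∀ z ∈ halfBall R, w z = 0 → negGrad w z = 0 → F' z = 0) :
    ∫ z in phaseMinus (halfBall R) w, F z = ∫ z in halfBall R, F' z := by
  rw [setIntegral_congr_fun hw.isOpen_phaseMinus.measurableSet h1]
  refine (setIntegral_eq_of_subset_of_forall_sdiff_eq_zero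
    (isOpen_halfBall R).measurableSet (fun z hz => hz.1) fun z hz => ?_).symm
  obtain ⟨a, b⟩ := hw.eq_zero_of_notMem hz.1 hz.2
  exact h2 z hz.1 a b

/-- The energy identity: the equation is tested with `ψ w`. -/
theorem HalfSol.integral_energy (hw : HalfSol R C w) {ψ : ℂ → ℝ} (hψ : ContDiff ℝ 1 ψ)
    (hψs : tsupport ψ ⊆ Metric.ball 0 R) :
    ∫ z in halfBall R, (ψ z * ‖negGrad w z‖ ^ 2 + w z * fderiv ℝ ψ z (negGrad w z)) = 0 := by
  rw [← hw.integral_eq_zero hψ hψs hw.contDiffOn_gradient (B := C * √R) fun z hz =>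
    ⟨hw.norm_gradient_le le_rfl hz.1, by
      rw [hw.divergence_gradient hz, abs_zero]
      exact mul_nonneg hw.const_nonneg (Real.sqrt_nonneg _)⟩]
  refine (hw.setIntegral_phaseMinus (fun z hz => ?_) fun z _ h1 h2 => ?_).symm
  · rw [hw.negGrad_of_mem hz, hw.divergence_gradient hz, real_inner_self_eq_norm_sq]; ring
  · rw [h1, h2]; simp

/-- `negGrad w` is the weak gradient of `w`. The test function may be nonzero on the lid, where `w`
vanishes. -/
theorem HalfSol.integral_weakGradient (hw : HalfSol R C w) {ψ : ℂ → ℝ} (hψ : ContDiff ℝ 1 ψ)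
    (hψs : tsupport ψ ⊆ Metric.ball 0 R) (v : ℂ) :
    ∫ z in halfBall R, (ψ z * inner ℝ (negGrad w z) v + w z * fderiv ℝ ψ z v) = 0 := by
  rw [← hw.integral_eq_zero hψ hψs (Y := fun _ => v) contDiffOn_const (B := ‖v‖) fun z hz =>
    ⟨le_rfl, by rw [divergence_const, abs_zero]; exact norm_nonneg _⟩]
  refine (hw.setIntegral_phaseMinus (fun z hz => ?_) fun z _ h1 h2 => ?_).symm
  · rw [hw.negGrad_of_mem hz, divergence_const]; ring
  · rw [h1, h2]; simp

/-- The divergence theorem for the field `w² ψ z`. -/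
theorem HalfSol.integral_sq (hw : HalfSol R C w) {ψ : ℂ → ℝ} (hψ : ContDiff ℝ 1 ψ)
    (hψs : tsupport ψ ⊆ Metric.ball 0 R) :
    ∫ z in halfBall R, (ψ z * (2 * w z * inner ℝ (negGrad w z) z + 2 * w z ^ 2)
      + w z ^ 2 * fderiv ℝ ψ z z) = 0 := by
  have hdiv : ∀ z ∈ phaseMinus (halfBall R) w,
      divergence (fun z => w z • z) z = inner ℝ (gradient w z) z + 2 * w z := by
    intro z hz
    rw [divergence_smul (X := fun z => z) (hw.hasFDerivAt hz).differentiableAt differentiableAt_id,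
      (hw.hasFDerivAt hz).fderiv]
    simp [divergence]
    ring
  rw [← hw.integral_eq_zero hψ hψs (Y := fun z => w z • z) (hw.contDiffOn.smul contDiffOn_id)
    (B := C * √R * R * R + (C * √R * R + 2 * (C * √R * R))) fun z hz => ?_]
  · refine (hw.setIntegral_phaseMinus (fun z hz => ?_) fun z _ h1 h2 => ?_).symm
    · rw [hw.negGrad_of_mem hz, hdiv z hz, real_inner_smul_right, map_smul, smul_eq_mul]; ring
    · rw [h1, h2]; simp
  · have hR : 0 ≤ R := (norm_nonneg z).trans hz.1.1.le
    have hCR : 0 ≤ C * √R := mul_nonneg hw.const_nonneg (Real.sqrt_nonneg _)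
    have h1 : |w z| ≤ C * √R * R :=
      (hw.abs_le le_rfl (halfBall_subset_lidBall R hz.1)).trans
        (mul_le_mul_of_nonneg_left hz.1.1.le hCR)
    have h2 : |(inner ℝ (gradient w z) z : ℝ)| ≤ C * √R * R :=
      (abs_real_inner_le_norm _ _).trans
        (mul_le_mul (hw.norm_gradient_le le_rfl hz.1) hz.1.1.le (norm_nonneg _) hCR)
    have h3 : 0 ≤ C * √R * R := mul_nonneg hCR hR
    constructor
    · rw [norm_smul]
      have := mul_le_mul h1 hz.1.1.le (norm_nonneg _) h3
      rw [Real.norm_eq_abs]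
      linarith
    · rw [hdiv z hz]
      have h4 : |2 * w z| ≤ 2 * (C * √R * R) := by rw [abs_mul]; simpa using h1
      have h5 : 0 ≤ C * √R * R * R := mul_nonneg h3 hR
      linarith [abs_add_le (inner ℝ (gradient w z) z : ℝ) (2 * w z)]

theorem HalfSol.aestronglyMeasurable (hw : HalfSol R C w) :
    AEStronglyMeasurable w (volume.restrict (halfBall R)) :=
  (hw.continuousOn.mono (halfBall_subset_lidBall R)).aestronglyMeasurable
    (isOpen_halfBall R).measurableSet

theorem HalfSol.aestronglyMeasurable_negGrad (hw : HalfSol R C w) :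
    AEStronglyMeasurable (negGrad w) (volume.restrict (halfBall R)) := by
  have h1 : AEStronglyMeasurable ((phaseMinus (halfBall R) w).indicator (gradient w)) volume :=
    (aestronglyMeasurable_indicator_iff hw.isOpen_phaseMinus.measurableSet).2
      (hw.contDiffOn_gradient.continuousOn.aestronglyMeasurable hw.isOpen_phaseMinus.measurableSet)
  refine h1.restrict.congr ?_
  filter_upwards [ae_restrict_mem (isOpen_halfBall R).measurableSet] with z hz
  by_cases h : z ∈ phaseMinus (halfBall R) w
  · rw [indicator_of_mem h, hw.negGrad_of_mem h]
  · rw [indicator_of_notMem h, (hw.eq_zero_of_notMem hz h).2]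

end Identities

/-- Criticality of `w` on the half-disc of radius `R`, with density `ρ`, for domain variations
tangential to the lid. -/
def IsCritical (R : ℝ) (w ρ : ℂ → ℝ) : Prop :=
  ∀ φ : ℂ → ℂ, ContDiff ℝ 1 φ → tsupport φ ⊆ Metric.ball 0 R →
    (∀ z : ℂ, z.im = 0 → (φ z).im = 0) →
    ∫ z in halfBall R, (‖negGrad w z‖ ^ 2 * divergence φ z
      - 2 * inner ℝ (negGrad w z) (fderiv ℝ φ z (negGrad w z))
      - ρ z * divergence (fun y => y.im • φ y) z) = 0

theorem hasDerivAt_posPart_pow (n : ℕ) (x : ℝ) :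
    HasDerivAt (fun x : ℝ => max x 0 ^ (n + 2)) ((n + 2 : ℕ) * max x 0 ^ (n + 1)) x := by
  rcases lt_trichotomy x 0 with h | h | h
  · rw [max_eq_right h.le, zero_pow (by omega), mul_zero]
    refine (hasDerivAt_const x (0 : ℝ)).congr_of_eventuallyEq ?_
    filter_upwards [Iio_mem_nhds h] with y hy
    rw [max_eq_right (le_of_lt hy), zero_pow (by omega)]
  · subst h
    rw [max_self, zero_pow (by omega), mul_zero, hasDerivAt_iff_isLittleO]
    simp only [max_self, sub_zero, smul_zero]
    refine (Asymptotics.isBigO_of_le _ fun y => ?_).trans_isLittleO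
      (Asymptotics.isLittleO_pow_id (𝕜 := ℝ) (n := n + 2) (by omega))
    rw [zero_pow (by omega), sub_zero, norm_pow, norm_pow]
    refine pow_le_pow_left₀ (norm_nonneg _) ?_ _
    rw [Real.norm_eq_abs, Real.norm_eq_abs, abs_of_nonneg (le_max_right _ _)]
    exact max_le (le_abs_self y) (abs_nonneg y)
  · rw [max_eq_left h.le]
    refine (hasDerivAt_pow (n + 2) x).congr_of_eventuallyEq ?_
    filter_upwards [Ioi_mem_nhds h] with y hy
    rw [max_eq_left (le_of_lt hy)]

/-- The radial cutoff profile, as a function of the square of the radius. -/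
def cutoff (s : ℝ) : ℝ := max (1 - s) 0 ^ 3

/-- The derivative of `cutoff`. -/
def cutoff' (s : ℝ) : ℝ := -3 * max (1 - s) 0 ^ 2

/-- The second derivative of `cutoff`. -/
def cutoff'' (s : ℝ) : ℝ := 6 * max (1 - s) 0

theorem hasDerivAt_cutoff (s : ℝ) : HasDerivAt cutoff (cutoff' s) s := by
  have := (hasDerivAt_posPart_pow 1 (1 - s)).comp s ((hasDerivAt_id s).const_sub 1)
  refine (this.congr_deriv ?_)
  simp [cutoff']

theorem hasDerivAt_cutoff' (s : ℝ) : HasDerivAt cutoff' (cutoff'' s) s := by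
  have := ((hasDerivAt_posPart_pow 0 (1 - s)).comp s ((hasDerivAt_id s).const_sub 1)).const_mul (-3)
  refine (this.congr_deriv ?_)
  simp [cutoff'']; ring

theorem continuous_cutoff' : Continuous cutoff' := by unfold cutoff'; fun_prop
theorem continuous_cutoff'' : Continuous cutoff'' := by unfold cutoff''; fun_prop
theorem continuous_cutoff : Continuous cutoff := by unfold cutoff; fun_prop

theorem contDiff_one_of_hasDerivAt {f f' : ℝ → ℝ} (h : ∀ s, HasDerivAt f (f' s) s)
    (hc : Continuous f') : ContDiff ℝ 1 f := by
  rw [contDiff_one_iff_deriv]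
  refine ⟨fun s => (h s).differentiableAt, ?_⟩
  rwa [show deriv f = f' from funext fun s => (h s).deriv]

theorem posPart_le_one {s : ℝ} (hs : 0 ≤ s) : max (1 - s) 0 ≤ 1 :=
  max_le (by linarith) zero_le_one

theorem abs_cutoff_le {s : ℝ} (hs : 0 ≤ s) : |cutoff s| ≤ 1 := by
  unfold cutoff
  rw [abs_of_nonneg (by positivity)]
  exact pow_le_one₀ (le_max_right _ _) (posPart_le_one hs)

theorem abs_cutoff'_le {s : ℝ} (hs : 0 ≤ s) : |cutoff' s| ≤ 3 := by
  unfold cutoff'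
  rw [abs_mul, abs_of_nonneg (a := max (1 - s) 0 ^ 2) (by positivity)]
  have := pow_le_one₀ (n := 2) (le_max_right _ _) (posPart_le_one hs)
  rw [abs_neg, abs_of_nonneg (by norm_num : (0 : ℝ) ≤ 3)]
  linarith

theorem abs_cutoff''_le {s : ℝ} (hs : 0 ≤ s) : |cutoff'' s| ≤ 6 := by
  unfold cutoff''
  rw [abs_of_nonneg (by positivity)]
  linarith [posPart_le_one hs]

/-- Radial functions `f (|z|² / l²)`, for `f` supported in `(-∞, 1]`. -/
theorem hasFDerivAt_radial {f f' : ℝ → ℝ} (h : ∀ s, HasDerivAt f (f' s) s) (l : ℝ) (z : ℂ) :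
    HasFDerivAt (fun z : ℂ => f (‖z‖ ^ 2 / l ^ 2))
      ((f' (‖z‖ ^ 2 / l ^ 2) * (2 / l ^ 2)) • innerSL ℝ z) z := by
  have h1 : HasFDerivAt (fun z : ℂ => ‖z‖ ^ 2 / l ^ 2) ((2 / l ^ 2) • innerSL ℝ z) z := by
    have := ((hasStrictFDerivAt_norm_sq z).hasFDerivAt).mul_const (l ^ 2)⁻¹
    refine (this.congr_fderiv ?_)
    ext v
    simp
    ring
  have := (h (‖z‖ ^ 2 / l ^ 2)).comp_hasFDerivAt z h1
  rwa [smul_smul] at this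

theorem contDiff_radial {f f' : ℝ → ℝ} (h : ∀ s, HasDerivAt f (f' s) s) (hc : Continuous f')
    (l : ℝ) : ContDiff ℝ 1 fun z : ℂ => f (‖z‖ ^ 2 / l ^ 2) :=
  (contDiff_one_of_hasDerivAt h hc).comp ((contDiff_norm_sq ℝ).div_const _)

theorem tsupport_radial {f : ℝ → ℝ} (h : ∀ s, 1 ≤ s → f s = 0) {l : ℝ} (hl : 0 < l) :
    tsupport (fun z : ℂ => f (‖z‖ ^ 2 / l ^ 2)) ⊆ Metric.closedBall 0 l := by
  refine closure_minimal (fun z hz => ?_) Metric.isClosed_closedBall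
  rw [mem_closedBall_zero_iff]
  by_contra hlt
  push Not at hlt
  refine hz (h _ ?_)
  rw [one_le_div (by positivity)]
  exact pow_le_pow_left₀ hl.le hlt.le 2

theorem cutoff_eq_zero {s : ℝ} (h : 1 ≤ s) : cutoff s = 0 := by
  simp [cutoff, max_eq_right (sub_nonpos.2 h)]

theorem cutoff'_eq_zero {s : ℝ} (h : 1 ≤ s) : cutoff' s = 0 := by
  simp [cutoff', max_eq_right (sub_nonpos.2 h)]

/-- The bulk energy density `|∇w|² - y ρ`. -/
def energyDensity (w ρ : ℂ → ℝ) (z : ℂ) : ℝ := ‖negGrad w z‖ ^ 2 - z.im * ρ z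

/-- The boundary adjusted energy `M`, integrated over the radii `0 < s < l` against the weight
`-2 l⁻⁵ s⁴ cutoff' (s² / l²)`. By Fubini's theorem this is a single integral over the half-disc; in
this form no traces on circles occur, and the dependence on `l` is differentiable. -/
def smoothEnergy (R : ℝ) (w ρ : ℂ → ℝ) (l : ℝ) : ℝ :=
  ∫ z in halfBall R, ((l ^ 3)⁻¹ * (energyDensity w ρ z * cutoff (‖z‖ ^ 2 / l ^ 2))
    + 3 * (l ^ 5)⁻¹ * (w z ^ 2 * cutoff' (‖z‖ ^ 2 / l ^ 2)))

/-- The integrand of the derivative of `smoothEnergy`. -/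
def smoothEnergy' (w ρ : ℂ → ℝ) (l : ℝ) (z : ℂ) : ℝ :=
  -3 * (l ^ 4)⁻¹ * (energyDensity w ρ z * cutoff (‖z‖ ^ 2 / l ^ 2))
    + (l ^ 3)⁻¹ * (energyDensity w ρ z * (cutoff' (‖z‖ ^ 2 / l ^ 2) * (-2 * ‖z‖ ^ 2 * (l ^ 3)⁻¹)))
    + (-15 * (l ^ 6)⁻¹ * (w z ^ 2 * cutoff' (‖z‖ ^ 2 / l ^ 2))
    + 3 * (l ^ 5)⁻¹ * (w z ^ 2 * (cutoff'' (‖z‖ ^ 2 / l ^ 2) * (-2 * ‖z‖ ^ 2 * (l ^ 3)⁻¹))))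

section Monotonicity

variable {R C b : ℝ} {w ρ : ℂ → ℝ}

theorem HalfSol.abs_energyDensity_le (hw : HalfSol R C w) (hb : ∀ z, |ρ z| ≤ b) {z : ℂ}
    (hz : z ∈ halfBall R) : |energyDensity w ρ z| ≤ (C * √R) ^ 2 + R * b := by
  unfold energyDensity
  have h1 := hw.norm_negGrad_le le_rfl hz
  have h2 : |z.im * ρ z| ≤ R * b := by
    rw [abs_mul]
    exact mul_le_mul ((Complex.abs_im_le_norm z).trans hz.1.le) (hb z) (abs_nonneg _)
      ((norm_nonneg z).trans hz.1.le)
  have h3 : |‖negGrad w z‖ ^ 2| ≤ (C * √R) ^ 2 := by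
    rw [abs_of_nonneg (by positivity)]
    exact pow_le_pow_left₀ (norm_nonneg _) h1 2
  exact (abs_sub _ _).trans (add_le_add h3 h2)

theorem HalfSol.sq_le (hw : HalfSol R C w) {z : ℂ} (hz : z ∈ halfBall R) :
    w z ^ 2 ≤ (C * √R * R) ^ 2 := by
  have hCR : 0 ≤ C * √R := mul_nonneg hw.const_nonneg (Real.sqrt_nonneg _)
  have h1 := (hw.abs_le le_rfl (halfBall_subset_lidBall R hz)).trans
        (mul_le_mul_of_nonneg_left hz.1.le hCR)
  rw [← sq_abs]
  exact pow_le_pow_left₀ (abs_nonneg _) h1 2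

theorem continuous_radial {f : ℝ → ℝ} (hf : Continuous f) (l : ℝ) :
    Continuous fun z : ℂ => f (‖z‖ ^ 2 / l ^ 2) :=
  hf.comp (by fun_prop)

theorem integrableOn_halfBall_of_bound {E : Type*} [NormedAddCommGroup E] {f : ℂ → E} {R : ℝ}
    (hf : AEStronglyMeasurable f (volume.restrict (halfBall R))) (B : ℝ)
    (hB : ∀ z ∈ halfBall R, ‖f z‖ ≤ B) : IntegrableOn f (halfBall R) :=
  IntegrableOn.of_bound (volume_halfBall_lt_top R) hf B
    ((ae_restrict_iff' (isOpen_halfBall R).measurableSet).2 (Eventually.of_forall hB))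

/-- Measurable and bounded on the half-disc of radius `R`. -/
def IsBddMeas (R : ℝ) (f : ℂ → ℝ) : Prop :=
  AEStronglyMeasurable f (volume.restrict (halfBall R)) ∧ ∃ B, ∀ z ∈ halfBall R, |f z| ≤ B

namespace IsBddMeas

variable {f g : ℂ → ℝ}

theorem integrableOn (hf : IsBddMeas R f) : IntegrableOn f (halfBall R) := by
  obtain ⟨B, hB⟩ := hf.2
  exact integrableOn_halfBall_of_bound hf.1 B hB

theorem const (c : ℝ) : IsBddMeas R fun _ => c :=
  ⟨aestronglyMeasurable_const, |c|, fun _ _ => le_rfl⟩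

theorem mul (hf : IsBddMeas R f) (hg : IsBddMeas R g) : IsBddMeas R fun z => f z * g z := by
  obtain ⟨A, hA⟩ := hf.2
  obtain ⟨B, hB⟩ := hg.2
  refine ⟨hf.1.mul hg.1, A * B, fun z hz => ?_⟩
  rw [abs_mul]
  exact mul_le_mul (hA z hz) (hB z hz) (abs_nonneg _) ((abs_nonneg _).trans (hA z hz))

theorem add (hf : IsBddMeas R f) (hg : IsBddMeas R g) : IsBddMeas R fun z => f z + g z := by
  obtain ⟨A, hA⟩ := hf.2
  obtain ⟨B, hB⟩ := hg.2
  exact ⟨hf.1.add hg.1, A + B, fun z hz => (abs_add_le _ _).trans (add_le_add (hA z hz) (hB z hz))⟩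

theorem sub (hf : IsBddMeas R f) (hg : IsBddMeas R g) : IsBddMeas R fun z => f z - g z := by
  obtain ⟨A, hA⟩ := hf.2
  obtain ⟨B, hB⟩ := hg.2
  exact ⟨hf.1.sub hg.1, A + B, fun z hz => (abs_sub _ _).trans (add_le_add (hA z hz) (hB z hz))⟩

theorem sq (hf : IsBddMeas R f) : IsBddMeas R fun z => f z ^ 2 := by
  simp_rw [pow_two]; exact hf.mul hf

theorem of_continuous (hf : Continuous f) : IsBddMeas R f := by
  obtain ⟨B, hB⟩ := (isCompact_closedBall (0 : ℂ) R).exists_bound_of_continuousOn hf.continuousOn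
  exact ⟨hf.aestronglyMeasurable, B, fun z hz => hB z (mem_closedBall_zero_iff.2 hz.1.le)⟩

theorem of_measurable (hρ : Measurable ρ) (hb : ∀ z, |ρ z| ≤ b) : IsBddMeas R ρ :=
  ⟨hρ.aestronglyMeasurable, b, fun z _ => hb z⟩

end IsBddMeas

theorem HalfSol.isBddMeas (hw : HalfSol R C w) : IsBddMeas R w := by
  refine ⟨hw.aestronglyMeasurable, C * √R * R, fun z hz => ?_⟩
  exact (hw.abs_le le_rfl (halfBall_subset_lidBall R hz)).trans
    (mul_le_mul_of_nonneg_left hz.1.le (mul_nonneg hw.const_nonneg (Real.sqrt_nonneg _)))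

theorem HalfSol.isBddMeas_norm_negGrad (hw : HalfSol R C w) :
    IsBddMeas R fun z => ‖negGrad w z‖ :=
  ⟨hw.aestronglyMeasurable_negGrad.norm, C * √R, fun z hz => by
    rw [abs_norm]; exact hw.norm_negGrad_le le_rfl hz⟩

theorem HalfSol.isBddMeas_inner_negGrad (hw : HalfSol R C w) :
    IsBddMeas R fun z => inner ℝ (negGrad w z) z := by
  refine ⟨hw.aestronglyMeasurable_negGrad.inner continuous_id.aestronglyMeasurable,
    C * √R * R, fun z hz => (abs_real_inner_le_norm _ _).trans ?_⟩
  exact mul_le_mul (hw.norm_negGrad_le le_rfl hz) hz.1.le (norm_nonneg _)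
    (mul_nonneg hw.const_nonneg (Real.sqrt_nonneg _))

theorem HalfSol.isBddMeas_energyDensity (hw : HalfSol R C w) (hρ : Measurable ρ)
    (hb : ∀ z, |ρ z| ≤ b) : IsBddMeas R (energyDensity w ρ) :=
  hw.isBddMeas_norm_negGrad.sq.sub
    ((IsBddMeas.of_continuous Complex.continuous_im).mul (.of_measurable hρ hb))

/-- Differentiation under the integral sign. -/
theorem HalfSol.hasDerivAt_smoothEnergy (hw : HalfSol R C w) (hρ : Measurable ρ)
    (hb : ∀ z, |ρ z| ≤ b) {l : ℝ} (hl : 0 < l) :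
    HasDerivAt (smoothEnergy R w ρ) (∫ z in halfBall R, smoothEnergy' w ρ l z) l := by
  have hfin : IsFiniteMeasure (volume.restrict (halfBall R)) :=
    ⟨by simpa using volume_halfBall_lt_top R⟩
  have hmE := (hw.isBddMeas_energyDensity hρ hb).1
  have hmw := hw.aestronglyMeasurable.pow 2
  have hm : ∀ l : ℝ, AEStronglyMeasurable (fun z =>
      (l ^ 3)⁻¹ * (energyDensity w ρ z * cutoff (‖z‖ ^ 2 / l ^ 2))
        + 3 * (l ^ 5)⁻¹ * (w z ^ 2 * cutoff' (‖z‖ ^ 2 / l ^ 2))) (volume.restrict (halfBall R)) :=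
    fun l => ((hmE.mul (continuous_radial continuous_cutoff l).aestronglyMeasurable).const_mul _).add
      ((hmw.mul (continuous_radial continuous_cutoff' l).aestronglyMeasurable).const_mul _)
  set H := (C * √R) ^ 2 + R * b with hH
  set W := (C * √R * R) ^ 2 with hW
  have hpos : ∀ {z : ℂ} {l : ℝ}, 0 ≤ ‖z‖ ^ 2 / l ^ 2 := by intro z l; positivity
  set m := l / 2 with hmdef
  have hm0 : 0 < m := by positivity
  refine (hasDerivAt_integral_of_dominated_loc_of_deriv_le (s := Ioi m)
    (F' := fun l z => smoothEnergy' w ρ l z)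
    (bound := fun _ => 3 * (m ^ 4)⁻¹ * (H * 1) + (m ^ 3)⁻¹ * (H * (3 * (2 * R ^ 2 * (m ^ 3)⁻¹)))
      + (15 * (m ^ 6)⁻¹ * (W * 3) + 3 * (m ^ 5)⁻¹ * (W * (6 * (2 * R ^ 2 * (m ^ 3)⁻¹)))))
    (Ioi_mem_nhds (by rw [hmdef]; linarith)) (Eventually.of_forall hm) ?_ ?_ ?_
    (integrable_const _) ?_).2
  · exact (((IsBddMeas.const _).mul ((hw.isBddMeas_energyDensity hρ hb).mul
      (.of_continuous (continuous_radial continuous_cutoff l)))).add ((IsBddMeas.const _).mul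
      (hw.isBddMeas.sq.mul (.of_continuous (continuous_radial continuous_cutoff' l))))).integrableOn
  · have c1 := (continuous_radial continuous_cutoff l).aestronglyMeasurable
      (μ := volume.restrict (halfBall R))
    have c2 := (continuous_radial continuous_cutoff' l).aestronglyMeasurable
      (μ := volume.restrict (halfBall R))
    have c3 := (continuous_radial continuous_cutoff'' l).aestronglyMeasurable
      (μ := volume.restrict (halfBall R))
    have c4 : AEStronglyMeasurable (fun z : ℂ => -2 * ‖z‖ ^ 2 * (l ^ 3)⁻¹)
      (volume.restrict (halfBall R)) := Continuous.aestronglyMeasurable (by fun_prop)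
    exact (((hmE.mul c1).const_mul _).add ((hmE.mul (c2.mul c4)).const_mul _)).add
      (((hmw.mul c2).const_mul _).add ((hmw.mul (c3.mul c4)).const_mul _))
  · refine (ae_restrict_iff' (isOpen_halfBall R).measurableSet).2
      (Eventually.of_forall fun z hz x hx => ?_)
    have hx : m < x := hx
    have h1 := hw.abs_energyDensity_le hb hz
    have hH0 : 0 ≤ H := (abs_nonneg _).trans h1
    have hR : 0 ≤ R := (norm_nonneg z).trans hz.1.le
    have hx0 : 0 < x := hm0.trans hx
    have hinv : ∀ k : ℕ, (x ^ k)⁻¹ ≤ (m ^ k)⁻¹ := fun k =>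
      inv_anti₀ (by positivity) (pow_le_pow_left₀ hm0.le hx.le k)
    have h2 : |(-2 * ‖z‖ ^ 2 * (x ^ 3)⁻¹ : ℝ)| ≤ 2 * R ^ 2 * (m ^ 3)⁻¹ := by
      rw [abs_mul, abs_mul, abs_of_nonneg (a := ‖z‖ ^ 2) (by positivity),
        abs_of_nonneg (a := (x ^ 3)⁻¹) (by positivity)]
      have := pow_le_pow_left₀ (norm_nonneg z) hz.1.le 2
      have h3 : |(-2 : ℝ)| = 2 := by norm_num
      rw [h3]
      exact mul_le_mul (mul_le_mul_of_nonneg_left this (by norm_num)) (hinv 3) (by positivity)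
        (by positivity)
    refine (norm_add_le _ _).trans (add_le_add ((norm_add_le _ _).trans (add_le_add ?_ ?_))
      ((norm_add_le _ _).trans (add_le_add ?_ ?_)))
    · rw [norm_mul, norm_mul, norm_mul, Real.norm_of_nonneg (r := (x ^ 4)⁻¹) (by positivity)]
      refine mul_le_mul (mul_le_mul (by norm_num) (hinv 4) (by positivity) (by positivity))
        (mul_le_mul h1 (abs_cutoff_le hpos) (abs_nonneg _) hH0) (by positivity) (by positivity)
    · rw [norm_mul, norm_mul, norm_mul, Real.norm_of_nonneg (r := (x ^ 3)⁻¹) (by positivity)]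
      exact mul_le_mul (hinv 3) (mul_le_mul h1 (mul_le_mul (abs_cutoff'_le hpos) h2 (abs_nonneg _)
        (by positivity)) (by positivity) hH0) (by positivity) (by positivity)
    · rw [norm_mul, norm_mul, norm_mul, Real.norm_of_nonneg (r := (x ^ 6)⁻¹) (by positivity),
        Real.norm_of_nonneg (r := w z ^ 2) (by positivity)]
      refine mul_le_mul (mul_le_mul (by norm_num) (hinv 6) (by positivity) (by positivity))
        (mul_le_mul (hw.sq_le hz) (abs_cutoff'_le hpos) (abs_nonneg _) (by positivity))
        (by positivity) (by positivity)
    · rw [norm_mul, norm_mul, norm_mul, norm_mul,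
        Real.norm_of_nonneg (r := (x ^ 5)⁻¹) (by positivity),
        Real.norm_of_nonneg (r := w z ^ 2) (by positivity)]
      refine mul_le_mul (mul_le_mul (by norm_num) (hinv 5) (by positivity) (by positivity))
        (mul_le_mul (hw.sq_le hz) (mul_le_mul (abs_cutoff''_le hpos) h2 (abs_nonneg _)
        (by positivity)) (by positivity) (by positivity)) (by positivity) (by positivity)
  · refine Eventually.of_forall fun z x hx => ?_
    have hx0 : 0 < x := hm0.trans hx
    have hx' : x ≠ 0 := hx0.ne'
    have d0 : HasDerivAt (fun x : ℝ => ‖z‖ ^ 2 / x ^ 2) (-2 * ‖z‖ ^ 2 * (x ^ 3)⁻¹) x := by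
      have := ((hasDerivAt_pow 2 x).inv (by positivity)).const_mul (‖z‖ ^ 2)
      refine this.congr_deriv ?_
      field_simp
      norm_num
      ring
    have d1 := (hasDerivAt_cutoff (‖z‖ ^ 2 / x ^ 2)).comp x d0
    have d2 := (hasDerivAt_cutoff' (‖z‖ ^ 2 / x ^ 2)).comp x d0
    have i3 : HasDerivAt (fun x : ℝ => (x ^ 3)⁻¹) (-3 * (x ^ 4)⁻¹) x := by
      refine ((hasDerivAt_pow 3 x).inv (by positivity)).congr_deriv ?_
      field_simp
      norm_num
      ring
    have i5 : HasDerivAt (fun x : ℝ => 3 * (x ^ 5)⁻¹) (-15 * (x ^ 6)⁻¹) x := by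
      refine (((hasDerivAt_pow 5 x).inv (by positivity)).const_mul 3).congr_deriv ?_
      field_simp
      norm_num
      ring
    exact (i3.mul (d1.const_mul (energyDensity w ρ z))).add (i5.mul (d2.const_mul (w z ^ 2)))

/-- The monotonicity formula: the radial domain variation, the energy identity and the divergence
theorem combine to a complete square, which vanishes exactly on functions that are homogeneous of
degree `3/2`. -/
theorem HalfSol.integral_smoothEnergy' (hw : HalfSol R C w) (hρ : Measurable ρ)
    (hb : ∀ z, |ρ z| ≤ b) (hcrit : IsCritical R w ρ) {l : ℝ} (hl : 0 < l) (hlR : l < R) :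
    ∫ z in halfBall R, smoothEnergy' w ρ l z =
      12 * (l ^ 6)⁻¹ * ∫ z in halfBall R, max (1 - ‖z‖ ^ 2 / l ^ 2) 0 ^ 2 *
        (inner ℝ (negGrad w z) z - 3 / 2 * w z) ^ 2 := by
  set κ : ℂ → ℝ := fun z => cutoff (‖z‖ ^ 2 / l ^ 2) with hκ
  set κ' : ℂ → ℝ := fun z => cutoff' (‖z‖ ^ 2 / l ^ 2) with hκ'
  have hκC : ContDiff ℝ 1 κ := contDiff_radial hasDerivAt_cutoff continuous_cutoff' l
  have hκ'C : ContDiff ℝ 1 κ' := contDiff_radial hasDerivAt_cutoff' continuous_cutoff'' l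
  have hball : Metric.closedBall (0 : ℂ) l ⊆ Metric.ball 0 R := Metric.closedBall_subset_ball hlR
  have hκs : tsupport κ ⊆ Metric.closedBall 0 l := tsupport_radial (fun _ => cutoff_eq_zero) hl
  have hκ's : tsupport κ' ⊆ Metric.closedBall 0 l := tsupport_radial (fun _ => cutoff'_eq_zero) hl
  set φ : ℂ → ℂ := fun z => κ z • z with hφ
  have hφC : ContDiff ℝ 1 φ := hκC.smul contDiff_id
  have I1 := hcrit φ hφC (((tsupport_smul_subset_left κ _).trans hκs).trans hball) (fun z hz => by
    simp [hφ, hz])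
  have I2 := hw.integral_energy hκC (hκs.trans hball)
  have I3 := hw.integral_sq hκ'C (hκ's.trans hball)
  -- the first variation along `κ z`, computed
  have e1 : ∀ z, (‖negGrad w z‖ ^ 2 * divergence φ z
      - 2 * inner ℝ (negGrad w z) (fderiv ℝ φ z (negGrad w z))
      - ρ z * divergence (fun y => y.im • φ y) z) =
      ‖negGrad w z‖ ^ 2 * (2 * (‖z‖ ^ 2 / l ^ 2) * κ' z)
        - 4 / l ^ 2 * κ' z * inner ℝ (negGrad w z) z ^ 2
        - z.im * ρ z * (3 * κ z + 2 * (‖z‖ ^ 2 / l ^ 2) * κ' z) := by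
    intro z
    have hd := hasFDerivAt_radial hasDerivAt_cutoff l z
    have hdφ : HasFDerivAt φ _ z := hd.smul (hasFDerivAt_id z)
    have hdiv : divergence φ z = 2 * κ z + 2 * (‖z‖ ^ 2 / l ^ 2) * κ' z := by
      rw [hφ, divergence_smul (X := fun z => z) hd.differentiableAt differentiableAt_id, hd.fderiv]
      simp [divergence, hκ, hκ']
      ring
    have him : HasFDerivAt (fun y : ℂ => y.im) Complex.imCLM z := Complex.imCLM.hasFDerivAt
    have hdiv2 : divergence (fun y => y.im • φ y) z = κ z * z.im + z.im * divergence φ z := by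
      rw [divergence_smul him.differentiableAt hdφ.differentiableAt, him.fderiv]
      simp [hφ]
    rw [hdiv2, hdiv, hdφ.fderiv]
    simp only [_root_.add_apply, _root_.smul_apply, ContinuousLinearMap.smulRight_apply,
      ContinuousLinearMap.id_apply, inner_add_right, real_inner_smul_right, innerSL_apply_apply,
      smul_eq_mul, real_inner_self_eq_norm_sq, real_inner_comm z]
    simp only [hκ, hκ', real_inner_comm (negGrad w z) z]
    ring
  have e2 : ∀ z, fderiv ℝ κ z (negGrad w z) = κ' z * (2 / l ^ 2) * inner ℝ (negGrad w z) z := by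
    intro z
    rw [(hasFDerivAt_radial hasDerivAt_cutoff l z).fderiv]
    simp [hκ', real_inner_comm]
  have e3 : ∀ z, fderiv ℝ κ' z z = cutoff'' (‖z‖ ^ 2 / l ^ 2) * (2 * (‖z‖ ^ 2 / l ^ 2)) := by
    intro z
    rw [(hasFDerivAt_radial hasDerivAt_cutoff' l z).fderiv]
    simp
    ring
  simp_rw [e1] at I1
  simp_rw [e2] at I2
  simp_rw [e3] at I3
  have bG := hw.isBddMeas_norm_negGrad.sq
  have bi := hw.isBddMeas_inner_negGrad
  have bw := hw.isBddMeas
  have bρ : IsBddMeas R ρ := .of_measurable hρ hb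
  have bκ : IsBddMeas R κ := .of_continuous hκC.continuous
  have bκ' : IsBddMeas R κ' := .of_continuous hκ'C.continuous
  have bκ'' : IsBddMeas R fun z => cutoff'' (‖z‖ ^ 2 / l ^ 2) :=
    .of_continuous (continuous_radial continuous_cutoff'' l)
  have bs : IsBddMeas R fun z => 2 * (‖z‖ ^ 2 / l ^ 2) := .of_continuous (by fun_prop)
  have bim : IsBddMeas R fun z => z.im := .of_continuous Complex.continuous_im
  have J1 := (((bG.mul (bs.mul bκ')).sub (((IsBddMeas.const (4 / l ^ 2)).mul bκ').mul bi.sq)).sub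
    ((bim.mul bρ).mul (((IsBddMeas.const 3).mul bκ).add (bs.mul bκ')))).integrableOn
  have J2 := ((bκ.mul bG).add (bw.mul ((bκ'.mul (.const (2 / l ^ 2))).mul bi))).integrableOn
  have J3 := ((bκ'.mul ((((IsBddMeas.const 2).mul bw).mul bi).add
    ((IsBddMeas.const 2).mul bw.sq))).add (bw.sq.mul (bκ''.mul bs))).integrableOn
  have bS : IsBddMeas R fun z : ℂ => max (1 - ‖z‖ ^ 2 / l ^ 2) 0 ^ 2 *
      (inner ℝ (negGrad w z) z - 3 / 2 * w z) ^ 2 := by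
    refine IsBddMeas.mul (.of_continuous (by fun_prop)) (bi.sub ((IsBddMeas.const _).mul bw)).sq
  -- the three vanishing integrals and the square, with the coefficients of their combination
  have e : ∀ z, smoothEnergy' w ρ l z =
      (-(l ^ 4)⁻¹) * (‖negGrad w z‖ ^ 2 * (2 * (‖z‖ ^ 2 / l ^ 2) * κ' z)
        - 4 / l ^ 2 * κ' z * inner ℝ (negGrad w z) z ^ 2
        - z.im * ρ z * (3 * κ z + 2 * (‖z‖ ^ 2 / l ^ 2) * κ' z))
      + (-3 * (l ^ 4)⁻¹) * (κ z * ‖negGrad w z‖ ^ 2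
        + w z * (κ' z * (2 / l ^ 2) * inner ℝ (negGrad w z) z))
      + (-3 * (l ^ 6)⁻¹) * (κ' z * (2 * w z * inner ℝ (negGrad w z) z + 2 * w z ^ 2)
        + w z ^ 2 * (cutoff'' (‖z‖ ^ 2 / l ^ 2) * (2 * (‖z‖ ^ 2 / l ^ 2))))
      + 12 * (l ^ 6)⁻¹ * (max (1 - ‖z‖ ^ 2 / l ^ 2) 0 ^ 2 *
        (inner ℝ (negGrad w z) z - 3 / 2 * w z) ^ 2) := by
    intro z
    have h1 : max (1 - ‖z‖ ^ 2 / l ^ 2) 0 ^ 2 = -κ' z / 3 := by simp only [hκ', cutoff']; ring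
    rw [h1]
    simp only [smoothEnergy', energyDensity]
    change _ * (_ * κ z) + _ * (_ * (κ' z * _)) + (_ * (_ * κ' z) + _) = _
    field_simp
    ring
  rw [integral_congr_ae (Eventually.of_forall e), integral_add _ (bS.integrableOn.const_mul _),
    integral_add _ (J3.const_mul _), integral_add (J1.const_mul _) (J2.const_mul _)]
  · simp only [integral_const_mul]
    rw [I1, I2, I3]
    ring
  · exact (J1.const_mul _).add (J2.const_mul _)
  · exact ((J1.const_mul _).add (J2.const_mul _)).add (J3.const_mul _)

end Monotonicity

section Monotone

variable {R C b : ℝ} {w ρ : ℂ → ℝ}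

/-- The increment of the energy between the radii `c` and `2c` controls the deviation of `w` from
homogeneity in the half-disc of radius `c`. -/
theorem HalfSol.le_smoothEnergy_sub (hw : HalfSol R C w) (hρ : Measurable ρ)
    (hb : ∀ z, |ρ z| ≤ b) (hcrit : IsCritical R w ρ) {c : ℝ} (hc : 0 < c) (hcR : 2 * c < R) :
    12 * c * ((2 * c) ^ 6)⁻¹ * ∫ z in halfBall R, max (1 - ‖z‖ ^ 2 / c ^ 2) 0 ^ 2 *
        (inner ℝ (negGrad w z) z - 3 / 2 * w z) ^ 2 ≤
      smoothEnergy R w ρ (2 * c) - smoothEnergy R w ρ c := by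
  have hder : ∀ l, 0 < l → HasDerivAt (smoothEnergy R w ρ) _ l := fun l hl =>
    hw.hasDerivAt_smoothEnergy hρ hb hl
  -- by the mean value theorem, the derivative at some `l ∈ (c, 2c)` represents the increment
  obtain ⟨l, hl, hs⟩ := exists_hasDerivAt_eq_slope (smoothEnergy R w ρ)
    (fun l => ∫ z in halfBall R, smoothEnergy' w ρ l z) (show c < 2 * c by linarith)
    (fun x hx => (hder x (hc.trans_le hx.1)).continuousAt.continuousWithinAt)
    (fun x hx => hder x (hc.trans hx.1))
  have hl0 : 0 < l := hc.trans hl.1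
  have hslope : smoothEnergy R w ρ (2 * c) - smoothEnergy R w ρ c =
      c * ∫ z in halfBall R, smoothEnergy' w ρ l z := by
    rw [hs]; field_simp; ring
  have hS : ∀ l : ℝ, IsBddMeas R fun z : ℂ => max (1 - ‖z‖ ^ 2 / l ^ 2) 0 ^ 2 *
      (inner ℝ (negGrad w z) z - 3 / 2 * w z) ^ 2 := fun l =>
    IsBddMeas.mul (.of_continuous (by fun_prop))
      (hw.isBddMeas_inner_negGrad.sub ((IsBddMeas.const _).mul hw.isBddMeas)).sq
  rw [hslope, hw.integral_smoothEnergy' hρ hb hcrit hl0 (hl.2.trans hcR)]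
  have h1 : ∫ z in halfBall R, max (1 - ‖z‖ ^ 2 / c ^ 2) 0 ^ 2 *
        (inner ℝ (negGrad w z) z - 3 / 2 * w z) ^ 2 ≤
      ∫ z in halfBall R, max (1 - ‖z‖ ^ 2 / l ^ 2) 0 ^ 2 *
        (inner ℝ (negGrad w z) z - 3 / 2 * w z) ^ 2 := by
    refine integral_mono (hS c).integrableOn (hS l).integrableOn fun z => ?_
    have h3 : ‖z‖ ^ 2 / l ^ 2 ≤ ‖z‖ ^ 2 / c ^ 2 :=
      div_le_div_of_nonneg_left (by positivity) (by positivity)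
        (pow_le_pow_left₀ hc.le hl.1.le 2)
    simp only
    gcongr
  have h0 : 0 ≤ ∫ z in halfBall R, max (1 - ‖z‖ ^ 2 / c ^ 2) 0 ^ 2 *
        (inner ℝ (negGrad w z) z - 3 / 2 * w z) ^ 2 := integral_nonneg fun z => by positivity
  have h2 : ((2 * c) ^ 6)⁻¹ ≤ (l ^ 6)⁻¹ :=
    inv_anti₀ (by positivity) (pow_le_pow_left₀ hl0.le hl.2.le 6)
  calc _ = c * (12 * ((2 * c) ^ 6)⁻¹ * ∫ z in halfBall R, max (1 - ‖z‖ ^ 2 / c ^ 2) 0 ^ 2 *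
        (inner ℝ (negGrad w z) z - 3 / 2 * w z) ^ 2) := by ring
    _ ≤ _ := by gcongr

theorem HalfSol.monotoneOn_smoothEnergy (hw : HalfSol R C w) (hρ : Measurable ρ)
    (hb : ∀ z, |ρ z| ≤ b) (hcrit : IsCritical R w ρ) :
    MonotoneOn (smoothEnergy R w ρ) (Ioo 0 R) := by
  have hder : ∀ l, 0 < l → HasDerivAt (smoothEnergy R w ρ) _ l := fun l hl =>
    hw.hasDerivAt_smoothEnergy hρ hb hl
  refine monotoneOn_of_deriv_nonneg (convex_Ioo 0 R)
    (fun l hl => (hder l hl.1).continuousAt.continuousWithinAt)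
    (fun l hl => (hder l (interior_subset hl).1).differentiableAt.differentiableWithinAt)
    fun l hl => ?_
  have hl := interior_subset hl
  rw [(hder l hl.1).deriv, hw.integral_smoothEnergy' hρ hb hcrit hl.1 hl.2]
  have : 0 ≤ ∫ z in halfBall R, max (1 - ‖z‖ ^ 2 / l ^ 2) 0 ^ 2 *
        (inner ℝ (negGrad w z) z - 3 / 2 * w z) ^ 2 := integral_nonneg fun z => by positivity
  have hl0 := hl.1
  positivity

end Monotone

/-! ### The blowup scaling -/

theorem rpow_three_halves {r : ℝ} (hr : 0 < r) : r ^ (3 / 2 : ℝ) = r * √r := by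
  rw [show (3 / 2 : ℝ) = 1 + 1 / 2 by norm_num, Real.rpow_add hr, Real.rpow_one,
    ← Real.sqrt_eq_rpow]

theorem mul_mem_halfBall {R r : ℝ} (hr : 0 < r) {z : ℂ} :
    (r : ℂ) * z ∈ halfBall R ↔ z ∈ halfBall (R / r) := by
  simp only [halfBall, Set.mem_ofPred_eq, norm_mul, Complex.norm_real, Real.norm_of_nonneg hr.le,
    Complex.im_ofReal_mul, lt_div_iff₀ hr, mul_neg_iff]
  constructor
  · rintro ⟨h1, h2 | h2⟩
    · exact ⟨by linarith, h2.2⟩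
    · exact absurd h2.1 (not_lt.2 hr.le)
  · rintro ⟨h1, h2⟩
    exact ⟨by linarith, Or.inl ⟨hr, h2⟩⟩

theorem mul_mem_lidBall {R r : ℝ} (hr : 0 < r) {z : ℂ} :
    (r : ℂ) * z ∈ lidBall R ↔ z ∈ lidBall (R / r) := by
  simp only [lidBall, Set.mem_ofPred_eq, norm_mul, Complex.norm_real, Real.norm_of_nonneg hr.le,
    Complex.im_ofReal_mul, lt_div_iff₀ hr]
  rw [mul_comm r ‖z‖, mul_nonpos_iff_pos_imp_nonpos]
  constructor
  · rintro ⟨h1, h2⟩; exact ⟨h1, h2.1 hr⟩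
  · rintro ⟨h1, h2⟩; exact ⟨h1, fun _ => h2, fun _ => hr.le⟩

theorem rescale_neg_iff {u : ℂ → ℝ} {r : ℝ} (hr : 0 < r) {z : ℂ} :
    rescale u r z < 0 ↔ u ((r : ℂ) * z) < 0 := by
  unfold rescale
  rw [div_lt_iff₀ (Real.rpow_pos_of_pos hr _), zero_mul]

theorem setIntegral_halfBall_comp_mul {r : ℝ} (hr : 0 < r) (R : ℝ) (f : ℂ → ℝ) :
    ∫ z in halfBall (R / r), f ((r : ℂ) * z) = (r ^ 2)⁻¹ * ∫ z in halfBall R, f z := by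
  rw [← integral_indicator (isOpen_halfBall _).measurableSet,
    ← integral_indicator (isOpen_halfBall _).measurableSet]
  have h := Measure.integral_comp_smul (volume : Measure ℂ) ((halfBall R).indicator f) r
  rw [Complex.finrank_real_complex, abs_of_nonneg (by positivity), smul_eq_mul] at h
  rw [← h]
  refine integral_congr_ae (Eventually.of_forall fun z => ?_)
  simp only [Complex.real_smul]
  by_cases hz : z ∈ halfBall (R / r)
  · rw [indicator_of_mem hz, indicator_of_mem ((mul_mem_halfBall hr).2 hz)]
  · rw [indicator_of_notMem hz, indicator_of_notMem fun h => hz ((mul_mem_halfBall hr).1 h)]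

theorem hasGradientAt_rescale {u : ℂ → ℝ} {r : ℝ} (hr : 0 < r) {z : ℂ}
    (h : DifferentiableAt ℝ u ((r : ℂ) * z)) :
    HasGradientAt (rescale u r) ((√r)⁻¹ • gradient u ((r : ℂ) * z)) z := by
  rw [hasGradientAt_iff_innerSL]
  have h1 := hasFDerivAt_innerSL_gradient h
  have h2 : HasFDerivAt (fun z : ℂ => (r : ℂ) * z) (r • ContinuousLinearMap.id ℝ ℂ) z := by
    have := (hasFDerivAt_id (𝕜 := ℝ) z).const_smul r
    refine this.congr_of_eventuallyEq (Eventually.of_forall fun y => ?_)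
    simp
  have h3 := (h1.comp z h2).mul_const (r ^ (3 / 2 : ℝ))⁻¹
  refine h3.congr_fderiv ?_
  have hs : √r ≠ 0 := (Real.sqrt_pos.2 hr).ne'
  ext v
  rw [rpow_three_halves hr]
  simp only [_root_.smul_apply, ContinuousLinearMap.comp_apply, innerSL_apply_apply,
    ContinuousLinearMap.id_apply, smul_eq_mul, real_inner_smul_left, real_inner_smul_right]
  field_simp

namespace HalfSol

variable {R C : ℝ} {u ρ : ℂ → ℝ} {r : ℝ}

theorem gradient_rescale (hu : HalfSol R C u) (hr : 0 < r) {z : ℂ}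
    (hz : z ∈ phaseMinus (halfBall (R / r)) (rescale u r)) :
    DifferentiableAt ℝ (rescale u r) z ∧
      gradient (rescale u r) z = (√r)⁻¹ • gradient u ((r : ℂ) * z) := by
  have h := hasGradientAt_rescale hr (hu.hasFDerivAt
    ⟨(mul_mem_halfBall hr).2 hz.1, (rescale_neg_iff hr).1 hz.2⟩).differentiableAt
  exact ⟨h.differentiableAt, h.gradient⟩

theorem negGrad_rescale (hu : HalfSol R C u) (hr : 0 < r) {z : ℂ} (hz : z ∈ halfBall (R / r)) :
    negGrad (rescale u r) z = (√r)⁻¹ • negGrad u ((r : ℂ) * z) := by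
  have hz' := (mul_mem_halfBall hr).2 hz
  by_cases h : rescale u r z < 0
  · rw [negGrad_of_neg hz.2 h, negGrad_of_neg hz'.2 ((rescale_neg_iff hr).1 h),
      (hu.gradient_rescale hr ⟨hz, h⟩).2]
  · rw [negGrad_of_nonneg (not_lt.1 h), negGrad_of_nonneg, smul_zero]
    exact not_lt.1 fun h' => h ((rescale_neg_iff hr).2 h')

theorem rescale (hu : HalfSol R C u) (hr : 0 < r) : HalfSol (R / r) C (rescale u r) where
  const_nonneg := hu.const_nonneg
  nonpos z hz := div_nonpos_of_nonpos_of_nonneg (hu.nonpos _ ((mul_mem_lidBall hr).2 hz))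
    (Real.rpow_nonneg hr.le _)
  lid z hz h := by
    unfold GravityCurrent.rescale
    rw [hu.lid _ ((mul_mem_lidBall hr).2 hz) (by simp [h]), zero_div]
  lip s hs z hz z' hz' := by
    have hs' : s * r ≤ R := (le_div_iff₀ hr).1 hs
    have e : s * r / r = s := by field_simp
    have hm : ∀ z ∈ lidBall s, (r : ℂ) * z ∈ lidBall (s * r) := fun z hz =>
      (mul_mem_lidBall hr).2 (by rwa [e])
    have h := hu.lip (s * r) hs' _ (hm z hz) _ (hm z' hz')
    have hsq : 0 < √r := Real.sqrt_pos.2 hr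
    unfold GravityCurrent.rescale
    rw [rpow_three_halves hr, ← sub_div, abs_div, abs_of_pos (a := r * √r) (by positivity),
      div_le_iff₀ (by positivity)]
    refine h.trans (le_of_eq ?_)
    rw [← mul_sub, norm_mul, Complex.norm_real, Real.norm_of_nonneg hr.le, mul_comm s r,
      Real.sqrt_mul hr.le]
    ring
  hol := by
    refine ⟨fun z hz => (hu.gradient_rescale hr hz).1.differentiableWithinAt, ?_⟩
    have h1 : DifferentiableOn ℂ (fun z => ((√r)⁻¹ : ℂ) * conj (gradient u ((r : ℂ) * z)))
        (phaseMinus (halfBall (R / r)) (GravityCurrent.rescale u r)) := by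
      refine DifferentiableOn.const_mul ?_ _
      refine hu.hol.2.comp (t := phaseMinus (halfBall R) u) (f := fun z => (r : ℂ) * z)
        (by fun_prop) fun z hz => ?_
      exact ⟨(mul_mem_halfBall hr).2 hz.1, (rescale_neg_iff hr).1 hz.2⟩
    refine h1.congr fun z hz => ?_
    rw [(hu.gradient_rescale hr hz).2, Complex.real_smul, map_mul, Complex.conj_ofReal,
      Complex.ofReal_inv]

end HalfSol

theorem divergence_im_smul {φ : ℂ → ℂ} {z : ℂ} (hφ : DifferentiableAt ℝ φ z) :
    divergence (fun y => y.im • φ y) z = (φ z).im + z.im * divergence φ z := by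
  have him : HasFDerivAt (fun y : ℂ => y.im) Complex.imCLM z := Complex.imCLM.hasFDerivAt
  rw [divergence_smul him.differentiableAt hφ, him.fderiv]
  rfl

section Scaling

variable {R C : ℝ} {u ρ : ℂ → ℝ} {r : ℝ}

theorem IsCritical.rescale (hc : IsCritical R u ρ) (hu : HalfSol R C u) (hr : 0 < r) :
    IsCritical (R / r) (rescale u r) fun z => ρ ((r : ℂ) * z) := by
  intro φ hφ hs ht
  set φ' : ℂ → ℂ := fun z => φ (r⁻¹ • z) with hφ'
  have hC : ContDiff ℝ 1 φ' := hφ.comp (contDiff_const_smul _)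
  have hd := hφ.differentiable (by simp)
  have hs' : tsupport φ' ⊆ Metric.ball 0 R := by
    have h1 : IsClosed ((fun z : ℂ => r⁻¹ • z) ⁻¹' tsupport φ) :=
      (isClosed_tsupport φ).preimage (by fun_prop)
    have h2 : tsupport φ' ⊆ (fun z : ℂ => r⁻¹ • z) ⁻¹' tsupport φ :=
      closure_minimal (fun z hz => subset_tsupport φ hz) h1
    intro z hz
    have := hs (h2 hz)
    rw [mem_ball_zero_iff, norm_smul, norm_inv, Real.norm_of_nonneg hr.le, inv_mul_lt_iff₀ hr,
      mul_div_cancel₀ _ hr.ne'] at this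
    exact mem_ball_zero_iff.2 this
  have h := hc φ' hC hs' (fun z hz => ht _ (by simp [hz]))
  have hres := setIntegral_halfBall_comp_mul hr R (fun z => ‖negGrad u z‖ ^ 2 * divergence φ' z
      - 2 * inner ℝ (negGrad u z) (fderiv ℝ φ' z (negGrad u z))
      - ρ z * divergence (fun y => y.im • φ' y) z)
  rw [h, mul_zero] at hres
  rw [← hres]
  refine setIntegral_congr_fun (isOpen_halfBall _).measurableSet fun z hz => ?_
  have hf : fderiv ℝ φ' ((r : ℂ) * z) = r⁻¹ • fderiv ℝ φ z := by
    have e : r⁻¹ • ((r : ℂ) * z) = z := by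
      rw [Complex.real_smul, ← mul_assoc, ← Complex.ofReal_mul, inv_mul_cancel₀ hr.ne']; simp
    have h2 : HasFDerivAt (fun z : ℂ => r⁻¹ • z) (r⁻¹ • ContinuousLinearMap.id ℝ ℂ) ((r : ℂ) * z) :=
      (hasFDerivAt_id (𝕜 := ℝ) _).const_smul r⁻¹
    have h3 : HasFDerivAt φ (fderiv ℝ φ z) (r⁻¹ • ((r : ℂ) * z)) := by
      rw [e]; exact (hd z).hasFDerivAt
    have h4 : HasFDerivAt φ' _ _ := h3.comp _ h2
    rw [h4.fderiv]
    ext v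
    simp
  have hdiv : divergence φ' ((r : ℂ) * z) = r⁻¹ * divergence φ z := by
    unfold divergence
    rw [hf]; simp; ring
  have hval : φ' ((r : ℂ) * z) = φ z := by
    simp only [hφ']
    rw [Complex.real_smul, ← mul_assoc, ← Complex.ofReal_mul, inv_mul_cancel₀ hr.ne']; simp
  have hs2 : √r * √r = r := Real.mul_self_sqrt hr.le
  have hsq : √r ≠ 0 := (Real.sqrt_pos.2 hr).ne'
  simp only
  rw [divergence_im_smul (hd z), divergence_im_smul (hC.differentiable (by simp) _), hdiv, hval, hf,
    hu.negGrad_rescale hr hz]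
  simp only [norm_smul, map_smul, _root_.smul_apply, real_inner_smul_left, real_inner_smul_right,
    norm_inv, Real.norm_of_nonneg (Real.sqrt_nonneg r), Complex.im_ofReal_mul, mul_pow, inv_pow,
    Real.sq_sqrt hr.le]
  have e1 : (√r)⁻¹ * ((√r)⁻¹ * inner ℝ (negGrad u (↑r * z)) ((fderiv ℝ φ z) (negGrad u (↑r * z)))) =
      r⁻¹ * inner ℝ (negGrad u (↑r * z)) ((fderiv ℝ φ z) (negGrad u (↑r * z))) := by
    rw [← mul_assoc, ← mul_inv, hs2]
  have e2 : r * z.im * (r⁻¹ * divergence φ z) = z.im * divergence φ z := by field_simp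
  rw [e2]
  linear_combination (-2) * e1

theorem HalfSol.energyDensity_rescale (hu : HalfSol R C u) (hr : 0 < r) {z : ℂ}
    (hz : z ∈ halfBall (R / r)) :
    energyDensity (GravityCurrent.rescale u r) (fun z => ρ ((r : ℂ) * z)) z =
      r⁻¹ * energyDensity u ρ ((r : ℂ) * z) := by
  unfold energyDensity
  rw [hu.negGrad_rescale hr hz, norm_smul, norm_inv, Real.norm_of_nonneg (Real.sqrt_nonneg r),
    mul_pow, inv_pow, Real.sq_sqrt hr.le, Complex.im_ofReal_mul]
  field_simp

theorem rescale_sq (hr : 0 < r) (z : ℂ) :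
    rescale u r z ^ 2 = (r ^ 3)⁻¹ * u ((r : ℂ) * z) ^ 2 := by
  unfold rescale
  rw [rpow_three_halves hr, div_pow, mul_pow, Real.sq_sqrt hr.le]
  field_simp

theorem HalfSol.smoothEnergy_rescale (hu : HalfSol R C u) (hr : 0 < r) (l : ℝ) :
    smoothEnergy (R / r) (GravityCurrent.rescale u r) (fun z => ρ ((r : ℂ) * z)) l =
      smoothEnergy R u ρ (r * l) := by
  have h := setIntegral_halfBall_comp_mul hr R (fun z =>
    (((r * l) ^ 3)⁻¹ * (energyDensity u ρ z * cutoff (‖z‖ ^ 2 / (r * l) ^ 2))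
    + 3 * ((r * l) ^ 5)⁻¹ * (u z ^ 2 * cutoff' (‖z‖ ^ 2 / (r * l) ^ 2))))
  unfold smoothEnergy
  rw [eq_comm, inv_mul_eq_iff_eq_mul₀ (by positivity)] at h
  rw [h, ← integral_const_mul]
  refine setIntegral_congr_fun (isOpen_halfBall _).measurableSet fun z hz => ?_
  rw [hu.energyDensity_rescale hr hz, rescale_sq hr, norm_mul, Complex.norm_real,
    Real.norm_of_nonneg hr.le]
  have e : (r * ‖z‖) ^ 2 / (r * l) ^ 2 = ‖z‖ ^ 2 / l ^ 2 := by
    rw [mul_pow, mul_pow, mul_div_mul_left _ _ (by positivity)]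
  rw [e]
  rcases eq_or_ne l 0 with h0 | h0
  · simp [h0]
  · field_simp

/-- At scale one the weight vanishes outside the unit disc. -/
theorem smoothEnergy_of_one_le {R : ℝ} (hR : 1 ≤ R) (w ρ : ℂ → ℝ) :
    smoothEnergy R w ρ 1 = smoothEnergy 1 w ρ 1 := by
  refine setIntegral_eq_of_subset_of_forall_sdiff_eq_zero (isOpen_halfBall _).measurableSet
    (halfBall_mono hR) fun z hz => ?_
  have hn : 1 ≤ ‖z‖ ^ 2 / 1 ^ 2 := by
    by_contra hlt
    push Not at hlt
    refine hz.2 ⟨?_, hz.1.2⟩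
    rw [one_pow, div_one] at hlt
    exact (sq_lt_one_iff₀ (norm_nonneg z)).1 hlt
  rw [cutoff_eq_zero hn, cutoff'_eq_zero hn]
  simp

/-- The smoothed energy has a limit at the origin. -/
theorem HalfSol.exists_tendsto_smoothEnergy (hu : HalfSol R C u) (hR : 0 < R) {b : ℝ}
    (hρ : Measurable ρ) (hb : ∀ z, |ρ z| ≤ b) (hcrit : IsCritical R u ρ) :
    ∃ L, Tendsto (smoothEnergy R u ρ) (𝓝[>] 0) (𝓝 L) := by
  have hmono : MonotoneOn (smoothEnergy R u ρ) (Ioo 0 (R / 2)) :=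
    (hu.monotoneOn_smoothEnergy hρ hb hcrit).mono (Ioo_subset_Ioo le_rfl (by linarith))
  refine ⟨_, hmono.tendsto_nhdsWithin_Ioo_right ⟨R / 4, by constructor <;> linarith⟩ ?_⟩
  set B := (((C * √2) ^ 2 + 2 * b) * 1 + 3 * ((C * √2 * 2) ^ 2 * 3)) * volume.real (halfBall 2)
  refine ⟨-B, ?_⟩
  rintro _ ⟨l, hl, rfl⟩
  have hl2 : (2 : ℝ) ≤ R / l := by rw [le_div_iff₀ hl.1]; linarith [hl.2]
  have hw := hu.rescale hl.1
  have hw2 := hw.mono hl2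
  have e : smoothEnergy R u ρ l =
      smoothEnergy 2 (GravityCurrent.rescale u l) (fun z => ρ ((l : ℂ) * z)) 1 := by
    have h1 := hu.smoothEnergy_rescale (ρ := ρ) hl.1 1
    rw [mul_one] at h1
    rw [← h1, smoothEnergy_of_one_le (by linarith), smoothEnergy_of_one_le (R := 2) one_le_two]
  rw [e]
  refine neg_le_of_abs_le ?_
  rw [← Real.norm_eq_abs]
  refine norm_setIntegral_le_of_norm_le_const (volume_halfBall_lt_top 2) fun z hz => ?_
  have hpos : (0 : ℝ) ≤ ‖z‖ ^ 2 / 1 ^ 2 := by positivity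
  have h1 := hw2.abs_energyDensity_le (ρ := fun z => ρ ((l : ℂ) * z)) (fun z => hb _) hz
  have h2 := hw2.sq_le hz
  refine (norm_add_le _ _).trans (add_le_add ?_ ?_)
  · rw [one_pow, inv_one, one_mul, norm_mul]
    exact mul_le_mul h1 (abs_cutoff_le hpos) (abs_nonneg _) ((abs_nonneg _).trans h1)
  · rw [one_pow, inv_one, mul_one, norm_mul, norm_mul, Real.norm_of_nonneg (r := 3) (by norm_num),
      Real.norm_of_nonneg (sq_nonneg _)]
    exact mul_le_mul_of_nonneg_left (mul_le_mul h2 (abs_cutoff'_le hpos) (abs_nonneg _)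
      (by positivity)) (by norm_num)

end Scaling

/-! ### Limits of solutions -/

/-- The functions `w m` are solutions on half-discs that exhaust the lower half-plane, with one
constant `C`, and they converge to `u₀` locally uniformly up to the lid. -/
structure IsHalfLimit (C : ℝ) (w : ℕ → ℂ → ℝ) (u₀ : ℂ → ℝ) : Prop where
  sol : ∀ R, ∀ᶠ m in atTop, HalfSol R C (w m)
  unif : ∀ R, TendstoUniformlyOn w u₀ atTop (lidBall R)

theorem mem_lidBall_norm {z : ℂ} (hz : z.im ≤ 0) : z ∈ lidBall (‖z‖ + 1) := ⟨by simp, hz⟩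

theorem mem_halfBall_norm {z : ℂ} (hz : z.im < 0) : z ∈ halfBall (‖z‖ + 1) := ⟨by simp, hz⟩

namespace IsHalfLimit

variable {C : ℝ} {w : ℕ → ℂ → ℝ} {u₀ : ℂ → ℝ}

theorem tendsto (h : IsHalfLimit C w u₀) {z : ℂ} (hz : z.im ≤ 0) :
    Tendsto (fun m => w m z) atTop (𝓝 (u₀ z)) :=
  (h.unif _).tendsto_at (mem_lidBall_norm hz)

theorem lip (h : IsHalfLimit C w u₀) (s : ℝ) {z z' : ℂ} (hz : z ∈ lidBall s)
    (hz' : z' ∈ lidBall s) : |u₀ z - u₀ z'| ≤ C * √s * ‖z - z'‖ := by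
  refine le_of_tendsto ((h.tendsto hz.2).sub (h.tendsto hz'.2)).abs ?_
  filter_upwards [h.sol s] with m hm
  exact hm.lip s le_rfl z hz z' hz'

theorem continuousOn (h : IsHalfLimit C w u₀) (R : ℝ) : ContinuousOn u₀ (lidBall R) := by
  obtain ⟨m, hm⟩ := (h.sol R).exists
  have : LipschitzOnWith (C * √R).toNNReal u₀ (lidBall R) := by
    refine LipschitzOnWith.of_dist_le_mul fun z hz z' hz' => ?_
    rw [Real.dist_eq, dist_eq_norm, Real.coe_toNNReal _ (mul_nonneg hm.const_nonneg (by positivity))]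
    exact h.lip R hz hz'
  exact this.continuousOn

theorem eventually_neg (h : IsHalfLimit C w u₀) {z : ℂ} (hz : z.im ≤ 0) (hn : u₀ z < 0) :
    ∀ᶠ m in atTop, w m z < 0 := (h.tendsto hz).eventually_lt_const hn

/-- Near a point where the limit is negative, the functions are harmonic, so that the gradients
converge. -/
theorem local_limit (h : IsHalfLimit C w u₀) {z : ℂ} (hz : z.im < 0) (hn : u₀ z < 0) :
    (∃ ρ > 0, HolGrad u₀ (Metric.ball z ρ)) ∧
      Tendsto (fun m => gradient (w m) z) atTop (𝓝 (gradient u₀ z)) := by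
  set R := ‖z‖ + 1
  have hzR : z ∈ halfBall R := mem_halfBall_norm hz
  have hopen : IsOpen (halfBall R ∩ u₀ ⁻¹' Iio (u₀ z / 2)) :=
    ((h.continuousOn R).mono (halfBall_subset_lidBall R)).isOpen_inter_preimage (isOpen_halfBall R)
      isOpen_Iio
  obtain ⟨ρ, hρ, hsub⟩ := Metric.isOpen_iff.1 hopen z
    ⟨hzR, by simp only [mem_preimage, mem_Iio]; linarith⟩
  have hunif : TendstoUniformlyOn w u₀ atTop (Metric.ball z ρ) :=
    (h.unif R).mono fun y hy => halfBall_subset_lidBall R (hsub hy).1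
  have hev : ∀ᶠ m in atTop, HolGrad (w m) (Metric.ball z ρ) := by
    filter_upwards [h.sol R, Metric.tendstoUniformlyOn_iff.1 hunif (-u₀ z / 2) (by linarith)]
      with m hm hd
    refine hm.hol.mono fun y hy => ⟨(hsub hy).1, ?_⟩
    have h1 := hd y hy
    have h2 : u₀ y < u₀ z / 2 := (hsub hy).2
    rw [Real.dist_eq] at h1
    have := (abs_lt.1 h1).1
    linarith
  obtain ⟨h1, h2⟩ := HolGrad.of_tendstoUniformlyOn hρ hev hunif
  exact ⟨⟨ρ / 2, by positivity, h1⟩, h2⟩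

theorem halfSol (h : IsHalfLimit C w u₀) (R : ℝ) : HalfSol R C u₀ where
  const_nonneg := (h.sol R).exists.choose_spec.const_nonneg
  nonpos z hz := le_of_tendsto (h.tendsto hz.2) ((h.sol R).mono fun _ hm => hm.nonpos z hz)
  lid z hz h0 := tendsto_nhds_unique (h.tendsto hz.2) (tendsto_const_nhds.congr'
    ((h.sol R).mono fun _ hm => (hm.lid z hz h0).symm))
  lip s _ z hz z' hz' := h.lip s hz hz'
  hol := by
    have key : ∀ z ∈ phaseMinus (halfBall R) u₀, ∃ ρ > 0, HolGrad u₀ (Metric.ball z ρ) :=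
      fun z hz => (h.local_limit hz.1.2 hz.2).1
    constructor
    · intro z hz
      obtain ⟨ρ, hρ, h1⟩ := key z hz
      exact (h1.1.differentiableAt (Metric.ball_mem_nhds z hρ)).differentiableWithinAt
    · intro z hz
      obtain ⟨ρ, hρ, h1⟩ := key z hz
      exact (h1.2.differentiableAt (Metric.ball_mem_nhds z hρ)).differentiableWithinAt

theorem tendsto_negGrad (h : IsHalfLimit C w u₀) {z : ℂ} (hz : z.im < 0) (hn : u₀ z < 0) :
    Tendsto (fun m => negGrad (w m) z) atTop (𝓝 (negGrad u₀ z)) := by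
  rw [negGrad_of_neg hz hn]
  refine (h.local_limit hz hn).2.congr' ?_
  filter_upwards [h.eventually_neg hz.le hn] with m hm
  rw [negGrad_of_neg hz hm]

/-- A quantity which is continuous in the gradient and vanishes with the value or with the limit
gradient passes to the limit: at points where `u₀ = 0` only boundedness of the gradients is used. -/
theorem tendsto_mul_inner (h : IsHalfLimit C w u₀) {z : ℂ} (hz : z.im < 0) (v : ℂ) :
    Tendsto (fun m => w m z * inner ℝ (negGrad (w m) z) v) atTop
      (𝓝 (u₀ z * inner ℝ (negGrad u₀ z) v)) := by
  rcases ((h.halfSol _).nonpos z (mem_lidBall_norm hz.le)).lt_or_eq with hn | h0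
  · exact (h.tendsto hz.le).mul ((h.tendsto_negGrad hz hn).inner tendsto_const_nhds)
  · rw [h0, zero_mul]
    refine squeeze_zero_norm' (a := fun m => |w m z| * (C * √(‖z‖ + 1) * ‖v‖)) ?_ ?_
    · filter_upwards [h.sol (‖z‖ + 1)] with m hm
      rw [norm_mul]
      refine mul_le_mul_of_nonneg_left ((norm_inner_le_norm _ _).trans ?_) (norm_nonneg _)
      gcongr
      exact hm.norm_negGrad_le le_rfl (mem_halfBall_norm hz)
    · have := ((h.tendsto hz.le).abs.mul_const (C * √(‖z‖ + 1) * ‖v‖))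
      rwa [h0, abs_zero, zero_mul] at this

theorem tendsto_inner_negGrad (h : IsHalfLimit C w u₀) {z : ℂ} (hz : z.im < 0) :
    Tendsto (fun m => inner ℝ (negGrad (w m) z) (negGrad u₀ z)) atTop
      (𝓝 (‖negGrad u₀ z‖ ^ 2)) := by
  rw [← real_inner_self_eq_norm_sq]
  rcases ((h.halfSol _).nonpos z (mem_lidBall_norm hz.le)).lt_or_eq with hn | h0
  · exact (h.tendsto_negGrad hz hn).inner tendsto_const_nhds
  · rw [negGrad_of_nonneg h0.ge]
    simp

/-- The gradients converge strongly in `L²`: the energies converge because each of them equals an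
expression that is continuous under locally uniform convergence. -/
theorem tendsto_integral_norm_sub (h : IsHalfLimit C w u₀) (R : ℝ) :
    Tendsto (fun m => ∫ z in halfBall R, ‖negGrad (w m) z - negGrad u₀ z‖ ^ 2) atTop (𝓝 0) := by
  rcases le_or_gt R 0 with hR | hR
  · have : halfBall R = ∅ := by
      ext z
      simp only [halfBall, Set.mem_ofPred_eq, mem_empty_iff_false, iff_false, not_and]
      intro hz
      exact absurd ((norm_nonneg z).trans_lt hz) (not_lt.2 hR)
    simp [this]
  set b : ContDiffBump (0 : ℂ) := ⟨R, R + 1, hR, by linarith⟩ with hb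
  set S := R + 2
  have hψ : ContDiff ℝ 1 b := b.contDiff
  have hψs : tsupport b ⊆ Metric.ball 0 S := by
    rw [b.tsupport_eq]; exact Metric.closedBall_subset_ball (by simp [hb, S])
  have hS := h.halfSol S
  have hC := hS.const_nonneg
  obtain ⟨B, hB⟩ : ∃ B, ∀ z, ‖fderiv ℝ b z‖ ≤ B :=
    (hψ.continuous_fderiv one_ne_zero).bounded_above_of_compact_support
      (b.hasCompactSupport.fderiv ℝ)
  have hb1 : ∀ z, |b z| ≤ 1 := fun z => by
    rw [abs_of_nonneg b.nonneg]; exact b.le_one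
  have hgm : ∀ {v : ℂ → ℝ}, HalfSol S C v → AEStronglyMeasurable
      (fun z => v z * fderiv ℝ b z (negGrad v z)) (volume.restrict (halfBall S)) := by
    intro v hv
    refine hv.aestronglyMeasurable.mul ?_
    exact (ContinuousLinearMap.apply ℝ ℝ).flip.isBoundedBilinearMap.continuous
      |>.comp_aestronglyMeasurable
      (((hψ.continuous_fderiv one_ne_zero).aestronglyMeasurable).prodMk
        hv.aestronglyMeasurable_negGrad)
  -- the energy is continuous
  have hE : ∀ {v : ℂ → ℝ}, HalfSol S C v → ∫ z in halfBall S, b z * ‖negGrad v z‖ ^ 2 =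
      - ∫ z in halfBall S, v z * fderiv ℝ b z (negGrad v z) := by
    intro v hv
    have h1 := hv.integral_energy hψ hψs
    rw [integral_add] at h1
    · linarith
    · exact (IsBddMeas.mul (.of_continuous hψ.continuous) hv.isBddMeas_norm_negGrad.sq).integrableOn
    · refine integrableOn_halfBall_of_bound (hgm hv) (C * √S * S * (B * (C * √S))) fun z hz => ?_
      rw [norm_mul]
      have e1 := hv.abs_le le_rfl (halfBall_subset_lidBall S hz)
      have hz1 := hz.1.le
      refine mul_le_mul (e1.trans (by gcongr)) ((ContinuousLinearMap.le_opNorm _ _).trans ?_)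
        (norm_nonneg _) (by positivity)
      have := (norm_nonneg _).trans (hB 0)
      exact mul_le_mul (hB z) (hv.norm_negGrad_le le_rfl hz) (norm_nonneg _) this
  have hconv1 : Tendsto (fun m => ∫ z in halfBall S, w m z * fderiv ℝ b z (negGrad (w m) z)) atTop
      (𝓝 (∫ z in halfBall S, u₀ z * fderiv ℝ b z (negGrad u₀ z))) := by
    have : IsFiniteMeasure (volume.restrict (halfBall S)) :=
      ⟨by simpa using volume_halfBall_lt_top S⟩
    refine tendsto_integral_filter_of_dominated_convergence
      (fun _ => C * √S * S * (B * (C * √S))) ?_ ?_ (integrable_const _) ?_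
    · filter_upwards [h.sol S] with m hm using hgm hm
    · filter_upwards [h.sol S] with m hm
      refine (ae_restrict_iff' (isOpen_halfBall S).measurableSet).2 (.of_forall fun z hz => ?_)
      rw [norm_mul]
      have e1 := hm.abs_le le_rfl (halfBall_subset_lidBall S hz)
      have hz1 := hz.1.le
      refine mul_le_mul (e1.trans (by gcongr)) ((ContinuousLinearMap.le_opNorm _ _).trans ?_)
        (norm_nonneg _) (by positivity)
      have := (norm_nonneg _).trans (hB 0)
      exact mul_le_mul (hB z) (hm.norm_negGrad_le le_rfl hz) (norm_nonneg _) this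
    · refine (ae_restrict_iff' (isOpen_halfBall S).measurableSet).2 (.of_forall fun z hz => ?_)
      have e : ∀ v, fderiv ℝ b z v = inner ℝ v (gradient b z) := fun v => by
        rw [(hasFDerivAt_innerSL_gradient (b.contDiff (n := 1)|>.differentiable one_ne_zero z)).fderiv,
          innerSL_apply_apply, real_inner_comm]
      simp only [e]
      exact h.tendsto_mul_inner hz.2 _
  have hsq : ∀ {v : ℂ → ℝ}, HalfSol S C v → IntegrableOn (fun z => b z * ‖negGrad v z‖ ^ 2)
      (halfBall S) := fun hv =>
    (IsBddMeas.mul (.of_continuous hψ.continuous) hv.isBddMeas_norm_negGrad.sq).integrableOn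
  have hinm : ∀ {v : ℂ → ℝ}, HalfSol S C v → AEStronglyMeasurable (fun z => b z *
      inner ℝ (negGrad v z) (negGrad u₀ z)) (volume.restrict (halfBall S)) := fun hv =>
    hψ.continuous.aestronglyMeasurable.mul
      (hv.aestronglyMeasurable_negGrad.inner hS.aestronglyMeasurable_negGrad)
  have hinb : ∀ {v : ℂ → ℝ}, HalfSol S C v → ∀ z ∈ halfBall S, ‖b z *
      inner ℝ (negGrad v z) (negGrad u₀ z)‖ ≤ 1 * (C * √S * (C * √S)) := fun hv z hz => by
    rw [norm_mul]
    refine mul_le_mul (hb1 z) ((norm_inner_le_norm _ _).trans ?_) (norm_nonneg _) zero_le_one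
    exact mul_le_mul (hv.norm_negGrad_le le_rfl hz) (hS.norm_negGrad_le le_rfl hz) (norm_nonneg _)
      (by positivity)
  have hconv2 : Tendsto (fun m => ∫ z in halfBall S, b z * inner ℝ (negGrad (w m) z) (negGrad u₀ z))
      atTop (𝓝 (∫ z in halfBall S, b z * ‖negGrad u₀ z‖ ^ 2)) := by
    have : IsFiniteMeasure (volume.restrict (halfBall S)) :=
      ⟨by simpa using volume_halfBall_lt_top S⟩
    refine tendsto_integral_filter_of_dominated_convergence
      (fun _ => 1 * (C * √S * (C * √S))) ?_ ?_ (integrable_const _) ?_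
    · filter_upwards [h.sol S] with m hm using hinm hm
    · filter_upwards [h.sol S] with m hm
      exact (ae_restrict_iff' (isOpen_halfBall S).measurableSet).2 (.of_forall (hinb hm))
    · refine (ae_restrict_iff' (isOpen_halfBall S).measurableSet).2 (.of_forall fun z hz => ?_)
      exact (h.tendsto_inner_negGrad hz.2).const_mul _
  have htot : Tendsto (fun m => - ∫ z in halfBall S, w m z * fderiv ℝ b z (negGrad (w m) z))
      atTop (𝓝 (∫ z in halfBall S, b z * ‖negGrad u₀ z‖ ^ 2)) := by
    rw [hE hS]; exact hconv1.neg
  have hlim := (htot.sub (hconv2.const_mul 2)).add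
    (tendsto_const_nhds (x := ∫ z in halfBall S, b z * ‖negGrad u₀ z‖ ^ 2))
  rw [show ∀ a : ℝ, a - 2 * a + a = 0 from fun a => by ring] at hlim
  refine squeeze_zero' (.of_forall fun m => integral_nonneg fun z => by positivity) ?_ hlim
  filter_upwards [h.sol S] with m hm
  have hi := integrableOn_halfBall_of_bound (hinm hm) _ (hinb hm)
  have hi2 : IntegrableOn (fun z => b z * ‖negGrad (w m) z‖ ^ 2 -
      2 * (b z * inner ℝ (negGrad (w m) z) (negGrad u₀ z))) (halfBall S) :=
    (hsq hm).sub (hi.const_mul 2)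
  rw [← hE hm, ← integral_const_mul, ← integral_sub (hsq hm) (hi.const_mul 2),
    ← integral_add hi2 (hsq hS)]
  have heq : ∀ z, b z * ‖negGrad (w m) z‖ ^ 2 - 2 * (b z * inner ℝ (negGrad (w m) z) (negGrad u₀ z))
      + b z * ‖negGrad u₀ z‖ ^ 2 = b z * ‖negGrad (w m) z - negGrad u₀ z‖ ^ 2 := fun z => by
    rw [norm_sub_sq_real]; ring
  have hint : IntegrableOn (fun z => b z * ‖negGrad (w m) z - negGrad u₀ z‖ ^ 2) (halfBall S) := by
    simp only [← heq]
    exact hi2.add (hsq hS)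
  simp only [heq]
  have hRS : halfBall R ⊆ halfBall S := halfBall_mono (by simp [S])
  calc ∫ z in halfBall R, ‖negGrad (w m) z - negGrad u₀ z‖ ^ 2
      = ∫ z in halfBall R, b z * ‖negGrad (w m) z - negGrad u₀ z‖ ^ 2 := by
        refine setIntegral_congr_fun (isOpen_halfBall R).measurableSet fun z hz => ?_
        rw [b.one_of_mem_closedBall (by simpa [hb] using hz.1.le), one_mul]
    _ ≤ _ := setIntegral_mono_set hint (.of_forall fun z => mul_nonneg b.nonneg (sq_nonneg _))
        hRS.eventuallyLE

end IsHalfLimit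

/-- The constant in the Lipschitz bound is invariant under the blowup scaling, so that rescalings
qualify for the compactness results. -/
theorem isHalfLimit_rescale {δ C : ℝ} {u u₀ : ℂ → ℝ} (hδ : 0 < δ) (hu : HalfSol δ C u) {r : ℕ → ℝ}
    (hr : ∀ m, 0 < r m) (hr0 : Tendsto r atTop (𝓝 0))
    (hlim : ∀ R, TendstoUniformlyOn (fun m => rescale u (r m)) u₀ atTop (lidBall R)) :
    IsHalfLimit C (fun m => rescale u (r m)) u₀ where
  unif := hlim
  sol R := by
    have h1 : ∀ᶠ m in atTop, r m * |R| < δ := by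
      have := hr0.mul_const |R|
      rw [zero_mul] at this
      exact this.eventually_lt_const hδ
    filter_upwards [h1] with m hm
    exact (hu.rescale (hr m)).mono ((le_abs_self R).trans
      ((le_div_iff₀ (hr m)).2 (by rw [mul_comm]; exact hm.le)))

/-- Blowup limits are homogeneous of degree `3/2` (in the infinitesimal form) where they are
negative. -/
theorem inner_gradient_of_isHalfLimit {δ C b : ℝ} {u u₀ ρ : ℂ → ℝ} (hδ : 0 < δ)
    (hu : HalfSol δ C u) (hρ : Measurable ρ) (hb : ∀ z, |ρ z| ≤ b) (hcrit : IsCritical δ u ρ)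
    {r : ℕ → ℝ} (hr : ∀ m, 0 < r m) (hr0 : Tendsto r atTop (𝓝 0))
    (hlim : IsHalfLimit C (fun m => rescale u (r m)) u₀) {z : ℂ} (hz : z.im < 0) (hn : u₀ z < 0) :
    inner ℝ (gradient u₀ z) z = 3 / 2 * u₀ z := by
  set c := ‖z‖ + 1
  have hc : 0 < c := by positivity
  have hS := hlim.halfSol c
  set D := phaseMinus (halfBall c) u₀ with hD
  have hDo : IsOpen D := hS.isOpen_phaseMinus
  have hDs : D ⊆ halfBall c := fun z hz => hz.1
  set Φ : (ℂ → ℝ) → ℂ → ℝ := fun v z => max (1 - ‖z‖ ^ 2 / c ^ 2) 0 ^ 2 *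
        (inner ℝ (negGrad v z) z - 3 / 2 * v z) ^ 2 with hΦ
  have hΦ0 : ∀ v z, 0 ≤ Φ v z := fun v z => by simp only [hΦ]; positivity
  have hΦm : ∀ {R : ℝ} {v : ℂ → ℝ}, HalfSol R C v → IsBddMeas R (Φ v) := fun hv =>
    IsBddMeas.mul (.of_continuous (by fun_prop))
      (hv.isBddMeas_inner_negGrad.sub ((IsBddMeas.const _).mul hv.isBddMeas)).sq
  obtain ⟨L, hL⟩ := hu.exists_tendsto_smoothEnergy hδ hρ hb hcrit
  have hseq : ∀ l : ℝ, 0 < l → Tendsto (fun m => smoothEnergy δ u ρ (r m * l)) atTop (𝓝 L) := by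
    intro l hl
    refine hL.comp (tendsto_nhdsWithin_iff.2 ⟨?_, .of_forall fun m => mul_pos (hr m) hl⟩)
    simpa using hr0.mul_const l
  have hK : 0 < 12 * c * ((2 * c) ^ 6)⁻¹ := by positivity
  have hdiff : Tendsto (fun m => (12 * c * ((2 * c) ^ 6)⁻¹)⁻¹ *
      (smoothEnergy δ u ρ (r m * (2 * c)) - smoothEnergy δ u ρ (r m * c))) atTop (𝓝 0) := by
    simpa using ((hseq (2 * c) (by positivity)).sub (hseq c hc)).const_mul
      (12 * c * ((2 * c) ^ 6)⁻¹)⁻¹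
  have hsmall : ∀ᶠ m in atTop, r m * (2 * c) < δ := by
    have := hr0.mul_const (2 * c)
    rw [zero_mul] at this
    exact this.eventually_lt_const hδ
  have hle : ∀ᶠ m in atTop, ∫ z in D, Φ (rescale u (r m)) z ≤ (12 * c * ((2 * c) ^ 6)⁻¹)⁻¹ *
      (smoothEnergy δ u ρ (r m * (2 * c)) - smoothEnergy δ u ρ (r m * c)) := by
    filter_upwards [hsmall] with m hm
    have hlt : 2 * c < δ / r m := (lt_div_iff₀ (hr m)).2 (by linarith)
    have hres := hu.rescale (hr m)
    have h1 := hres.le_smoothEnergy_sub (ρ := fun z => ρ ((r m : ℂ) * z))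
      (hρ.comp (by fun_prop)) (fun z => hb _) (hcrit.rescale hu (hr m)) hc hlt
    rw [hu.smoothEnergy_rescale (hr m), hu.smoothEnergy_rescale (hr m)] at h1
    rw [← div_eq_inv_mul, le_div_iff₀ hK, mul_comm]
    refine le_trans (mul_le_mul_of_nonneg_left ?_ hK.le) h1
    exact setIntegral_mono_set (hΦm hres).integrableOn (.of_forall fun z => hΦ0 _ z)
      (LE.le.eventuallyLE (hDs.trans (halfBall_mono (by linarith))))
  have hconv : Tendsto (fun m => ∫ z in D, Φ (rescale u (r m)) z) atTop (𝓝 (∫ z in D, Φ u₀ z)) := by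
    have : IsFiniteMeasure (volume.restrict D) :=
      ⟨by simpa using (measure_mono hDs).trans_lt (volume_halfBall_lt_top c)⟩
    refine tendsto_integral_filter_of_dominated_convergence
      (fun _ => 1 ^ 2 * (C * √c * c + 3 / 2 * (C * √c * c)) ^ 2) ?_ ?_ (integrable_const _) ?_
    · filter_upwards [hlim.sol c] with m hm
      exact (hΦm hm).1.mono_measure (Measure.restrict_mono hDs le_rfl)
    · filter_upwards [hlim.sol c] with m hm
      refine (ae_restrict_iff' hDo.measurableSet).2 (.of_forall fun z hz => ?_)
      have hzc := hDs hz
      have e1 := hm.abs_le le_rfl (halfBall_subset_lidBall c hzc)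
      have e2 := hm.norm_negGrad_le le_rfl hzc
      have hC := hm.const_nonneg
      have e4 : C * √c * ‖z‖ ≤ C * √c * c := by
        have := hzc.1.le
        gcongr
      have e3 : |inner ℝ (negGrad (rescale u (r m)) z) z| ≤ C * √c * c :=
        (abs_real_inner_le_norm _ _).trans (le_trans (by gcongr) e4)
      rw [Real.norm_of_nonneg (hΦ0 _ z)]
      simp only [hΦ]
      refine mul_le_mul ?_ ?_ (sq_nonneg _) (by positivity)
      · have : max (1 - ‖z‖ ^ 2 / c ^ 2) 0 ≤ 1 :=
          max_le (sub_le_self _ (by positivity)) zero_le_one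
        gcongr
      · refine sq_le_sq' ?_ ?_
        · have := (abs_le.1 e3).1; have := (abs_le.1 e1).2; linarith
        · have := (abs_le.1 e3).2; have := (abs_le.1 e1).1; linarith
    · refine (ae_restrict_iff' hDo.measurableSet).2 (.of_forall fun z hz => ?_)
      exact ((((hlim.tendsto_negGrad hz.1.2 hz.2).inner tendsto_const_nhds).sub
        ((hlim.tendsto hz.1.2.le).const_mul _)).pow 2).const_mul _
  have hint0 : ∫ z in D, Φ u₀ z = 0 :=
    le_antisymm (le_of_tendsto_of_tendsto hconv hdiff hle) (integral_nonneg fun z => hΦ0 _ z)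
  have hae := (setIntegral_eq_zero_iff_of_nonneg_ae (.of_forall fun z => hΦ0 u₀ z)
    ((hΦm hS).integrableOn.mono_set hDs)).1 hint0
  have hcont : ContinuousOn (Φ u₀) D := by
    have h1 : ContinuousOn (negGrad u₀) D :=
      hS.contDiffOn_gradient.continuousOn.congr fun z hz => hS.negGrad_of_mem hz
    have h2 : ContinuousOn u₀ D := hS.continuousOn.mono (hDs.trans (halfBall_subset_lidBall c))
    exact (Continuous.continuousOn (by fun_prop)).mul
      (((h1.inner continuousOn_id).sub (h2.const_smul (3 / 2 : ℝ))).pow 2)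
  have hzD : z ∈ D := ⟨mem_halfBall_norm hz, hn⟩
  have h0 := Measure.eqOn_open_of_ae_eq hae hDo hcont continuousOn_const hzD
  simp only [hΦ, Pi.zero_apply, mul_eq_zero, pow_eq_zero_iff two_ne_zero] at h0
  rcases h0 with h0 | h0
  · have : ‖z‖ ^ 2 / c ^ 2 < 1 := by
      rw [div_lt_one (by positivity)]
      exact pow_lt_pow_left₀ (by simp [c]) (norm_nonneg z) two_ne_zero
    have h3 := le_max_left (1 - ‖z‖ ^ 2 / c ^ 2) 0
    linarith
  · rw [negGrad_of_neg hz hn] at h0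
    linarith

/-! ### The variational solution near the origin -/

/-- The density of the fluids, `ρ₊ χ⁺ + ρ₋ χ⁻`. -/
def fluidDensity (ρp ρm : ℝ) (u : ℂ → ℝ) (z : ℂ) : ℝ :=
  ρp * chiPlus (halfBall 1) u z + ρm * chiMinus (halfBall 1) u z

/-- The properties of the variational solution on the half-disc of radius `δ` used below: the
weak gradient is the gradient on `Ω⁻` and vanishes elsewhere, and the phases fill the half-disc. -/
structure IsLocalSol (ρp ρm δ C : ℝ) (u : ℂ → ℝ) (g : ℂ → ℂ) : Prop where
  pos : 0 < δ
  sol : HalfSol δ C u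
  grad : ∀ᵐ z, z ∈ halfBall δ → g z = negGrad u z
  fill : ∀ᵐ z, z ∈ halfBall δ → z ∈ phasePlus (halfBall 1) u ∪ phaseMinus (halfBall 1) u
  critical : IsCritical δ u (fluidDensity ρp ρm u)
  measurable : Measurable (fluidDensity ρp ρm u)
  isOpen_phaseMinus : IsOpen (phaseMinus (halfBall 1) u)

theorem chiPlus_eq_of_mem {U : Set ℂ} {v : ℂ → ℝ} {z : ℂ} (h : z ∈ phasePlus U v) :
    chiPlus U v z = 1 ∧ chiMinus U v z = 0 :=
  ⟨indicator_of_mem h _,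
    indicator_of_notMem (disjoint_left.1 (phasePlus_disjoint_phaseMinus U v) h) _⟩

theorem chiMinus_eq_of_mem {U : Set ℂ} {v : ℂ → ℝ} {z : ℂ} (h : z ∈ phaseMinus U v) :
    chiPlus U v z = 0 ∧ chiMinus U v z = 1 :=
  ⟨indicator_of_notMem (disjoint_right.1 (phasePlus_disjoint_phaseMinus U v) h) _,
    indicator_of_mem h _⟩

theorem chiPlus_nonneg_le (U : Set ℂ) (v : ℂ → ℝ) (z : ℂ) :
    0 ≤ chiPlus U v z ∧ chiPlus U v z ≤ 1 := by
  unfold chiPlus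
  by_cases h : z ∈ phasePlus U v
  · rw [indicator_of_mem h]; norm_num
  · rw [indicator_of_notMem h]; norm_num

theorem chiMinus_nonneg_le (U : Set ℂ) (v : ℂ → ℝ) (z : ℂ) :
    0 ≤ chiMinus U v z ∧ chiMinus U v z ≤ 1 := by
  unfold chiMinus
  by_cases h : z ∈ phaseMinus U v
  · rw [indicator_of_mem h]; norm_num
  · rw [indicator_of_notMem h]; norm_num

theorem abs_fluidDensity_le (ρp ρm : ℝ) (u : ℂ → ℝ) (z : ℂ) :
    |fluidDensity ρp ρm u z| ≤ |ρp| + |ρm| := by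
  have h1 := chiPlus_nonneg_le (halfBall 1) u z
  have h2 := chiMinus_nonneg_le (halfBall 1) u z
  refine (abs_add_le _ _).trans (add_le_add ?_ ?_)
  · rw [abs_mul, abs_of_nonneg h1.1]
    exact mul_le_of_le_one_right (abs_nonneg _) h1.2
  · rw [abs_mul, abs_of_nonneg h2.1]
    exact mul_le_of_le_one_right (abs_nonneg _) h2.2

/-- The Lipschitz bound extends from the half-disc to the lid by continuity. -/
theorem IsVariationalSolution.exists_halfSol {ρp ρm : ℝ} {u : ℂ → ℝ} {g : ℂ → ℂ}
    (hu : IsVariationalSolution ρp ρm 0 u g) (hdecay : LipschitzDecay u) :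
    ∃ δ C, 0 < δ ∧ δ ≤ 1 / 2 ∧ HalfSol δ C u := by
  obtain ⟨C, r₀, hr₀, hlip⟩ := hdecay
  refine ⟨min (r₀ / 2) (1 / 2), max C 0, by positivity, min_le_right _ _, ?_⟩
  set δ := min (r₀ / 2) (1 / 2) with hδ
  have hδ1 : δ ≤ 1 / 2 := min_le_right _ _
  have hδ2 : δ < r₀ := (min_le_left _ _).trans_lt (by linarith)
  have hsub : lidBall δ ⊆ halfBall 1 ∪ lid := by
    intro z hz
    rcases hz.2.lt_or_eq with h | h
    · exact Or.inl ⟨by linarith [hz.1], h⟩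
    · exact Or.inr ⟨by linarith [hz.1], h⟩
  have hnear : ∀ {s : ℝ} {z : ℂ}, z ∈ lidBall s →
      ∀ᶠ t : ℝ in 𝓝[>] 0, z - (t : ℂ) * Complex.I ∈ halfBall s := by
    intro s z hz
    have h1 : ∀ᶠ t : ℝ in 𝓝 0, ‖z - (t : ℂ) * Complex.I‖ < s := by
      refine ContinuousAt.eventually_lt (f := fun t : ℝ => ‖z - (t : ℂ) * Complex.I‖)
        (Continuous.continuousAt (by fun_prop)) continuousAt_const ?_
      simpa using hz.1
    filter_upwards [h1.filter_mono nhdsWithin_le_nhds, self_mem_nhdsWithin] with t h1 h2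
    refine ⟨h1, ?_⟩
    have := hz.2
    have h2 : 0 < t := h2
    simp only [Complex.sub_im, Complex.mul_im, Complex.ofReal_re, Complex.I_im, mul_one,
      Complex.ofReal_im, Complex.I_re, mul_zero, add_zero]
    linarith
  have hlim : ∀ {z : ℂ}, z ∈ lidBall δ →
      Tendsto (fun t : ℝ => z - (t : ℂ) * Complex.I) (𝓝[>] 0) (𝓝 z) := by
    intro z _
    have : Continuous fun t : ℝ => z - (t : ℂ) * Complex.I := by fun_prop
    have h2 := this.tendsto 0
    simp only [Complex.ofReal_zero, zero_mul, sub_zero] at h2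
    exact h2.mono_left nhdsWithin_le_nhds
  have hulim : ∀ {z : ℂ}, z ∈ lidBall δ →
      Tendsto (fun t : ℝ => u (z - (t : ℂ) * Complex.I)) (𝓝[>] 0) (𝓝 (u z)) := by
    intro z hz
    refine (hu.continuousOn z (hsub hz)).tendsto.comp (tendsto_nhdsWithin_iff.2 ⟨hlim hz, ?_⟩)
    filter_upwards [hnear hz] with t ht
    exact Or.inl (halfBall_mono (by linarith) ht)
  refine ⟨le_max_right _ _, fun z hz => ?_, fun z hz h0 => ?_, fun s hs z hz z' hz' => ?_, ?_⟩
  · rcases hsub hz with h | h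
    · exact hu.nonpos z h
    · exact (hu.eq_zero_on_lid z h).le
  · exact hu.eq_zero_on_lid z ⟨by linarith [hz.1], h0⟩
  · have hs0 : 0 < s := (norm_nonneg z).trans_lt hz.1
    have hzδ := lidBall_mono hs hz
    have hzδ' := lidBall_mono hs hz'
    refine le_of_tendsto_of_tendsto ((hulim hzδ).sub (hulim hzδ')).abs
      (((hlim hzδ).sub (hlim hzδ')).norm.const_mul (max C 0 * √s)) ?_
    filter_upwards [hnear hz, hnear hz'] with t ht ht'
    refine (hlip s hs0 (hs.trans_lt hδ2) _ ht _ ht').trans ?_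
    rw [Real.sqrt_eq_rpow]
    gcongr
    exact le_max_left _ _
  · exact hu.holGrad.mono fun z hz => ⟨halfBall_mono (by linarith) hz.1, hz.2⟩

/-- Almost every point lies in one of the two open phases: in `Ω⁻` the solution is smooth, and in
`Ω⁺` it vanishes. This determines the weak gradient. -/
theorem IsVariationalSolution.exists_isLocalSol {ρp ρm : ℝ} {u : ℂ → ℝ} {g : ℂ → ℂ}
    (hu : IsVariationalSolution ρp ρm 0 u g) (hdecay : LipschitzDecay u)
    (hfill : PhasesFillNearZero u) : ∃ δ C, IsLocalSol ρp ρm δ C u g := by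
  obtain ⟨δ₁, C, hδ₁, hδ₁', hsol⟩ := hu.exists_halfSol hdecay
  obtain ⟨δ₂, hδ₂, hnull⟩ := hfill
  set δ := min δ₁ δ₂
  have hδ : 0 < δ := lt_min hδ₁ hδ₂
  have hδ' : δ ≤ 1 / 2 := (min_le_left _ _).trans hδ₁'
  have hsol : HalfSol δ C u := hsol.mono (min_le_left _ _)
  have hopen : IsOpen (phaseMinus (halfBall 1) u) :=
    (hu.continuousOn.mono subset_union_left).isOpen_inter_preimage (isOpen_halfBall 1) isOpen_Iio
  have hopen' : IsOpen (phasePlus (halfBall 1) u) := isOpen_interior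
  have hfill : ∀ᵐ z, z ∈ halfBall δ →
      z ∈ phasePlus (halfBall 1) u ∪ phaseMinus (halfBall 1) u := by
    have : ∀ᵐ z, z ∉ halfBall δ₂ \ (phasePlus (halfBall 1) u ∪ phaseMinus (halfBall 1) u) :=
      measure_eq_zero_iff_ae_notMem.1 hnull
    filter_upwards [this] with z hz hzδ
    by_contra h
    exact hz ⟨halfBall_mono (min_le_right _ _) hzδ, h⟩
  have hmeas : Measurable (fluidDensity ρp ρm u) :=
    ((measurable_const.indicator hopen'.measurableSet).const_mul _).add
      ((measurable_const.indicator hopen.measurableSet).const_mul _)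
  have hpsub : phasePlus (halfBall 1) u ⊆ halfBall 1 := fun z hz => (interior_subset hz).1
  have hzero : ∀ z ∈ phasePlus (halfBall 1) u, u z = 0 := fun z hz =>
    le_antisymm (hu.nonpos z (hpsub hz)) (interior_subset hz).2
  have hgrad : ∀ᵐ z, z ∈ halfBall δ → g z = negGrad u z := by
    have h1 := ae_eq_gradient_of_hasWeakGradient hu.weakGradient hopen (fun z hz => hz.1)
      (hu.contDiffOn.of_le (by norm_num))
    have h2 := ae_eq_gradient_of_hasWeakGradient hu.weakGradient hopen' hpsub
      (contDiffOn_const (c := (0 : ℝ)).congr hzero)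
    filter_upwards [h1, h2, hfill] with z h1 h2 h3 hz
    rcases h3 hz with hp | hm
    · rw [h2 hp, negGrad_of_nonneg (hzero z hp).ge]
      have : u =ᶠ[𝓝 z] fun _ => (0 : ℝ) := by
        filter_upwards [hopen'.mem_nhds hp] with y hy using hzero y hy
      rw [this.gradient_eq]
      exact gradient_const z (0 : ℝ)
    · rw [h1 hm, negGrad_of_neg hz.2 hm.2]
  refine ⟨δ, C, hδ, hsol, hgrad, hfill, ?_, hmeas, hopen⟩
  intro φ hφ hs ht
  have hcomp : HasCompactSupport φ :=
    (isCompact_closedBall (0 : ℂ) δ).of_isClosed_subset (isClosed_tsupport φ)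
      (hs.trans Metric.ball_subset_closedBall)
  have h := hu.critical φ hφ hcomp (hs.trans (Metric.ball_subset_ball (by linarith))) ht
  simp only [add_zero] at h
  rw [← h]
  rw [setIntegral_eq_of_subset_of_forall_sdiff_eq_zero (isOpen_halfBall 1).measurableSet
    (halfBall_mono (r := δ) (by linarith))]
  · refine setIntegral_congr_ae (isOpen_halfBall _).measurableSet ?_
    filter_upwards [hgrad] with z hz hzδ
    rw [hz hzδ, fluidDensity]
  · intro z hz
    have hz' : z ∉ tsupport φ := fun h' => hz.2 ⟨by simpa using hs h', hz.1.2⟩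
    have e1 : divergence φ z = 0 := divergence_eq_zero_of_notMem_tsupport hz'
    have e2 : fderiv ℝ φ z = 0 := by
      by_contra hne
      exact hz' (support_fderiv_subset ℝ hne)
    rw [divergence_im_smul (hφ.differentiable one_ne_zero z), e1, e2,
      image_eq_zero_of_notMem_tsupport hz']
    simp

/-! ### Scaling of the phases and of the energy -/

theorem ae_comp_mul {r : ℝ} (hr : 0 < r) {p : ℂ → Prop} (h : ∀ᵐ z, p z) :
    ∀ᵐ z : ℂ, p ((r : ℂ) * z) := by
  have h1 := Measure.map_addHaar_smul (volume : Measure ℂ) hr.ne'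
  have h2 : ∀ᵐ z ∂(Measure.map (fun z : ℂ => r • z) volume), p z := by
    change ∀ᵐ z ∂(Measure.map (r • ·) volume), p z
    rw [h1]
    exact Measure.ae_smul_measure h _
  have h3 := ae_of_ae_map (by fun_prop) h2
  simpa only [Complex.real_smul] using h3

theorem mem_phaseMinus_rescale {R r : ℝ} (hr : 0 < r) {u : ℂ → ℝ} {z : ℂ} :
    z ∈ phaseMinus (halfBall (R / r)) (rescale u r) ↔ (r : ℂ) * z ∈ phaseMinus (halfBall R) u :=
  and_congr (mul_mem_halfBall hr).symm (rescale_neg_iff hr)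

theorem mem_phasePlus_rescale {R r : ℝ} (hr : 0 < r) {u : ℂ → ℝ} {z : ℂ} :
    z ∈ phasePlus (halfBall (R / r)) (rescale u r) ↔ (r : ℂ) * z ∈ phasePlus (halfBall R) u := by
  have hr' : (r : ℂ) ≠ 0 := by exact_mod_cast hr.ne'
  have e : {z | z ∈ halfBall (R / r) ∧ 0 ≤ rescale u r z} =
      (Homeomorph.mulLeft₀ (r : ℂ) hr') ⁻¹' {z | z ∈ halfBall R ∧ 0 ≤ u z} := by
    ext y
    simp only [Set.mem_ofPred_eq, mem_preimage, Homeomorph.coe_mulLeft₀, mul_mem_halfBall hr]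
    rw [← not_lt, rescale_neg_iff hr, not_lt]
  unfold phasePlus
  rw [e, ← Homeomorph.preimage_interior]
  rfl

theorem chiPlus_rescale {R r : ℝ} (hr : 0 < r) (u : ℂ → ℝ) (z : ℂ) :
    chiPlus (halfBall (R / r)) (rescale u r) z = chiPlus (halfBall R) u ((r : ℂ) * z) := by
  unfold chiPlus
  by_cases h : (r : ℂ) * z ∈ phasePlus (halfBall R) u
  · rw [indicator_of_mem h, indicator_of_mem ((mem_phasePlus_rescale hr).2 h)]
  · rw [indicator_of_notMem h, indicator_of_notMem fun h' => h ((mem_phasePlus_rescale hr).1 h')]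

theorem chiMinus_rescale {R r : ℝ} (hr : 0 < r) (u : ℂ → ℝ) (z : ℂ) :
    chiMinus (halfBall (R / r)) (rescale u r) z = chiMinus (halfBall R) u ((r : ℂ) * z) := by
  unfold chiMinus
  by_cases h : (r : ℂ) * z ∈ phaseMinus (halfBall R) u
  · rw [indicator_of_mem h, indicator_of_mem ((mem_phaseMinus_rescale hr).2 h)]
  · rw [indicator_of_notMem h, indicator_of_notMem fun h' => h ((mem_phaseMinus_rescale hr).1 h')]

theorem fluidDensity_rescale {r : ℝ} (hr : 0 < r) (ρp ρm : ℝ) (u : ℂ → ℝ) (z : ℂ) :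
    fluidDensity ρp ρm u ((r : ℂ) * z) =
      ρp * chiPlus (halfBall (1 / r)) (rescale u r) z +
        ρm * chiMinus (halfBall (1 / r)) (rescale u r) z := by
  rw [chiPlus_rescale hr, chiMinus_rescale hr, fluidDensity]

/-- The boundary adjusted energy at radius one. -/
def unitEnergy (w ρ : ℂ → ℝ) : ℝ :=
  (∫ z in halfBall 1, energyDensity w ρ z)
    - 3 / 2 * ∫ θ in (-Real.pi)..0, w (Complex.exp (θ * Complex.I)) ^ 2

namespace IsLocalSol

variable {ρp ρm δ C : ℝ} {u : ℂ → ℝ} {g : ℂ → ℂ}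

theorem ae_rescaleGrad (h : IsLocalSol ρp ρm δ C u g) {r : ℝ} (hr : 0 < r) :
    ∀ᵐ z, z ∈ halfBall (δ / r) → rescaleGrad g r z = negGrad (rescale u r) z := by
  filter_upwards [ae_comp_mul hr h.grad] with z hz hzR
  rw [rescaleGrad, hz ((mul_mem_halfBall hr).2 hzR), h.sol.negGrad_rescale hr hzR,
    Real.rpow_neg hr.le, Real.sqrt_eq_rpow]

theorem ae_fill (h : IsLocalSol ρp ρm δ C u g) {r : ℝ} (hr : 0 < r) :
    ∀ᵐ z, z ∈ halfBall (δ / r) → z ∈ phasePlus (halfBall (1 / r)) (rescale u r) ∪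
      phaseMinus (halfBall (1 / r)) (rescale u r) := by
  filter_upwards [ae_comp_mul hr h.fill] with z hz hzR
  rcases hz ((mul_mem_halfBall hr).2 hzR) with h1 | h1
  · exact Or.inl ((mem_phasePlus_rescale hr).2 h1)
  · exact Or.inr ((mem_phaseMinus_rescale hr).2 h1)

/-- The boundary adjusted energy is invariant under the blowup scaling. -/
theorem energyM_eq (h : IsLocalSol ρp ρm δ C u g) {r : ℝ} (hr : 0 < r) (hrδ : r ≤ δ) :
    energyM ρp ρm u g r =
      unitEnergy (rescale u r) (fun z => fluidDensity ρp ρm u ((r : ℂ) * z)) := by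
  have hsub : halfBall 1 ⊆ halfBall (δ / r) := halfBall_mono ((one_le_div hr).2 hrδ)
  unfold energyM unitEnergy
  congr 1
  · have h1 : ∫ z in halfBall r, (‖g z‖ ^ 2 - z.im * (ρp * chiPlus (halfBall 1) u z
        + ρm * chiMinus (halfBall 1) u z)) =
        ∫ z in halfBall r, energyDensity u (fluidDensity ρp ρm u) z := by
      refine setIntegral_congr_ae (isOpen_halfBall _).measurableSet ?_
      filter_upwards [h.grad] with z hz hzr
      rw [hz (halfBall_mono hrδ hzr), energyDensity, fluidDensity]
    have h2 := setIntegral_halfBall_comp_mul hr r (energyDensity u (fluidDensity ρp ρm u))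
    rw [div_self hr.ne'] at h2
    rw [h1, setIntegral_congr_fun (isOpen_halfBall 1).measurableSet fun z hz =>
      h.sol.energyDensity_rescale hr (hsub hz), integral_const_mul, h2]
    field_simp
  · rw [← intervalIntegral.integral_const_mul]
    congr 1
    refine intervalIntegral.integral_congr fun θ _ => ?_
    rw [rescale_sq hr]
    field_simp

end IsLocalSol

/-! ### Compactness of the rescalings -/

theorem isCompact_lidDisc (R : ℝ) : IsCompact {z : ℂ | ‖z‖ ≤ R ∧ z.im ≤ 0} := by
  have : {z : ℂ | ‖z‖ ≤ R ∧ z.im ≤ 0} = Metric.closedBall 0 R ∩ {z : ℂ | z.im ≤ 0} := by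
    ext z; simp
  rw [this]
  exact (isCompact_closedBall 0 R).inter_right (isClosed_le Complex.continuous_im continuous_const)

theorem exists_subset_lidBall {K : Set ℂ} (hK : IsCompact K) (hK' : K ⊆ {z | z.im ≤ 0}) :
    ∃ R > 0, K ⊆ lidBall R := by
  obtain ⟨R, hR⟩ := hK.isBounded.subset_ball (0 : ℂ)
  exact ⟨max R 1, by positivity, fun z hz =>
    ⟨(mem_ball_zero_iff.1 (hR hz)).trans_le (le_max_left _ _), hK' hz⟩⟩

theorem exists_subseq_of_countable {α X : Type*} [Countable α] [TopologicalSpace X]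
    [FirstCountableTopology X] {K : α → Set X} (hK : ∀ a, IsCompact (K a)) {x : ℕ → α → X}
    (hx : ∀ a m, x m a ∈ K a) :
    ∃ κ : ℕ → ℕ, StrictMono κ ∧ ∃ y : α → X, ∀ a, Tendsto (fun m => x (κ m) a) atTop (𝓝 (y a)) := by
  obtain ⟨y, -, κ, hκ, hy⟩ := (isCompact_univ_pi hK).tendsto_subseq (x := x)
    fun m a _ => hx a m
  exact ⟨κ, hκ, y, fun a => (tendsto_pi_nhds.1 hy) a⟩

/-- A sequence of solutions with a common constant on half-discs that exhaust the lower half-plane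
has a locally uniformly convergent subsequence. -/
theorem exists_isHalfLimit {C : ℝ} {w : ℕ → ℂ → ℝ} (hw : ∀ R, ∀ᶠ m in atTop, HalfSol R C (w m)) :
    ∃ κ : ℕ → ℕ, StrictMono κ ∧ ∃ u₀, IsHalfLimit C (w ∘ κ) u₀ := by
  classical
  have hC : 0 ≤ C := (hw 0).exists.choose_spec.const_nonneg
  obtain ⟨D, hDc, hDd⟩ := TopologicalSpace.exists_countable_dense {z : ℂ // z.im ≤ 0}
  have : Countable D := hDc.to_subtype
  let x : ℕ → D → ℝ := fun m d =>
    if HalfSol (‖(d : ℂ)‖ + 1) C (w m) then w m d else 0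
  obtain ⟨κ, hκ, y, hy⟩ := exists_subseq_of_countable (x := x)
    (K := fun d : D => Metric.closedBall 0 (C * √(‖(d : ℂ)‖ + 1) * ‖(d : ℂ)‖))
    (fun d => isCompact_closedBall _ _) (fun d m => by
      simp only [x]
      split_ifs with h
      · simpa using h.abs_le le_rfl (mem_lidBall_norm d.1.2)
      · simp only [Metric.mem_closedBall, dist_self]; positivity)
  have hsol : ∀ R, ∀ᶠ m in atTop, HalfSol R C ((w ∘ κ) m) := fun R =>
    hκ.tendsto_atTop.eventually (hw R)
  have hyw : ∀ d : D, Tendsto (fun m => (w ∘ κ) m d) atTop (𝓝 (y d)) := fun d =>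
    (hy d).congr' ((hsol (‖(d : ℂ)‖ + 1)).mono fun m hm => if_pos hm)
  have hcauchy : ∀ R, UniformCauchySeqOn (w ∘ κ) atTop (lidBall R) := by
    intro R
    rw [Metric.uniformCauchySeqOn_iff]
    intro ε hε
    set L := C * √(R + 1) with hL
    have hL0 : 0 ≤ L := by positivity
    set η := min 1 (ε / (4 * (L + 1)))
    have hη : 0 < η := by positivity
    obtain ⟨t, ht⟩ := (isCompact_lidDisc R).elim_finite_subcover
      (fun d : D => Metric.ball (d : ℂ) η) (fun d => Metric.isOpen_ball) (by
        intro z hz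
        obtain ⟨d, hd, hdz⟩ := hDd.exists_dist_lt (⟨z, hz.2⟩ : {z : ℂ // z.im ≤ 0}) hη
        exact mem_iUnion.2 ⟨⟨d, hd⟩, hdz⟩)
    have hev : ∀ d ∈ t, ∀ᶠ m in atTop, |(w ∘ κ) m d - y d| < ε / 8 := fun d _ => by
      have := (Metric.tendsto_nhds.1 (hyw d)) (ε / 8) (by positivity)
      simpa [Real.dist_eq] using this
    have hev' := (t.eventually_all (l := atTop)).2 hev
    obtain ⟨M, hM⟩ := eventually_atTop.1 (hev'.and (hsol (R + 1)))
    refine ⟨M, fun m hm n hn z hz => ?_⟩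
    obtain ⟨d, hdt, hdz⟩ := mem_iUnion₂.1 (ht ⟨hz.1.le, hz.2⟩)
    rw [Metric.mem_ball, dist_eq_norm] at hdz
    have hd : (d : ℂ) ∈ lidBall (R + 1) := by
      refine ⟨?_, d.1.2⟩
      have h1 : ‖(d : ℂ)‖ ≤ ‖z‖ + ‖z - d‖ := by
        have := norm_sub_le z (z - d); simpa using this
      have h2 : η ≤ 1 := min_le_left _ _
      linarith [hz.1]
    have hz' : z ∈ lidBall (R + 1) := lidBall_mono (by linarith) hz
    have hLη : L * ‖z - d‖ ≤ ε / 4 := by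
      have h3 : η ≤ ε / (4 * (L + 1)) := min_le_right _ _
      calc L * ‖z - d‖ ≤ (L + 1) * (ε / (4 * (L + 1))) := by gcongr <;> linarith
        _ = ε / 4 := by field_simp
    have h1 := abs_le.1 (((hM m hm).2.lip _ le_rfl z hz' d hd).trans hLη)
    have h2 := abs_le.1 (((hM n hn).2.lip _ le_rfl z hz' d hd).trans hLη)
    have h3 := abs_lt.1 ((hM m hm).1 d hdt)
    have h4 := abs_lt.1 ((hM n hn).1 d hdt)
    rw [Real.dist_eq, abs_lt]
    constructor <;> linarith [h1.1, h1.2, h2.1, h2.2, h3.1, h3.2, h4.1, h4.2]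
  have hpt : ∀ z : ℂ, z.im ≤ 0 → ∃ a, Tendsto (fun m => (w ∘ κ) m z) atTop (𝓝 a) := fun z hz =>
    cauchySeq_tendsto_of_complete ((hcauchy _).cauchySeq (mem_lidBall_norm hz))
  choose! u₀ hu₀ using hpt
  exact ⟨κ, hκ, u₀, hsol, fun R => (hcauchy R).tendstoUniformlyOn_of_tendsto fun z hz => hu₀ z hz.2⟩

namespace IsHalfLimit

variable {C : ℝ} {w : ℕ → ℂ → ℝ} {u₀ : ℂ → ℝ}

/-- Interpolation between uniform convergence and the Lipschitz bound. -/
theorem holder (h : IsHalfLimit C w u₀) {ε : ℝ} (hε : 0 < ε) (hε1 : ε < 1) {K : Set ℂ}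
    (hK : IsCompact K) (hK' : K ⊆ {z | z.im ≤ 0}) {δ : ℝ} (hδ : 0 < δ) :
    ∀ᶠ m in atTop, (∀ z ∈ K, |w m z - u₀ z| ≤ δ) ∧
      (∀ z ∈ K, ∀ y ∈ K, |(w m z - u₀ z) - (w m y - u₀ y)| ≤ δ * ‖z - y‖ ^ ε) := by
  obtain ⟨R, -, hKR⟩ := exists_subset_lidBall hK hK'
  have hC : 0 ≤ C := (h.sol 0).exists.choose_spec.const_nonneg
  set L := 2 * (C * √R)
  have hL : 0 ≤ L := by positivity
  have h1ε : 0 < 1 - ε := by linarith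
  set η := min δ ((δ / (L ^ ε + 1)) ^ (1 - ε)⁻¹ / 2) with hη
  have hη0 : 0 < η := lt_min hδ (by positivity)
  have hη1 : (2 * η) ^ (1 - ε) * L ^ ε ≤ δ := by
    have h1 : 2 * η ≤ (δ / (L ^ ε + 1)) ^ (1 - ε)⁻¹ := by
      have := min_le_right δ ((δ / (L ^ ε + 1)) ^ (1 - ε)⁻¹ / 2)
      linarith
    have h2 : (2 * η) ^ (1 - ε) ≤ δ / (L ^ ε + 1) := by
      refine (Real.rpow_le_rpow (by positivity) h1 h1ε.le).trans_eq ?_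
      rw [← Real.rpow_mul (by positivity), inv_mul_cancel₀ h1ε.ne', Real.rpow_one]
    have h3 : 0 ≤ L ^ ε := by positivity
    calc (2 * η) ^ (1 - ε) * L ^ ε ≤ δ / (L ^ ε + 1) * (L ^ ε + 1) := by gcongr; linarith
      _ = δ := by field_simp
  filter_upwards [h.sol R, Metric.tendstoUniformlyOn_iff.1 (h.unif R) η hη0] with m hm hd
  have hd' : ∀ z ∈ K, |w m z - u₀ z| ≤ η := fun z hz => by
    have := hd z (hKR hz)
    rw [dist_comm, Real.dist_eq] at this
    exact this.le
  refine ⟨fun z hz => (hd' z hz).trans (min_le_left _ _), fun z hz y hy => ?_⟩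
  set Δ := |(w m z - u₀ z) - (w m y - u₀ y)|
  have hΔ0 : 0 ≤ Δ := abs_nonneg _
  have hΔ1 : Δ ≤ 2 * η := (abs_sub _ _).trans (by linarith [hd' z hz, hd' y hy])
  have hΔ2 : Δ ≤ L * ‖z - y‖ := by
    have e1 := hm.lip R le_rfl z (hKR hz) y (hKR hy)
    have e2 := h.lip R (hKR hz) (hKR hy)
    have e3 : Δ = |(w m z - w m y) - (u₀ z - u₀ y)| := by simp only [Δ]; congr 1; ring
    rw [e3]
    refine (abs_sub _ _).trans ((add_le_add e1 e2).trans_eq ?_)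
    simp only [L]; ring
  rcases hΔ0.eq_or_lt with h0 | h0
  · rw [← h0]; positivity
  calc Δ = Δ ^ (1 - ε) * Δ ^ ε := by rw [← Real.rpow_add h0]; simp
    _ ≤ (2 * η) ^ (1 - ε) * (L * ‖z - y‖) ^ ε := by gcongr
    _ = (2 * η) ^ (1 - ε) * L ^ ε * ‖z - y‖ ^ ε := by
        rw [Real.mul_rpow hL (norm_nonneg _)]; ring
    _ ≤ δ * ‖z - y‖ ^ ε := by gcongr

end IsHalfLimit

/-- A solution on every half-disc has the weak gradient `negGrad`. -/
theorem hasWeakGradient_negGrad {C : ℝ} {v : ℂ → ℝ} (hv : ∀ R, HalfSol R C v) :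
    HasWeakGradient lowerHalf v (negGrad v) := by
  have hnhds : ∀ z ∈ lowerHalf, halfBall (‖z‖ + 1) ∈ 𝓝[lowerHalf] z := fun z hz =>
    mem_nhdsWithin_of_mem_nhds ((isOpen_halfBall _).mem_nhds (mem_halfBall_norm hz))
  refine ⟨fun z hz => ⟨_, hnhds z hz, (hv _).isBddMeas.integrableOn⟩, fun z hz => ⟨_, hnhds z hz,
    integrableOn_halfBall_of_bound (hv _).aestronglyMeasurable_negGrad _
      fun y hy => (hv _).norm_negGrad_le le_rfl hy⟩, fun ζ hζ hc hs v' => ?_⟩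
  obtain ⟨R, hR⟩ := hc.isBounded.subset_ball (0 : ℂ)
  have hsub : ∀ z, z ∈ lowerHalf \ halfBall R → z ∉ tsupport ζ := fun z hz h =>
    hz.2 ⟨by simpa using hR h, hz.1⟩
  have hlow : MeasurableSet lowerHalf := measurableSet_lt Complex.measurable_im measurable_const
  have hsub' : halfBall R ⊆ lowerHalf := fun z hz => hz.2
  rw [setIntegral_eq_of_subset_of_forall_sdiff_eq_zero hlow hsub',
    setIntegral_eq_of_subset_of_forall_sdiff_eq_zero hlow hsub']
  · have hζ1 : ContDiff ℝ 1 ζ := hζ.of_le (by simp)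
    have h := (hv R).integral_weakGradient hζ1 hR v'
    have i1 : IntegrableOn (fun z => ζ z * inner ℝ (negGrad v z) v') (halfBall R) := by
      refine IsBddMeas.integrableOn (IsBddMeas.mul (.of_continuous hζ1.continuous) ?_)
      refine ⟨(hv R).aestronglyMeasurable_negGrad.inner aestronglyMeasurable_const,
        C * √R * ‖v'‖, fun z hz => ?_⟩
      refine (abs_real_inner_le_norm _ _).trans ?_
      gcongr
      exact (hv R).norm_negGrad_le le_rfl hz
    have i2 : IntegrableOn (fun z => v z * fderiv ℝ ζ z v') (halfBall R) :=
      IsBddMeas.integrableOn ((hv R).isBddMeas.mul (.of_continuous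
        ((hζ1.continuous_fderiv one_ne_zero).clm_apply continuous_const)))
    rw [integral_add i1 i2] at h
    have e : ∫ z in halfBall R, inner ℝ (negGrad v z) v' * ζ z =
        ∫ z in halfBall R, ζ z * inner ℝ (negGrad v z) v' := by simp only [mul_comm]
    rw [e]
    linarith
  · intro z hz
    rw [image_eq_zero_of_notMem_tsupport (hsub z hz), mul_zero]
  · intro z hz
    have : fderiv ℝ ζ z = 0 := by
      by_contra hne
      exact hsub z hz (support_fderiv_subset ℝ hne)
    simp [this]

theorem volume_lidBall_diff (R : ℝ) : volume (lidBall R \ halfBall R) = 0 := by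
  refine measure_mono_null (t := {z : ℂ | z.im = 0}) (fun z hz => ?_) ?_
  · by_contra h
    exact hz.2 ⟨hz.1.1, lt_of_le_of_ne hz.1.2 h⟩
  · have := Measure.addHaar_submodule (volume : Measure ℂ) (LinearMap.ker Complex.imLm) (by
      intro h
      have : Complex.I ∈ LinearMap.ker Complex.imLm := h ▸ Submodule.mem_top
      simp at this)
    exact this

theorem lidBall_ae_eq (R : ℝ) : (lidBall R : Set ℂ) =ᵐ[volume] halfBall R := by
  refine (ae_le_set.2 (volume_lidBall_diff R)).antisymm ?_
  exact (halfBall_subset_lidBall R).eventuallyLE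

/-- The gradients of the rescalings converge in `L²` up to the lid. -/
theorem IsLocalSol.tendsto_lintegral_rescaleGrad {ρp ρm δ C : ℝ} {u u₀ : ℂ → ℝ} {g : ℂ → ℂ}
    (h : IsLocalSol ρp ρm δ C u g) {r : ℕ → ℝ} (hr : ∀ m, 0 < r m) (hr0 : Tendsto r atTop (𝓝 0))
    (hlim : IsHalfLimit C (fun m => rescale u (r m)) u₀) {K : Set ℂ} (hK : IsCompact K)
    (hK' : K ⊆ {z | z.im ≤ 0}) :
    Tendsto (fun m => ∫⁻ z in K, ‖rescaleGrad g (r m) z - negGrad u₀ z‖ₑ ^ 2) atTop (𝓝 0) := by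
  obtain ⟨R, -, hKR⟩ := exists_subset_lidBall hK hK'
  have h1 := ENNReal.tendsto_ofReal (hlim.tendsto_integral_norm_sub R)
  rw [ENNReal.ofReal_zero] at h1
  refine tendsto_of_tendsto_of_tendsto_of_le_of_le' tendsto_const_nhds h1
    (.of_forall fun _ => zero_le) ?_
  have hsmall : ∀ᶠ m in atTop, r m * |R| < δ := by
    have := hr0.mul_const |R|
    rw [zero_mul] at this
    exact this.eventually_lt_const h.pos
  filter_upwards [hlim.sol R, hsmall] with m hm hs
  have hRm : R ≤ δ / r m :=
    (le_abs_self R).trans ((le_div_iff₀ (hr m)).2 (by rw [mul_comm]; exact hs.le))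
  calc ∫⁻ z in K, ‖rescaleGrad g (r m) z - negGrad u₀ z‖ₑ ^ 2
      ≤ ∫⁻ z in lidBall R, ‖rescaleGrad g (r m) z - negGrad u₀ z‖ₑ ^ 2 := lintegral_mono_set hKR
    _ = ∫⁻ z in halfBall R, ‖rescaleGrad g (r m) z - negGrad u₀ z‖ₑ ^ 2 := by
        rw [Measure.restrict_congr_set (lidBall_ae_eq R)]
    _ = ∫⁻ z in halfBall R, ENNReal.ofReal (‖negGrad (rescale u (r m)) z - negGrad u₀ z‖ ^ 2) := by
        refine lintegral_congr_ae ((ae_restrict_iff' (isOpen_halfBall R).measurableSet).2 ?_)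
        filter_upwards [h.ae_rescaleGrad (hr m)] with z hz hzR
        rw [hz (halfBall_mono hRm hzR), ← ofReal_norm, ENNReal.ofReal_pow (norm_nonneg _)]
    _ ≤ _ := by
        rw [ofReal_integral_eq_lintegral_ofReal]
        · refine IsBddMeas.integrableOn (IsBddMeas.sq ⟨?_, C * √R + C * √R, fun z hz => ?_⟩)
          · exact (hm.aestronglyMeasurable_negGrad.sub
              (hlim.halfSol R).aestronglyMeasurable_negGrad).norm
          · rw [abs_norm]
            exact (norm_sub_le _ _).trans (add_le_add (hm.norm_negGrad_le le_rfl hz)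
              ((hlim.halfSol R).norm_negGrad_le le_rfl hz))
        · exact .of_forall fun z => sq_nonneg _

/-! ### Compactness of the phases -/

theorem inter_frontier_nonempty_of_isPreconnected {B Ω : Set ℂ} (hB : IsPreconnected B)
    (hΩ : IsOpen Ω) (h1 : ¬ B ⊆ Ω) (h2 : ¬ Disjoint B Ω) : (B ∩ frontier Ω).Nonempty := by
  by_contra h
  rw [not_nonempty_iff_eq_empty] at h
  have hcov : B ⊆ Ω ∪ (closure Ω)ᶜ := by
    intro z hz
    by_cases hzΩ : z ∈ Ω
    · exact Or.inl hzΩ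
    · refine Or.inr fun hc => ?_
      have : z ∈ B ∩ frontier Ω := ⟨hz, by rw [hΩ.frontier_eq]; exact ⟨hc, hzΩ⟩⟩
      rw [h] at this
      exact this
  rcases IsPreconnected.subset_or_subset hΩ isClosed_closure.isOpen_compl
    (disjoint_left.2 fun z hz hz' => hz' (subset_closure hz)) hcov hB with h3 | h3
  · exact h1 h3
  · exact h2 (disjoint_left.2 fun z hz hz' => h3 hz (subset_closure hz'))

/-- Open sets whose boundaries are covered, at each small scale `ε`, by `O(1 / ε)` discs of radius
`O(ε)`, have a subsequence that converges pointwise almost everywhere: on each disc of a countable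
base one may assume that eventually the disc is inside, or outside, or meets the boundary, and the
points all of whose basic neighbourhoods meet the boundaries form a null set. -/
theorem exists_subseq_isOpen {Ω : ℕ → Set ℂ} (hΩ : ∀ m, IsOpen (Ω m))
    (hcov : ∀ R : ℝ, 0 < R → ∃ A : ℝ, 0 ≤ A ∧ ∀ n : ℕ, ∀ᶠ m in atTop, ∃ F : Finset ℂ,
      (F.card : ℝ) ≤ A * (n + 1) ∧ frontier (Ω m) ∩ Metric.closedBall 0 R ⊆
        ⋃ c ∈ F, Metric.closedBall c (A / (n + 1))) :
    ∃ κ : ℕ → ℕ, StrictMono κ ∧ ∃ P : Set ℂ, IsOpen P ∧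
      ∀ᵐ z, ((∀ᶠ m in atTop, z ∈ Ω (κ m)) ∧ z ∈ P) ∨ ((∀ᶠ m in atTop, z ∉ Ω (κ m)) ∧ z ∉ P) := by
  classical
  -- the discs of a countable base, and the three possible positions of a disc relative to `Ω m`
  let B : ℕ × ℕ → Set ℂ := fun a => Metric.ball (TopologicalSpace.denseSeq ℂ a.1) (1 / (a.2 + 1))
  let x : ℕ → ℕ × ℕ → Fin 3 := fun m a =>
    if B a ⊆ Ω m then 0 else if Disjoint (B a) (Ω m) then 1 else 2
  obtain ⟨κ, hκ, y, hy⟩ := exists_subseq_of_countable (x := x) (K := fun _ => univ)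
    (fun _ => isCompact_univ) (fun _ _ => mem_univ _)
  have hev : ∀ a, ∀ᶠ m in atTop, x (κ m) a = y a := fun a =>
    (hy a).eventually ((isOpen_discrete {y a}).mem_nhds rfl)
  have h0 : ∀ a, y a = 0 → ∀ᶠ m in atTop, B a ⊆ Ω (κ m) := by
    intro a ha
    filter_upwards [hev a] with m hm
    by_contra h
    rw [ha] at hm
    simp only [x, if_neg h] at hm
    split_ifs at hm <;> simp at hm
  have h1 : ∀ a, y a = 1 → ∀ᶠ m in atTop, Disjoint (B a) (Ω (κ m)) := by
    intro a ha
    filter_upwards [hev a] with m hm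
    by_contra h
    rw [ha] at hm
    simp only [x, if_neg h] at hm
    split_ifs at hm <;> simp at hm
  have h2 : ∀ a, y a ≠ 0 → y a ≠ 1 → ∀ᶠ m in atTop, (B a ∩ frontier (Ω (κ m))).Nonempty := by
    intro a ha ha'
    filter_upwards [hev a] with m hm
    refine inter_frontier_nonempty_of_isPreconnected (convex_ball _ _).isPreconnected (hΩ _) ?_ ?_
    · intro h
      simp only [x, if_pos h] at hm
      exact ha hm.symm
    · intro h
      by_cases h' : B a ⊆ Ω (κ m)
      · simp only [x, if_pos h'] at hm
        exact ha hm.symm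
      · simp only [x, if_neg h', if_pos h] at hm
        exact ha' hm.symm
  set P : Set ℂ := ⋃ a ∈ {a | y a = 0}, B a with hP
  have hPo : IsOpen P := isOpen_biUnion fun a _ => Metric.isOpen_ball
  refine ⟨κ, hκ, P, hPo, ?_⟩
  -- the points at which no disc of the base decides
  set N : Set ℂ := {z | ∀ a, z ∈ B a → y a ≠ 0 ∧ y a ≠ 1} with hN
  have hgood : ∀ z ∉ N, ((∀ᶠ m in atTop, z ∈ Ω (κ m)) ∧ z ∈ P) ∨
      ((∀ᶠ m in atTop, z ∉ Ω (κ m)) ∧ z ∉ P) := by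
    intro z hz
    simp only [hN, Set.mem_ofPred_eq, not_forall] at hz
    obtain ⟨a, hza, ha⟩ := hz
    by_cases hzP : z ∈ P
    · obtain ⟨b, hb, hzb⟩ := mem_iUnion₂.1 hzP
      exact Or.inl ⟨(h0 b hb).mono fun m hm => hm hzb, hzP⟩
    · have ha0 : y a ≠ 0 := fun h => hzP (mem_iUnion₂.2 ⟨a, h, hza⟩)
      have ha1 : y a = 1 := by
        by_contra h
        exact ha ⟨ha0, h⟩
      exact Or.inr ⟨(h1 a ha1).mono fun m hm => disjoint_left.1 hm hza, hzP⟩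
  have hNR : ∀ k : ℕ, volume (N ∩ Metric.closedBall 0 k) = 0 := by
    intro k
    obtain ⟨A, hA, hc⟩ := hcov (k + 2) (by positivity)
    have hbound : ∀ n : ℕ, volume (N ∩ Metric.closedBall 0 k) ≤
        ENNReal.ofReal (A * (A + 2) ^ 2 * Real.pi * (1 / ((n : ℝ) + 1))) := by
      intro n
      have hn : (0 : ℝ) < n + 1 := by positivity
      set T : ℕ → Set ℂ := fun m =>
        {z | ‖z‖ ≤ k ∧ ∃ p ∈ frontier (Ω (κ m)), ‖z - p‖ ≤ 2 / (n + 1)} with hT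
      have hsub : N ∩ Metric.closedBall 0 k ⊆ ⋃ M : ℕ, ⋂ m ≥ M, T m := by
        rintro z ⟨hz, hzk⟩
        obtain ⟨i, hi⟩ := (TopologicalSpace.denseRange_denseSeq ℂ).exists_dist_lt z
          (show (0 : ℝ) < 1 / (n + 1) by positivity)
        have hzB : z ∈ B (i, n) := hi
        obtain ⟨M, hM⟩ := eventually_atTop.1 (h2 (i, n) (hz _ hzB).1 (hz _ hzB).2)
        refine mem_iUnion.2 ⟨M, mem_iInter₂.2 fun m hm => ?_⟩
        obtain ⟨p, hpB, hp⟩ := hM m hm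
        refine ⟨by simpa using hzk, p, hp, ?_⟩
        have e1 : dist z p ≤ dist z (TopologicalSpace.denseSeq ℂ i) +
          dist p (TopologicalSpace.denseSeq ℂ i) := dist_triangle_right _ _ _
        have e2 : dist p (TopologicalSpace.denseSeq ℂ i) < 1 / (n + 1) := hpB
        rw [dist_eq_norm] at e1
        refine e1.trans ((add_le_add hi.le e2.le).trans_eq (by ring))
      have hTvol : ∀ᶠ m in atTop, volume (T m) ≤
          ENNReal.ofReal (A * (A + 2) ^ 2 * Real.pi * (1 / ((n : ℝ) + 1))) := by
        filter_upwards [hκ.tendsto_atTop.eventually (hc n)] with m hm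
        obtain ⟨F, hF, hsubF⟩ := hm
        have hTs : T m ⊆ ⋃ c ∈ F, Metric.closedBall c ((A + 2) / (n + 1)) := by
          rintro z ⟨hzk, p, hp, hzp⟩
          have hpk : p ∈ Metric.closedBall (0 : ℂ) (k + 2) := by
            rw [mem_closedBall_zero_iff]
            have e1 : ‖p‖ ≤ ‖z‖ + ‖z - p‖ := by
              have := norm_sub_le z (z - p); simpa using this
            have e2 : (2 : ℝ) / (n + 1) ≤ 2 := by
              rw [div_le_iff₀ hn]; nlinarith [(Nat.cast_nonneg n : (0 : ℝ) ≤ n)]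
            linarith
          obtain ⟨c, hcF, hpc⟩ := mem_iUnion₂.1 (hsubF ⟨hp, hpk⟩)
          refine mem_iUnion₂.2 ⟨c, hcF, ?_⟩
          rw [Metric.mem_closedBall] at hpc ⊢
          have := dist_triangle z p c
          rw [dist_eq_norm z p] at this
          rw [add_div]
          linarith
        have hA2 : 0 ≤ (A + 2) / ((n : ℝ) + 1) := by positivity
        have hvol : ∀ c : ℂ, volume (Metric.closedBall c ((A + 2) / ((n : ℝ) + 1))) =
            ENNReal.ofReal (((A + 2) / ((n : ℝ) + 1)) ^ 2 * Real.pi) := by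
          intro c
          rw [Complex.volume_closedBall, ENNReal.ofReal_mul (sq_nonneg _), ENNReal.ofReal_pow hA2]
          congr 1
          exact ENNReal.ofReal_eq_coe_nnreal Real.pi_pos.le |>.symm
        calc volume (T m) ≤ ∑ c ∈ F, volume (Metric.closedBall c ((A + 2) / ((n : ℝ) + 1))) :=
              (measure_mono hTs).trans (measure_biUnion_finset_le _ _)
          _ = ENNReal.ofReal (F.card * (((A + 2) / ((n : ℝ) + 1)) ^ 2 * Real.pi)) := by
              simp only [hvol, Finset.sum_const, nsmul_eq_mul]
              rw [ENNReal.ofReal_mul (Nat.cast_nonneg _), ENNReal.ofReal_natCast]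
          _ ≤ _ := by
              refine ENNReal.ofReal_le_ofReal ?_
              calc (F.card : ℝ) * (((A + 2) / ((n : ℝ) + 1)) ^ 2 * Real.pi)
                  ≤ A * (n + 1) * (((A + 2) / ((n : ℝ) + 1)) ^ 2 * Real.pi) := by
                    have := Real.pi_pos; gcongr
                _ = _ := by field_simp
      refine (measure_mono hsub).trans ?_
      have hmono : Monotone fun M : ℕ => ⋂ m ≥ M, T m := fun M M' h =>
        biInter_subset_biInter_left fun m hm => le_trans h hm
      rw [hmono.measure_iUnion]
      refine iSup_le fun M => ?_
      obtain ⟨m, hm, hmM⟩ := (hTvol.and (eventually_ge_atTop M)).exists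
      exact (measure_mono (biInter_subset_of_mem hmM)).trans hm
    have hlim : Tendsto (fun n : ℕ => ENNReal.ofReal (A * (A + 2) ^ 2 * Real.pi *
        (1 / ((n : ℝ) + 1)))) atTop (𝓝 0) := by
      have := ENNReal.tendsto_ofReal ((tendsto_one_div_add_atTop_nhds_zero_nat (𝕜 := ℝ)).const_mul
        (A * (A + 2) ^ 2 * Real.pi))
      simpa using this
    exact le_antisymm (ge_of_tendsto' hlim hbound) zero_le
  have hN0 : volume N = 0 := by
    refine measure_mono_null (t := ⋃ k : ℕ, N ∩ Metric.closedBall 0 k) (fun z hz => ?_)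
      (measure_iUnion_null hNR)
    obtain ⟨k, hk⟩ := exists_nat_ge ‖z‖
    exact mem_iUnion.2 ⟨k, hz, by simpa using hk⟩
  filter_upwards [measure_eq_zero_iff_ae_notMem.1 hN0] with z hz using hgood z hz

/-- The part of a bi-Lipschitz curve in the disc of radius `ρ` is covered by `n + 2` discs of radius
`O(ρ / n)`: its parameters lie in an interval of length `O(ρ)`. -/
theorem IsLipschitzCurve.exists_cover {S : Set ℂ} (hS : IsLipschitzCurve S) :
    ∃ A : ℝ, 0 ≤ A ∧ ∀ ρ : ℝ, 0 < ρ → ∀ n : ℕ, ∃ F : Finset ℂ, F.card ≤ n + 2 ∧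
      S ∩ Metric.closedBall 0 ρ ⊆ ⋃ c ∈ F, Metric.closedBall c (A * ρ / (n + 1)) := by
  classical
  obtain ⟨γ, c, C, hc, hγ, rfl⟩ := hS
  refine ⟨4 * |C| / c, by positivity, fun ρ hρ n => ?_⟩
  have hn : (0 : ℝ) < n + 1 := by positivity
  by_cases hne : ∃ s₀ ∈ Icc (0 : ℝ) 1, γ s₀ ∈ Metric.closedBall 0 ρ
  swap
  · refine ⟨∅, by simp, ?_⟩
    rintro _ ⟨⟨s, hs, rfl⟩, hz⟩
    exact absurd ⟨s, hs, hz⟩ hne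
  obtain ⟨s₀, hs₀, hz₀⟩ := hne
  set G : Set ℝ := {s | s ∈ Icc (0 : ℝ) 1 ∧ γ s ∈ Metric.closedBall 0 ρ}
  -- the parameters of the points in the disc lie in an interval of length `4ρ / c`
  have hG : ∀ s ∈ G, |s - s₀| ≤ 2 * ρ / c := by
    intro s hs
    rw [le_div_iff₀ hc, mul_comm]
    refine (hγ s hs.1 s₀ hs₀).1.trans ((norm_sub_le _ _).trans ?_)
    have h1 := mem_closedBall_zero_iff.1 hs.2
    have h2 := mem_closedBall_zero_iff.1 hz₀
    linarith
  set q : ℝ → ℝ := fun s => (s - s₀ + 2 * ρ / c) * ((n + 1) * c / (4 * ρ)) with hq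
  have hq0 : ∀ s ∈ G, 0 ≤ q s := fun s hs => by
    have := (abs_le.1 (hG s hs)).1
    exact mul_nonneg (by linarith) (by positivity)
  have hq1 : ∀ s ∈ G, q s ≤ n + 1 := fun s hs => by
    have := (abs_le.1 (hG s hs)).2
    calc q s ≤ (2 * ρ / c + 2 * ρ / c) * ((n + 1) * c / (4 * ρ)) := by
          simp only [hq]; gcongr
      _ = n + 1 := by field_simp; ring
  -- the interval is divided into `n + 1` parts, and one point is chosen over each part
  let f : ℕ → ℂ := fun i => if h : ∃ s ∈ G, ⌊q s⌋₊ = i then γ h.choose else 0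
  refine ⟨(Finset.range (n + 2)).image f, Finset.card_image_le.trans (by simp), ?_⟩
  rintro _ ⟨⟨s, hs, rfl⟩, hz⟩
  have hsG : s ∈ G := ⟨hs, hz⟩
  have hex : ∃ s' ∈ G, ⌊q s'⌋₊ = ⌊q s⌋₊ := ⟨s, hsG, rfl⟩
  refine mem_iUnion₂.2 ⟨f ⌊q s⌋₊, Finset.mem_image_of_mem f (Finset.mem_range.2 ?_), ?_⟩
  · have h1 := (Nat.floor_le (hq0 s hsG)).trans (hq1 s hsG)
    have h2 : ⌊q s⌋₊ ≤ n + 1 := by exact_mod_cast h1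
    omega
  · simp only [f, dif_pos hex]
    set s' := hex.choose with hs'
    have hs'G : s' ∈ G := hex.choose_spec.1
    have hfl : ⌊q s'⌋₊ = ⌊q s⌋₊ := hex.choose_spec.2
    have hlt : |q s - q s'| < 1 := by
      have a1 := Nat.floor_le (hq0 s hsG)
      have a2 := Nat.lt_floor_add_one (q s)
      have a3 := Nat.floor_le (hq0 s' hs'G)
      have a4 := Nat.lt_floor_add_one (q s')
      rw [hfl] at a3 a4
      rw [abs_lt]; constructor <;> linarith
    have hqq : q s - q s' = (s - s') * ((n + 1) * c / (4 * ρ)) := by simp only [hq]; ring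
    rw [hqq, abs_mul, abs_of_pos (by positivity : (0 : ℝ) < (n + 1) * c / (4 * ρ))] at hlt
    have hss : |s - s'| ≤ 4 * ρ / ((n + 1) * c) := by
      rw [le_div_iff₀ (by positivity)]
      rw [← mul_div_assoc, div_lt_one (by positivity)] at hlt
      exact hlt.le
    rw [Metric.mem_closedBall, dist_eq_norm]
    calc ‖γ s - γ s'‖ ≤ C * |s - s'| := (hγ s hs s' hs'G.1).2
      _ ≤ |C| * (4 * ρ / ((n + 1) * c)) := by
          gcongr
          exact le_abs_self C
      _ = 4 * |C| / c * ρ / (n + 1) := by field_simp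

/-- The scale-invariant covering property of the free boundary; the constant does not depend on the
radius `ρ`. -/
theorem FreeBoundaryLipschitzNearZero.exists_cover {u : ℂ → ℝ}
    (h : FreeBoundaryLipschitzNearZero u) :
    ∃ δ : ℝ, 0 < δ ∧ ∃ A : ℝ, 0 ≤ A ∧ ∀ ρ : ℝ, 0 < ρ → ρ < δ → ∀ n : ℕ, ∃ F : Finset ℂ,
      (F.card : ℝ) ≤ A * (n + 1) ∧ frontier (phasePlus (halfBall 1) u) ∩ Metric.closedBall 0 ρ ⊆
        ⋃ c ∈ F, Metric.closedBall c (A * ρ / (n + 1)) := by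
  classical
  obtain ⟨δ, hδ, N, S, hS, heq⟩ := h
  choose A hA hcov using fun i => (hS i).exists_cover
  have hsum : 0 ≤ ∑ i, A i := Finset.sum_nonneg fun i _ => hA i
  refine ⟨min δ 1, by positivity, ∑ i, A i + 2 * N, by positivity, fun ρ hρ hρδ n => ?_⟩
  have hn : (0 : ℝ) < n + 1 := by positivity
  choose F hF hsub using fun i => hcov i ρ hρ n
  refine ⟨Finset.univ.biUnion F, ?_, ?_⟩
  · have h1 : (Finset.univ.biUnion F).card ≤ ∑ i : Fin N, (n + 2) :=
      Finset.card_biUnion_le.trans (Finset.sum_le_sum fun i _ => hF i)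
    simp only [Finset.sum_const, Finset.card_univ, Fintype.card_fin, smul_eq_mul] at h1
    have h2 : ((Finset.univ.biUnion F).card : ℝ) ≤ N * (n + 2) := by exact_mod_cast h1
    have h3 : (0 : ℝ) ≤ N * n := by positivity
    have h4 : 0 ≤ (∑ i, A i) * (n + 1) := by positivity
    nlinarith
  · rintro p ⟨hp, hpρ⟩
    have hpn : ‖p‖ < min δ 1 := (mem_closedBall_zero_iff.1 hpρ).trans_lt hρδ
    have hmem : p ∈ freeBoundary u ∩ Metric.ball 0 δ := by
      refine ⟨⟨hp, fun h1 => ?_⟩, mem_ball_zero_iff.2 (hpn.trans_le (min_le_left _ _))⟩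
      rw [mem_sphere_zero_iff_norm] at h1
      have := hpn.trans_le (min_le_right _ _)
      linarith
    rw [heq] at hmem
    obtain ⟨i, hi⟩ := mem_iUnion.1 hmem.1
    obtain ⟨c, hc, hpc⟩ := mem_iUnion₂.1 (hsub i ⟨hi, hpρ⟩)
    refine mem_iUnion₂.2 ⟨c, Finset.mem_biUnion.2 ⟨i, Finset.mem_univ _, hc⟩,
      Metric.closedBall_subset_closedBall ?_ hpc⟩
    gcongr
    have := Finset.single_le_sum (fun j _ => hA j) (Finset.mem_univ i)
    have h5 : (0 : ℝ) ≤ N := Nat.cast_nonneg N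
    linarith

theorem mem_frontier_phasePlus_rescale {R r : ℝ} (hr : 0 < r) {u : ℂ → ℝ} {z : ℂ} :
    z ∈ frontier (phasePlus (halfBall (R / r)) (rescale u r)) ↔
      (r : ℂ) * z ∈ frontier (phasePlus (halfBall R) u) := by
  have hr' : (r : ℂ) ≠ 0 := by exact_mod_cast hr.ne'
  have e : phasePlus (halfBall (R / r)) (rescale u r) =
      (Homeomorph.mulLeft₀ (r : ℂ) hr') ⁻¹' phasePlus (halfBall R) u := by
    ext y; exact mem_phasePlus_rescale hr
  rw [e, ← Homeomorph.preimage_frontier]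
  rfl

/-- Along a subsequence, the phases `Ω⁺` of the rescalings converge almost everywhere. -/
theorem exists_subseq_phasePlus {u : ℂ → ℝ} (h : FreeBoundaryLipschitzNearZero u) {r : ℕ → ℝ}
    (hr : ∀ m, 0 < r m) (hr0 : Tendsto r atTop (𝓝 0)) :
    ∃ κ : ℕ → ℕ, StrictMono κ ∧ ∃ P : Set ℂ, IsOpen P ∧
      ∀ᵐ z, Tendsto (fun m => chiPlus (halfBall (1 / r (κ m))) (rescale u (r (κ m))) z) atTop
        (𝓝 (P.indicator (fun _ => 1) z)) := by
  classical
  obtain ⟨δ, hδ, A, hA, hcov⟩ := h.exists_cover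
  obtain ⟨κ, hκ, P, hP, hae⟩ := exists_subseq_isOpen
    (Ω := fun m => phasePlus (halfBall (1 / r m)) (rescale u (r m))) (fun m => isOpen_interior) (by
      intro R hR
      refine ⟨A * (1 + R), by positivity, fun n => ?_⟩
      have hev : ∀ᶠ m in atTop, r m * R < δ := by
        have := hr0.mul_const R
        rw [zero_mul] at this
        exact this.eventually_lt_const hδ
      filter_upwards [hev] with m hm
      obtain ⟨F, hF, hsub⟩ := hcov (r m * R) (mul_pos (hr m) hR) hm n
      refine ⟨F.image fun c => ((r m : ℂ))⁻¹ * c, ?_, ?_⟩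
      · have h1 : ((F.image fun c => ((r m : ℂ))⁻¹ * c).card : ℝ) ≤ F.card := by
          exact_mod_cast Finset.card_image_le
        have h2 : 0 ≤ A * R * (n + 1) := by positivity
        linarith
      · rintro p ⟨hp, hpR⟩
        have hp' := (mem_frontier_phasePlus_rescale (hr m)).1 hp
        have hpn : (r m : ℂ) * p ∈ Metric.closedBall (0 : ℂ) (r m * R) := by
          rw [mem_closedBall_zero_iff, norm_mul, Complex.norm_real, Real.norm_of_nonneg (hr m).le]
          exact mul_le_mul_of_nonneg_left (mem_closedBall_zero_iff.1 hpR) (hr m).le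
        obtain ⟨c, hc, hpc⟩ := mem_iUnion₂.1 (hsub ⟨hp', hpn⟩)
        refine mem_iUnion₂.2 ⟨((r m : ℂ))⁻¹ * c, Finset.mem_image_of_mem _ hc, ?_⟩
        have hrm : (r m : ℂ) ≠ 0 := by exact_mod_cast (hr m).ne'
        rw [Metric.mem_closedBall, dist_eq_norm] at hpc ⊢
        have e : p - (r m : ℂ)⁻¹ * c = (r m : ℂ)⁻¹ * ((r m : ℂ) * p - c) := by field_simp
        rw [e, norm_mul, norm_inv, Complex.norm_real, Real.norm_of_nonneg (hr m).le,
          inv_mul_le_iff₀ (hr m)]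
        refine hpc.trans ?_
        have h3 : A * (r m * R) / (n + 1) = r m * (A * R / (n + 1)) := by ring
        rw [h3]
        have := (hr m).le
        gcongr
        linarith)
  refine ⟨κ, hκ, P, hP, ?_⟩
  filter_upwards [hae] with z hz
  rcases hz with ⟨h1, h2⟩ | ⟨h1, h2⟩
  · rw [indicator_of_mem h2]
    exact tendsto_const_nhds.congr' (h1.mono fun m hm => (indicator_of_mem hm _).symm)
  · rw [indicator_of_notMem h2]
    exact tendsto_const_nhds.congr' (h1.mono fun m hm => (indicator_of_notMem hm _).symm)

theorem enorm_sub_le_two {a b : ℝ} (ha : 0 ≤ a ∧ a ≤ 1) (hb : 0 ≤ b ∧ b ≤ 1) :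
    ‖a - b‖ₑ ≤ ENNReal.ofReal 1 := by
  rw [← ofReal_norm, Real.norm_eq_abs]
  refine ENNReal.ofReal_le_ofReal (abs_le.2 ⟨?_, ?_⟩) <;> linarith [ha.1, ha.2, hb.1, hb.2]

/-- Every sequence of radii has a subsequence along which a blowup limit exists. -/
theorem IsLocalSol.exists_isBlowupLimit {ρp ρm δ C : ℝ} {u : ℂ → ℝ} {g : ℂ → ℂ}
    (h : IsLocalSol ρp ρm δ C u g) (hΓ : FreeBoundaryLipschitzNearZero u) {r : ℕ → ℝ}
    (hr : ∀ m, 0 < r m) (hr0 : Tendsto r atTop (𝓝 0)) :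
    ∃ κ : ℕ → ℕ, StrictMono κ ∧ ∃ u₀ χp χm : ℂ → ℝ, IsBlowupLimit u g (r ∘ κ) u₀ χp χm := by
  obtain ⟨κ₁, hκ₁, P, hP, hae⟩ := exists_subseq_phasePlus hΓ hr hr0
  have hsol : ∀ R, ∀ᶠ m in atTop, HalfSol R C (rescale u (r (κ₁ m))) := by
    intro R
    have hev : ∀ᶠ m in atTop, r (κ₁ m) * |R| < δ := by
      have := (hr0.comp hκ₁.tendsto_atTop).mul_const |R|
      rw [zero_mul] at this
      exact this.eventually_lt_const h.pos
    filter_upwards [hev] with m hm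
    exact (h.sol.rescale (hr _)).mono ((le_abs_self R).trans
      ((le_div_iff₀ (hr _)).2 (by rw [mul_comm]; exact hm.le)))
  obtain ⟨κ₂, hκ₂, u₀, hlim⟩ := exists_isHalfLimit hsol
  set s : ℕ → ℝ := r ∘ (κ₁ ∘ κ₂) with hs
  have hs0 : Tendsto s atTop (𝓝 0) := hr0.comp (hκ₁.comp hκ₂).tendsto_atTop
  have hspos : ∀ m, 0 < s m := fun m => hr _
  have hlim : IsHalfLimit C (fun m => rescale u (s m)) u₀ := hlim
  have hae : ∀ᵐ z, Tendsto (fun m => chiPlus (halfBall (1 / s m)) (rescale u (s m)) z) atTop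
        (𝓝 (P.indicator (fun _ => 1) z)) := by
    filter_upwards [hae] with z hz
    exact hz.comp hκ₂.tendsto_atTop
  have hfill : ∀ᵐ z, ∀ m, z ∈ halfBall (δ / s m) →
      z ∈ phasePlus (halfBall (1 / s m)) (rescale u (s m)) ∪
        phaseMinus (halfBall (1 / s m)) (rescale u (s m)) :=
    ae_all_iff.2 fun m => h.ae_fill (hspos m)
  set χp : ℂ → ℝ := P.indicator fun _ => 1 with hχp
  have hχm : Measurable χp := measurable_const.indicator hP.measurableSet
  have hχb : ∀ z, 0 ≤ χp z ∧ χp z ≤ 1 := fun z => by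
    simp only [hχp]
    by_cases hz : z ∈ P
    · rw [indicator_of_mem hz]; norm_num
    · rw [indicator_of_notMem hz]; norm_num
  have hloc : LocallyIntegrable χp := by
    refine (locallyIntegrable_const (1 : ℝ)).mono hχm.aestronglyMeasurable (.of_forall fun z => ?_)
    rw [Real.norm_of_nonneg (hχb z).1, norm_one]
    exact (hχb z).2
  have hminus : ∀ᵐ z, z.im < 0 →
      Tendsto (fun m => chiMinus (halfBall (1 / s m)) (rescale u (s m)) z) atTop
        (𝓝 (1 - χp z)) := by
    filter_upwards [hae, hfill] with z hz hzf hneg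
    refine (tendsto_const_nhds.sub hz).congr' ?_
    have hev : ∀ᶠ m in atTop, s m * (‖z‖ + 1) < δ := by
      have := hs0.mul_const (‖z‖ + 1)
      rw [zero_mul] at this
      exact this.eventually_lt_const h.pos
    filter_upwards [hev] with m hm
    have hzm : z ∈ halfBall (δ / s m) := by
      refine ⟨(lt_div_iff₀ (hspos m)).2 ?_, hneg⟩
      nlinarith [hspos m]
    rcases hzf m hzm with h1 | h1
    · rw [(chiPlus_eq_of_mem h1).1, (chiPlus_eq_of_mem h1).2, sub_self]
    · rw [(chiMinus_eq_of_mem h1).1, (chiMinus_eq_of_mem h1).2, sub_zero]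
  have hL1 : ∀ {f : ℕ → ℂ → ℝ} {f₀ : ℂ → ℝ}, (∀ m, Measurable (f m)) → Measurable f₀ →
      (∀ m z, 0 ≤ f m z ∧ f m z ≤ 1) → (∀ z, 0 ≤ f₀ z ∧ f₀ z ≤ 1) →
      (∀ᵐ z, z.im < 0 → Tendsto (fun m => f m z) atTop (𝓝 (f₀ z))) → ∀ K : Set ℂ, IsCompact K →
      K ⊆ {z | z.im ≤ 0} → Tendsto (fun m => ∫⁻ z in K, ‖f m z - f₀ z‖ₑ) atTop (𝓝 0) := by
    intro f f₀ hfm hf₀m hfb hf₀b hconv K hK hK'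
    have hz : ∫⁻ z in K, (0 : ENNReal) = 0 := by simp
    rw [← hz]
    refine tendsto_lintegral_filter_of_dominated_convergence (fun _ => ENNReal.ofReal 1)
      (.of_forall fun m => ((hfm m).sub hf₀m).enorm)
      (.of_forall fun m => .of_forall fun z => enorm_sub_le_two (hfb m z) (hf₀b z)) ?_ ?_
    · rw [setLIntegral_const]
      exact ENNReal.mul_ne_top ENNReal.ofReal_ne_top hK.measure_lt_top.ne
    · have hline : ∀ᵐ z : ℂ, z ∈ K → z.im < 0 := by
        obtain ⟨R, -, hKR⟩ := exists_subset_lidBall hK hK'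
        filter_upwards [measure_eq_zero_iff_ae_notMem.1 (volume_lidBall_diff R)] with z hz hzK
        by_contra hn
        exact hz ⟨hKR hzK, fun hh => hn hh.2⟩
      refine (ae_restrict_iff' hK.measurableSet).2 ?_
      filter_upwards [hconv, hline] with z h1 h2 hzK
      have h3 := (h1 (h2 hzK)).sub_const (f₀ z)
      rw [sub_self] at h3
      simpa using h3.enorm
  refine ⟨κ₁ ∘ κ₂, hκ₁.comp hκ₂, u₀, χp, fun z => 1 - χp z, ?_⟩
  refine ⟨hspos, hs0, fun ε hε hε1 K hK hK' d hd => hlim.holder hε hε1 hK hK' hd,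
    ⟨negGrad u₀, hasWeakGradient_negGrad hlim.halfSol, fun K hK hK' =>
      h.tendsto_lintegral_rescaleGrad hspos hs0 hlim hK hK'⟩,
    hloc.locallyIntegrableOn _, ((locallyIntegrable_const (1 : ℝ)).sub hloc).locallyIntegrableOn _,
    hL1 (fun m => measurable_const.indicator isOpen_interior.measurableSet) hχm
      (fun m z => chiPlus_nonneg_le _ _ _) hχb (by filter_upwards [hae] with z hz _ using hz),
    hL1 (fun m => ?_) (measurable_const.sub hχm) (fun m z => chiMinus_nonneg_le _ _ _)
      (fun z => ⟨by linarith [(hχb z).2], by linarith [(hχb z).1]⟩) hminus⟩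
  have hm : Measurable (chiMinus (halfBall 1) u) :=
    measurable_const.indicator h.isOpen_phaseMinus.measurableSet
  have : chiMinus (halfBall (1 / s m)) (rescale u (s m)) =
      fun z => chiMinus (halfBall 1) u ((s m : ℂ) * z) := funext fun z => chiMinus_rescale (hspos m) u z
  rw [this]
  exact hm.comp (by fun_prop)

/-! ### Properties of blowup limits -/

/-- The density `ρ₊ χ₀⁺ + ρ₋ χ₀⁻` of a limit configuration. -/
def limitDensity (ρp ρm : ℝ) (χp χm : ℂ → ℝ) (z : ℂ) : ℝ := ρp * χp z + ρm * χm z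

/-- The properties of a blowup limit that determine it: it is a solution which is homogeneous of
degree `3/2` (in the infinitesimal form) and critical for its density, and almost everywhere
exactly one of the phases is present, namely `Ω⁻` where the limit is negative. -/
structure IsConeSol (ρp ρm C : ℝ) (v χp χm : ℂ → ℝ) : Prop where
  sol : ∀ R, HalfSol R C v
  hom : ∀ z : ℂ, z.im < 0 → v z < 0 → inner ℝ (gradient v z) z = 3 / 2 * v z
  phases : ∀ᵐ z : ℂ, z.im < 0 → (χp z = 1 ∧ χm z = 0 ∨ χp z = 0 ∧ χm z = 1) ∧
    (v z < 0 → χm z = 1)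
  measurable : AEStronglyMeasurable (limitDensity ρp ρm χp χm) (volume.restrict lowerHalf)
  critical : ∀ R, IsCritical R v (limitDensity ρp ρm χp χm)

theorem measurableSet_lowerHalf : MeasurableSet lowerHalf :=
  measurableSet_lt Complex.measurable_im measurable_const

theorem IsCritical.mono {R R' : ℝ} {w ρ : ℂ → ℝ} (h : IsCritical R' w ρ) (hR : R ≤ R') :
    IsCritical R w ρ := by
  intro φ hφ hs ht
  rw [← h φ hφ (hs.trans (Metric.ball_subset_ball hR)) ht, eq_comm]
  refine setIntegral_eq_of_subset_of_forall_sdiff_eq_zero (isOpen_halfBall _).measurableSet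
    (halfBall_mono hR) fun z hz => ?_
  have hz' : z ∉ tsupport φ := fun h' => hz.2 ⟨by simpa using hs h', hz.1.2⟩
  have e2 : fderiv ℝ φ z = 0 := by
    by_contra hne
    exact hz' (support_fderiv_subset ℝ hne)
  rw [divergence_im_smul (hφ.differentiable one_ne_zero z),
    divergence_eq_zero_of_notMem_tsupport hz', e2, image_eq_zero_of_notMem_tsupport hz']
  simp

theorem exists_subseq_ae_tendsto_zero {μ : Measure ℂ} {F : ℕ → ℂ → ENNReal}
    (hF : ∀ᶠ m in atTop, AEMeasurable (F m) μ)
    (h : Tendsto (fun m => ∫⁻ z, F m z ∂μ) atTop (𝓝 0)) :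
    ∃ κ : ℕ → ℕ, StrictMono κ ∧ ∀ᵐ z ∂μ, Tendsto (fun m => F (κ m) z) atTop (𝓝 0) := by
  obtain ⟨κ, hκ, hb⟩ := extraction_forall_of_eventually
    (P := fun n k => ∫⁻ z, F k z ∂μ ≤ (2⁻¹ : ENNReal) ^ n ∧ AEMeasurable (F k) μ) fun n =>
      ((ENNReal.tendsto_nhds_zero.1 h) _ (by
        rw [gt_iff_lt, pos_iff_ne_zero]
        exact pow_ne_zero _ (by simp))).and hF
  refine ⟨κ, hκ, ?_⟩
  have hsum : ∫⁻ z, ∑' n, F (κ n) z ∂μ ≠ ⊤ := by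
    rw [lintegral_tsum fun n => (hb n).2]
    refine ne_top_of_le_ne_top ?_ (ENNReal.tsum_le_tsum fun n => (hb n).1)
    rw [ENNReal.tsum_geometric]
    simp
  filter_upwards [ae_lt_top' (AEMeasurable.tsum fun n => (hb n).2) hsum] with z hz
  exact ENNReal.tendsto_atTop_zero_of_tsum_ne_top hz.ne

theorem tendsto_of_enorm_sub {E : Type*} [NormedAddCommGroup E] {f : ℕ → E} {a : E}
    (h : Tendsto (fun m => ‖f m - a‖ₑ) atTop (𝓝 0)) : Tendsto f atTop (𝓝 a) := by
  rw [tendsto_iff_norm_sub_tendsto_zero]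
  have := (ENNReal.tendsto_toReal ENNReal.zero_ne_top).comp h
  simpa [Function.comp_def] using this

namespace IsBlowupLimit

variable {ρp ρm δ C : ℝ} {u u₀ χp χm : ℂ → ℝ} {g : ℂ → ℂ} {r : ℕ → ℝ}

theorem isHalfLimit (h : IsBlowupLimit u g r u₀ χp χm) (hu : IsLocalSol ρp ρm δ C u g) :
    IsHalfLimit C (fun m => rescale u (r m)) u₀ := by
  refine isHalfLimit_rescale hu.pos hu.sol h.r_pos h.r_tendsto fun R => ?_
  refine TendstoUniformlyOn.mono (s := {z : ℂ | ‖z‖ ≤ R ∧ z.im ≤ 0}) ?_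
    fun z hz => ⟨hz.1.le, hz.2⟩
  rw [Metric.tendstoUniformlyOn_iff]
  intro ε hε
  filter_upwards [h.holder (1 / 2) (by norm_num) (by norm_num) _ (isCompact_lidDisc R)
    (fun z hz => hz.2) (ε / 2) (by positivity)] with m hm z hz
  rw [dist_comm, Real.dist_eq]
  linarith [hm.1 z hz]

theorem comp {κ : ℕ → ℕ} (h : IsBlowupLimit u g r u₀ χp χm) (hκ : StrictMono κ) :
    IsBlowupLimit u g (r ∘ κ) u₀ χp χm where
  r_pos m := h.r_pos _
  r_tendsto := h.r_tendsto.comp hκ.tendsto_atTop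
  holder ε hε hε1 K hK hK' d hd := hκ.tendsto_atTop.eventually (h.holder ε hε hε1 K hK hK' d hd)
  gradient := by
    obtain ⟨g₀, hg, hl⟩ := h.gradient
    exact ⟨g₀, hg, fun K hK hK' => (hl K hK hK').comp hκ.tendsto_atTop⟩
  plus_integrable := h.plus_integrable
  minus_integrable := h.minus_integrable
  plus K hK hK' := (h.plus K hK hK').comp hκ.tendsto_atTop
  minus K hK hK' := (h.minus K hK hK').comp hκ.tendsto_atTop

theorem eventually_le (h : IsBlowupLimit u g r u₀ χp χm) (hδ : 0 < δ) (R : ℝ) :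
    ∀ᶠ m in atTop, R ≤ δ / r m := by
  have hev : ∀ᶠ m in atTop, r m * R < δ := by
    have := h.r_tendsto.mul_const R
    rw [zero_mul] at this
    exact this.eventually_lt_const hδ
  filter_upwards [hev] with m hm
  exact (le_div_iff₀ (h.r_pos m)).2 (by rw [mul_comm]; exact hm.le)

/-- Along a subsequence the gradients and the phases converge almost everywhere. -/
theorem exists_subseq_ae (h : IsBlowupLimit u g r u₀ χp χm) (hu : IsLocalSol ρp ρm δ C u g)
    (R : ℝ) : ∃ κ : ℕ → ℕ, StrictMono κ ∧ ∀ᵐ z ∂(volume.restrict (halfBall R)),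
      Tendsto (fun m => negGrad (rescale u (r (κ m))) z) atTop (𝓝 (negGrad u₀ z)) ∧
      Tendsto (fun m => chiPlus (halfBall (1 / r (κ m))) (rescale u (r (κ m))) z) atTop
        (𝓝 (χp z)) ∧
      Tendsto (fun m => chiMinus (halfBall (1 / r (κ m))) (rescale u (r (κ m))) z) atTop
        (𝓝 (χm z)) := by
  have hlim := h.isHalfLimit hu
  have hsub : halfBall R ⊆ {z : ℂ | ‖z‖ ≤ R ∧ z.im ≤ 0} := fun z hz => ⟨hz.1.le, hz.2.le⟩
  have hsub' : {z : ℂ | ‖z‖ ≤ R ∧ z.im ≤ 0} ⊆ {z : ℂ | z.im ≤ 0} := fun z hz => hz.2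
  have hP := h.plus _ (isCompact_lidDisc R) hsub'
  have hM := h.minus _ (isCompact_lidDisc R) hsub'
  have hG := ENNReal.tendsto_ofReal (hlim.tendsto_integral_norm_sub R)
  rw [ENNReal.ofReal_zero] at hG
  set F : ℕ → ℂ → ENNReal := fun m z =>
    ENNReal.ofReal (‖negGrad (rescale u (r m)) z - negGrad u₀ z‖ ^ 2)
      + (‖chiPlus (halfBall (1 / r m)) (rescale u (r m)) z - χp z‖ₑ
      + ‖chiMinus (halfBall (1 / r m)) (rescale u (r m)) z - χm z‖ₑ) with hF
  have hpm : AEStronglyMeasurable χp (volume.restrict (halfBall R)) :=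
    h.plus_integrable.aestronglyMeasurable.mono_measure
      (Measure.restrict_mono (hsub.trans hsub') le_rfl)
  have hmm : AEStronglyMeasurable χm (volume.restrict (halfBall R)) :=
    h.minus_integrable.aestronglyMeasurable.mono_measure
      (Measure.restrict_mono (hsub.trans hsub') le_rfl)
  have hcm : ∀ m, Measurable (chiMinus (halfBall (1 / r m)) (rescale u (r m))) := fun m => by
    have e : chiMinus (halfBall (1 / r m)) (rescale u (r m)) =
      fun z => chiMinus (halfBall 1) u ((r m : ℂ) * z) :=
        funext fun z => chiMinus_rescale (h.r_pos m) u z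
    have hm : Measurable (chiMinus (halfBall 1) u) :=
      measurable_const.indicator hu.isOpen_phaseMinus.measurableSet
    rw [e]
    exact hm.comp (by fun_prop)
  have m1 : ∀ m, HalfSol R C (rescale u (r m)) → AEMeasurable (fun z =>
      ENNReal.ofReal (‖negGrad (rescale u (r m)) z - negGrad u₀ z‖ ^ 2))
      (volume.restrict (halfBall R)) := fun m hm =>
    ((hm.aestronglyMeasurable_negGrad.sub
      (hlim.halfSol R).aestronglyMeasurable_negGrad).norm.aemeasurable.pow_const 2).ennreal_ofReal
  have m2 : ∀ m, AEMeasurable (fun z => ‖chiPlus (halfBall (1 / r m)) (rescale u (r m)) z - χp z‖ₑ)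
      (volume.restrict (halfBall R)) := fun m =>
    ((measurable_const.indicator isOpen_interior.measurableSet).aestronglyMeasurable.sub hpm).enorm
  have m3 : ∀ m, AEMeasurable (fun z => ‖chiMinus (halfBall (1 / r m)) (rescale u (r m)) z - χm z‖ₑ)
      (volume.restrict (halfBall R)) := fun m => ((hcm m).aestronglyMeasurable.sub hmm).enorm
  have hFm : ∀ᶠ m in atTop, AEMeasurable (F m) (volume.restrict (halfBall R)) := by
    filter_upwards [hlim.sol R] with m hm
    exact (m1 m hm).add ((m2 m).add (m3 m))
  have hFt : Tendsto (fun m => ∫⁻ z in halfBall R, F m z) atTop (𝓝 0) := by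
    have hsum := hG.add (hP.add hM)
    rw [add_zero, add_zero] at hsum
    refine tendsto_of_tendsto_of_tendsto_of_le_of_le' tendsto_const_nhds hsum
      (.of_forall fun _ => zero_le) ?_
    filter_upwards [hlim.sol R] with m hm
    rw [lintegral_add_left' (m1 m hm), lintegral_add_left' (m2 m)]
    refine add_le_add (le_of_eq ?_) (add_le_add (lintegral_mono_set hsub) (lintegral_mono_set hsub))
    rw [ofReal_integral_eq_lintegral_ofReal]
    · refine IsBddMeas.integrableOn (IsBddMeas.sq ⟨?_, C * √R + C * √R, fun z hz => ?_⟩)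
      · exact (hm.aestronglyMeasurable_negGrad.sub
          (hlim.halfSol R).aestronglyMeasurable_negGrad).norm
      · rw [abs_norm]
        exact (norm_sub_le _ _).trans (add_le_add (hm.norm_negGrad_le le_rfl hz)
          ((hlim.halfSol R).norm_negGrad_le le_rfl hz))
    · exact .of_forall fun z => sq_nonneg _
  obtain ⟨κ, hκ, hae⟩ := exists_subseq_ae_tendsto_zero hFm hFt
  refine ⟨κ, hκ, ?_⟩
  filter_upwards [hae] with z hz
  refine ⟨?_, ?_, ?_⟩
  · have h1 : Tendsto (fun m => ENNReal.ofReal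
        (‖negGrad (rescale u (r (κ m))) z - negGrad u₀ z‖ ^ 2)) atTop (𝓝 0) :=
      tendsto_of_tendsto_of_tendsto_of_le_of_le tendsto_const_nhds hz (fun _ => zero_le)
        fun m => le_self_add
    have h2 := (ENNReal.tendsto_toReal ENNReal.zero_ne_top).comp h1
    simp only [Function.comp_def, ENNReal.toReal_ofReal (sq_nonneg _), ENNReal.toReal_zero] at h2
    rw [tendsto_iff_norm_sub_tendsto_zero]
    have h3 := (Real.continuous_sqrt.tendsto 0).comp h2
    simpa [Function.comp_def, Real.sqrt_sq (norm_nonneg _)] using h3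
  · refine tendsto_of_enorm_sub (tendsto_of_tendsto_of_tendsto_of_le_of_le tendsto_const_nhds hz
      (fun _ => zero_le) fun m => ?_)
    exact le_self_add.trans le_add_self
  · refine tendsto_of_enorm_sub (tendsto_of_tendsto_of_tendsto_of_le_of_le tendsto_const_nhds hz
      (fun _ => zero_le) fun m => ?_)
    exact le_add_self.trans le_add_self

theorem aestronglyMeasurable_density (h : IsBlowupLimit u g r u₀ χp χm) :
    AEStronglyMeasurable (limitDensity ρp ρm χp χm) (volume.restrict lowerHalf) := by
  have hsub : lowerHalf ⊆ {z : ℂ | z.im ≤ 0} := fun z hz => (show z.im < 0 from hz).le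
  have hle : volume.restrict lowerHalf ≤ volume.restrict {z : ℂ | z.im ≤ 0} :=
    Measure.restrict_mono hsub le_rfl
  exact ((h.plus_integrable.aestronglyMeasurable.mono_measure hle).const_mul ρp).add
    ((h.minus_integrable.aestronglyMeasurable.mono_measure hle).const_mul ρm)

/-- The relations between the phases and the solution pass to the limit almost everywhere. -/
theorem ae_phases (h : IsBlowupLimit u g r u₀ χp χm) (hu : IsLocalSol ρp ρm δ C u g) :
    ∀ᵐ z : ℂ, z.im < 0 → (χp z = 1 ∧ χm z = 0 ∨ χp z = 0 ∧ χm z = 1) ∧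
      (u₀ z < 0 → χm z = 1) := by
  have hlim := h.isHalfLimit hu
  have key : ∀ R : ℕ, ∀ᵐ z : ℂ, z ∈ halfBall R →
      (χp z = 1 ∧ χm z = 0 ∨ χp z = 0 ∧ χm z = 1) ∧ (u₀ z < 0 → χm z = 1) := by
    intro R
    obtain ⟨κ, hκ, hae⟩ := h.exists_subseq_ae hu R
    have hfill : ∀ᵐ z, ∀ m, z ∈ halfBall (δ / r (κ m)) →
        z ∈ phasePlus (halfBall (1 / r (κ m))) (rescale u (r (κ m))) ∪
          phaseMinus (halfBall (1 / r (κ m))) (rescale u (r (κ m))) :=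
      ae_all_iff.2 fun m => hu.ae_fill (h.r_pos _)
    filter_upwards [(ae_restrict_iff' (isOpen_halfBall _).measurableSet).1 hae, hfill]
      with z hz hzf hzR
    obtain ⟨-, hp, hm⟩ := hz hzR
    have hmem : ∀ᶠ m in atTop, z ∈ phasePlus (halfBall (1 / r (κ m))) (rescale u (r (κ m))) ∪
          phaseMinus (halfBall (1 / r (κ m))) (rescale u (r (κ m))) := by
      filter_upwards [hκ.tendsto_atTop.eventually (h.eventually_le hu.pos R)] with m hm
      exact hzf m (halfBall_mono hm hzR)
    have e1 : χp z + χm z = 1 := by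
      refine tendsto_nhds_unique (hp.add hm) (tendsto_const_nhds.congr' ?_)
      filter_upwards [hmem] with m hm
      rcases hm with h1 | h1
      · rw [(chiPlus_eq_of_mem h1).1, (chiPlus_eq_of_mem h1).2, add_zero]
      · rw [(chiMinus_eq_of_mem h1).1, (chiMinus_eq_of_mem h1).2, zero_add]
    have e2 : χp z * χm z = 0 := by
      refine tendsto_nhds_unique (hp.mul hm) (tendsto_const_nhds.congr' ?_)
      filter_upwards [hmem] with m hm
      rcases hm with h1 | h1
      · rw [(chiPlus_eq_of_mem h1).2, mul_zero]
      · rw [(chiMinus_eq_of_mem h1).1, zero_mul]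
    refine ⟨?_, fun hn => ?_⟩
    · rcases mul_eq_zero.1 e2 with h1 | h1
      · exact Or.inr ⟨h1, by linarith⟩
      · exact Or.inl ⟨by linarith, h1⟩
    · refine tendsto_nhds_unique hm (tendsto_const_nhds.congr' ?_)
      filter_upwards [hmem, hκ.tendsto_atTop.eventually (hlim.eventually_neg hzR.2.le hn)]
        with m hm hneg
      rcases hm with h1 | h1
      · exact absurd (interior_subset h1).2 (not_le.2 hneg)
      · rw [(chiMinus_eq_of_mem h1).2]
  filter_upwards [ae_all_iff.2 key] with z hz hneg
  obtain ⟨R, hR⟩ := exists_nat_gt ‖z‖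
  exact hz R ⟨hR, hneg⟩

/-- Criticality passes to the limit, because the gradients and the phases converge almost everywhere
and are bounded. -/
theorem isCritical (h : IsBlowupLimit u g r u₀ χp χm) (hu : IsLocalSol ρp ρm δ C u g) (R : ℝ) :
    IsCritical R u₀ (limitDensity ρp ρm χp χm) := by
  intro φ hφ hs ht
  have hlim := h.isHalfLimit hu
  obtain ⟨κ, hκ, hae⟩ := h.exists_subseq_ae hu R
  have hcomp : HasCompactSupport φ :=
    (isCompact_closedBall (0 : ℂ) R).of_isClosed_subset (isClosed_tsupport φ)
      (hs.trans Metric.ball_subset_closedBall)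
  have hφ' : ContDiff ℝ 1 fun y : ℂ => y.im • φ y := contDiff_im.smul hφ
  have hcomp' : HasCompactSupport fun y : ℂ => y.im • φ y := hcomp.mono fun y hy => by
    rw [Function.mem_support] at hy ⊢
    exact fun h0 => hy (by rw [h0, smul_zero])
  have hdiv0 : ∀ {ψ : ℂ → ℂ}, ContDiff ℝ 1 ψ → HasCompactSupport ψ →
      ∃ B, ∀ z, ‖divergence ψ z‖ ≤ B := fun hψ hc =>
    (continuous_divergence hψ).bounded_above_of_compact_support (hc.mono' fun z hz => by
      by_contra hn
      exact hz (divergence_eq_zero_of_notMem_tsupport hn))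
  obtain ⟨B₁, hB₁⟩ := hdiv0 hφ hcomp
  obtain ⟨B₂, hB₂⟩ := hdiv0 hφ' hcomp'
  obtain ⟨B₃, hB₃⟩ := (hφ.continuous_fderiv one_ne_zero).bounded_above_of_compact_support
    (hcomp.fderiv ℝ)
  have hB₁0 := (norm_nonneg _).trans (hB₁ 0)
  have hB₂0 := (norm_nonneg _).trans (hB₂ 0)
  have hB₃0 := (norm_nonneg _).trans (hB₃ 0)
  set ρ' : ℕ → ℂ → ℝ := fun m z => fluidDensity ρp ρm u ((r (κ m) : ℂ) * z)
  set Φ : ℕ → ℂ → ℝ := fun m z => ‖negGrad (rescale u (r (κ m))) z‖ ^ 2 * divergence φ z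
      - 2 * inner ℝ (negGrad (rescale u (r (κ m))) z)
        (fderiv ℝ φ z (negGrad (rescale u (r (κ m))) z))
      - ρ' m z * divergence (fun y => y.im • φ y) z with hΦ
  have hzero : ∀ᶠ m in atTop, ∫ z in halfBall R, Φ m z = 0 := by
    filter_upwards [hκ.tendsto_atTop.eventually (h.eventually_le hu.pos R)] with m hm
    exact ((hu.critical.rescale hu.sol (h.r_pos _)).mono hm) φ hφ hs ht
  have hsol := hκ.tendsto_atTop.eventually (hlim.sol R)
  have : IsFiniteMeasure (volume.restrict (halfBall R)) :=
    ⟨by simpa using volume_halfBall_lt_top R⟩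
  refine tendsto_nhds_unique (tendsto_integral_filter_of_dominated_convergence (F := Φ)
    (fun _ => (C * √R) ^ 2 * B₁ + 2 * (C * √R * (B₃ * (C * √R))) + (|ρp| + |ρm|) * B₂)
    ?_ ?_ (integrable_const _) ?_) (tendsto_const_nhds.congr' (hzero.mono fun m hm => hm.symm))
  · filter_upwards [hsol] with m hm
    have hG := hm.aestronglyMeasurable_negGrad
    refine ((hG.norm.pow 2).mul (continuous_divergence hφ).aestronglyMeasurable).sub
      ((hG.inner ?_).const_mul 2) |>.sub ?_
    · exact (isBoundedBilinearMap_apply (𝕜 := ℝ) (E := ℂ) (F := ℂ)).continuous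
        |>.comp_aestronglyMeasurable
        ((hφ.continuous_fderiv one_ne_zero).aestronglyMeasurable.prodMk hG)
    · exact (hu.measurable.comp (by fun_prop)).aestronglyMeasurable.mul
        (continuous_divergence hφ').aestronglyMeasurable
  · filter_upwards [hsol] with m hm
    refine (ae_restrict_iff' (isOpen_halfBall R).measurableSet).2 (.of_forall fun _ hz => ?_)
    have hg := hm.norm_negGrad_le le_rfl hz
    have hC := hm.const_nonneg
    refine (norm_sub_le _ _).trans (add_le_add ((norm_sub_le _ _).trans (add_le_add ?_ ?_)) ?_)
    · rw [norm_mul, norm_pow, norm_norm]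
      gcongr
      exact hB₁ _
    · rw [norm_mul, Real.norm_of_nonneg (by norm_num : (0 : ℝ) ≤ 2)]
      refine mul_le_mul_of_nonneg_left ((norm_inner_le_norm _ _).trans ?_) (by norm_num)
      refine mul_le_mul hg ((ContinuousLinearMap.le_opNorm _ _).trans ?_) (norm_nonneg _)
        (by positivity)
      exact mul_le_mul (hB₃ _) hg (norm_nonneg _) hB₃0
    · rw [norm_mul]
      exact mul_le_mul (abs_fluidDensity_le _ _ _ _) (hB₂ _) (norm_nonneg _) (by positivity)
  · filter_upwards [hae] with z hz
    obtain ⟨hG, hp, hm⟩ := hz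
    refine (((hG.norm.pow 2).mul_const _).sub ((hG.inner ?_).const_mul 2)).sub
      (Tendsto.mul_const _ ?_)
    · exact ((fderiv ℝ φ z).continuous.tendsto _).comp hG
    · have e : ∀ m, ρ' m z = ρp * chiPlus (halfBall (1 / r (κ m))) (rescale u (r (κ m))) z +
          ρm * chiMinus (halfBall (1 / r (κ m))) (rescale u (r (κ m))) z := fun m =>
        fluidDensity_rescale (h.r_pos _) _ _ _ z
      simp only [e]
      exact (hp.const_mul _).add (hm.const_mul _)

theorem isConeSol (h : IsBlowupLimit u g r u₀ χp χm) (hu : IsLocalSol ρp ρm δ C u g) :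
    IsConeSol ρp ρm C u₀ χp χm where
  sol := (h.isHalfLimit hu).halfSol
  hom _ hz hn := inner_gradient_of_isHalfLimit hu.pos hu.sol hu.measurable
    (abs_fluidDensity_le ρp ρm u) hu.critical h.r_pos h.r_tendsto (h.isHalfLimit hu) hz hn
  phases := h.ae_phases hu
  measurable := h.aestronglyMeasurable_density
  critical := h.isCritical hu

end IsBlowupLimit

/-! ### The phases are constant where the limit vanishes -/

/-- A bounded function whose distributional derivatives vanish in a convex open set is constant
there: its mollifications are locally constant, and they converge almost everywhere. -/
theorem ae_const_of_integral_fderiv_eq_zero {f : ℂ → ℝ} (hf : LocallyIntegrable f) {W : Set ℂ}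
    (hW : IsOpen W) (hWc : Convex ℝ W) (hWn : W.Nonempty)
    (h : ∀ ζ : ℂ → ℝ, ContDiff ℝ 1 ζ → HasCompactSupport ζ → tsupport ζ ⊆ W → ∀ v : ℂ,
      ∫ z, f z * fderiv ℝ ζ z v = 0) :
    ∃ x₀ ∈ W, ∀ᵐ x, x ∈ W → f x = f x₀ := by
  set b : ℕ → ContDiffBump (0 : ℂ) := fun n =>
    ⟨1 / ((n : ℝ) + 1) / 2, 1 / ((n : ℝ) + 1), by positivity, half_lt_self (by positivity)⟩
  have hb0 : Tendsto (fun n => (b n).rOut) atTop (𝓝 0) := tendsto_one_div_add_atTop_nhds_zero_nat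
  have hae : ∀ᵐ x, Tendsto (fun n => convolution ((b n).normed volume) f
      (ContinuousLinearMap.lsmul ℝ ℝ) volume x) atTop (𝓝 (f x)) :=
    ContDiffBump.ae_convolution_tendsto_right_of_locallyIntegrable (K := 2) hb0
      (.of_forall fun n => by simp only [b]; linarith) hf
  have key : ∀ x ∈ W, ∀ y ∈ W, ∀ᶠ n in atTop,
      convolution ((b n).normed volume) f (ContinuousLinearMap.lsmul ℝ ℝ) volume y =
      convolution ((b n).normed volume) f (ContinuousLinearMap.lsmul ℝ ℝ) volume x := by
    intro x hx y hy
    have hseg : IsCompact (segment ℝ x y) := by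
      rw [segment_eq_image_lineMap]
      exact isCompact_Icc.image (by fun_prop)
    obtain ⟨η, hη, hsub⟩ := hseg.exists_thickening_subset_open hW (hWc.segment_subset hx hy)
    filter_upwards [hb0.eventually_lt_const hη] with n hn
    set k : ℂ → ℝ := (b n).normed volume with hk
    have hkC : ContDiff ℝ 1 k := (b n).contDiff_normed
    have hkc : HasCompactSupport k := (b n).hasCompactSupport_normed
    have hder : ∀ p ∈ segment ℝ x y, HasFDerivWithinAt
        (convolution k f (ContinuousLinearMap.lsmul ℝ ℝ) volume) (0 : ℂ →L[ℝ] ℝ)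
        (segment ℝ x y) p := by
      intro p hp
      have h1 := hkc.hasFDerivAt_convolution_left (ContinuousLinearMap.lsmul ℝ ℝ) hkC hf p
        (μ := volume)
      refine (h1.congr_fderiv ?_).hasFDerivWithinAt
      ext v
      have h2 : Continuous (fderiv ℝ k) := hkC.continuous_fderiv one_ne_zero
      have h3 : (convolution (fderiv ℝ k) f
          ((ContinuousLinearMap.lsmul ℝ ℝ).precompL ℂ) volume p) v =
          ∫ t, fderiv ℝ k (p - t) v * f t := by
        have hex := (hkc.fderiv ℝ).convolutionExists_left
          ((ContinuousLinearMap.lsmul ℝ ℝ).precompL ℂ) h2 hf p (μ := volume)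
        rw [convolution_eq_swap, ContinuousLinearMap.integral_apply hex.integrable_swap]
        rfl
      rw [h3]
      set ζ : ℂ → ℝ := fun t => k (p - t) with hζ
      have hζC : ContDiff ℝ 1 ζ := hkC.comp (contDiff_const.sub contDiff_id)
      have hts : tsupport ζ ⊆ Metric.closedBall p (b n).rOut := by
        refine closure_minimal (fun t ht => ?_) Metric.isClosed_closedBall
        have h5 : p - t ∈ tsupport k := subset_tsupport k ht
        rw [hk, (b n).tsupport_normed_eq, mem_closedBall_zero_iff] at h5
        rwa [Metric.mem_closedBall, dist_comm, dist_eq_norm]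
      have hζc : HasCompactSupport ζ :=
        (isCompact_closedBall p _).of_isClosed_subset (isClosed_tsupport ζ) hts
      have hζW : tsupport ζ ⊆ W := by
        refine hts.trans (Subset.trans ?_ hsub)
        refine (Metric.closedBall_subset_ball hn).trans ?_
        exact Metric.ball_subset_thickening hp η
      have hfd : ∀ t, fderiv ℝ ζ t v = - fderiv ℝ k (p - t) v := by
        intro t
        have h6 : HasFDerivAt (fun t : ℂ => p - t) (-ContinuousLinearMap.id ℝ ℂ) t :=
          (hasFDerivAt_id t).const_sub p
        have h7 : HasFDerivAt ζ _ t :=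
          ((hkC.differentiable one_ne_zero (p - t)).hasFDerivAt).comp t h6
        rw [h7.fderiv]
        simp
      have h8 := h ζ hζC hζc hζW v
      simp only [hfd, mul_neg, integral_neg, neg_eq_zero] at h8
      simpa [mul_comm] using h8
    have h9 := Convex.norm_image_sub_le_of_norm_hasFDerivWithin_le hder (C := 0)
      (fun p _ => by simp) (convex_segment x y) (left_mem_segment ℝ x y) (right_mem_segment ℝ x y)
    rw [zero_mul, norm_le_zero_iff, sub_eq_zero] at h9
    exact h9
  have hpos : 0 < volume W := hW.measure_pos volume hWn
  obtain ⟨x₀, hx₀, hlim₀⟩ : ∃ x₀ ∈ W, Tendsto (fun n => convolution ((b n).normed volume) f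
      (ContinuousLinearMap.lsmul ℝ ℝ) volume x₀) atTop (𝓝 (f x₀)) := by
    by_contra hno
    push Not at hno
    have : volume W = 0 := measure_mono_null (fun x hx => hno x hx) (ae_iff.1 hae)
    exact hpos.ne' this
  refine ⟨x₀, hx₀, ?_⟩
  filter_upwards [hae] with x hx hxW
  exact tendsto_nhds_unique hx (hlim₀.congr' ((key x hxW x₀ hx₀).mono fun n hn => hn))

namespace IsConeSol

variable {ρp ρm C : ℝ} {v χp χm : ℂ → ℝ}

theorem ae_density (h : IsConeSol ρp ρm C v χp χm) :
    ∀ᵐ z : ℂ, z.im < 0 → limitDensity ρp ρm χp χm z = ρp ∨ limitDensity ρp ρm χp χm z = ρm := by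
  filter_upwards [h.phases] with z hz hneg
  rcases (hz hneg).1 with ⟨h1, h2⟩ | ⟨h1, h2⟩
  · left; simp [limitDensity, h1, h2]
  · right; simp [limitDensity, h1, h2]

/-- In a convex open set where the limit vanishes, a single fluid is present. -/
theorem ae_const (h : IsConeSol ρp ρm C v χp χm) {W : Set ℂ} (hW : IsOpen W) (hWc : Convex ℝ W)
    (hWn : W.Nonempty) (hWl : W ⊆ lowerHalf) (hv : ∀ z ∈ W, v z = 0) :
    (∀ᵐ z, z ∈ W → limitDensity ρp ρm χp χm z = ρp) ∨
      ∀ᵐ z, z ∈ W → limitDensity ρp ρm χp χm z = ρm := by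
  set f : ℂ → ℝ := lowerHalf.indicator (limitDensity ρp ρm χp χm) with hf
  have hfm : AEStronglyMeasurable f volume :=
    (aestronglyMeasurable_indicator_iff measurableSet_lowerHalf).2 h.measurable
  have hfl : LocallyIntegrable f := by
    refine (locallyIntegrable_const (|ρp| + |ρm|)).mono hfm ?_
    filter_upwards [h.ae_density] with z hz
    rw [Real.norm_of_nonneg (by positivity : (0 : ℝ) ≤ |ρp| + |ρm|)]
    by_cases hzl : z ∈ lowerHalf
    · rw [hf, indicator_of_mem hzl]
      rcases hz hzl with h1 | h1 <;> rw [h1, Real.norm_eq_abs]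
      · exact le_add_of_nonneg_right (abs_nonneg _)
      · exact le_add_of_nonneg_left (abs_nonneg _)
    · rw [hf, indicator_of_notMem hzl, norm_zero]; positivity
  obtain ⟨x₀, hx₀, hc⟩ := ae_const_of_integral_fderiv_eq_zero hfl hW hWc hWn (by
    intro ζ hζ hc hs e
    -- the variation `ζ e / y` turns criticality into the vanishing of the derivative along `e`
    set φ : ℂ → ℂ := fun z => (z.im⁻¹ * ζ z) • e with hφ
    have hφs : tsupport φ ⊆ tsupport ζ := closure_mono fun z hz => by
      rw [Function.mem_support] at hz ⊢
      exact fun h0 => hz (by simp [hφ, h0])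
    have hφC : ContDiff ℝ 1 φ := by
      refine contDiff_of_tsupport fun z hz => ?_
      have hz0 : z.im ≠ 0 := ne_of_lt (hWl (hs (hφs hz)))
      exact ((contDiff_im.contDiffAt.inv hz0).mul hζ.contDiffAt).smul contDiffAt_const
    obtain ⟨R, hR⟩ := hc.isBounded.subset_ball (0 : ℂ)
    have hcrit := h.critical R φ hφC (hφs.trans hR) (fun z hz => by simp [hφ, hz])
    have hY : ∀ z, z.im • φ z = ζ z • e := by
      intro z
      by_cases hz : z ∈ tsupport ζ
      · have hz0 : z.im ≠ 0 := ne_of_lt (hWl (hs hz))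
        simp only [hφ, smul_smul]
        rw [← mul_assoc, mul_inv_cancel₀ hz0, one_mul]
      · simp [hφ, image_eq_zero_of_notMem_tsupport hz]
    have hdiv : ∀ z, divergence (fun y => y.im • φ y) z = fderiv ℝ ζ z e := by
      intro z
      simp only [hY]
      rw [divergence_smul (hζ.differentiable one_ne_zero z) (differentiableAt_const e),
        divergence_const]
      simp
    have hzero : ∀ z ∈ halfBall R, (‖negGrad v z‖ ^ 2 * divergence φ z
      - 2 * inner ℝ (negGrad v z) (fderiv ℝ φ z (negGrad v z))
      - limitDensity ρp ρm χp χm z * divergence (fun y => y.im • φ y) z) =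
        - (limitDensity ρp ρm χp χm z * fderiv ℝ ζ z e) := by
      intro z _
      rw [hdiv]
      by_cases hz : z ∈ tsupport ζ
      · rw [negGrad_of_nonneg (hv z (hs hz)).ge]
        simp
      · have hz' : z ∉ tsupport φ := fun h' => hz (hφs h')
        have e2 : fderiv ℝ φ z = 0 := by
          by_contra hne
          exact hz' (support_fderiv_subset ℝ hne)
        rw [divergence_eq_zero_of_notMem_tsupport hz', e2]
        simp
    rw [setIntegral_congr_fun (isOpen_halfBall R).measurableSet hzero, integral_neg,
      neg_eq_zero] at hcrit
    rw [← hcrit, ← integral_indicator (isOpen_halfBall R).measurableSet]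
    refine integral_congr_ae (.of_forall fun z => ?_)
    by_cases hz : z ∈ tsupport ζ
    · have hzl := hWl (hs hz)
      have hzR : z ∈ halfBall R := ⟨by simpa using hR hz, hzl⟩
      simp only [hf, indicator_of_mem hzl, indicator_of_mem hzR]
    · have e2 : fderiv ℝ ζ z = 0 := by
        by_contra hne
        exact hz (support_fderiv_subset ℝ hne)
      simp [e2, indicator])
  -- the constant is attained at some point where one of the phases has full density
  have hex : ∃ y ∈ W, f y = f x₀ ∧ (limitDensity ρp ρm χp χm y = ρp ∨
      limitDensity ρp ρm χp χm y = ρm) := by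
    by_contra hno
    push Not at hno
    have h0 : volume W = 0 := by
      have hboth := hc.and h.ae_density
      refine measure_mono_null (fun y hy => ?_) (ae_iff.1 hboth)
      intro hcon
      have h1 := hno y hy (hcon.1 hy)
      rcases hcon.2 (hWl hy) with h2 | h2
      · exact h1.1 h2
      · exact h1.2 h2
    exact (hW.measure_pos volume hWn).ne' h0
  obtain ⟨y, hy, hy0, hy1⟩ := hex
  have hfy : ∀ z ∈ W, f z = limitDensity ρp ρm χp χm z := fun z hz => indicator_of_mem (hWl hz) _
  rw [← hy0] at hc
  rcases hy1 with h1 | h1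
  · left
    filter_upwards [hc] with z hz hzW
    rw [← hfy z hzW, hz hzW, hfy y hy, h1]
  · right
    filter_upwards [hc] with z hz hzW
    rw [← hfy z hzW, hz hzW, hfy y hy, h1]

end IsConeSol

/-! ### Homogeneous solutions -/

/-- The harmonic function `-β |z|^{3/2} sin (3/2 (θ - a))` on the sector `a < θ < a + 2π/3`,
extended by zero. -/
def sectorFun (β a : ℝ) (z : ℂ) : ℝ :=
  if a < z.arg ∧ z.arg < a + 2 * Real.pi / 3 then
    -β * ‖z‖ ^ (3 / 2 : ℝ) * Real.sin (3 / 2 * (z.arg - a))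
  else 0

/-- A nonpositive function `h` on `[-π, 0]` with zero boundary values which solves
`h'' = -(9/4) h` where it is negative. The equation is given in integrated form: `h` is the real
part of a multiple of `exp (3/2 i θ)`, with a locally constant factor `W`. -/
structure IsAngularProfile (h : ℝ → ℝ) (W : ℝ → ℂ) : Prop where
  cont : ContinuousOn h (Icc (-Real.pi) 0)
  left : h (-Real.pi) = 0
  right : h 0 = 0
  nonpos : ∀ θ ∈ Icc (-Real.pi) 0, h θ ≤ 0
  deriv : ∀ θ ∈ Ioo (-Real.pi) 0, h θ < 0 → HasDerivAt W 0 θ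
  eq : ∀ θ ∈ Ioo (-Real.pi) 0, h θ < 0 →
    h θ = 2 / 3 * (W θ * Complex.exp (((3 / 2 * θ : ℝ) : ℂ) * Complex.I)).re

namespace IsAngularProfile

variable {h : ℝ → ℝ} {W : ℝ → ℂ}

/-- The component of `{h < 0}` that contains a given angle is an interval of length `2π/3`, and `h`
is a sine there. -/
theorem exists_component (hp : IsAngularProfile h W) {θ₀ : ℝ} (hθ₀ : θ₀ ∈ Ioo (-Real.pi) 0)
    (hn : h θ₀ < 0) : ∃ β a : ℝ, 0 < β ∧ -Real.pi ≤ a ∧ a + 2 * Real.pi / 3 ≤ 0 ∧ a < θ₀ ∧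
      θ₀ < a + 2 * Real.pi / 3 ∧
      ∀ θ ∈ Ioo a (a + 2 * Real.pi / 3), h θ = -β * Real.sin (3 / 2 * (θ - a)) := by
  have hpi := Real.pi_pos
  set c := W θ₀ with hc
  set H : ℝ → ℝ := fun θ => 2 / 3 * (c * Complex.exp (((3 / 2 * θ : ℝ) : ℂ) * Complex.I)).re
    with hH
  have hHc : Continuous H := by fun_prop
  -- `H` is the sine that agrees with `h` at `θ₀`, and `(a, b)` is the interval around `θ₀` between
  -- two consecutive zeros of `H`
  set w₀ := -(c * Complex.exp (((3 / 2 * θ₀ : ℝ) : ℂ) * Complex.I)) with hw₀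
  have hH0 : H θ₀ < 0 := by
    have := hp.eq θ₀ hθ₀ hn
    simp only [hH, hc]
    linarith
  have hw₀re : 0 < w₀.re := by
    rw [hw₀, Complex.neg_re]
    simp only [hH] at hH0
    linarith
  set τ := w₀.arg with hτ
  have h_lt : |τ| < Real.pi / 2 := Complex.abs_arg_lt_pi_div_two_iff.2 (Or.inl hw₀re)
  obtain ⟨hτ1, hτ2⟩ := abs_lt.1 h_lt
  set a := θ₀ - 2 / 3 * (τ + Real.pi / 2) with ha
  set b := a + 2 * Real.pi / 3 with hb
  set β := 2 / 3 * ‖w₀‖ with hβ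
  have hβ0 : 0 < β := by
    have : w₀ ≠ 0 := fun h0 => by rw [h0] at hw₀re; simp at hw₀re
    positivity
  have hHeq : ∀ θ, H θ = -β * Real.sin (3 / 2 * (θ - a)) := by
    intro θ
    have e1 : c * Complex.exp (((3 / 2 * θ : ℝ) : ℂ) * Complex.I) =
        -(‖w₀‖ : ℂ) * Complex.exp (((τ + 3 / 2 * (θ - θ₀) : ℝ) : ℂ) * Complex.I) := by
      have e2 : -(‖w₀‖ * Complex.exp (τ * Complex.I)) =
          c * Complex.exp (((3 / 2 * θ₀ : ℝ) : ℂ) * Complex.I) := by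
        rw [hτ, Complex.norm_mul_exp_arg_mul_I, hw₀, neg_neg]
      have e3 : Complex.exp (((3 / 2 * θ : ℝ) : ℂ) * Complex.I) =
          Complex.exp (((3 / 2 * θ₀ : ℝ) : ℂ) * Complex.I) *
            Complex.exp (((3 / 2 * (θ - θ₀) : ℝ) : ℂ) * Complex.I) := by
        rw [← Complex.exp_add]; congr 1; push_cast; ring
      rw [e3, ← mul_assoc, ← e2]
      have e4 : Complex.exp (((τ + 3 / 2 * (θ - θ₀) : ℝ) : ℂ) * Complex.I) =
          Complex.exp (τ * Complex.I) *
            Complex.exp (((3 / 2 * (θ - θ₀) : ℝ) : ℂ) * Complex.I) := by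
        rw [← Complex.exp_add]; congr 1; push_cast; ring
      rw [e4]; ring
    simp only [hH]
    rw [e1, ← Complex.ofReal_neg, Complex.re_ofReal_mul, Complex.exp_ofReal_mul_I_re]
    have e5 : 3 / 2 * (θ - a) = (τ + 3 / 2 * (θ - θ₀)) + Real.pi / 2 := by
      simp only [ha]; ring
    rw [e5, Real.sin_add_pi_div_two]
    simp only [hβ]; ring
  have hHneg : ∀ θ ∈ Ioo a b, H θ < 0 := by
    intro θ hθ
    rw [hHeq, neg_mul, neg_lt_zero]
    refine mul_pos hβ0 (Real.sin_pos_of_pos_of_lt_pi ?_ ?_)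
    · linarith [hθ.1]
    · have := hθ.2
      simp only [hb] at this
      linarith
  have hθa : a < θ₀ := by simp only [ha]; linarith
  have hθb : θ₀ < b := by simp only [hb, ha]; linarith
  set I := Ioo (max a (-Real.pi)) (min b 0) with hI
  have hIsub : I ⊆ Ioo (-Real.pi) 0 := fun θ hθ =>
    ⟨(le_max_right _ _).trans_lt hθ.1, hθ.2.trans_le (min_le_right _ _)⟩
  have hIab : I ⊆ Ioo a b := fun θ hθ =>
    ⟨(le_max_left _ _).trans_lt hθ.1, hθ.2.trans_le (min_le_left _ _)⟩
  have hθI : θ₀ ∈ I := ⟨max_lt hθa hθ₀.1, lt_min hθb hθ₀.2⟩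
  have hcontI : ContinuousOn h I := hp.cont.mono fun θ hθ => Ioo_subset_Icc_self (hIsub hθ)
  -- the angles with the same factor `c` form an open and closed subset of `I`
  set S := {θ | θ ∈ I ∧ h θ < 0 ∧ W θ = c} with hS
  have hSH : ∀ θ ∈ S, h θ = H θ := fun θ hθ => by
    rw [hp.eq θ (hIsub hθ.1) hθ.2.1, hθ.2.2]
  have hSo : IsOpen S := by
    rw [isOpen_iff_mem_nhds]
    intro θ hθ
    have hopen : IsOpen (I ∩ h ⁻¹' Iio 0) := hcontI.isOpen_inter_preimage isOpen_Ioo isOpen_Iio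
    obtain ⟨ε, hε, hsub⟩ := Metric.isOpen_iff.1 hopen θ ⟨hθ.1, hθ.2.1⟩
    refine mem_of_superset (Metric.ball_mem_nhds θ hε) fun t ht => ⟨(hsub ht).1, (hsub ht).2, ?_⟩
    have h1 := Convex.norm_image_sub_le_of_norm_hasDerivWithin_le (f := W) (f' := fun _ => 0)
      (C := 0) (s := Metric.ball θ ε)
      (fun s hs => (hp.deriv s (hIsub (hsub hs).1) (hsub hs).2).hasDerivWithinAt)
      (fun s _ => by simp) (convex_ball θ ε) (Metric.mem_ball_self hε) ht
    rw [zero_mul, norm_le_zero_iff, sub_eq_zero] at h1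
    rw [h1, hθ.2.2]
  have hSI : I ⊆ S := by
    refine isPreconnected_Ioo.subset_of_closure_inter_subset hSo ⟨θ₀, hθI, hθI, hn, rfl⟩ ?_
    rintro θ ⟨hθc, hθ⟩
    obtain ⟨x, hxS, hx⟩ := mem_closure_iff_seq_limit.1 hθc
    have hh : h θ = H θ := by
      have h1 : Tendsto (fun n => h (x n)) atTop (𝓝 (h θ)) :=
        ((hcontI.continuousAt (isOpen_Ioo.mem_nhds hθ)).tendsto).comp hx
      have h2 : Tendsto (fun n => H (x n)) atTop (𝓝 (H θ)) := (hHc.tendsto θ).comp hx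
      exact tendsto_nhds_unique h1 (h2.congr fun n => (hSH _ (hxS n)).symm)
    have hneg : h θ < 0 := hh ▸ hHneg θ (hIab hθ)
    refine ⟨hθ, hneg, ?_⟩
    have h3 : Tendsto (fun n => W (x n)) atTop (𝓝 (W θ)) :=
      ((hp.deriv θ (hIsub hθ) hneg).continuousAt.tendsto).comp hx
    exact tendsto_nhds_unique h3 (tendsto_const_nhds.congr fun n => (hxS n).2.2.symm)
  -- the interval cannot reach beyond the boundary angles, where `h` vanishes
  have hne : max a (-Real.pi) < min b 0 := hθI.1.trans hθI.2
  have ha' : -Real.pi ≤ a := by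
    by_contra hlt
    push Not at hlt
    have hmax : max a (-Real.pi) = -Real.pi := max_eq_right hlt.le
    have hmem : Ioo (-Real.pi) (min b 0) ∈ 𝓝[>] (-Real.pi) := Ioo_mem_nhdsGT (hmax ▸ hne)
    have h1 : Tendsto h (𝓝[>] (-Real.pi)) (𝓝 (h (-Real.pi))) := by
      refine ((hp.cont _ ⟨le_rfl, by linarith⟩).tendsto).mono_left ?_
      rw [nhdsWithin_le_iff]
      exact mem_of_superset hmem fun t ht => ⟨ht.1.le, (ht.2.trans_le (min_le_right _ _)).le⟩
    have h2 : Tendsto h (𝓝[>] (-Real.pi)) (𝓝 (H (-Real.pi))) := by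
      refine ((hHc.tendsto _).mono_left nhdsWithin_le_nhds).congr' ?_
      filter_upwards [hmem] with t ht
      exact (hSH t (hSI (by rw [hI, hmax]; exact ht))).symm
    have h3 := tendsto_nhds_unique h1 h2
    have h4 := hHneg (-Real.pi) ⟨hlt, hmax ▸ hne.trans_le (min_le_left _ _)⟩
    rw [← h3, hp.left] at h4
    exact lt_irrefl _ h4
  have hb' : b ≤ 0 := by
    by_contra hlt
    push Not at hlt
    have hmin : min b 0 = 0 := min_eq_right hlt.le
    have hmem : Ioo (max a (-Real.pi)) 0 ∈ 𝓝[<] (0 : ℝ) := Ioo_mem_nhdsLT (hmin ▸ hne)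
    have h1 : Tendsto h (𝓝[<] 0) (𝓝 (h 0)) := by
      refine ((hp.cont _ ⟨by linarith, le_rfl⟩).tendsto).mono_left ?_
      rw [nhdsWithin_le_iff]
      exact mem_of_superset hmem fun t ht => ⟨((le_max_right _ _).trans_lt ht.1).le, ht.2.le⟩
    have h2 : Tendsto h (𝓝[<] 0) (𝓝 (H 0)) := by
      refine ((hHc.tendsto _).mono_left nhdsWithin_le_nhds).congr' ?_
      filter_upwards [hmem] with t ht
      exact (hSH t (hSI (by rw [hI, hmin]; exact ht))).symm
    have h3 := tendsto_nhds_unique h1 h2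
    have h4 := hHneg 0 ⟨(le_max_left _ _).trans_lt (hmin ▸ hne), hlt⟩
    rw [← h3, hp.right] at h4
    exact lt_irrefl _ h4
  refine ⟨β, a, hβ0, ha', hb', hθa, hθb, fun θ hθ => ?_⟩
  rw [← hHeq]
  refine hSH θ (hSI ⟨max_lt hθ.1 (ha'.trans_lt hθ.1), lt_min hθ.2 (hθ.2.trans_le hb')⟩)

/-- There is room for only one component of length `2π/3` in an interval of length `π`. -/
theorem eq_zero_or_exists (hp : IsAngularProfile h W) :
    (∀ θ ∈ Icc (-Real.pi) 0, h θ = 0) ∨ ∃ β a : ℝ, 0 < β ∧ -Real.pi ≤ a ∧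
      a + 2 * Real.pi / 3 ≤ 0 ∧ ∀ θ ∈ Icc (-Real.pi) 0, h θ =
        if a < θ ∧ θ < a + 2 * Real.pi / 3 then -β * Real.sin (3 / 2 * (θ - a)) else 0 := by
  have hpi := Real.pi_pos
  have hmem : ∀ θ ∈ Icc (-Real.pi) 0, h θ < 0 → θ ∈ Ioo (-Real.pi) 0 := by
    intro θ hθ hn
    refine ⟨lt_of_le_of_ne hθ.1 ?_, lt_of_le_of_ne hθ.2 ?_⟩
    · rintro rfl; rw [hp.left] at hn; exact lt_irrefl _ hn
    · rintro rfl; rw [hp.right] at hn; exact lt_irrefl _ hn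
  by_cases hz : ∀ θ ∈ Icc (-Real.pi) 0, h θ = 0
  · exact Or.inl hz
  right
  push Not at hz
  obtain ⟨θ₀, hθ₀, hne⟩ := hz
  have hn := lt_of_le_of_ne (hp.nonpos θ₀ hθ₀) hne
  obtain ⟨β, a, hβ, ha, hb, -, -, hform⟩ := hp.exists_component (hmem θ₀ hθ₀ hn) hn
  refine ⟨β, a, hβ, ha, hb, fun θ hθ => ?_⟩
  split_ifs with hcase
  · exact hform θ hcase
  by_contra hne'
  have hn' := lt_of_le_of_ne (hp.nonpos θ hθ) hne'
  obtain ⟨β', a', hβ', ha', hb', h1, h2, hform'⟩ := hp.exists_component (hmem θ hθ hn') hn'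
  have hsin : ∀ {β a t : ℝ}, 0 < β → t ∈ Ioo a (a + 2 * Real.pi / 3) →
      -β * Real.sin (3 / 2 * (t - a)) < 0 := by
    intro β a t hβ ht
    rw [neg_mul, neg_lt_zero]
    exact mul_pos hβ (Real.sin_pos_of_pos_of_lt_pi (by linarith [ht.1]) (by linarith [ht.2]))
  -- `h` vanishes at the end points of the first interval
  have hend : ∀ t ∈ Icc (-Real.pi) 0, t = a ∨ t = a + 2 * Real.pi / 3 →
      ¬ (a' < t ∧ t < a' + 2 * Real.pi / 3) := by
    intro t ht hta hcon
    have hlt := hsin hβ' hcon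
    rw [← hform' t hcon] at hlt
    obtain ⟨β₂, a₂, hβ₂, -, -, h3, h4, hform₂⟩ := hp.exists_component (hmem t ht hlt) hlt
    have hHc : ContinuousAt (fun s => -β * Real.sin (3 / 2 * (s - a))) t := by fun_prop
    have hhc : ContinuousAt h t := hp.cont.continuousAt
      (Icc_mem_nhds (hmem t ht hlt).1 (hmem t ht hlt).2)
    have hval : -β * Real.sin (3 / 2 * (t - a)) = 0 := by
      rcases hta with rfl | rfl
      · simp
      · have : 3 / 2 * (a + 2 * Real.pi / 3 - a) = Real.pi := by ring
        rw [this, Real.sin_pi, mul_zero]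
    have heq : h t = -β * Real.sin (3 / 2 * (t - a)) := by
      have hcl : t ∈ closure (Ioo a (a + 2 * Real.pi / 3)) := by
        rw [closure_Ioo (by linarith)]
        rcases hta with rfl | rfl <;> constructor <;> linarith
      obtain ⟨x, hxS, hx⟩ := mem_closure_iff_seq_limit.1 hcl
      exact tendsto_nhds_unique (hhc.tendsto.comp hx)
        ((hHc.tendsto.comp hx).congr fun n => (hform _ (hxS n)).symm)
    rw [heq, hval] at hlt
    exact lt_irrefl _ hlt
  have hcase' : θ ≤ a ∨ a + 2 * Real.pi / 3 ≤ θ := by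
    by_contra hcon
    push Not at hcon
    exact hcase hcon
  rcases hcase' with hle | hle
  · have h5 := hend a ⟨ha, by linarith⟩ (Or.inl rfl)
    push Not at h5
    have := h5 (h1.trans_le hle)
    linarith
  · have h5 := hend (a + 2 * Real.pi / 3) ⟨by linarith, hb⟩ (Or.inr rfl)
    by_cases h6 : a' < a + 2 * Real.pi / 3
    · exact h5 ⟨h6, hle.trans_lt h2⟩
    · linarith

end IsAngularProfile

section Homogeneous

variable {C : ℝ} {v : ℂ → ℝ}

theorem inner_eq_re (p z : ℂ) : inner ℝ p z = (conj p * z).re := by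
  rw [real_inner_comm, Complex.inner]
  simp [mul_comm]

/-- Homogeneity along rays. -/
theorem radial_homogeneous (hv : ∀ R, HalfSol R C v)
    (hom : ∀ z : ℂ, z.im < 0 → v z < 0 → inner ℝ (gradient v z) z = 3 / 2 * v z) {z : ℂ}
    (hz : z.im < 0) {t : ℝ} (ht : 0 < t) : v ((t : ℂ) * z) = t ^ (3 / 2 : ℝ) * v z := by
  have him : ∀ x : ℝ, 0 < x → ((x : ℂ) * z).im < 0 := fun x hx => by
    rw [Complex.im_ofReal_mul]; exact mul_neg_of_pos_of_neg hx hz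
  have key : ∀ z : ℂ, z.im < 0 → v z < 0 → ∀ x : ℝ, v ((Real.exp x : ℂ) * z) *
      Real.exp (-(3 / 2 * x)) = v z := by
    intro z hz hn
    have him : ∀ x : ℝ, ((Real.exp x : ℂ) * z).im < 0 := fun x => by
      rw [Complex.im_ofReal_mul]; exact mul_neg_of_pos_of_neg (Real.exp_pos x) hz
    set y : ℝ → ℝ := fun x => v ((Real.exp x : ℂ) * z) * Real.exp (-(3 / 2 * x)) with hy
    have hvc : Continuous fun x : ℝ => v ((Real.exp x : ℂ) * z) := by
      rw [continuous_iff_continuousAt]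
      intro x
      have h1 : ContinuousAt v ((Real.exp x : ℂ) * z) :=
        ((hv _).continuousOn.mono (halfBall_subset_lidBall _)).continuousAt
          ((isOpen_halfBall _).mem_nhds (mem_halfBall_norm (him x)))
      exact ContinuousAt.comp (f := fun x : ℝ => (Real.exp x : ℂ) * z) h1 (by fun_prop)
    have hyc : Continuous y := hvc.mul (by fun_prop)
    have hder : ∀ x, y x < 0 → HasDerivAt y 0 x := by
      intro x hx
      have hneg : v ((Real.exp x : ℂ) * z) < 0 := by
        by_contra hge
        exact not_le.2 hx (mul_nonneg (not_lt.1 hge) (Real.exp_pos _).le)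
      have h1 := (hv _).hasFDerivAt ⟨mem_halfBall_norm (him x), hneg⟩
      have h2 : HasDerivAt (fun x : ℝ => (Real.exp x : ℂ) * z) ((Real.exp x : ℂ) * z) x :=
        ((Real.hasDerivAt_exp x).ofReal_comp).mul_const z
      have h3 : HasDerivAt (fun x : ℝ => v ((Real.exp x : ℂ) * z)) _ x := h1.comp_hasDerivAt x h2
      rw [innerSL_apply_apply, hom _ (him x) hneg] at h3
      have h4 : HasDerivAt (fun x : ℝ => Real.exp (-(3 / 2 * x)))
          (Real.exp (-(3 / 2 * x)) * -(3 / 2)) x := by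
        refine HasDerivAt.exp ?_
        have h5 : HasDerivAt (fun x : ℝ => -(3 / 2 * x)) (-(3 / 2 * 1)) x :=
          ((hasDerivAt_id x).const_mul (3 / 2 : ℝ)).neg
        simpa using h5
      refine (h3.mul h4).congr_deriv ?_
      ring
    have hy0 : y 0 = v z := by simp [hy]
    have hcl : IsClopen {x | y x = y 0} := by
      refine ⟨isClosed_eq hyc continuous_const, isOpen_iff_mem_nhds.2 fun x hx => ?_⟩
      have hx' : y x < 0 := by rw [hx, hy0]; exact hn
      obtain ⟨ε, hε, hsub⟩ := Metric.isOpen_iff.1 (isOpen_Iio.preimage hyc) x hx'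
      refine mem_of_superset (Metric.ball_mem_nhds x hε) fun s hs => ?_
      have h1 := Convex.norm_image_sub_le_of_norm_hasDerivWithin_le (f := y) (f' := fun _ => 0)
        (C := 0) (s := Metric.ball x ε) (fun s hs => (hder s (hsub hs)).hasDerivWithinAt)
        (fun s _ => by simp) (convex_ball x ε) (Metric.mem_ball_self hε) hs
      rw [zero_mul, norm_le_zero_iff, sub_eq_zero] at h1
      exact h1.trans hx
    intro x
    have hx : x ∈ {x | y x = y 0} := by
      rw [hcl.eq_univ ⟨0, rfl⟩]; trivial
    exact hx.trans hy0
  have main : ∀ z : ℂ, z.im < 0 → v z < 0 → ∀ t : ℝ, 0 < t →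
      v ((t : ℂ) * z) = t ^ (3 / 2 : ℝ) * v z := by
    intro z hz hn t ht
    have h1 := key z hz hn (Real.log t)
    rw [Real.exp_log ht, Real.exp_neg, ← div_eq_mul_inv, div_eq_iff (Real.exp_pos _).ne'] at h1
    rw [h1, Real.rpow_def_of_pos ht]
    ring_nf
  rcases ((hv _).nonpos z (mem_lidBall_norm hz.le)).lt_or_eq with hn | h0
  · exact main z hz hn t ht
  · rw [h0, mul_zero]
    by_contra hne
    have hn := lt_of_le_of_ne ((hv _).nonpos _ (mem_lidBall_norm (him t ht).le)) hne
    have h1 := main _ (him t ht) hn t⁻¹ (by positivity)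
    have htc : (t : ℂ) ≠ 0 := by exact_mod_cast ht.ne'
    rw [← mul_assoc, Complex.ofReal_inv, inv_mul_cancel₀ htc, one_mul, h0] at h1
    exact (mul_neg_of_pos_of_neg (Real.rpow_pos_of_pos (inv_pos.2 ht) _) hn).ne h1.symm

/-- For a homogeneous solution, the holomorphic function `f = conj ∇v` satisfies `z f' = f / 2`:
`z f - (3/2) ∫ f` has vanishing real part. -/
theorem hasDerivAt_conj_gradient (hv : ∀ R, HalfSol R C v)
    (hom : ∀ z : ℂ, z.im < 0 → v z < 0 → inner ℝ (gradient v z) z = 3 / 2 * v z) {z : ℂ}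
    (hz : z.im < 0) (hn : v z < 0) :
    ∃ f' : ℂ, HasDerivAt (fun z => conj (gradient v z)) f' z ∧
      f' * z = conj (gradient v z) / 2 := by
  have hmem : z ∈ phaseMinus (halfBall (‖z‖ + 1)) v := ⟨mem_halfBall_norm hz, hn⟩
  obtain ⟨ε, hε, hsub⟩ := Metric.isOpen_iff.1 (hv (‖z‖ + 1)).isOpen_phaseMinus z hmem
  have hh : HolGrad v (Metric.ball z ε) := (hv _).hol.mono hsub
  obtain ⟨F, hF, hFv⟩ := hh.exists_primitive
  have hzb : z ∈ Metric.ball z ε := Metric.mem_ball_self hε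
  have hd := (hh.2.differentiableAt (Metric.isOpen_ball.mem_nhds hzb)).hasDerivAt
  refine ⟨_, hd, ?_⟩
  set q := deriv (fun z => conj (gradient v z)) z
  have hQ : HasDerivAt (fun y => conj (gradient v y) * y - 3 / 2 * F y)
      (q * z + conj (gradient v z) * 1 - 3 / 2 * conj (gradient v z)) z :=
    (hd.mul (hasDerivAt_id z)).sub ((hF z hzb).const_mul _)
  have hre : (fun y => (conj (gradient v y) * y - 3 / 2 * F y).re) =ᶠ[𝓝 z] fun _ => 0 := by
    filter_upwards [Metric.isOpen_ball.mem_nhds hzb] with y hy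
    have h1 := hom y (hsub hy).1.2 (hsub hy).2
    rw [inner_eq_re, hFv y hy] at h1
    have h2 : ((3 / 2 : ℂ) * F y).re = 3 / 2 * (F y).re := by
      rw [show (3 / 2 : ℂ) = ((3 / 2 : ℝ) : ℂ) by norm_num, Complex.re_ofReal_mul]
    rw [Complex.sub_re, h1, h2, sub_self]
  have hg1 := (hasGradientAt_re hQ).gradient
  rw [hre.gradient_eq, show gradient (fun _ : ℂ => (0 : ℝ)) z = 0 from gradient_const z (0 : ℝ),
    eq_comm, map_eq_zero] at hg1
  linear_combination hg1

theorem exp_im_neg {θ : ℝ} (hθ : θ ∈ Ioo (-Real.pi) 0) :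
    (Complex.exp (θ * Complex.I)).im < 0 := by
  rw [Complex.exp_ofReal_mul_I_im]
  exact Real.sin_neg_of_neg_of_neg_pi_lt hθ.2 hθ.1

theorem exp_im_nonpos {θ : ℝ} (hθ : θ ∈ Icc (-Real.pi) 0) :
    (Complex.exp (θ * Complex.I)).im ≤ 0 := by
  rw [Complex.exp_ofReal_mul_I_im]
  exact Real.sin_nonpos_of_nonpos_of_neg_pi_le hθ.2 hθ.1

/-- The values of a homogeneous solution on the unit circle. With `f = conj ∇v`, homogeneity says that
`v = (2/3) Re (z f)`, and `z f' = f / 2` says that `z f exp (-3/2 i θ)` is locally constant. -/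
theorem isAngularProfile (hv : ∀ R, HalfSol R C v)
    (hom : ∀ z : ℂ, z.im < 0 → v z < 0 → inner ℝ (gradient v z) z = 3 / 2 * v z) :
    IsAngularProfile (fun θ => v (Complex.exp (θ * Complex.I))) fun θ =>
      conj (gradient v (Complex.exp (θ * Complex.I))) * Complex.exp (θ * Complex.I) *
        Complex.exp (-(((3 / 2 * θ : ℝ) : ℂ) * Complex.I)) where
  cont := by
    refine (hv 2).continuousOn.comp (f := fun θ : ℝ => Complex.exp (θ * Complex.I)) (by fun_prop)
      fun θ hθ => ⟨?_, exp_im_nonpos hθ⟩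
    rw [Complex.norm_exp_ofReal_mul_I]; norm_num
  left := (hv 2).lid _ ⟨by rw [Complex.norm_exp_ofReal_mul_I]; norm_num,
    exp_im_nonpos ⟨le_rfl, by linarith [Real.pi_pos]⟩⟩ (by
      rw [Complex.exp_ofReal_mul_I_im, Real.sin_neg, Real.sin_pi, neg_zero])
  right := (hv 2).lid _ ⟨by simp, by simp⟩ (by simp)
  nonpos θ hθ := (hv _).nonpos _ (mem_lidBall_norm (exp_im_nonpos hθ))
  deriv θ hθ hn := by
    obtain ⟨f', hf, hf'⟩ := hasDerivAt_conj_gradient hv hom (exp_im_neg hθ) hn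
    have hE : HasDerivAt (fun θ : ℝ => Complex.exp (θ * Complex.I))
        (Complex.exp (θ * Complex.I) * Complex.I) θ := by
      have h1 : HasDerivAt (fun θ : ℝ => (θ : ℂ) * Complex.I) (1 * Complex.I) θ :=
        (hasDerivAt_id θ).ofReal_comp.mul_const Complex.I
      simpa using h1.cexp
    have hE2 : HasDerivAt (fun θ : ℝ => Complex.exp (-(((3 / 2 * θ : ℝ) : ℂ) * Complex.I)))
        (Complex.exp (-(((3 / 2 * θ : ℝ) : ℂ) * Complex.I)) * (-((3 / 2 : ℝ) * Complex.I))) θ := by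
      have h0 : HasDerivAt (fun θ : ℝ => 3 / 2 * θ) (3 / 2) θ := by
        simpa using (hasDerivAt_id θ).const_mul (3 / 2 : ℝ)
      have h1 : HasDerivAt (fun θ : ℝ => -(((3 / 2 * θ : ℝ) : ℂ) * Complex.I))
          (-((3 / 2 : ℝ) * Complex.I)) θ := (h0.ofReal_comp.mul_const Complex.I).neg
      exact h1.cexp
    have hfE := hf.comp θ hE
    refine ((hfE.mul hE).mul hE2).congr_deriv ?_
    simp only [Function.comp_def, Pi.mul_apply]
    push_cast
    linear_combination (Complex.I * Complex.exp (θ * Complex.I) *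
      Complex.exp (-(3 / 2 * (θ : ℂ) * Complex.I))) * hf'
  eq θ hθ hn := by
    have h1 := hom _ (exp_im_neg hθ) hn
    rw [inner_eq_re] at h1
    rw [mul_assoc _ _ (Complex.exp (((3 / 2 * θ : ℝ) : ℂ) * Complex.I)), ← Complex.exp_add,
      neg_add_cancel, Complex.exp_zero, mul_one, h1]
    ring

theorem arg_mem_of_im_neg {z : ℂ} (hz : z.im < 0) : z.arg ∈ Ioo (-Real.pi) 0 :=
  ⟨Complex.neg_pi_lt_arg z, Complex.arg_neg_iff.2 hz⟩

/-- A homogeneous solution is supported in a single sector of opening `2π/3`, or vanishes. -/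
theorem eq_zero_or_eq_sectorFun (hv : ∀ R, HalfSol R C v)
    (hom : ∀ z : ℂ, z.im < 0 → v z < 0 → inner ℝ (gradient v z) z = 3 / 2 * v z) :
    (∀ z : ℂ, z.im ≤ 0 → v z = 0) ∨ ∃ β a : ℝ, 0 < β ∧ -Real.pi ≤ a ∧
      a + 2 * Real.pi / 3 ≤ 0 ∧ ∀ z : ℂ, z.im ≤ 0 → v z = sectorFun β a z := by
  have hpolar : ∀ z : ℂ, z.im < 0 →
      v z = ‖z‖ ^ (3 / 2 : ℝ) * v (Complex.exp (z.arg * Complex.I)) := by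
    intro z hz
    have hz0 : 0 < ‖z‖ := norm_pos_iff.2 fun h => by simp [h] at hz
    rw [← radial_homogeneous hv hom (exp_im_neg (arg_mem_of_im_neg hz)) hz0,
      Complex.norm_mul_exp_arg_mul_I]
  have hlid : ∀ z : ℂ, z.im = 0 → v z = 0 := fun z hz =>
    (hv _).lid z (mem_lidBall_norm hz.le) hz
  rcases (isAngularProfile hv hom).eq_zero_or_exists with h0 | ⟨β, a, hβ, ha, hb, hform⟩
  · left
    intro z hz
    rcases hz.lt_or_eq with hz | hz
    · rw [hpolar z hz, h0 _ (Ioo_subset_Icc_self (arg_mem_of_im_neg hz)), mul_zero]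
    · exact hlid z hz
  · right
    refine ⟨β, a, hβ, ha, hb, fun z hz => ?_⟩
    unfold sectorFun
    rcases hz.lt_or_eq with hz | hz
    · rw [hpolar z hz, hform _ (Ioo_subset_Icc_self (arg_mem_of_im_neg hz))]
      split_ifs
      · ring
      · rw [mul_zero]
    · rw [hlid z hz, if_neg]
      rintro ⟨h1, h2⟩
      have h3 : z.arg < 0 := h2.trans_le hb
      rw [Complex.arg_neg_iff] at h3
      exact h3.ne hz

end Homogeneous

/-! ### Integration in polar coordinates -/

/-- The integral over a half-disc of a function with separated polar variables. -/
theorem integral_halfBall_polar (R : ℝ) (A B : ℝ → ℝ) :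
    ∫ z in halfBall R, A ‖z‖ * B z.arg =
      (∫ r in Ioo 0 R, r * A r) * ∫ θ in Ioo (-Real.pi) 0, B θ := by
  have hpi := Real.pi_pos
  rw [← integral_indicator (isOpen_halfBall R).measurableSet, ← Complex.integral_comp_polarCoord_symm]
  have htarget : polarCoord.target = Ioi (0 : ℝ) ×ˢ Ioo (-Real.pi) Real.pi := rfl
  rw [htarget]
  have h1 : ∀ p ∈ Ioi (0 : ℝ) ×ˢ Ioo (-Real.pi) Real.pi,
      p.1 • (halfBall R).indicator (fun z => A ‖z‖ * B z.arg) (Complex.polarCoord.symm p) =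
        (Ioo 0 R).indicator (fun r => r * A r) p.1 * (Ioo (-Real.pi) 0).indicator B p.2 := by
    rintro ⟨r, θ⟩ ⟨hr, hθ⟩
    have hr : 0 < r := hr
    have hθ : θ ∈ Ioo (-Real.pi) Real.pi := hθ
    have harg : (Complex.polarCoord.symm (r, θ)).arg = θ := by
      rw [Complex.polarCoord_symm_apply, Complex.ofReal_cos, Complex.ofReal_sin]
      exact Complex.arg_mul_cos_add_sin_mul_I hr (Ioo_subset_Ioc_self hθ)
    have hnorm : ‖Complex.polarCoord.symm (r, θ)‖ = r := by
      rw [Complex.norm_polarCoord_symm, abs_of_pos hr]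
    have him : (Complex.polarCoord.symm (r, θ)).im < 0 ↔ θ < 0 := by
      rw [← Complex.arg_neg_iff, harg]
    have hmem : Complex.polarCoord.symm (r, θ) ∈ halfBall R ↔ r ∈ Ioo 0 R ∧ θ ∈ Ioo (-Real.pi) 0 := by
      change ‖_‖ < R ∧ _ ↔ _
      rw [hnorm, him]
      exact ⟨fun h => ⟨⟨hr, h.1⟩, hθ.1, h.2⟩, fun h => ⟨h.1.2, h.2.2⟩⟩
    by_cases hm : r ∈ Ioo 0 R ∧ θ ∈ Ioo (-Real.pi) 0
    · rw [indicator_of_mem (hmem.2 hm), indicator_of_mem hm.1, indicator_of_mem hm.2, harg, hnorm,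
        smul_eq_mul]
      ring
    · rw [indicator_of_notMem fun h => hm (hmem.1 h), smul_zero]
      rw [not_and_or] at hm
      rcases hm with hm | hm
      · rw [indicator_of_notMem hm, zero_mul]
      · rw [indicator_of_notMem hm, mul_zero]
  rw [setIntegral_congr_fun (measurableSet_Ioi.prod measurableSet_Ioo) h1]
  rw [Measure.volume_eq_prod, setIntegral_prod_mul (fun r => (Ioo 0 R).indicator (fun r => r * A r) r)
    (fun θ => (Ioo (-Real.pi) 0).indicator B θ)]
  rw [setIntegral_indicator measurableSet_Ioo, setIntegral_indicator measurableSet_Ioo]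
  congr 2
  · rw [inter_eq_right.2 Ioo_subset_Ioi_self]
  · rw [inter_eq_right.2 (Ioo_subset_Ioo_right hpi.le)]

/-- The step function with the values `x`, `y`, `w` on the angles before, in, and after the sector
`(a, a + 2π/3)`. -/
def angularStep (a x y w θ : ℝ) : ℝ :=
  if θ ≤ a then x else if θ < a + 2 * Real.pi / 3 then y else w

theorem measurable_angularStep (a x y w : ℝ) : Measurable (angularStep a x y w) :=
  Measurable.ite measurableSet_Iic measurable_const
    (Measurable.ite measurableSet_Iio measurable_const measurable_const)

theorem abs_angularStep_le (a x y w θ : ℝ) : |angularStep a x y w θ| ≤ |x| + |y| + |w| := by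
  have := abs_nonneg x; have := abs_nonneg y; have := abs_nonneg w
  unfold angularStep
  split_ifs <;> linarith

theorem integral_angularStep_mul {a : ℝ} (ha : -Real.pi ≤ a) (hb : a + 2 * Real.pi / 3 ≤ 0)
    (x y w : ℝ) {f : ℝ → ℝ} (hf : Continuous f) :
    ∫ θ in Ioo (-Real.pi) 0, angularStep a x y w θ * f θ =
      x * (∫ θ in (-Real.pi)..a, f θ) + y * (∫ θ in a..(a + 2 * Real.pi / 3), f θ)
        + w * ∫ θ in (a + 2 * Real.pi / 3)..0, f θ := by
  have hpi := Real.pi_pos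
  have hab : a ≤ a + 2 * Real.pi / 3 := by linarith
  set b := a + 2 * Real.pi / 3 with hb'
  have e1 : EqOn (fun θ => x * f θ) (fun θ => angularStep a x y w θ * f θ) (Ioo (-Real.pi) a) :=
    fun θ hθ => by simp only [angularStep, if_pos hθ.2.le]
  have e2 : EqOn (fun θ => y * f θ) (fun θ => angularStep a x y w θ * f θ) (Ioo a b) :=
    fun θ hθ => by simp only [angularStep, if_neg (not_le.2 hθ.1)]; rw [if_pos hθ.2]
  have e3 : EqOn (fun θ => w * f θ) (fun θ => angularStep a x y w θ * f θ) (Ioo b 0) :=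
    fun θ hθ => by
      simp only [angularStep, if_neg (not_le.2 (hab.trans_lt hθ.1))]
      rw [if_neg (not_lt.2 hθ.1.le)]
  have hi : ∀ p q : ℝ, IntervalIntegrable (fun θ => angularStep a x y w θ * f θ) volume p q := by
    intro p q
    refine intervalIntegrable_iff.2 ((intervalIntegrable_iff.1 (hf.intervalIntegrable p q)).bdd_mul
      (measurable_angularStep a x y w).aestronglyMeasurable (c := |x| + |y| + |w|) ?_)
    exact .of_forall fun θ => abs_angularStep_le a x y w θ
  rw [← integral_Ioc_eq_integral_Ioo, ← intervalIntegral.integral_of_le (by linarith),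
    ← intervalIntegral.integral_add_adjacent_intervals (hi _ a) (hi a 0),
    ← intervalIntegral.integral_add_adjacent_intervals (hi a b) (hi b 0)]
  have conv : ∀ {p q : ℝ} {c : ℝ}, p ≤ q → EqOn (fun θ => c * f θ)
      (fun θ => angularStep a x y w θ * f θ) (Ioo p q) →
      ∫ θ in p..q, angularStep a x y w θ * f θ = c * ∫ θ in p..q, f θ := by
    intro p q c hpq he
    rw [← intervalIntegral.integral_const_mul, intervalIntegral.integral_of_le hpq,
      intervalIntegral.integral_of_le hpq, integral_Ioc_eq_integral_Ioo,
      integral_Ioc_eq_integral_Ioo]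
    exact (setIntegral_congr_fun measurableSet_Ioo he).symm
  rw [conv ha e1, conv hab e2, conv hb e3]
  ring

/-- Integration by parts for a radial weight that vanishes at the radius `R`. -/
theorem integral_radial_deriv {R : ℝ} (hR : 0 ≤ R) {f f' : ℝ → ℝ}
    (h : ∀ s, HasDerivAt f (f' s) s) (hc : Continuous f') (h0 : f (R ^ 2) = 0) :
    ∫ r in Ioo 0 R, r * (r ^ 3 * f' (r ^ 2)) =
      -(3 / 2) * ∫ r in Ioo 0 R, r * (r * f (r ^ 2)) := by
  have hfc : Continuous f := continuous_iff_continuousAt.2 fun s => (h s).continuousAt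
  have hd : ∀ r : ℝ, HasDerivAt (fun r => r ^ 3 * f (r ^ 2))
      (3 * (r * (r * f (r ^ 2))) + 2 * (r * (r ^ 3 * f' (r ^ 2)))) r := by
    intro r
    have h1 := (h (r ^ 2)).comp r (hasDerivAt_pow 2 r)
    refine ((hasDerivAt_pow 3 r).mul h1).congr_deriv ?_
    simp only [Function.comp_def]
    push_cast
    ring
  have hi := intervalIntegral.integral_eq_sub_of_hasDerivAt (a := 0) (b := R)
    (fun r _ => hd r) (Continuous.intervalIntegrable (by fun_prop) _ _)
  rw [h0, intervalIntegral.integral_add (Continuous.intervalIntegrable (by fun_prop) _ _)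
    (Continuous.intervalIntegrable (by fun_prop) _ _), intervalIntegral.integral_const_mul,
    intervalIntegral.integral_const_mul, intervalIntegral.integral_of_le hR,
    intervalIntegral.integral_of_le hR, integral_Ioc_eq_integral_Ioo,
    integral_Ioc_eq_integral_Ioo] at hi
  simp only [mul_zero, ne_eq, OfNat.ofNat_ne_zero, not_false_eq_true, zero_pow, zero_mul,
    sub_zero] at hi
  linarith

/-! ### Solutions supported in a sector -/

/-- The signed distance from the line through the origin in the direction `e^{ic}`. -/
def sideFun (c : ℝ) (z : ℂ) : ℝ := (z * Complex.exp (-(c : ℂ) * Complex.I)).im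

theorem sideFun_eq (c : ℝ) (z : ℂ) : sideFun c z = ‖z‖ * Real.sin (z.arg - c) := by
  have e : z * Complex.exp (-(c : ℂ) * Complex.I) =
      (‖z‖ : ℂ) * Complex.exp (((z.arg - c : ℝ) : ℂ) * Complex.I) := by
    conv_lhs => rw [← Complex.norm_mul_exp_arg_mul_I z]
    rw [mul_assoc, ← Complex.exp_add]
    congr 2
    push_cast
    ring
  rw [sideFun, e, Complex.im_ofReal_mul, Complex.exp_ofReal_mul_I_im]

theorem sideFun_pos_iff {c : ℝ} (hc : c ∈ Icc (-Real.pi) 0) {z : ℂ} (hz : z.im < 0) :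
    0 < sideFun c z ↔ c < z.arg := by
  have hz0 : 0 < ‖z‖ := norm_pos_iff.2 fun h => by simp [h] at hz
  obtain ⟨h1, h2⟩ := arg_mem_of_im_neg hz
  rw [sideFun_eq, mul_pos_iff_of_pos_left hz0]
  constructor
  · intro h
    by_contra hle
    push Not at hle
    exact not_lt.2 (Real.sin_nonpos_of_nonpos_of_neg_pi_le (by linarith) (by linarith [hc.2])) h
  · intro h
    exact Real.sin_pos_of_pos_of_lt_pi (by linarith) (by linarith [hc.1])

theorem sideFun_neg_iff {c : ℝ} (hc : c ∈ Icc (-Real.pi) 0) {z : ℂ} (hz : z.im < 0) :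
    sideFun c z < 0 ↔ z.arg < c := by
  have hz0 : 0 < ‖z‖ := norm_pos_iff.2 fun h => by simp [h] at hz
  obtain ⟨h1, h2⟩ := arg_mem_of_im_neg hz
  rw [sideFun_eq, mul_neg_iff]
  constructor
  · rintro (h | h)
    · by_contra hle
      push Not at hle
      exact not_lt.2 (Real.sin_nonneg_of_nonneg_of_le_pi (by linarith) (by linarith [hc.1])) h.2
    · exact absurd h.1 (not_lt.2 hz0.le)
  · intro h
    exact Or.inl ⟨hz0, Real.sin_neg_of_neg_of_neg_pi_lt (by linarith) (by linarith [hc.2])⟩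

theorem isLinearMap_sideFun (c : ℝ) : IsLinearMap ℝ (sideFun c) where
  map_add z w := by simp [sideFun, add_mul]
  map_smul t z := by
    rw [sideFun, sideFun, Complex.real_smul, mul_assoc, Complex.im_ofReal_mul, smul_eq_mul]

theorem continuous_sideFun (c : ℝ) : Continuous (sideFun c) := by unfold sideFun; fun_prop

theorem ae_sideFun_ne_zero (c : ℝ) : ∀ᵐ z, sideFun c z ≠ 0 := by
  have h := Measure.addHaar_submodule (volume : Measure ℂ)
    (LinearMap.ker (isLinearMap_sideFun c).mk') (by
      intro h
      have : Complex.I * Complex.exp ((c : ℂ) * Complex.I) ∈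
        LinearMap.ker (isLinearMap_sideFun c).mk' := h ▸ Submodule.mem_top
      rw [LinearMap.mem_ker, IsLinearMap.mk'_apply, sideFun, mul_assoc, ← Complex.exp_add] at this
      simp at this)
  exact measure_eq_zero_iff_ae_notMem.1 h

/-- The solution `v` is supported in the sector `(a, a + 2π/3)`, and its density has the values
`ρL`, `ρC`, `ρR` on the angles before, in, and after the sector. -/
structure IsSectorial (β a ρL ρC ρR : ℝ) (v ρ : ℂ → ℝ) : Prop where
  nonneg : 0 ≤ β
  left : -Real.pi ≤ a
  right : a + 2 * Real.pi / 3 ≤ 0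
  eq : ∀ z : ℂ, z.im ≤ 0 → v z = sectorFun β a z
  density : ∀ᵐ z : ℂ, z.im < 0 → ρ z = angularStep a ρL ρC ρR z.arg

theorem isOpen_lowerHalf : IsOpen lowerHalf := isOpen_lt Complex.continuous_im continuous_const

theorem convex_lowerHalf : Convex ℝ lowerHalf :=
  convex_halfSpace_lt (f := Complex.im) Complex.imLm.isLinear 0

/-- A blowup limit is sectorial; the density is `ρ₋` in the sector, unless the limit vanishes. -/
theorem IsConeSol.exists_isSectorial {ρp ρm C : ℝ} {v χp χm : ℂ → ℝ}
    (h : IsConeSol ρp ρm C v χp χm) : ∃ β a ρL ρC ρR : ℝ,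
      IsSectorial β a ρL ρC ρR v (limitDensity ρp ρm χp χm) ∧
      ((β = 0 ∧ ρL = ρC ∧ ρR = ρC ∧ (ρC = ρp ∨ ρC = ρm)) ∨
        (0 < β ∧ ρC = ρm ∧ (ρL = ρp ∨ ρL = ρm) ∧ (ρR = ρp ∨ ρR = ρm))) := by
  have hpi := Real.pi_pos
  have hneI : (-Complex.I) ∈ lowerHalf := by simp [lowerHalf]
  rcases eq_zero_or_eq_sectorFun h.sol h.hom with h0 | ⟨β, a, hβ, ha, hb, hv⟩
  · have hc := h.ae_const isOpen_lowerHalf convex_lowerHalf ⟨_, hneI⟩ Subset.rfl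
      fun z hz => h0 z (le_of_lt hz)
    have hsec : ∀ c, (∀ᵐ z, z ∈ lowerHalf → limitDensity ρp ρm χp χm z = c) →
        IsSectorial 0 (-Real.pi) c c c v (limitDensity ρp ρm χp χm) := fun c hc =>
      ⟨le_rfl, le_rfl, by linarith, fun z hz => by rw [h0 z hz]; simp [sectorFun], by
        filter_upwards [hc] with z hz hneg
        rw [hz hneg]; simp [angularStep]⟩
    rcases hc with hc | hc
    · exact ⟨0, _, ρp, ρp, ρp, hsec _ hc, Or.inl ⟨rfl, rfl, rfl, Or.inl rfl⟩⟩
    · exact ⟨0, _, ρm, ρm, ρm, hsec _ hc, Or.inl ⟨rfl, rfl, rfl, Or.inr rfl⟩⟩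
  have haI : a ∈ Icc (-Real.pi) 0 := ⟨ha, by linarith⟩
  have hbI : a + 2 * Real.pi / 3 ∈ Icc (-Real.pi) 0 := ⟨by linarith, hb⟩
  have hL : ∃ ρL, (ρL = ρp ∨ ρL = ρm) ∧
      ∀ᵐ z : ℂ, z.im < 0 → z.arg < a → limitDensity ρp ρm χp χm z = ρL := by
    by_cases hW : (lowerHalf ∩ {z | sideFun a z < 0}).Nonempty
    · have hc := h.ae_const (isOpen_lowerHalf.inter (isOpen_lt (continuous_sideFun a)
        continuous_const)) (convex_lowerHalf.inter (convex_halfSpace_lt (isLinearMap_sideFun a) 0))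
        hW inter_subset_left (fun z hz => by
          have hz1 : z.im < 0 := hz.1
          rw [hv z hz1.le, sectorFun, if_neg]
          have := (sideFun_neg_iff haI hz1).1 hz.2
          rintro ⟨h1, -⟩
          exact lt_asymm this h1)
      rcases hc with hc | hc
      · refine ⟨ρp, Or.inl rfl, ?_⟩
        filter_upwards [hc] with z hz h1 h2 using hz ⟨h1, (sideFun_neg_iff haI h1).2 h2⟩
      · refine ⟨ρm, Or.inr rfl, ?_⟩
        filter_upwards [hc] with z hz h1 h2 using hz ⟨h1, (sideFun_neg_iff haI h1).2 h2⟩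
    · exact ⟨ρp, Or.inl rfl, .of_forall fun z h1 h2 =>
        absurd ⟨z, h1, (sideFun_neg_iff haI h1).2 h2⟩ hW⟩
  have hR : ∃ ρR, (ρR = ρp ∨ ρR = ρm) ∧ ∀ᵐ z : ℂ, z.im < 0 → a + 2 * Real.pi / 3 < z.arg →
      limitDensity ρp ρm χp χm z = ρR := by
    by_cases hW : (lowerHalf ∩ {z | 0 < sideFun (a + 2 * Real.pi / 3) z}).Nonempty
    · have hc := h.ae_const (isOpen_lowerHalf.inter (isOpen_lt continuous_const
        (continuous_sideFun _))) (convex_lowerHalf.inter (convex_halfSpace_gt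
          (isLinearMap_sideFun _) 0)) hW inter_subset_left (fun z hz => by
          have hz1 : z.im < 0 := hz.1
          rw [hv z hz1.le, sectorFun, if_neg]
          have := (sideFun_pos_iff hbI hz1).1 hz.2
          rintro ⟨-, h1⟩
          exact lt_asymm this h1)
      rcases hc with hc | hc
      · refine ⟨ρp, Or.inl rfl, ?_⟩
        filter_upwards [hc] with z hz h1 h2 using hz ⟨h1, (sideFun_pos_iff hbI h1).2 h2⟩
      · refine ⟨ρm, Or.inr rfl, ?_⟩
        filter_upwards [hc] with z hz h1 h2 using hz ⟨h1, (sideFun_pos_iff hbI h1).2 h2⟩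
    · exact ⟨ρp, Or.inl rfl, .of_forall fun z h1 h2 =>
        absurd ⟨z, h1, (sideFun_pos_iff hbI h1).2 h2⟩ hW⟩
  obtain ⟨ρL, hρL, hL⟩ := hL
  obtain ⟨ρR, hρR, hR⟩ := hR
  refine ⟨β, a, ρL, ρm, ρR, ⟨hβ.le, ha, hb, hv, ?_⟩, Or.inr ⟨hβ, rfl, hρL, hρR⟩⟩
  filter_upwards [hL, hR, h.phases, ae_sideFun_ne_zero a, ae_sideFun_ne_zero (a + 2 * Real.pi / 3)]
    with z h1 h2 h3 h4 h5 hz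
  have hz0 : 0 < ‖z‖ := norm_pos_iff.2 fun h => by simp [h] at hz
  have hne : ∀ c, sideFun c z ≠ 0 → z.arg ≠ c := fun c hc he => hc (by
    rw [sideFun_eq, he, sub_self, Real.sin_zero, mul_zero])
  rcases lt_trichotomy z.arg a with hlt | heq | hgt
  · rw [h1 hz hlt, angularStep, if_pos hlt.le]
  · exact absurd heq (hne a h4)
  rcases lt_trichotomy z.arg (a + 2 * Real.pi / 3) with hlt' | heq | hgt'
  · rw [angularStep, if_neg (not_le.2 hgt), if_pos hlt']
    have hneg : v z < 0 := by
      rw [hv z hz.le, sectorFun, if_pos ⟨hgt, hlt'⟩]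
      have : 0 < Real.sin (3 / 2 * (z.arg - a)) :=
        Real.sin_pos_of_pos_of_lt_pi (by linarith) (by linarith)
      have h6 : 0 < ‖z‖ ^ (3 / 2 : ℝ) := Real.rpow_pos_of_pos hz0 _
      have : 0 < β * ‖z‖ ^ (3 / 2 : ℝ) * Real.sin (3 / 2 * (z.arg - a)) := by positivity
      linarith
    have hm := (h3 hz).2 hneg
    rcases (h3 hz).1 with ⟨-, hm'⟩ | ⟨hp, -⟩
    · rw [hm] at hm'; norm_num at hm'
    · simp [limitDensity, hm, hp]
  · exact absurd heq (hne _ h5)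
  · rw [h2 hz hgt', angularStep, if_neg (not_le.2 hgt), if_neg (not_lt.2 hgt'.le)]

/-- The gradient in the sector: it has norm `(3/2) β |z|^{1/2}`, and its radial and angular
components are those of the sine profile. -/
theorem sectorFun_gradient {β a : ℝ} {v : ℂ → ℝ} (hβ : 0 ≤ β)
    (hv : ∀ z : ℂ, z.im ≤ 0 → v z = sectorFun β a z) {z : ℂ} (hz : z.im < 0) (h1 : a < z.arg)
    (h2 : z.arg < a + 2 * Real.pi / 3) :
    ‖negGrad v z‖ ^ 2 = 9 / 4 * β ^ 2 * ‖z‖ ∧ inner ℝ (negGrad v z) z = 3 / 2 * v z ∧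
      inner ℝ (negGrad v z) (Complex.I * z) =
        -(3 / 2) * β * ‖z‖ ^ (3 / 2 : ℝ) * Real.cos (3 / 2 * (z.arg - a)) := by
  have hz0 : 0 < ‖z‖ := norm_pos_iff.2 fun h => by simp [h] at hz
  have hzne : z ≠ 0 := norm_pos_iff.1 hz0
  have hval : v z = -β * ‖z‖ ^ (3 / 2 : ℝ) * Real.sin (3 / 2 * (z.arg - a)) := by
    rw [hv z hz.le, sectorFun, if_pos ⟨h1, h2⟩]
  rcases hβ.eq_or_lt with h0 | hβ
  · have hv0 : v z = 0 := by rw [hval, ← h0]; simp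
    rw [negGrad_of_nonneg hv0.ge, hv0, ← h0]
    simp
  have hneg : v z < 0 := by
    have : 0 < Real.sin (3 / 2 * (z.arg - a)) :=
      Real.sin_pos_of_pos_of_lt_pi (by linarith) (by linarith)
    have h6 : 0 < ‖z‖ ^ (3 / 2 : ℝ) := Real.rpow_pos_of_pos hz0 _
    have : 0 < β * ‖z‖ ^ (3 / 2 : ℝ) * Real.sin (3 / 2 * (z.arg - a)) := by positivity
    linarith
  set c : ℂ := β * Complex.I * Complex.exp (((-(3 / 2 * a) : ℝ) : ℂ) * Complex.I) with hc
  set F : ℂ → ℂ := fun z => c * Complex.exp (3 / 2 * Complex.log z) with hF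
  -- in polar coordinates, `F = i β r^{3/2} e^{(3/2) i (θ - a)}`
  have hFpolar : ∀ y : ℂ, y ≠ 0 → F y = ((β * ‖y‖ ^ (3 / 2 : ℝ) : ℝ) : ℂ) *
      (Complex.I * Complex.exp (((3 / 2 * (y.arg - a) : ℝ) : ℂ) * Complex.I)) := by
    intro y hy
    have hy0 : 0 < ‖y‖ := norm_pos_iff.2 hy
    have e1 : Complex.exp (3 / 2 * Complex.log y) = ((‖y‖ ^ (3 / 2 : ℝ) : ℝ) : ℂ) *
        Complex.exp (((3 / 2 * y.arg : ℝ) : ℂ) * Complex.I) := by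
      rw [Real.rpow_def_of_pos hy0, Complex.ofReal_exp, ← Complex.exp_add, Complex.log]
      congr 1; push_cast; ring
    have e2 : Complex.exp (((3 / 2 * (y.arg - a) : ℝ) : ℂ) * Complex.I) =
        Complex.exp (((-(3 / 2 * a) : ℝ) : ℂ) * Complex.I) *
          Complex.exp (((3 / 2 * y.arg : ℝ) : ℂ) * Complex.I) := by
      rw [← Complex.exp_add]; congr 1; push_cast; ring
    simp only [hF, hc]
    rw [e1, e2]; push_cast; ring
  have hFre : ∀ y : ℂ, y ≠ 0 → (F y).re =
      -β * ‖y‖ ^ (3 / 2 : ℝ) * Real.sin (3 / 2 * (y.arg - a)) := by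
    intro y hy
    rw [hFpolar y hy, Complex.re_ofReal_mul, Complex.I_mul_re, Complex.exp_ofReal_mul_I_im]; ring
  have hFim : (F z).im = β * ‖z‖ ^ (3 / 2 : ℝ) * Real.cos (3 / 2 * (z.arg - a)) := by
    rw [hFpolar z hzne, Complex.im_ofReal_mul, Complex.I_mul_im, Complex.exp_ofReal_mul_I_re]
  have hFnorm : ‖F z‖ = β * ‖z‖ ^ (3 / 2 : ℝ) := by
    rw [hFpolar z hzne, norm_mul, norm_mul, Complex.norm_I, Complex.norm_exp_ofReal_mul_I,
      Complex.norm_real, Real.norm_of_nonneg (by positivity)]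
    ring
  have hslit : z ∈ Complex.slitPlane := Or.inr hz.ne
  have hFd : HasDerivAt F (3 / 2 * F z / z) z := by
    have h3 := (((Complex.hasDerivAt_log hslit).const_mul (3 / 2)).cexp).const_mul c
    refine h3.congr_deriv ?_
    simp only [hF]
    field_simp
  have hev : v =ᶠ[𝓝 z] fun y => (F y).re := by
    have hargc : ContinuousAt Complex.arg z := Complex.continuousAt_arg hslit
    filter_upwards [isOpen_lowerHalf.mem_nhds hz, hargc.eventually (lt_mem_nhds h1),
      hargc.eventually (gt_mem_nhds h2)] with y hy h4 h5
    have hy : y.im < 0 := hy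
    rw [hv y hy.le, sectorFun, if_pos ⟨h4, h5⟩, hFre y fun h => by simp [h] at hy]
  have hgrad : negGrad v z = conj (3 / 2 * F z / z) := by
    rw [negGrad_of_neg hz hneg, hev.gradient_eq, (hasGradientAt_re hFd).gradient]
  have h32 : (3 / 2 : ℂ) = ((3 / 2 : ℝ) : ℂ) := by norm_num
  refine ⟨?_, ?_, ?_⟩
  · rw [hgrad, RCLike.norm_conj, norm_div, norm_mul, hFnorm, rpow_three_halves hz0, h32,
      Complex.norm_real, Real.norm_of_nonneg (by norm_num)]
    rw [div_pow, mul_pow, mul_pow, mul_pow, Real.sq_sqrt hz0.le]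
    field_simp
    norm_num
  · rw [hgrad, inner_eq_re, Complex.conj_conj, div_mul_cancel₀ _ hzne, h32, Complex.re_ofReal_mul,
      hFre z hzne, hval]
  · rw [hgrad, inner_eq_re, Complex.conj_conj]
    have e : 3 / 2 * F z / z * (Complex.I * z) = ((3 / 2 : ℝ) : ℂ) * (Complex.I * F z) := by
      rw [← h32]; field_simp
    rw [e, Complex.re_ofReal_mul, Complex.I_mul_re, hFim]
    ring

/-! ### The jump conditions on the sides of the sector -/

theorem isBddMeas_polar {R : ℝ} (a x y w : ℝ) {A f : ℝ → ℝ} (hA : Continuous A)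
    (hf : Continuous f) :
    IsBddMeas R fun z : ℂ => A ‖z‖ * (angularStep a x y w z.arg * f z.arg) := by
  obtain ⟨B, hB⟩ := (isCompact_Icc (a := -Real.pi) (b := Real.pi)).exists_bound_of_continuousOn
    hf.continuousOn
  have h1 : IsBddMeas R fun z : ℂ => A ‖z‖ := .of_continuous (by fun_prop)
  have h2 : IsBddMeas R fun z : ℂ => angularStep a x y w z.arg :=
    .of_measurable ((measurable_angularStep a x y w).comp Complex.measurable_arg)
      fun z => abs_angularStep_le a x y w z.arg
  have h3 : IsBddMeas R fun z : ℂ => f z.arg :=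
    .of_measurable (b := B) (hf.measurable.comp Complex.measurable_arg)
      fun z => hB _ ⟨(Complex.neg_pi_lt_arg z).le, Complex.arg_le_pi z⟩
  exact h1.mul (h2.mul h3)

theorem integral_polar_angularStep {R a : ℝ} (ha : -Real.pi ≤ a) (hb : a + 2 * Real.pi / 3 ≤ 0)
    (x y w : ℝ) (A : ℝ → ℝ) {f : ℝ → ℝ} (hf : Continuous f) :
    ∫ z in halfBall R, A ‖z‖ * (angularStep a x y w z.arg * f z.arg) =
      (∫ r in Ioo 0 R, r * A r) *
      (x * (∫ θ in (-Real.pi)..a, f θ) + y * (∫ θ in a..(a + 2 * Real.pi / 3), f θ)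
        + w * ∫ θ in (a + 2 * Real.pi / 3)..0, f θ) := by
  rw [integral_halfBall_polar R A fun θ => angularStep a x y w θ * f θ,
    integral_angularStep_mul ha hb x y w hf]

/-- The function `κ(|z|²) ξ(arg z)`. -/
def angularCutoff (κ ξ : ℝ → ℝ) (z : ℂ) : ℝ := κ (‖z‖ ^ 2) * ξ z.arg

section

variable {κ ξ : ℝ → ℝ}

theorem hasFDerivAt_arg {z : ℂ} (hz : z ∈ Complex.slitPlane) :
    HasFDerivAt Complex.arg (Complex.imCLM.comp
      ((ContinuousLinearMap.toSpanSingleton ℂ z⁻¹).restrictScalars ℝ)) z := by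
  have h1 := (Complex.hasStrictDerivAt_log hz).hasDerivAt.hasFDerivAt.restrictScalars ℝ
  have h2 := Complex.imCLM.hasFDerivAt.comp z h1
  refine h2.congr_of_eventuallyEq (.of_forall fun y => ?_)
  simp [Complex.log_im]

theorem contDiffAt_arg {z : ℂ} (hz : z ∈ Complex.slitPlane) {n : WithTop ℕ∞} :
    ContDiffAt ℝ n Complex.arg z := by
  have h1 : ContDiffAt ℝ n Complex.log z := (Complex.contDiffAt_log hz).restrict_scalars ℝ
  have h2 := Complex.imCLM.contDiff.contDiffAt.comp z h1
  refine h2.congr_of_eventuallyEq (.of_forall fun y => ?_)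
  simp [Complex.log_im]

theorem fderiv_angularCutoff (hκ : ContDiff ℝ 1 κ) (hξ : ContDiff ℝ 1 ξ) {z : ℂ} (hz : z.im < 0)
    (p : ℂ) : DifferentiableAt ℝ (angularCutoff κ ξ) z ∧ fderiv ℝ (angularCutoff κ ξ) z p =
      2 * deriv κ (‖z‖ ^ 2) * inner ℝ p z * ξ z.arg +
        κ (‖z‖ ^ 2) * deriv ξ z.arg * (inner ℝ p (Complex.I * z) / ‖z‖ ^ 2) := by
  have hs : z ∈ Complex.slitPlane := Or.inr hz.ne
  have d1 : HasFDerivAt (fun z : ℂ => κ (‖z‖ ^ 2)) (deriv κ (‖z‖ ^ 2) • (2 • (innerSL ℝ z))) z :=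
    ((hκ.differentiable one_ne_zero _).hasDerivAt).comp_hasFDerivAt z
      (hasStrictFDerivAt_norm_sq z).hasFDerivAt
  have d2 := ((hξ.differentiable one_ne_zero z.arg).hasDerivAt).comp_hasFDerivAt z
    (hasFDerivAt_arg hs)
  have d := d1.mul d2
  refine ⟨d.differentiableAt, ?_⟩
  have hz0 : ‖z‖ ^ 2 ≠ 0 := by
    have : z ≠ 0 := fun h => by simp [h] at hz
    positivity
  have him : (p * z⁻¹).im = inner ℝ p (Complex.I * z) / ‖z‖ ^ 2 := by
    rw [inner_eq_re, Complex.inv_def, ← mul_assoc, Complex.normSq_eq_norm_sq, Complex.im_mul_ofReal,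
      div_eq_mul_inv]
    congr 1
    simp
  have e : fderiv ℝ (angularCutoff κ ξ) z = _ := d.fderiv
  rw [e]
  simp only [_root_.add_apply, _root_.smul_apply, ContinuousLinearMap.comp_apply,
    ContinuousLinearMap.coe_restrictScalars', ContinuousLinearMap.toSpanSingleton_apply,
    Complex.imCLM_apply, smul_eq_mul, him, innerSL_apply_apply, real_inner_comm p z,
    Function.comp_apply, nsmul_eq_mul]
  push_cast
  ring

/-- The cutoff vanishes near the line `{y = 0}`. -/
theorem exists_tsupport_angularCutoff (hξc : HasCompactSupport ξ)
    (hξs : tsupport ξ ⊆ Ioo (-Real.pi) 0) (h1 : ∀ s, κ s ≠ 0 → 1 ≤ s ∧ s ≤ 3) :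
    ∀ z ∈ tsupport (angularCutoff κ ξ), z.im < 0 ∧ ‖z‖ < 2 := by
  obtain ⟨m, hm, hle⟩ : ∃ m > 0, ∀ θ ∈ tsupport ξ, Real.sin θ ≤ -m := by
    rcases (tsupport ξ).eq_empty_or_nonempty with he | hne
    · exact ⟨1, one_pos, by simp [he]⟩
    · obtain ⟨θ, hθ, hmax⟩ := hξc.isCompact.exists_isMaxOn hne Real.continuous_sin.continuousOn
      refine ⟨-Real.sin θ, ?_, fun y hy => by simpa using hmax hy⟩
      have := Real.sin_neg_of_neg_of_neg_pi_lt (hξs hθ).2 (hξs hθ).1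
      linarith
  have hsub : Function.support (angularCutoff κ ξ) ⊆ {z : ℂ | z.im ≤ -m} ∩ {z | ‖z‖ ^ 2 ≤ 3} := by
    intro z hz
    have hz' := mul_ne_zero_iff.1 hz
    obtain ⟨h3, h4⟩ := h1 _ hz'.1
    have h5 := hle _ (subset_tsupport ξ hz'.2)
    refine ⟨?_, h4⟩
    have h6 : z.im = ‖z‖ * Real.sin z.arg := (Complex.norm_mul_sin_arg z).symm
    have h7 : 1 ≤ ‖z‖ := by nlinarith [norm_nonneg z]
    change z.im ≤ -m
    rw [h6]
    nlinarith
  have hcl : IsClosed ({z : ℂ | z.im ≤ -m} ∩ {z | ‖z‖ ^ 2 ≤ 3}) :=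
    (isClosed_le Complex.continuous_im continuous_const).inter
      (isClosed_le (by fun_prop) continuous_const)
  intro z hz
  obtain ⟨h3, h4⟩ := closure_minimal hsub hcl hz
  have h3 : z.im ≤ -m := h3
  have h4 : ‖z‖ ^ 2 ≤ 3 := h4
  exact ⟨by linarith, by nlinarith [norm_nonneg z]⟩

/-- The field `κ(|z|²) ξ(arg z) i z` is of class `C¹` with support in the open half-disc. -/
theorem contDiff_angularCutoff_smul (hκ : ContDiff ℝ 1 κ) (hξ : ContDiff ℝ 1 ξ)
    (hξc : HasCompactSupport ξ) (hξs : tsupport ξ ⊆ Ioo (-Real.pi) 0)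
    (h1 : ∀ s, κ s ≠ 0 → 1 ≤ s ∧ s ≤ 3) :
    ContDiff ℝ 1 (fun z => angularCutoff κ ξ z • (Complex.I * z)) := by
  have hA : ContDiff ℝ 1 (angularCutoff κ ξ) := by
    refine contDiff_of_tsupport fun z hz => ?_
    have hs : z ∈ Complex.slitPlane := Or.inr
      (exists_tsupport_angularCutoff hξc hξs h1 z hz).1.ne
    exact (hκ.comp (contDiff_norm_sq ℝ)).contDiffAt.mul
      (hξ.contDiffAt.comp z (contDiffAt_arg hs))
  exact hA.smul (contDiff_const.mul contDiff_id)

end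

variable {β a ρL ρC ρR C : ℝ} {v ρ : ℂ → ℝ} {κ ξ : ℝ → ℝ}

/-- The integrand of the domain variation along `κ(|z|²) ξ(arg z) i z`, in polar coordinates. -/
theorem IsSectorial.integrand (h : IsSectorial β a ρL ρC ρR v ρ)
    (hκ : ContDiff ℝ 1 κ) (hξ : ContDiff ℝ 1 ξ) {z : ℂ} (hz : z.im < 0)
    (hρ : ρ z = angularStep a ρL ρC ρR z.arg) :
    ‖negGrad v z‖ ^ 2 * divergence (fun z => angularCutoff κ ξ z • (Complex.I * z)) z
      - 2 * inner ℝ (negGrad v z)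
        (fderiv ℝ (fun z => angularCutoff κ ξ z • (Complex.I * z)) z (negGrad v z))
      - ρ z * divergence (fun y => y.im • (angularCutoff κ ξ y • (Complex.I * y))) z =
    ‖z‖ * κ (‖z‖ ^ 2) * (angularStep a 0 (-(9 / 4) * β ^ 2) 0 z.arg *
        (deriv ξ z.arg * Real.cos (3 * (z.arg - a))))
      + 2 * (‖z‖ ^ 3 * deriv κ (‖z‖ ^ 2)) * (angularStep a 0 (-(9 / 4) * β ^ 2) 0 z.arg *
        (ξ z.arg * Real.sin (3 * (z.arg - a))))
      - ‖z‖ * κ (‖z‖ ^ 2) * (angularStep a ρL ρC ρR z.arg *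
        (ξ z.arg * Real.cos z.arg + deriv ξ z.arg * Real.sin z.arg)) := by
  have hzne : z ≠ 0 := fun h => by simp [h] at hz
  have hz0 : 0 < ‖z‖ := norm_pos_iff.2 hzne
  have hX : HasFDerivAt (fun z : ℂ => Complex.I * z)
      (ContinuousLinearMap.mul ℝ ℂ Complex.I) z :=
    (ContinuousLinearMap.mul ℝ ℂ Complex.I).hasFDerivAt
  have hdivX : divergence (fun z : ℂ => Complex.I * z) z = 0 := by
    unfold divergence
    rw [hX.fderiv]
    simp
  obtain ⟨hAd, -⟩ := fderiv_angularCutoff hκ hξ hz 0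
  have hfd := fun p => (fderiv_angularCutoff hκ hξ hz p).2
  have hφ := hAd.hasFDerivAt.smul hX
  have hφ' : fderiv ℝ (fun z => angularCutoff κ ξ z • (Complex.I * z)) z = _ := hφ.fderiv
  have hφd : DifferentiableAt ℝ (fun z => angularCutoff κ ξ z • (Complex.I * z)) z :=
    hφ.differentiableAt
  have hself : inner ℝ (Complex.I * z) z = 0 := by
    rw [inner_eq_re]; simp; ring
  have hself' : inner ℝ (Complex.I * z) (Complex.I * z) = ‖z‖ ^ 2 := by
    rw [real_inner_self_eq_norm_sq, norm_mul, Complex.norm_I, one_mul]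
  have hdiv : divergence (fun z => angularCutoff κ ξ z • (Complex.I * z)) z =
      κ (‖z‖ ^ 2) * deriv ξ z.arg := by
    rw [divergence_smul hAd hX.differentiableAt, hdivX, hfd, hself, hself']
    field_simp
    ring
  have hpI : ∀ p : ℂ, inner ℝ p (Complex.I * p) = 0 := by
    intro p
    rw [inner_eq_re]; simp; ring
  have hDp : ∀ p, inner ℝ p (fderiv ℝ (fun z => angularCutoff κ ξ z • (Complex.I * z)) z p) =
      (2 * deriv κ (‖z‖ ^ 2) * inner ℝ p z * ξ z.arg +
        κ (‖z‖ ^ 2) * deriv ξ z.arg * (inner ℝ p (Complex.I * z) / ‖z‖ ^ 2)) *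
        inner ℝ p (Complex.I * z) := by
    intro p
    rw [hφ']
    simp only [_root_.add_apply, _root_.smul_apply, ContinuousLinearMap.smulRight_apply,
      ContinuousLinearMap.mul_apply', inner_add_right, real_inner_smul_right, hpI, hfd]
    ring
  have hdivρ : divergence (fun y => y.im • (angularCutoff κ ξ y • (Complex.I * y))) z =
      ‖z‖ * κ (‖z‖ ^ 2) * (ξ z.arg * Real.cos z.arg + deriv ξ z.arg * Real.sin z.arg) := by
    rw [divergence_im_smul hφd, hdiv, ← Complex.norm_mul_sin_arg z]
    have e : (angularCutoff κ ξ z • (Complex.I * z)).im =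
        κ (‖z‖ ^ 2) * ξ z.arg * (‖z‖ * Real.cos z.arg) := by
      rw [Complex.norm_mul_cos_arg]; simp [angularCutoff]
    rw [e]
    ring
  rw [hdiv, hDp, hdivρ, hρ]
  by_cases hin : a < z.arg ∧ z.arg < a + 2 * Real.pi / 3
  · obtain ⟨e1, e2, e3⟩ := sectorFun_gradient h.nonneg h.eq hz hin.1 hin.2
    have e4 : v z = -β * ‖z‖ ^ (3 / 2 : ℝ) * Real.sin (3 / 2 * (z.arg - a)) := by
      rw [h.eq z hz.le, sectorFun, if_pos hin]
    have e5 : angularStep a 0 (-(9 / 4) * β ^ 2) 0 z.arg = -(9 / 4) * β ^ 2 := by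
      rw [angularStep, if_neg (not_le.2 hin.1), if_pos hin.2]
    have e6 : (‖z‖ ^ (3 / 2 : ℝ)) ^ 2 = ‖z‖ ^ 3 := by
      rw [← Real.rpow_natCast, ← Real.rpow_mul hz0.le]; norm_num
    set ψ := 3 / 2 * (z.arg - a) with hψ
    rw [show 3 * (z.arg - a) = 2 * ψ by rw [hψ]; ring, Real.cos_two_mul, Real.sin_two_mul, e1, e2, e3,
      e4, e5]
    set N := ‖z‖ ^ (3 / 2 : ℝ)
    have e7 : N ^ 2 / ‖z‖ ^ 2 = ‖z‖ := by rw [e6]; field_simp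
    have e8 : κ (‖z‖ ^ 2) * deriv ξ z.arg * (-(3 / 2) * β * N * Real.cos ψ / ‖z‖ ^ 2) *
        (-(3 / 2) * β * N * Real.cos ψ) = 9 / 4 * β ^ 2 * κ (‖z‖ ^ 2) * deriv ξ z.arg *
        Real.cos ψ ^ 2 * ‖z‖ := by
      linear_combination (9 / 4 * β ^ 2 * κ (‖z‖ ^ 2) * deriv ξ z.arg * Real.cos ψ ^ 2) * e7
    linear_combination (-2) * e8 +
      (-9 * deriv κ (‖z‖ ^ 2) * ξ z.arg * β ^ 2 * Real.sin ψ * Real.cos ψ) * e6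
  · have hv0 : v z = 0 := by rw [h.eq z hz.le, sectorFun, if_neg hin]
    have e5 : angularStep a 0 (-(9 / 4) * β ^ 2) 0 z.arg = 0 := by
      unfold angularStep
      split_ifs with h1 h2
      · rfl
      · exact absurd ⟨not_le.1 h1, h2⟩ hin
      · rfl
    rw [negGrad_of_nonneg hv0.ge, e5]
    simp
    ring

/-- The jump conditions, tested with a function of the angle: on the sides of the sector the
squared gradient `(9/4) β² |z|` equals the jump of the density times `y`. -/
theorem IsSectorial.jump (h : IsSectorial β a ρL ρC ρR v ρ) (hc : ∀ R, IsCritical R v ρ)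
    (hξ : ContDiff ℝ 1 ξ) (hξc : HasCompactSupport ξ) (hξs : tsupport ξ ⊆ Ioo (-Real.pi) 0) :
    -(9 / 4) * β ^ 2 * (ξ (a + 2 * Real.pi / 3) - ξ a) =
      (ρL - ρC) * (Real.sin a * ξ a) +
        (ρC - ρR) * (Real.sin (a + 2 * Real.pi / 3) * ξ (a + 2 * Real.pi / 3)) := by
  have hpi := Real.pi_pos
  let κb : ContDiffBump (2 : ℝ) := ⟨1 / 2, 1, by norm_num, by norm_num⟩
  set κ : ℝ → ℝ := fun s => κb s with hκdef
  have hκ : ContDiff ℝ 1 κ := κb.contDiff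
  have h1 : ∀ s, κ s ≠ 0 → 1 ≤ s ∧ s ≤ 3 := by
    intro s hs
    have : s ∈ Function.support κb := hs
    rw [κb.support_eq, Metric.mem_ball, Real.dist_eq, abs_lt] at this
    change -1 < s - 2 ∧ s - 2 < 1 at this
    constructor <;> linarith [this.1, this.2]
  have hκc : Continuous κ := hκ.continuous
  have hκ'c : Continuous (deriv κ) := hκ.continuous_deriv le_rfl
  have hξcont : Continuous ξ := hξ.continuous
  have hξ'c : Continuous (deriv ξ) := hξ.continuous_deriv le_rfl
  set b := a + 2 * Real.pi / 3 with hb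
  set φ : ℂ → ℂ := fun z => angularCutoff κ ξ z • (Complex.I * z) with hφ
  have hsupp := exists_tsupport_angularCutoff hξc hξs h1
  have hφs : tsupport φ ⊆ tsupport (angularCutoff κ ξ) :=
    closure_mono fun z hz hz' => hz (by simp only [hφ, hz', zero_smul])
  have hcrit := hc 2 φ (contDiff_angularCutoff_smul hκ hξ hξc hξs h1)
    (fun z hz => mem_ball_zero_iff.2 (hsupp z (hφs hz)).2) (fun z hz => by
      have : z ∉ tsupport φ := fun h' => (hsupp z (hφs h')).1.ne hz
      rw [image_eq_zero_of_notMem_tsupport this, Complex.zero_im])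
  set f1 : ℝ → ℝ := fun θ => deriv ξ θ * Real.cos (3 * (θ - a)) with hf1
  set f2 : ℝ → ℝ := fun θ => ξ θ * Real.sin (3 * (θ - a)) with hf2
  set f3 : ℝ → ℝ := fun θ => ξ θ * Real.cos θ + deriv ξ θ * Real.sin θ with hf3
  have hf1c : Continuous f1 := by fun_prop
  have hf2c : Continuous f2 := by fun_prop
  have hf3c : Continuous f3 := by fun_prop
  set A : ℝ → ℝ := fun r => r * κ (r ^ 2) with hA
  set A' : ℝ → ℝ := fun r => 2 * (r ^ 3 * deriv κ (r ^ 2)) with hA'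
  have hAc : Continuous A := by fun_prop
  have hA'c : Continuous A' := by fun_prop
  have hEq : ∀ᵐ z ∂(volume.restrict (halfBall 2)),
      ‖negGrad v z‖ ^ 2 * divergence φ z - 2 * inner ℝ (negGrad v z) (fderiv ℝ φ z (negGrad v z))
        - ρ z * divergence (fun y => y.im • φ y) z =
      (A ‖z‖ * (angularStep a 0 (-(9 / 4) * β ^ 2) 0 z.arg * f1 z.arg) +
        A' ‖z‖ * (angularStep a 0 (-(9 / 4) * β ^ 2) 0 z.arg * f2 z.arg)) -
        A ‖z‖ * (angularStep a ρL ρC ρR z.arg * f3 z.arg) := by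
    rw [ae_restrict_iff' (isOpen_halfBall 2).measurableSet]
    filter_upwards [h.density] with z h3 h4 using h.integrand hκ hξ h4.2 (h3 h4.2)
  rw [integral_congr_ae hEq, integral_sub, integral_add,
    integral_polar_angularStep h.left h.right _ _ _ _ hf1c,
    integral_polar_angularStep h.left h.right _ _ _ _ hf2c,
    integral_polar_angularStep h.left h.right _ _ _ _ hf3c] at hcrit
  rotate_left
  · exact (isBddMeas_polar _ _ _ _ hAc hf1c).integrableOn
  · exact (isBddMeas_polar _ _ _ _ hA'c hf2c).integrableOn
  · exact ((isBddMeas_polar _ _ _ _ hAc hf1c).add (isBddMeas_polar _ _ _ _ hA'c hf2c)).integrableOn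
  · exact (isBddMeas_polar _ _ _ _ hAc hf3c).integrableOn
  set K := ∫ r in Ioo 0 2, r * A r with hK
  -- the radial integral of the term with `κ'` is a multiple of that of `κ`
  have hK' : ∫ r in Ioo 0 2, r * A' r = -3 * K := by
    have := integral_radial_deriv (R := 2) (by norm_num)
      (fun s => (hκ.differentiable one_ne_zero s).hasDerivAt) hκ'c (by
        by_contra hne
        have := (h1 _ hne).2
        norm_num at this)
    have e : ∀ r, r * A' r = 2 * (r * (r ^ 3 * deriv κ (r ^ 2))) := fun r => by
      simp only [hA']; ring
    simp_rw [e]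
    rw [integral_const_mul, this, hK]
    ring
  have hKpos : 0 < K := by
    have hKc : Continuous fun r => r * A r := by fun_prop
    rw [hK, ← integral_Ioc_eq_integral_Ioo, ← intervalIntegral.integral_of_le (by norm_num)]
    refine intervalIntegral.integral_pos (by norm_num) hKc.continuousOn (fun r hr => ?_)
      ⟨√2, ⟨by positivity, Real.sqrt_le_iff.2 ⟨by norm_num, by norm_num⟩⟩, ?_⟩
    · exact mul_nonneg hr.1.le (mul_nonneg hr.1.le κb.nonneg)
    · have : κ ((√2) ^ 2) = 1 := by
        rw [Real.sq_sqrt (by norm_num)]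
        exact κb.one_of_mem_closedBall (by simp [κb])
      simp only [hA]
      rw [this]
      positivity
  -- integration by parts in the angle
  have hd1 : ∫ θ in a..b, f1 θ = ξ b - ξ a + 3 * ∫ θ in a..b, f2 θ := by
    have := intervalIntegral.integral_eq_sub_of_hasDerivAt (a := a) (b := b)
      (f := fun θ => ξ θ * Real.cos (3 * (θ - a))) (f' := fun θ => f1 θ - 3 * f2 θ)
      (fun θ _ => by
        have h3 := ((hξ.differentiable one_ne_zero θ).hasDerivAt).mul
          ((((hasDerivAt_id θ).sub_const a).const_mul 3).cos)
        refine h3.congr_deriv ?_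
        simp [hf1, hf2]
        ring) (Continuous.intervalIntegrable (by fun_prop) _ _)
    rw [intervalIntegral.integral_sub (hf1c.intervalIntegrable _ _)
      ((hf2c.intervalIntegrable _ _).const_mul 3), intervalIntegral.integral_const_mul] at this
    have e : Real.cos (3 * (b - a)) = 1 := by
      rw [hb, show 3 * (a + 2 * Real.pi / 3 - a) = 2 * Real.pi by ring, Real.cos_two_pi]
    rw [e] at this
    simp only [sub_self, mul_zero, Real.cos_zero, mul_one] at this
    linarith
  have hd3 : ∀ p q : ℝ, ∫ θ in p..q, f3 θ = ξ q * Real.sin q - ξ p * Real.sin p := by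
    intro p q
    refine intervalIntegral.integral_eq_sub_of_hasDerivAt (f := fun θ => ξ θ * Real.sin θ)
      (fun θ _ => ?_) (hf3c.intervalIntegrable _ _)
    refine (((hξ.differentiable one_ne_zero θ).hasDerivAt).mul
      (Real.hasDerivAt_sin θ)).congr_deriv ?_
    simp only [hf3]; ring
  rw [hK', hd1, hd3, hd3, hd3, Real.sin_neg, Real.sin_pi, Real.sin_zero] at hcrit
  have hcrit' : K * (-(9 / 4) * β ^ 2 * (ξ b - ξ a) - ((ρL - ρC) * (Real.sin a * ξ a) +
      (ρC - ρR) * (Real.sin b * ξ b))) = 0 := by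
    linear_combination hcrit
  rcases mul_eq_zero.1 hcrit' with h3 | h3
  · exact absurd h3 hKpos.ne'
  · linarith

/-- A bump function of the angle that is one at `c` and vanishes at `c'` and outside `(-π, 0)`. -/
theorem exists_angular_bump {c c' : ℝ} (hc : c ∈ Ioo (-Real.pi) 0) (hcc : c ≠ c') :
    ∃ ξ : ℝ → ℝ, ContDiff ℝ 1 ξ ∧ HasCompactSupport ξ ∧ tsupport ξ ⊆ Ioo (-Real.pi) 0 ∧
      ξ c = 1 ∧ ξ c' = 0 := by
  obtain ⟨e, he, hball⟩ := Metric.isOpen_iff.1 (isOpen_Ioo.inter (isOpen_compl_singleton (x := c')))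
    c ⟨hc, hcc⟩
  let B : ContDiffBump c := ⟨e / 4, e / 2, by linarith, by linarith⟩
  have hsub : tsupport B ⊆ Metric.ball c e := by
    rw [B.tsupport_eq]
    exact Metric.closedBall_subset_ball (by change e / 2 < e; linarith)
  refine ⟨B, B.contDiff, B.hasCompactSupport, fun x hx => (hball (hsub hx)).1,
    B.one_of_mem_closedBall (Metric.mem_closedBall_self B.rIn_pos.le), ?_⟩
  exact image_eq_zero_of_notMem_tsupport fun h => (hball (hsub h)).2 rfl

theorem IsSectorial.jump_right (h : IsSectorial β a ρL ρC ρR v ρ) (hc : ∀ R, IsCritical R v ρ)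
    (hb : a + 2 * Real.pi / 3 < 0) :
    9 / 4 * β ^ 2 = (ρR - ρC) * Real.sin (a + 2 * Real.pi / 3) := by
  have hpi := Real.pi_pos
  obtain ⟨ξ, h1, h2, h3, h4, h5⟩ := exists_angular_bump (c := a + 2 * Real.pi / 3) (c' := a)
    ⟨by linarith [h.left], hb⟩ (by linarith)
  have := h.jump hc h1 h2 h3
  rw [h4, h5] at this
  linarith

theorem IsSectorial.jump_left (h : IsSectorial β a ρL ρC ρR v ρ) (hc : ∀ R, IsCritical R v ρ)
    (ha : -Real.pi < a) : 9 / 4 * β ^ 2 = (ρL - ρC) * Real.sin a := by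
  have hpi := Real.pi_pos
  obtain ⟨ξ, h1, h2, h3, h4, h5⟩ := exists_angular_bump (c := a) (c' := a + 2 * Real.pi / 3)
    ⟨ha, by linarith [h.right]⟩ (by linarith)
  have := h.jump hc h1 h2 h3
  rw [h4, h5] at this
  linarith

/-! ### Classification of blowup limits -/

theorem stokesCorner_polar {r ψ : ℝ} (hr : 0 < r) (h1 : -(7 * Real.pi / 6) ≤ ψ)
    (h2 : ψ ≤ 7 * Real.pi / 6) :
    stokesCorner (r * Complex.exp (ψ * Complex.I)) =
      if -(5 * Real.pi / 6) < ψ ∧ ψ < -(Real.pi / 6) then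
        -(Real.sqrt 2 / 3) * r ^ (3 / 2 : ℝ) * Real.cos (3 / 2 * (ψ + Real.pi / 2)) else 0 := by
  have hpi := Real.pi_pos
  have hnorm : ∀ t : ℝ, ‖(r : ℂ) * Complex.exp (t * Complex.I)‖ = r := fun t => by
    rw [norm_mul, Complex.norm_exp_ofReal_mul_I, mul_one, Complex.norm_real,
      Real.norm_of_nonneg hr.le]
  have harg : ∀ t ∈ Ioc (-Real.pi) Real.pi, ((r : ℂ) * Complex.exp (t * Complex.I)).arg = t := by
    intro t ht
    rw [Complex.exp_mul_I]
    exact Complex.arg_mul_cos_add_sin_mul_I hr ht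
  have hper : ∀ t : ℝ, Complex.exp (((t + 2 * Real.pi : ℝ) : ℂ) * Complex.I) =
      Complex.exp (t * Complex.I) := fun t => by
    push_cast
    rw [add_mul, Complex.exp_periodic]
  unfold stokesCorner
  rw [hnorm]
  rcases le_or_gt ψ (-Real.pi) with h3 | h3
  · rw [← hper ψ, harg _ ⟨by linarith, by linarith⟩, if_neg (by rintro ⟨-, h⟩; linarith),
      if_neg (by rintro ⟨h, -⟩; linarith)]
  rcases le_or_gt ψ Real.pi with h4 | h4
  · rw [harg _ ⟨h3, h4⟩]
  · have e : ψ = (ψ - 2 * Real.pi) + 2 * Real.pi := by ring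
    have e2 := hper (ψ - 2 * Real.pi)
    rw [← e] at e2
    rw [e2, harg _ ⟨by linarith, by linarith⟩, if_neg (by rintro ⟨h, -⟩; linarith),
      if_neg (by rintro ⟨-, h⟩; linarith)]

theorem sectorFun_zero (β a : ℝ) : sectorFun β a 0 = 0 := by
  unfold sectorFun
  split_ifs
  · rw [norm_zero, Real.zero_rpow (by norm_num)]; ring
  · rfl

/-- The rotated Stokes corners are the functions of the sectors obtained by rotation. -/
theorem stokesCorner_rotation {α : ℝ} (h1 : -(Real.pi / 6) ≤ α) (h2 : α ≤ Real.pi / 6) (z : ℂ) :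
    stokesCorner (rotation α z) = sectorFun (Real.sqrt 2 / 3) (-(5 * Real.pi / 6) - α) z := by
  have hpi := Real.pi_pos
  rcases eq_or_ne z 0 with rfl | hz
  · rw [sectorFun_zero, rotation, mul_zero, stokesCorner]
    split_ifs
    · rw [norm_zero, Real.zero_rpow (by norm_num)]; ring
    · rfl
  · have e : rotation α z = (‖z‖ : ℂ) * Complex.exp (((z.arg + α : ℝ) : ℂ) * Complex.I) := by
      conv_lhs => rw [rotation, ← Complex.norm_mul_exp_arg_mul_I z]
      rw [mul_left_comm, ← Complex.exp_add]
      congr 2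
      push_cast
      ring
    have h3 := Complex.neg_pi_lt_arg z
    have h4 := Complex.arg_le_pi z
    rw [e, stokesCorner_polar (norm_pos_iff.2 hz) (by linarith) (by linarith), sectorFun]
    have hiff : (-(5 * Real.pi / 6) < z.arg + α ∧ z.arg + α < -(Real.pi / 6)) ↔
        (-(5 * Real.pi / 6) - α < z.arg ∧ z.arg < -(5 * Real.pi / 6) - α + 2 * Real.pi / 3) := by
      constructor <;> rintro ⟨h, h'⟩ <;> constructor <;> linarith
    simp only [hiff]
    congr 1
    rw [← Real.sin_add_pi_div_two]
    congr 2
    ring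

theorem mul_sectorFun (c β a : ℝ) (z : ℂ) : c * sectorFun β a z = sectorFun (c * β) a z := by
  unfold sectorFun
  split_ifs
  · ring
  · ring

/-- Three times the energy of a sectorial configuration: the integral of `-ρ sin θ` over the angles
in `[-π, 0]`. -/
def sectorDensity (a ρL ρC ρR : ℝ) : ℝ :=
  ρL * (1 + Real.cos a) + ρC * (Real.cos (a + 2 * Real.pi / 3) - Real.cos a)
    + ρR * (1 - Real.cos (a + 2 * Real.pi / 3))

variable {ρp ρm β a ρL ρR C : ℝ} {v χp χm : ℂ → ℝ}

theorem IsSectorial.neg_iff {ρC : ℝ} {ρ : ℂ → ℝ} (h : IsSectorial β a ρL ρC ρR v ρ) (hβ : 0 < β)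
    {z : ℂ} (hz : z.im < 0) : v z < 0 ↔ a < z.arg ∧ z.arg < a + 2 * Real.pi / 3 := by
  have hz0 : 0 < ‖z‖ := norm_pos_iff.2 fun h => by simp [h] at hz
  rw [h.eq z hz.le, sectorFun]
  split_ifs with hin
  · refine ⟨fun _ => hin, fun _ => ?_⟩
    have : 0 < Real.sin (3 / 2 * (z.arg - a)) :=
      Real.sin_pos_of_pos_of_lt_pi (by linarith [hin.1]) (by linarith [hin.2])
    have h6 : 0 < ‖z‖ ^ (3 / 2 : ℝ) := Real.rpow_pos_of_pos hz0 _
    have : 0 < β * ‖z‖ ^ (3 / 2 : ℝ) * Real.sin (3 / 2 * (z.arg - a)) := by positivity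
    linarith
  · exact ⟨fun h' => absurd h' (lt_irrefl _), fun h' => absurd h' hin⟩

/-- If the density outside the sector is `ρ₊`, then the limit phases are those of the limit. -/
theorem IsSectorial.isProfile {ρC : ℝ}
    (h : IsSectorial β a ρL ρC ρR v (limitDensity ρp ρm χp χm)) (hβ : 0 < β) (hρ : ρp ≠ ρm)
    (hL : a = -Real.pi ∨ ρL = ρp) (hR : a + 2 * Real.pi / 3 = 0 ∨ ρR = ρp)
    (hph : ∀ᵐ z : ℂ, z.im < 0 → (χp z = 1 ∧ χm z = 0 ∨ χp z = 0 ∧ χm z = 1) ∧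
      (v z < 0 → χm z = 1)) {s : ℂ → ℝ} (hs : ∀ z : ℂ, z.im ≤ 0 → v z = s z) :
    IsProfile s v χp χm := by
  have hpi := Real.pi_pos
  have haI : a ∈ Icc (-Real.pi) 0 := ⟨h.left, by linarith [h.right]⟩
  have hbI : a + 2 * Real.pi / 3 ∈ Icc (-Real.pi) 0 := ⟨by linarith [h.left], h.right⟩
  refine ⟨hs, ?_⟩
  rw [ae_restrict_iff' measurableSet_lowerHalf]
  filter_upwards [h.density, hph, ae_sideFun_ne_zero a, ae_sideFun_ne_zero (a + 2 * Real.pi / 3)]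
    with z h1 h2 h4 h5 hz
  have hz : z.im < 0 := hz
  obtain ⟨h2, h3⟩ := h2 hz
  by_cases hneg : v z < 0
  · have hm := h3 hneg
    have hmem : z ∈ phaseMinus lowerHalf s := ⟨hz, by rw [← hs z hz.le]; exact hneg⟩
    obtain ⟨e1, e2⟩ := chiMinus_eq_of_mem hmem
    rw [e1, e2]
    rcases h2 with h2 | h2
    · rw [hm] at h2; norm_num at h2
    · exact h2
  · -- the point lies on one of the two open sides of the sector
    have hside : sideFun a z < 0 ∧ ρL = ρp ∨ 0 < sideFun (a + 2 * Real.pi / 3) z ∧ ρR = ρp := by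
      rw [h.neg_iff hβ hz, not_and_or, not_lt, not_lt] at hneg
      rcases hneg with hlt | hlt
      · have hlt' : sideFun a z < 0 := by
          refine h4.lt_or_gt.resolve_right fun hgt => ?_
          exact absurd ((sideFun_pos_iff haI hz).1 hgt) (not_lt.2 hlt)
        refine Or.inl ⟨hlt', hL.resolve_left fun ha => ?_⟩
        rw [ha] at hlt
        exact absurd (Complex.neg_pi_lt_arg z) (not_lt.2 hlt)
      · have hlt' : 0 < sideFun (a + 2 * Real.pi / 3) z := by
          refine h5.lt_or_gt.resolve_left fun hgt => ?_
          exact absurd ((sideFun_neg_iff hbI hz).1 hgt) (not_lt.2 hlt)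
        refine Or.inr ⟨hlt', hR.resolve_left fun hb => ?_⟩
        rw [hb] at hlt
        exact absurd (arg_mem_of_im_neg hz).2 (not_lt.2 hlt)
    have hρz : limitDensity ρp ρm χp χm z = ρp ∧ z ∈ phasePlus lowerHalf s := by
      rcases hside with ⟨hlt, hρL⟩ | ⟨hlt, hρR⟩
      · have harg := (sideFun_neg_iff haI hz).1 hlt
        refine ⟨by rw [h1 hz, angularStep, if_pos harg.le, hρL], ?_⟩
        refine interior_maximal ?_ (isOpen_lowerHalf.inter (isOpen_lt (continuous_sideFun a)
          continuous_const)) ⟨hz, hlt⟩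
        rintro y ⟨hy, hy'⟩
        have hy : y.im < 0 := hy
        refine ⟨hy, ?_⟩
        rw [← hs y hy.le, ← not_lt, h.neg_iff hβ hy]
        exact fun h' => lt_asymm h'.1 ((sideFun_neg_iff haI hy).1 hy')
      · have harg := (sideFun_pos_iff hbI hz).1 hlt
        refine ⟨by rw [h1 hz, angularStep, if_neg (by linarith), if_neg (by linarith), hρR], ?_⟩
        refine interior_maximal ?_ (isOpen_lowerHalf.inter (isOpen_lt continuous_const
          (continuous_sideFun _))) ⟨hz, hlt⟩
        rintro y ⟨hy, hy'⟩
        have hy : y.im < 0 := hy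
        refine ⟨hy, ?_⟩
        rw [← hs y hy.le, ← not_lt, h.neg_iff hβ hy]
        exact fun h' => lt_asymm h'.2 ((sideFun_pos_iff hbI hy).1 hy')
    obtain ⟨e1, e2⟩ := chiPlus_eq_of_mem hρz.2
    rw [e1, e2]
    rcases h2 with h2 | h2
    · exact h2
    · exfalso
      have := hρz.1
      rw [limitDensity, h2.1, h2.2] at this
      exact hρ (by linarith)

theorem eq_mul_sqrt_of_sq_eq {β t c : ℝ} (hβ : 0 < β) (hc : 0 ≤ c) (ht : 0 ≤ t)
    (h : β ^ 2 = c ^ 2 * t) : β = c * √t := by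
  have : β ^ 2 = (c * √t) ^ 2 := by rw [mul_pow, Real.sq_sqrt ht, h]
  exact (pow_left_inj₀ hβ.le (by positivity) two_ne_zero).1 this

/-- The Stokes corners: the jump conditions determine the sector, the amplitude and the densities
on the sides. Either both sides are in the open half-plane, and then they are symmetric, or one of
them is on the line `{y = 0}`. -/
theorem IsSectorial.classify (h : IsSectorial β a ρL ρm ρR v (limitDensity ρp ρm χp χm))
    (hc : ∀ R, IsCritical R v (limitDensity ρp ρm χp χm)) (hβ : 0 < β)
    (hL : ρL = ρp ∨ ρL = ρm) (hR : ρR = ρp ∨ ρR = ρm) :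
    (a = -(5 * Real.pi / 6) ∧ ρL = ρp ∧ ρR = ρp ∧ β = √|ρp - ρm| * (√2 / 3)) ∨
    (a = -Real.pi ∧ ρR = ρp ∧ β = (3 : ℝ) ^ (1 / 4 : ℝ) * √|ρp - ρm| * (√2 / 3)) ∨
    (a = -(2 * Real.pi / 3) ∧ ρL = ρp ∧ β = (3 : ℝ) ^ (1 / 4 : ℝ) * √|ρp - ρm| * (√2 / 3)) := by
  have hpi := Real.pi_pos
  have hl := h.left
  have hr := h.right
  have hβ2 : 0 < 9 / 4 * β ^ 2 := by positivity
  have h3 : ((3 : ℝ) ^ (1 / 4 : ℝ)) ^ 2 = √3 := by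
    rw [← Real.rpow_natCast, ← Real.rpow_mul (by norm_num), Real.sqrt_eq_rpow]
    norm_num
  have h2 : √2 ^ 2 = (2 : ℝ) := Real.sq_sqrt (by norm_num)
  -- a jump at an interior side forces the density `ρ₊ < ρ₋` beyond it
  have key : ∀ ρ θ : ℝ, ρ = ρp ∨ ρ = ρm → θ ∈ Ioo (-Real.pi) 0 →
      9 / 4 * β ^ 2 = (ρ - ρm) * Real.sin θ →
      ρ = ρp ∧ 9 / 4 * β ^ 2 = |ρp - ρm| * -Real.sin θ := by
    intro ρ θ hρ hθ he
    have hs := Real.sin_neg_of_neg_of_neg_pi_lt hθ.2 hθ.1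
    rcases hρ with rfl | rfl
    · refine ⟨rfl, ?_⟩
      have : ρ - ρm < 0 := by
        by_contra hge
        push Not at hge
        nlinarith
      rw [abs_of_neg this, he]
      ring
    · rw [sub_self, zero_mul] at he
      exact absurd he hβ2.ne'
  rcases hl.eq_or_lt with ha | ha
  · right; left
    have hb : a + 2 * Real.pi / 3 = -(Real.pi / 3) := by rw [← ha]; ring
    obtain ⟨h4, h5⟩ := key ρR _ hR ⟨by linarith, by linarith⟩ (h.jump_right hc (by linarith))
    refine ⟨ha.symm, h4, ?_⟩
    rw [hb, Real.sin_neg, neg_neg, Real.sin_pi_div_three] at h5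
    rw [mul_right_comm]
    refine eq_mul_sqrt_of_sq_eq hβ (by positivity) (abs_nonneg _) ?_
    rw [mul_pow, div_pow, h3, h2]
    linarith
  rcases hr.eq_or_lt with hb | hb
  · right; right
    have ha' : a = -(2 * Real.pi / 3) := by linarith
    obtain ⟨h4, h5⟩ := key ρL _ hL ⟨by linarith, by linarith⟩ (h.jump_left hc ha)
    refine ⟨ha', h4, ?_⟩
    rw [ha', Real.sin_neg, neg_neg, show 2 * Real.pi / 3 = Real.pi - Real.pi / 3 by ring,
      Real.sin_pi_sub, Real.sin_pi_div_three] at h5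
    rw [mul_right_comm]
    refine eq_mul_sqrt_of_sq_eq hβ (by positivity) (abs_nonneg _) ?_
    rw [mul_pow, div_pow, h3, h2]
    linarith
  · left
    obtain ⟨h4, h5⟩ := key ρL _ hL ⟨by linarith, by linarith⟩ (h.jump_left hc ha)
    obtain ⟨h6, h7⟩ := key ρR _ hR ⟨by linarith, by linarith⟩ (h.jump_right hc hb)
    have hΔ : |ρp - ρm| ≠ 0 := by
      intro h0
      rw [h0, zero_mul] at h5
      exact hβ2.ne' h5
    have hsin : Real.sin a = Real.sin (a + 2 * Real.pi / 3) := by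
      have := mul_left_cancel₀ hΔ (h5.symm.trans h7)
      linarith
    have hcos : Real.cos (a + Real.pi / 3) = 0 := by
      have := Real.sin_sub_sin a (a + 2 * Real.pi / 3)
      rw [hsin, sub_self, show (a - (a + 2 * Real.pi / 3)) / 2 = -(Real.pi / 3) by ring,
        show (a + (a + 2 * Real.pi / 3)) / 2 = a + Real.pi / 3 by ring, Real.sin_neg,
        Real.sin_pi_div_three] at this
      have h3' : (0 : ℝ) < √3 := by positivity
      rcases mul_eq_zero.1 this.symm with h8 | h8
      · linarith
      · exact h8
    have ha' : a = -(5 * Real.pi / 6) := by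
      obtain ⟨k, hk⟩ := Real.cos_eq_zero_iff.1 hcos
      have h8 : (k : ℝ) < 0 := by nlinarith
      have h9 : (-2 : ℝ) < k := by nlinarith
      have h8' : k < 0 := by exact_mod_cast h8
      have h9' : -2 < k := by exact_mod_cast h9
      have : k = -1 := by omega
      rw [this] at hk
      push_cast at hk
      linarith
    refine ⟨ha', h4, h6, ?_⟩
    rw [ha', Real.sin_neg, neg_neg, show 5 * Real.pi / 6 = Real.pi - Real.pi / 6 by ring,
      Real.sin_pi_sub, Real.sin_pi_div_six] at h5
    rw [mul_comm (√|ρp - ρm|)]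
    refine eq_mul_sqrt_of_sq_eq hβ (by positivity) (abs_nonneg _) ?_
    rw [div_pow, h2]
    linarith

/-- A blowup limit has one of the four shapes, and its energy is the corresponding density. -/
theorem IsConeSol.exists_limitShape (h : IsConeSol ρp ρm C v χp χm) (hρ : ρp ≠ ρm) :
    ∃ (i : Fin 4) (β a ρL ρC ρR : ℝ), limitShape ρp ρm v χp χm i ∧
      IsSectorial β a ρL ρC ρR v (limitDensity ρp ρm χp χm) ∧
      sectorDensity a ρL ρC ρR = 3 * density ρp ρm i := by
  have hpi := Real.pi_pos
  have h3 : (√3 : ℝ) ^ 2 = 3 := Real.sq_sqrt (by norm_num)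
  have h3' : (√3 : ℝ) ≠ 0 := by positivity
  have h3inv : 1 / (√3 : ℝ) = √3 / 3 := by
    rw [div_eq_div_iff h3' (by norm_num), one_mul, ← pow_two, h3]
  have c1 : Real.cos (5 * Real.pi / 6) = -(√3 / 2) := by
    rw [show 5 * Real.pi / 6 = Real.pi - Real.pi / 6 by ring, Real.cos_pi_sub, Real.cos_pi_div_six]
  have c2 : Real.cos (2 * Real.pi / 3) = -(1 / 2) := by
    rw [show 2 * Real.pi / 3 = Real.pi - Real.pi / 3 by ring, Real.cos_pi_sub,
      Real.cos_pi_div_three]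
  obtain ⟨β, a, ρL, ρC, ρR, hs, hcase⟩ := h.exists_isSectorial
  rcases hcase with ⟨hβ, hL, hR, hC⟩ | ⟨hβ, rfl, hL, hR⟩
  · have hv0 : ∀ z : ℂ, z.im ≤ 0 → v z = 0 := fun z hz => by
      rw [hs.eq z hz, hβ, sectorFun]; simp
    have hdens : ∀ᵐ z : ℂ, z.im < 0 → limitDensity ρp ρm χp χm z = ρC := by
      filter_upwards [hs.density] with z hz hneg
      rw [hz hneg, angularStep, hL, hR]
      split_ifs <;> rfl
    have hJ : sectorDensity a ρL ρC ρR = 2 * ρC := by rw [sectorDensity, hL, hR]; ring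
    rcases hC with hC | hC
    · refine ⟨1, β, a, ρL, ρC, ρR, ⟨hv0, ?_⟩, hs, ?_⟩
      · rw [ae_restrict_iff' measurableSet_lowerHalf]
        filter_upwards [hdens, h.phases] with z h1 h2 hz
        rcases (h2 hz).1 with h3 | h3
        · exact h3
        · have := h1 hz
          rw [limitDensity, h3.1, h3.2, hC] at this
          exact absurd (by linarith) hρ
      · rw [hJ, hC]; simp only [density, Matrix.cons_val]; ring
    · refine ⟨0, β, a, ρL, ρC, ρR, ⟨hv0, ?_⟩, hs, ?_⟩
      · rw [ae_restrict_iff' measurableSet_lowerHalf]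
        filter_upwards [hdens, h.phases] with z h1 h2 hz
        rcases (h2 hz).1 with h3 | h3
        · have := h1 hz
          rw [limitDensity, h3.1, h3.2, hC] at this
          exact absurd (by linarith) hρ
        · exact h3
      · rw [hJ, hC]; simp only [density, Matrix.cons_val]; ring
  · rcases hs.classify h.critical hβ hL hR with ⟨ha, hL', hR', hβ'⟩ | ⟨ha, hR', hβ'⟩ | ⟨ha, hL', hβ'⟩
    · refine ⟨2, β, a, ρL, ρC, ρR, ?_, hs, ?_⟩
      · refine hs.isProfile hβ hρ (Or.inr hL') (Or.inr hR') h.phases fun z hz => ?_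
        have := stokesCorner_rotation (α := 0) (by linarith) (by linarith) z
        rw [rotation, Complex.ofReal_zero, zero_mul, Complex.exp_zero, one_mul, sub_zero] at this
        rw [this, mul_sectorFun, hs.eq z hz, ha, hβ']
      · rw [sectorDensity, hL', hR', ha,
          show -(5 * Real.pi / 6) + 2 * Real.pi / 3 = -(Real.pi / 6) by ring, Real.cos_neg,
          Real.cos_neg, Real.cos_pi_div_six, c1]
        simp only [density, Matrix.cons_val]
        rw [div_eq_mul_one_div ρC, h3inv]
        ring
    · refine ⟨3, β, a, ρL, ρC, ρR, Or.inl ?_, hs, ?_⟩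
      · refine hs.isProfile hβ hρ (Or.inl ha) (Or.inr hR') h.phases fun z hz => ?_
        rw [stokesCorner_rotation (by linarith) le_rfl, mul_sectorFun, hs.eq z hz, ha, ← hβ']
        congr 1
        ring
      · rw [sectorDensity, hR', ha,
          show -Real.pi + 2 * Real.pi / 3 = -(Real.pi / 3) by ring, Real.cos_neg,
          Real.cos_neg, Real.cos_pi_div_three, Real.cos_pi]
        simp only [density, Matrix.cons_val]
        ring
    · refine ⟨3, β, a, ρL, ρC, ρR, Or.inr ?_, hs, ?_⟩
      · refine hs.isProfile hβ hρ (Or.inr hL') (Or.inl (by rw [ha]; ring)) h.phases fun z hz => ?_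
        rw [stokesCorner_rotation le_rfl (by linarith), mul_sectorFun, hs.eq z hz, ha, ← hβ']
        congr 1
        ring
      · rw [sectorDensity, hL', ha,
          show -(2 * Real.pi / 3) + 2 * Real.pi / 3 = 0 by ring, Real.cos_neg, Real.cos_zero, c2]
        simp only [density, Matrix.cons_val]
        ring

/-- The four densities are `(2/3) (ρ₊ + t (ρ₋ - ρ₊))` with `t = 1`, `0`, `√3 / 2` and `3 / 4`. -/
theorem density_injective (hρ : ρp ≠ ρm) : Function.Injective (density ρp ρm) := by
  have h3 : (√3 : ℝ) ^ 2 = 3 := Real.sq_sqrt (by norm_num)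
  have h3' : (√3 : ℝ) ≠ 0 := by positivity
  have h3inv : 1 / (√3 : ℝ) = √3 / 3 := by
    rw [div_eq_div_iff h3' (by norm_num), one_mul, ← pow_two, h3]
  have hb1 : 1.7 < √3 := Real.lt_sqrt_of_sq_lt (by norm_num)
  have hb2 : √3 < 1.75 := (Real.sqrt_lt' (by norm_num)).2 (by norm_num)
  set t : Fin 4 → ℝ := ![1, 0, √3 / 2, 3 / 4] with ht
  have he : ∀ i, density ρp ρm i = 2 / 3 * (ρp + t i * (ρm - ρp)) := by
    intro i
    fin_cases i
    · simp [density, ht]; ring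
    · simp [density, ht]; ring
    · change (2 / 3 - 1 / √3) * ρp + ρm / √3 = 2 / 3 * (ρp + √3 / 2 * (ρm - ρp))
      rw [div_eq_mul_one_div ρm, h3inv]; ring
    · change ρp / 6 + ρm / 2 = 2 / 3 * (ρp + 3 / 4 * (ρm - ρp))
      ring
  have hinj : Function.Injective t := by
    intro i j hij
    fin_cases i <;> fin_cases j <;> simp [ht] at hij ⊢ <;> linarith
  intro i j hij
  rw [he, he] at hij
  have : (t i - t j) * (ρm - ρp) = 0 := by linarith
  rcases mul_eq_zero.1 this with h | h
  · exact hinj (by linarith)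
  · exact absurd (by linarith) hρ

/-! ### The energies of blowup limits -/

section Values

variable {β a ρL ρC ρR : ℝ} {v ρ : ℂ → ℝ}

theorem IsSectorial.energyDensity_eq (h : IsSectorial β a ρL ρC ρR v ρ) {z : ℂ} (hz : z.im < 0)
    (hρ : ρ z = angularStep a ρL ρC ρR z.arg) :
    energyDensity v ρ z = ‖z‖ * (angularStep a 0 (9 / 4 * β ^ 2) 0 z.arg * 1) -
      ‖z‖ * (angularStep a ρL ρC ρR z.arg * Real.sin z.arg) := by
  have e : ‖negGrad v z‖ ^ 2 = ‖z‖ * angularStep a 0 (9 / 4 * β ^ 2) 0 z.arg := by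
    by_cases hin : a < z.arg ∧ z.arg < a + 2 * Real.pi / 3
    · rw [(sectorFun_gradient h.nonneg h.eq hz hin.1 hin.2).1, angularStep,
        if_neg (not_le.2 hin.1), if_pos hin.2]
      ring
    · have hv0 : v z = 0 := by rw [h.eq z hz.le, sectorFun, if_neg hin]
      have e5 : angularStep a 0 (9 / 4 * β ^ 2) 0 z.arg = 0 := by
        unfold angularStep
        split_ifs with h1 h2
        · rfl
        · exact absurd ⟨not_le.1 h1, h2⟩ hin
        · rfl
      rw [negGrad_of_nonneg hv0.ge, e5]
      simp
  rw [energyDensity, e, hρ, ← Complex.norm_mul_sin_arg z]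
  ring

theorem IsSectorial.sq_eq (h : IsSectorial β a ρL ρC ρR v ρ) {z : ℂ} (hz : z.im ≤ 0) :
    v z ^ 2 = ‖z‖ ^ 3 * (angularStep a 0 (β ^ 2) 0 z.arg * Real.sin (3 / 2 * (z.arg - a)) ^ 2) := by
  have e6 : (‖z‖ ^ (3 / 2 : ℝ)) ^ 2 = ‖z‖ ^ 3 := by
    rw [← Real.rpow_natCast, ← Real.rpow_mul (norm_nonneg z)]; norm_num
  rw [h.eq z hz, sectorFun, angularStep]
  by_cases h1 : z.arg ≤ a
  · rw [if_neg fun h' => absurd h'.1 (not_lt.2 h1), if_pos h1]; ring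
  · by_cases h2 : z.arg < a + 2 * Real.pi / 3
    · rw [if_pos ⟨not_le.1 h1, h2⟩, if_neg h1, if_pos h2, ← e6]; ring
    · rw [if_neg fun h' => absurd h'.2 h2, if_neg h1, if_neg h2]; ring

theorem integral_sin_sq_sector (a : ℝ) :
    ∫ θ in a..(a + 2 * Real.pi / 3), Real.sin (3 / 2 * (θ - a)) ^ 2 = Real.pi / 3 := by
  have hd : ∀ θ : ℝ, HasDerivAt (fun θ => θ / 2 - Real.sin (3 * (θ - a)) / 6)
      (Real.sin (3 / 2 * (θ - a)) ^ 2) θ := by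
    intro θ
    have h1 := ((hasDerivAt_id θ).div_const 2).sub
      (((((hasDerivAt_id θ).sub_const a).const_mul 3).sin).div_const 6)
    refine h1.congr_deriv ?_
    rw [id, show 3 * (θ - a) = 2 * (3 / 2 * (θ - a)) by ring, Real.cos_two_mul, Real.sin_sq]
    ring
  rw [intervalIntegral.integral_eq_sub_of_hasDerivAt (fun θ _ => hd θ)
    (Continuous.intervalIntegrable (by fun_prop) _ _),
    show 3 * (a + 2 * Real.pi / 3 - a) = 2 * Real.pi by ring, Real.sin_two_pi, sub_self, mul_zero,
    Real.sin_zero]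
  ring

theorem IsSectorial.ae_energyDensity_mul (h : IsSectorial β a ρL ρC ρR v ρ) (R : ℝ) (A : ℝ → ℝ) :
    ∀ᵐ z ∂(volume.restrict (halfBall R)), energyDensity v ρ z * A ‖z‖ =
      ‖z‖ * A ‖z‖ * (angularStep a 0 (9 / 4 * β ^ 2) 0 z.arg * 1) -
      ‖z‖ * A ‖z‖ * (angularStep a ρL ρC ρR z.arg * Real.sin z.arg) := by
  rw [ae_restrict_iff' (isOpen_halfBall R).measurableSet]
  filter_upwards [h.density] with z h3 h4
  rw [h.energyDensity_eq h4.2 (h3 h4.2)]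
  ring

theorem IsSectorial.integrableOn_energyDensity_mul (h : IsSectorial β a ρL ρC ρR v ρ) {R : ℝ}
    {A : ℝ → ℝ} (hA : Continuous A) :
    IntegrableOn (fun z => energyDensity v ρ z * A ‖z‖) (halfBall R) := by
  have hAc : Continuous fun r => r * A r := by fun_prop
  refine Integrable.congr ?_ (EventuallyEq.symm (h.ae_energyDensity_mul R A))
  exact ((isBddMeas_polar _ _ _ _ hAc (f := fun _ => 1) continuous_const).sub
    (isBddMeas_polar _ _ _ _ hAc Real.continuous_sin)).integrableOn

/-- The weighted energy integral: the gradient and the density of the fluids contribute. -/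
theorem IsSectorial.integral_energyDensity_mul (h : IsSectorial β a ρL ρC ρR v ρ) {R : ℝ}
    {A : ℝ → ℝ} (hA : Continuous A) :
    ∫ z in halfBall R, energyDensity v ρ z * A ‖z‖ =
      (∫ r in Ioo 0 R, r * (r * A r)) *
        (3 / 2 * Real.pi * β ^ 2 + sectorDensity a ρL ρC ρR) := by
  have hAc : Continuous fun r => r * A r := by fun_prop
  have hsin : ∀ p q : ℝ, ∫ θ in p..q, Real.sin θ = Real.cos p - Real.cos q := fun p q =>
    integral_sin
  rw [integral_congr_ae (h.ae_energyDensity_mul R A), integral_sub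
    (isBddMeas_polar _ _ _ _ hAc (f := fun _ => 1) continuous_const).integrableOn
    (isBddMeas_polar _ _ _ _ hAc Real.continuous_sin).integrableOn,
    integral_polar_angularStep h.left h.right _ _ _ (fun r => r * A r) (f := fun _ => 1)
      continuous_const,
    integral_polar_angularStep h.left h.right _ _ _ (fun r => r * A r) Real.continuous_sin,
    hsin, hsin, hsin, Real.cos_neg, Real.cos_pi, Real.cos_zero, sectorDensity]
  simp only [intervalIntegral.integral_const, smul_eq_mul]
  ring

/-- The gradient and the boundary term cancel, and only the density of the fluids contributes. -/
theorem IsSectorial.unitEnergy_eq (h : IsSectorial β a ρL ρC ρR v ρ) :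
    unitEnergy v ρ = sectorDensity a ρL ρC ρR / 3 := by
  have hpi := Real.pi_pos
  have h1 := h.integral_energyDensity_mul (R := 1) (A := fun _ => 1) continuous_const
  have h2 : ∫ r in Ioo (0 : ℝ) 1, r * (r * 1) = 1 / 3 := by
    rw [← integral_Ioc_eq_integral_Ioo, ← intervalIntegral.integral_of_le zero_le_one]
    have : ∀ r : ℝ, r * (r * 1) = r ^ 2 := fun r => by ring
    simp_rw [this]
    rw [integral_pow]
    norm_num
  have h3 : ∫ θ in (-Real.pi)..0, v (Complex.exp (θ * Complex.I)) ^ 2 = β ^ 2 * (Real.pi / 3) := by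
    have hc : Continuous fun θ : ℝ => Real.sin (3 / 2 * (θ - a)) ^ 2 := by fun_prop
    have e := integral_angularStep_mul h.left h.right 0 (β ^ 2) 0 hc
    rw [integral_sin_sq_sector, zero_mul, zero_mul, zero_add, add_zero] at e
    rw [intervalIntegral.integral_of_le (by linarith), integral_Ioc_eq_integral_Ioo, ← e]
    refine setIntegral_congr_fun measurableSet_Ioo fun θ hθ => ?_
    have harg : (Complex.exp (θ * Complex.I)).arg = θ := by
      rw [Complex.exp_mul_I]
      exact Complex.arg_cos_add_sin_mul_I ⟨hθ.1, by linarith [hθ.2]⟩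
    change v (Complex.exp (θ * Complex.I)) ^ 2 = _
    rw [h.sq_eq (exp_im_neg hθ).le, harg, Complex.norm_exp_ofReal_mul_I, one_pow, one_mul]
  simp only [mul_one] at h1 h2
  rw [unitEnergy, h1, h2, h3]
  ring

/-- The radial moment of the cutoff, which relates the smooth energy of a sectorial configuration to
`sectorDensity`. -/
def cutoffMass : ℝ := ∫ r in Ioo (0 : ℝ) 1, r * (r * cutoff (r ^ 2))

theorem cutoffMass_pos : 0 < cutoffMass := by
  have hc := continuous_cutoff
  have hpos : ∀ r ∈ Ioo (0 : ℝ) 1, 0 < cutoff (r ^ 2) := by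
    intro r hr
    have : r ^ 2 < 1 := by nlinarith [hr.1, hr.2]
    unfold cutoff
    rw [max_eq_left (by linarith)]
    have : 0 < 1 - r ^ 2 := by linarith
    positivity
  unfold cutoffMass
  rw [← integral_Ioc_eq_integral_Ioo, ← intervalIntegral.integral_of_le zero_le_one]
  refine intervalIntegral.intervalIntegral_pos_of_pos_on
    (Continuous.intervalIntegrable (by fun_prop) _ _) (fun r hr => ?_) zero_lt_one
  have := hpos r hr
  have := hr.1
  positivity

theorem IsSectorial.smoothEnergy_eq {C : ℝ} (h : IsSectorial β a ρL ρC ρR v ρ)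
    (hv : HalfSol 1 C v) :
    smoothEnergy 1 v ρ 1 = cutoffMass * sectorDensity a ρL ρC ρR := by
  have hc := continuous_cutoff
  have hc' := continuous_cutoff'
  have hA : Continuous fun r : ℝ => cutoff (r ^ 2) := by fun_prop
  have hA' : Continuous fun r : ℝ => r ^ 3 * cutoff' (r ^ 2) := by fun_prop
  have hsin : Continuous fun θ : ℝ => Real.sin (3 / 2 * (θ - a)) ^ 2 := by fun_prop
  have h1 := h.integral_energyDensity_mul (R := 1) hA
  have h2 : ∫ z in halfBall 1, v z ^ 2 * cutoff' (‖z‖ ^ 2) =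
      -(3 / 2) * cutoffMass * (β ^ 2 * (Real.pi / 3)) := by
    have e : EqOn (fun z : ℂ => v z ^ 2 * cutoff' (‖z‖ ^ 2)) (fun z : ℂ =>
        ‖z‖ ^ 3 * cutoff' (‖z‖ ^ 2) * (angularStep a 0 (β ^ 2) 0 z.arg *
          Real.sin (3 / 2 * (z.arg - a)) ^ 2)) (halfBall 1) := fun z hz => by
      change v z ^ 2 * _ = _
      rw [h.sq_eq hz.2.le]
      ring
    rw [setIntegral_congr_fun (isOpen_halfBall 1).measurableSet e,
      integral_polar_angularStep h.left h.right 0 (β ^ 2) 0 (fun r => r ^ 3 * cutoff' (r ^ 2)) hsin,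
      integral_radial_deriv zero_le_one hasDerivAt_cutoff hc' (cutoff_eq_zero (by norm_num)),
      integral_sin_sq_sector, cutoffMass]
    ring
  have e : ∀ z : ℂ, ((1 : ℝ) ^ 3)⁻¹ * (energyDensity v ρ z * cutoff (‖z‖ ^ 2 / 1 ^ 2))
      + 3 * ((1 : ℝ) ^ 5)⁻¹ * (v z ^ 2 * cutoff' (‖z‖ ^ 2 / 1 ^ 2)) =
      energyDensity v ρ z * cutoff (‖z‖ ^ 2) + 3 * (v z ^ 2 * cutoff' (‖z‖ ^ 2)) := fun z => by
    norm_num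
  unfold smoothEnergy
  simp_rw [e]
  rw [integral_add, integral_const_mul, h1, h2, ← cutoffMass]
  · ring
  · exact h.integrableOn_energyDensity_mul hA
  · exact ((hv.isBddMeas.sq.mul (.of_continuous (by fun_prop))).integrableOn).const_mul 3

end Values

/-! ### Convergence of the energies -/

theorem tendsto_setIntegral_halfBall {R B : ℝ} {F : ℕ → ℂ → ℝ} {f : ℂ → ℝ}
    (hF : ∀ᶠ m in atTop, AEStronglyMeasurable (F m) (volume.restrict (halfBall R)) ∧
      ∀ z ∈ halfBall R, |F m z| ≤ B)
    (hlim : ∀ᵐ z ∂(volume.restrict (halfBall R)), Tendsto (fun m => F m z) atTop (𝓝 (f z))) :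
    Tendsto (fun m => ∫ z in halfBall R, F m z) atTop (𝓝 (∫ z in halfBall R, f z)) := by
  have : IsFiniteMeasure (volume.restrict (halfBall R)) :=
    ⟨by simpa using volume_halfBall_lt_top R⟩
  refine tendsto_integral_filter_of_dominated_convergence (fun _ => B)
    (hF.mono fun m hm => hm.1) (hF.mono fun m hm => ?_) (integrable_const _) hlim
  exact (ae_restrict_iff' (isOpen_halfBall R).measurableSet).2 (.of_forall hm.2)

namespace IsBlowupLimit

variable {ρp ρm δ C : ℝ} {u u₀ χp χm : ℂ → ℝ} {g : ℂ → ℂ} {r : ℕ → ℝ}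

/-- Along a subsequence, the smooth energy and the boundary adjusted energy at the radii of the
blowup converge to the energies of the limit. -/
theorem tendsto_energies (h : IsBlowupLimit u g r u₀ χp χm) (hu : IsLocalSol ρp ρm δ C u g) :
    ∃ κ : ℕ → ℕ, StrictMono κ ∧
      Tendsto (fun m => smoothEnergy δ u (fluidDensity ρp ρm u) (r (κ m))) atTop
        (𝓝 (smoothEnergy 1 u₀ (limitDensity ρp ρm χp χm) 1)) ∧
      Tendsto (fun m => energyM ρp ρm u g (r (κ m))) atTop
        (𝓝 (unitEnergy u₀ (limitDensity ρp ρm χp χm))) := by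
  have hpi := Real.pi_pos
  have hlim := h.isHalfLimit hu
  obtain ⟨κ, hκ, hae⟩ := h.exists_subseq_ae hu 1
  set ρ' : ℕ → ℂ → ℝ := fun m z => fluidDensity ρp ρm u ((r (κ m) : ℂ) * z) with hρ'
  set w : ℕ → ℂ → ℝ := fun m => rescale u (r (κ m)) with hw
  have hb : ∀ m z, |ρ' m z| ≤ |ρp| + |ρm| := fun m z => abs_fluidDensity_le _ _ _ _
  have hmeas : ∀ m, Measurable (ρ' m) := fun m => hu.measurable.comp (by fun_prop)
  have hsol1 : ∀ᶠ m in atTop, HalfSol 1 C (w m) := hκ.tendsto_atTop.eventually (hlim.sol 1)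
  have hsol2 : ∀ᶠ m in atTop, HalfSol 2 C (w m) := hκ.tendsto_atTop.eventually (hlim.sol 2)
  have hle : ∀ᶠ m in atTop, 1 ≤ δ / r (κ m) :=
    hκ.tendsto_atTop.eventually (h.eventually_le hu.pos 1)
  have hEt : ∀ᵐ z ∂(volume.restrict (halfBall 1)), Tendsto (fun m => energyDensity (w m) (ρ' m) z)
      atTop (𝓝 (energyDensity u₀ (limitDensity ρp ρm χp χm) z)) := by
    filter_upwards [hae] with z hz
    refine (hz.1.norm.pow 2).sub (Tendsto.const_mul _ ?_)
    have e : ∀ m, ρ' m z = ρp * chiPlus (halfBall (1 / r (κ m))) (rescale u (r (κ m))) z +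
        ρm * chiMinus (halfBall (1 / r (κ m))) (rescale u (r (κ m))) z := fun m =>
      fluidDensity_rescale (h.r_pos _) _ _ _ z
    simp only [e]
    exact (hz.2.1.const_mul _).add (hz.2.2.const_mul _)
  have hwt : ∀ z : ℂ, z.im ≤ 0 → Tendsto (fun m => w m z) atTop (𝓝 (u₀ z)) := fun z hz =>
    (hlim.tendsto hz).comp hκ.tendsto_atTop
  refine ⟨κ, hκ, ?_, ?_⟩
  · have ht : Tendsto (fun m => smoothEnergy 1 (w m) (ρ' m) 1) atTop
        (𝓝 (smoothEnergy 1 u₀ (limitDensity ρp ρm χp χm) 1)) := by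
      refine tendsto_setIntegral_halfBall (B := ((C * √1) ^ 2 + 1 * (|ρp| + |ρm|)) * 1 +
        3 * ((C * √1 * 1) ^ 2 * 3)) ?_ ?_
      · filter_upwards [hsol1] with m hm
        have hc := continuous_radial continuous_cutoff 1
        have hc' := continuous_radial continuous_cutoff' 1
        refine ⟨((((hm.isBddMeas_energyDensity (hmeas m) (hb m)).mul (.of_continuous hc)).1.const_mul
          _).add ((hm.isBddMeas.sq.mul (.of_continuous hc')).1.const_mul _)), fun z hz => ?_⟩
        have hpos : (0 : ℝ) ≤ ‖z‖ ^ 2 / 1 ^ 2 := by positivity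
        have h1 := hm.abs_energyDensity_le (hb m) hz
        have h2 := hm.sq_le hz
        refine (abs_add_le _ _).trans (add_le_add ?_ ?_)
        · rw [one_pow, inv_one, one_mul, abs_mul]
          exact mul_le_mul h1 (abs_cutoff_le hpos) (abs_nonneg _) ((abs_nonneg _).trans h1)
        · rw [one_pow, inv_one, mul_one, abs_mul, abs_mul, abs_of_nonneg (a := (3 : ℝ)) (by norm_num),
            abs_of_nonneg (sq_nonneg _)]
          exact mul_le_mul_of_nonneg_left (mul_le_mul h2 (abs_cutoff'_le hpos) (abs_nonneg _)
            (by positivity)) (by norm_num)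
      · filter_upwards [hEt, ae_restrict_mem (isOpen_halfBall 1).measurableSet] with z hz hz1
        exact ((hz.mul_const _).const_mul _).add ((((hwt z hz1.2.le).pow 2).mul_const _).const_mul _)
    refine ht.congr' ?_
    filter_upwards [hle] with m hm
    have e := hu.sol.smoothEnergy_rescale (ρ := fluidDensity ρp ρm u) (h.r_pos (κ m)) 1
    rw [mul_one, smoothEnergy_of_one_le hm] at e
    exact e
  · have h1 : Tendsto (fun m => ∫ z in halfBall 1, energyDensity (w m) (ρ' m) z) atTop
        (𝓝 (∫ z in halfBall 1, energyDensity u₀ (limitDensity ρp ρm χp χm) z)) := by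
      refine tendsto_setIntegral_halfBall (B := (C * √1) ^ 2 + 1 * (|ρp| + |ρm|)) ?_ hEt
      filter_upwards [hsol1] with m hm
      exact ⟨(hm.isBddMeas_energyDensity (hmeas m) (hb m)).1,
        fun z hz => hm.abs_energyDensity_le (hb m) hz⟩
    have hexp : ∀ θ ∈ Icc (-Real.pi) 0, Complex.exp (θ * Complex.I) ∈ lidBall 2 := fun θ hθ =>
      ⟨by rw [Complex.norm_exp_ofReal_mul_I]; norm_num, exp_im_nonpos hθ⟩
    have h2 : Tendsto (fun m => ∫ θ in (-Real.pi)..0, w m (Complex.exp (θ * Complex.I)) ^ 2) atTop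
        (𝓝 (∫ θ in (-Real.pi)..0, u₀ (Complex.exp (θ * Complex.I)) ^ 2)) := by
      have hIoc : uIoc (-Real.pi) 0 ⊆ Icc (-Real.pi) 0 := by
        rw [uIoc_of_le (by linarith)]; exact Ioc_subset_Icc_self
      refine intervalIntegral.tendsto_integral_filter_of_dominated_convergence
        (fun _ => (C * √2) ^ 2) ?_ ?_ (by simp) ?_
      · filter_upwards [hsol2] with m hm
        refine ContinuousOn.aestronglyMeasurable ?_ measurableSet_uIoc
        refine ContinuousOn.pow (hm.continuousOn.comp (Continuous.continuousOn (by fun_prop))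
          fun θ hθ => hexp θ (hIoc hθ)) 2
      · filter_upwards [hsol2] with m hm
        refine .of_forall fun θ hθ => ?_
        have := hm.abs_le le_rfl (hexp θ (hIoc hθ))
        rw [Complex.norm_exp_ofReal_mul_I, mul_one] at this
        rw [Real.norm_of_nonneg (sq_nonneg _), ← sq_abs]
        exact pow_le_pow_left₀ (abs_nonneg _) this 2
      · exact .of_forall fun θ hθ => (hwt _ (hexp θ (hIoc hθ)).2).pow 2
    refine (h1.sub (h2.const_mul (3 / 2))).congr' ?_
    filter_upwards [hle] with m hm
    exact (hu.energyM_eq (h.r_pos _) ((one_le_div (h.r_pos _)).1 hm)).symm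

end IsBlowupLimit

/-- All blowup limits have the same shape index, because the limit of the monotone energy is the
same for all of them, and the four densities are distinct. -/
theorem IsLocalSol.exists_limitShape {ρp ρm δ C : ℝ} {u : ℂ → ℝ} {g : ℂ → ℂ}
    (hu : IsLocalSol ρp ρm δ C u g) (hΓ : FreeBoundaryLipschitzNearZero u) (hρ : ρp ≠ ρm) :
    ∃ i : Fin 4, Tendsto (energyM ρp ρm u g) (𝓝[>] 0) (𝓝 (density ρp ρm i)) ∧
      ∀ (r : ℕ → ℝ) (u₀ χp χm : ℂ → ℝ), IsBlowupLimit u g r u₀ χp χm →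
        limitShape ρp ρm u₀ χp χm i := by
  obtain ⟨L, hL⟩ := hu.sol.exists_tendsto_smoothEnergy hu.pos hu.measurable
    (abs_fluidDensity_le ρp ρm u) hu.critical
  have hK := cutoffMass_pos
  have key : ∀ (r : ℕ → ℝ) (u₀ χp χm : ℂ → ℝ), IsBlowupLimit u g r u₀ χp χm →
      ∃ i, limitShape ρp ρm u₀ χp χm i ∧ L = cutoffMass * (3 * density ρp ρm i) ∧
        ∃ κ : ℕ → ℕ, StrictMono κ ∧ Tendsto (fun m => energyM ρp ρm u g (r (κ m))) atTop
          (𝓝 (density ρp ρm i)) := by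
    intro r u₀ χp χm h
    have hcone := h.isConeSol hu
    obtain ⟨i, β, a, ρL, ρC, ρR, hshape, hsec, hJ⟩ := hcone.exists_limitShape hρ
    obtain ⟨κ, hκ, h1, h2⟩ := h.tendsto_energies hu
    rw [hsec.smoothEnergy_eq (hcone.sol 1), hJ] at h1
    rw [hsec.unitEnergy_eq, hJ, mul_div_cancel_left₀ _ (by norm_num)] at h2
    refine ⟨i, hshape, ?_, κ, hκ, h2⟩
    refine tendsto_nhds_unique (hL.comp ?_) h1
    exact tendsto_nhdsWithin_iff.2 ⟨h.r_tendsto.comp hκ.tendsto_atTop,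
      .of_forall fun m => h.r_pos _⟩
  have hinj : ∀ i j, L = cutoffMass * (3 * density ρp ρm i) →
      L = cutoffMass * (3 * density ρp ρm j) → i = j := fun i j hi hj => by
    refine density_injective hρ ?_
    have := mul_left_cancel₀ hK.ne' (hi.symm.trans hj)
    linarith
  obtain ⟨κ, -, u₀, χp, χm, h₀⟩ := hu.exists_isBlowupLimit hΓ (r := fun m => 1 / ((m : ℝ) + 1))
    (fun m => by positivity) tendsto_one_div_add_atTop_nhds_zero_nat
  obtain ⟨i, -, hi, -⟩ := key _ _ _ _ h₀
  refine ⟨i, ?_, fun r u₀ χp χm h => ?_⟩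
  · refine tendsto_of_subseq_tendsto fun s hs => ?_
    obtain ⟨hs0, hspos⟩ := tendsto_nhdsWithin_iff.1 hs
    obtain ⟨N, hN⟩ := eventually_atTop.1 hspos
    obtain ⟨κ, -, u₀, χp, χm, h⟩ := hu.exists_isBlowupLimit hΓ (r := fun m => s (m + N))
      (fun m => hN _ (by omega)) (hs0.comp (tendsto_add_atTop_nat N))
    obtain ⟨j, -, hj, κ', -, ht⟩ := key _ _ _ _ h
    rw [hinj j i hj hi] at ht
    exact ⟨fun m => κ (κ' m) + N, ht⟩
  · obtain ⟨j, hshape, hj, -⟩ := key _ _ _ _ h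
    rwa [hinj j i hj hi] at hshape

/-! ### Separation in the half-plane -/

/-- If `a` and `b` lie in a connected set disjoint from the closed set `K`, then the quotient
`(z - a) / (z - b)` has a continuous logarithm on `K`. -/
theorem exists_log_ratio {K T : Set ℂ} (hK : IsClosed K) (hT : IsPreconnected T)
    (hd : Disjoint T K) {a b : ℂ} (ha : a ∈ T) (hb : b ∈ T) :
    ∃ f : ℂ → ℂ, ContinuousOn f K ∧ ∀ z ∈ K, Complex.exp (f z) * (z - b) = z - a := by
  refine hT.induction₂ (fun a b => ∃ f : ℂ → ℂ, ContinuousOn f K ∧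
    ∀ z ∈ K, Complex.exp (f z) * (z - b) = z - a) (fun x hx => ?_) ?_ ?_ ha hb
  · obtain ⟨ε, hε, hball⟩ := Metric.isOpen_iff.1 hK.isOpen_compl x (disjoint_left.1 hd hx)
    filter_upwards [nhdsWithin_le_nhds (Metric.ball_mem_nhds x hε)] with y hy
    have hfar : ∀ z ∈ K, z - x ≠ 0 ∧ ‖(x - y) / (z - x)‖ < 1 := by
      intro z hz
      have h1 : ε ≤ ‖z - x‖ := by
        by_contra hlt
        push Not at hlt
        exact hball (mem_ball_iff_norm.2 hlt) hz
      have h2 : 0 < ‖z - x‖ := hε.trans_le h1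
      refine ⟨norm_pos_iff.1 h2, ?_⟩
      rw [norm_div, div_lt_one h2, norm_sub_rev]
      exact (mem_ball_iff_norm.1 hy).trans_le h1
    refine ⟨fun z => -Complex.log (1 + (x - y) / (z - x)), ?_, fun z hz => ?_⟩
    · refine ContinuousOn.neg (ContinuousOn.clog ?_ fun z hz =>
        Complex.mem_slitPlane_of_norm_lt_one (hfar z hz).2)
      exact continuousOn_const.add (continuousOn_const.div (by fun_prop) fun z hz => (hfar z hz).1)
    · obtain ⟨h1, h2⟩ := hfar z hz
      have h3 := Complex.slitPlane_ne_zero (Complex.mem_slitPlane_of_norm_lt_one h2)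
      rw [Complex.exp_neg, Complex.exp_log h3, inv_mul_eq_iff_eq_mul₀ h3]
      field_simp
      ring
  · rintro x y z - - - ⟨f, hf, hf'⟩ ⟨g, hg, hg'⟩
    refine ⟨fun z => f z + g z, hf.add hg, fun t ht => ?_⟩
    rw [Complex.exp_add, mul_assoc, hg' t ht, hf' t ht]
  · rintro x y - - ⟨f, hf, hf'⟩
    refine ⟨fun z => -f z, hf.neg, fun t ht => ?_⟩
    rw [Complex.exp_neg, ← hf' t ht, inv_mul_cancel_left₀ (Complex.exp_ne_zero _)]

/-- Two continuous logarithms on a connected set differ by a constant. -/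
theorem sub_eq_sub_of_exp_eq {S : Set ℂ} (hS : IsPreconnected S) {f g : ℂ → ℂ}
    (hf : ContinuousOn f S) (hg : ContinuousOn g S)
    (h : ∀ z ∈ S, Complex.exp (f z) = Complex.exp (g z)) {x y : ℂ} (hx : x ∈ S) (hy : y ∈ S) :
    f x - g x = f y - g y := by
  have hpi := Real.pi_pos
  have hn : ∀ z ∈ S, ∃ n : ℤ, f z - g z = n * (2 * Real.pi * Complex.I) := fun z hz => by
    obtain ⟨n, hn⟩ := Complex.exp_eq_exp_iff_exists_int.1 (h z hz)
    exact ⟨n, by rw [hn]; ring⟩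
  set k : ℂ → ℝ := fun z => (f z - g z).im / (2 * Real.pi) with hk
  have hkint : ∀ z n, f z - g z = (n : ℤ) * (2 * Real.pi * Complex.I) → k z = n := by
    intro z n hz
    have e : (n : ℂ) * (2 * Real.pi * Complex.I) = ((n * (2 * Real.pi) : ℝ) : ℂ) * Complex.I := by
      push_cast; ring
    rw [hk]
    simp only
    rw [hz, e, Complex.im_ofReal_mul, Complex.I_im, mul_one]
    field_simp
  have hkc : ContinuousOn k S := (Complex.continuous_im.comp_continuousOn (hf.sub hg)).div_const _
  have hord := (hS.image k hkc).ordConnected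
  have key : ∀ a ∈ S, ∀ b ∈ S, k a ≤ k b → k a = k b := by
    intro a ha b hb hab
    obtain ⟨n, hn'⟩ := hn a ha
    obtain ⟨m, hm'⟩ := hn b hb
    have ea := hkint a n hn'
    have eb := hkint b m hm'
    rcases hab.eq_or_lt with he | hlt
    · exact he
    · exfalso
      rw [ea, eb] at hlt
      have hnm : n + 1 ≤ m := by exact_mod_cast hlt
      have hnm' : (n : ℝ) + 1 ≤ m := by exact_mod_cast hnm
      obtain ⟨c, hc, hc'⟩ := hord.out (mem_image_of_mem k ha) (mem_image_of_mem k hb)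
        (show (n : ℝ) + 1 / 2 ∈ Icc (k a) (k b) by rw [ea, eb]; constructor <;> linarith)
      obtain ⟨l, hl⟩ := hn c hc
      rw [hkint c l hl] at hc'
      have h1 : (n : ℝ) < l := by linarith
      have h2 : (l : ℝ) < n + 1 := by linarith
      have h1' : n < l := by exact_mod_cast h1
      have h2' : l < n + 1 := by exact_mod_cast h2
      omega
  have hkxy : k x = k y := by
    rcases le_total (k x) (k y) with h | h
    · exact key x hx y hy h
    · exact (key y hy x hx h).symm
  obtain ⟨n, hn'⟩ := hn x hx
  obtain ⟨m, hm'⟩ := hn y hy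
  rw [hkint x n hn', hkint y m hm'] at hkxy
  have : n = m := by exact_mod_cast hkxy
  rw [hn', hm', this]

/-- In the lower half-plane, a curve `β` from a point `p` on the left to a point `q` on the right,
together with the vertical segments from these points to the boundary, separates the origin from
the points of larger norm. The closed curve that is formed by `β` and the reflected points would
otherwise have a continuous logarithm, but the argument grows by `2π` around it. -/
theorem not_disjoint_of_separating {β T : Set ℂ} {p q b : ℂ} (hβc : IsCompact β)
    (hβ : IsPreconnected β) (hβim : ∀ z ∈ β, z.im < 0) (hp : p ∈ β) (hq : q ∈ β) (hp0 : p.re < 0)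
    (hq0 : 0 < q.re) (hT : IsPreconnected T) (hTim : ∀ z ∈ T, z.im ≤ 0) (h0 : (0 : ℂ) ∈ T)
    (hb : b ∈ T) (hbβ : ∀ z ∈ β, ‖z‖ < ‖b‖) (hTβ : ∀ z ∈ T, z ∉ β)
    (hTp : ∀ z ∈ T, z ∉ segment ℝ p (conj p)) (hTq : ∀ z ∈ T, z ∉ segment ℝ q (conj q)) : False := by
  have hpi := Real.pi_pos
  have hpim := hβim p hp
  have hqim := hβim q hq
  set S : Set ℂ := segment ℝ p (conj p) ∪ segment ℝ (conj p) (conj q) ∪ segment ℝ q (conj q) with hS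
  have hSc : IsPreconnected S := by
    refine IsPreconnected.union (conj q) (Or.inr (right_mem_segment ℝ _ _))
      (right_mem_segment ℝ _ _) ?_ (convex_segment _ _).isPreconnected
    exact IsPreconnected.union (conj p) (right_mem_segment ℝ _ _) (left_mem_segment ℝ _ _)
      (convex_segment _ _).isPreconnected (convex_segment _ _).isPreconnected
  have hseg_compact : ∀ x y : ℂ, IsCompact (segment ℝ x y) := fun x y => by
    rw [segment_eq_image_lineMap]
    exact isCompact_Icc.image AffineMap.lineMap_continuous
  have hScomp : IsCompact S := ((hseg_compact _ _).union (hseg_compact _ _)).union (hseg_compact _ _)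
  have hpS : p ∈ S := Or.inl (Or.inl (left_mem_segment ℝ _ _))
  have hqS : q ∈ S := Or.inr (left_mem_segment ℝ _ _)
  -- the three segments avoid the negative imaginary half-axis
  have hmid : ∀ z ∈ segment ℝ (conj p) (conj q), 0 < z.im := by
    refine fun z hz => (convex_halfSpace_gt (f := Complex.im) Complex.imLm.isLinear 0).segment_subset
      ?_ ?_ hz
    · change 0 < (conj p).im; rw [Complex.conj_im]; linarith
    · change 0 < (conj q).im; rw [Complex.conj_im]; linarith
  have hleft : ∀ z ∈ segment ℝ p (conj p), z.re < 0 := by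
    refine fun z hz => (convex_halfSpace_lt (f := Complex.re) Complex.reLm.isLinear 0).segment_subset
      hp0 ?_ hz
    change (conj p).re < 0; rwa [Complex.conj_re]
  have hright : ∀ z ∈ segment ℝ q (conj q), 0 < z.re := by
    refine fun z hz => (convex_halfSpace_gt (f := Complex.re) Complex.reLm.isLinear 0).segment_subset
      hq0 ?_ hz
    change 0 < (conj q).re; rwa [Complex.conj_re]
  have hSslit : ∀ z ∈ S, -Complex.I * z ∈ Complex.slitPlane := by
    intro z hz
    have e1 : (-Complex.I * z).re = z.im := by simp
    have e2 : (-Complex.I * z).im = -z.re := by simp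
    rw [Complex.mem_slitPlane_iff, e1, e2]
    rcases hz with (hz | hz) | hz
    · exact Or.inr (by linarith [hleft z hz])
    · exact Or.inl (hmid z hz)
    · exact Or.inr (by linarith [hright z hz])
  have hSnorm : ∀ z ∈ S, ‖z‖ < ‖b‖ := by
    have hconv : Convex ℝ (Metric.ball (0 : ℂ) ‖b‖) := convex_ball _ _
    have m1 : p ∈ Metric.ball (0 : ℂ) ‖b‖ := mem_ball_zero_iff.2 (hbβ p hp)
    have m2 : q ∈ Metric.ball (0 : ℂ) ‖b‖ := mem_ball_zero_iff.2 (hbβ q hq)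
    have m3 : conj p ∈ Metric.ball (0 : ℂ) ‖b‖ :=
      mem_ball_zero_iff.2 (by rw [RCLike.norm_conj]; exact hbβ p hp)
    have m4 : conj q ∈ Metric.ball (0 : ℂ) ‖b‖ :=
      mem_ball_zero_iff.2 (by rw [RCLike.norm_conj]; exact hbβ q hq)
    rintro z ((hz | hz) | hz)
    · exact mem_ball_zero_iff.1 (hconv.segment_subset m1 m3 hz)
    · exact mem_ball_zero_iff.1 (hconv.segment_subset m3 m4 hz)
    · exact mem_ball_zero_iff.1 (hconv.segment_subset m2 m4 hz)
  have hd : Disjoint T (β ∪ S) := by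
    rw [disjoint_left]
    rintro z hz (h | (h | h) | h)
    · exact hTβ z hz h
    · exact hTp z hz h
    · exact not_lt.2 (hTim z hz) (hmid z h)
    · exact hTq z hz h
  obtain ⟨f, hf, hf'⟩ := exists_log_ratio (hβc.union hScomp).isClosed hT hd h0 hb
  have hnorm : ∀ z ∈ β ∪ S, ‖z‖ < ‖b‖ := fun z hz => hz.elim (hbβ z) (hSnorm z)
  have hb0 : b ≠ 0 := norm_pos_iff.1 ((norm_nonneg p).trans_lt (hbβ p hp))
  have hw : ∀ z ∈ β ∪ S, 1 + -(z / b) ∈ Complex.slitPlane := fun z hz =>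
    Complex.mem_slitPlane_of_norm_lt_one (by
      rw [norm_neg, norm_div, div_lt_one (norm_pos_iff.2 hb0)]; exact hnorm z hz)
  -- a continuous logarithm of `z` on the closed curve
  set F : ℂ → ℂ := fun z => f z + (Complex.log (1 + -(z / b)) + Complex.log (-b)) with hF
  have hFc : ContinuousOn F (β ∪ S) := by
    refine hf.add (ContinuousOn.add (ContinuousOn.clog ?_ hw) continuousOn_const)
    fun_prop
  have hFexp : ∀ z ∈ β ∪ S, Complex.exp (F z) = z := by
    intro z hz
    rw [hF]
    simp only
    rw [Complex.exp_add, Complex.exp_add, Complex.exp_log (Complex.slitPlane_ne_zero (hw z hz)),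
      Complex.exp_log (neg_ne_zero.2 hb0)]
    have e : (1 + -(z / b)) * -b = z - b := by field_simp; ring
    rw [e, hf' z hz, sub_zero]
  set G : ℂ → ℂ := fun z => Complex.log (-Complex.I * z) + (Real.pi / 2 : ℝ) * Complex.I with hG
  have hGc : ContinuousOn G S :=
    (ContinuousOn.clog (by fun_prop) hSslit).add continuousOn_const
  have hGexp : ∀ z ∈ S, Complex.exp (G z) = z := by
    intro z hz
    have e2 : Complex.exp (((Real.pi / 2 : ℝ) : ℂ) * Complex.I) = Complex.I := by
      push_cast; exact Complex.exp_pi_div_two_mul_I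
    rw [hG]
    simp only
    rw [Complex.exp_add, Complex.exp_log (Complex.slitPlane_ne_zero (hSslit z hz)), e2]
    linear_combination (-z) * Complex.I_mul_I
  have hβslit : ∀ z ∈ β, z ∈ Complex.slitPlane := fun z hz => Or.inr (hβim z hz).ne
  -- on `β` the function `F` is compared with the principal branch, and on the segments with the branch
  -- `G`; the two branches agree at `q`, and differ by `2π i` at `p`
  have h1 := sub_eq_sub_of_exp_eq hβ (hFc.mono subset_union_left)
    (ContinuousOn.clog continuousOn_id hβslit) (fun z hz => by
      rw [hFexp z (Or.inl hz)]
      exact (Complex.exp_log (Complex.slitPlane_ne_zero (hβslit z hz))).symm) hp hq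
  have h2 := sub_eq_sub_of_exp_eq hSc (hFc.mono subset_union_right) hGc
    (fun z hz => by rw [hFexp z (Or.inr hz), hGexp z hz]) hpS hqS
  simp only [id] at h1
  have h3 : (G p).im - p.arg = (G q).im - q.arg := by
    have : G p - Complex.log p = G q - Complex.log q := by linear_combination h1 - h2
    have := congrArg Complex.im this
    simpa only [Complex.sub_im, Complex.log_im] using this
  have hGim : ∀ z, (G z).im = (-Complex.I * z).arg + Real.pi / 2 := fun z => by
    rw [hG]
    simp only
    rw [Complex.add_im, Complex.log_im, Complex.im_ofReal_mul, Complex.I_im, mul_one]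
  rw [hGim, hGim] at h3
  have a1 : Real.pi / 2 < (-Complex.I * p).arg := by
    have hre : (-Complex.I * p).re < 0 := by simpa using hpim
    have him : 0 ≤ (-Complex.I * p).arg := Complex.arg_nonneg_iff.2 (by simpa using hp0.le)
    by_contra hle
    push Not at hle
    exact not_le.2 hre (Complex.abs_arg_le_pi_div_two_iff.1 (by rwa [abs_of_nonneg him]))
  have a2 : p.arg < 0 := Complex.arg_neg_iff.2 hpim
  have a3 : (-Complex.I * q).arg < 0 := Complex.arg_neg_iff.2 (by simpa using hq0)
  have a4 : -(Real.pi / 2) ≤ q.arg := (abs_le.1 (Complex.abs_arg_le_pi_div_two_iff.2 hq0.le)).1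
  linarith

/-! ### Exclusion of the symmetric Stokes corner -/

theorem stokesCorner_eq_zero {z : ℂ} (h : -‖z‖ ≤ 2 * z.im) : stokesCorner z = 0 := by
  have hpi := Real.pi_pos
  unfold stokesCorner
  refine if_neg ?_
  rintro ⟨h1, h2⟩
  have hz : z ≠ 0 := by
    rintro rfl
    rw [Complex.arg_zero] at h2
    linarith
  have hz0 : 0 < ‖z‖ := norm_pos_iff.2 hz
  have hcos : 1 / 2 < Real.cos (z.arg + Real.pi / 2) := by
    rw [← Real.cos_pi_div_three, ← Real.cos_abs (z.arg + Real.pi / 2)]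
    exact Real.cos_lt_cos_of_nonneg_of_le_pi (abs_nonneg _) (by linarith)
      (abs_lt.2 ⟨by linarith, by linarith⟩)
  rw [Real.cos_add_pi_div_two] at hcos
  rw [← Complex.norm_mul_sin_arg z] at h
  nlinarith

theorem stokesCorner_axis {t : ℝ} (ht : 0 < t) : stokesCorner ((t : ℂ) * -Complex.I) < 0 := by
  have hpi := Real.pi_pos
  unfold stokesCorner
  rw [Complex.arg_real_mul _ ht, Complex.arg_neg_I, if_pos ⟨by linarith, by linarith⟩, norm_mul,
    norm_neg, Complex.norm_I, mul_one, Complex.norm_real, Real.norm_of_nonneg ht.le,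
    show 3 / 2 * (-(Real.pi / 2) + Real.pi / 2) = 0 by ring, Real.cos_zero, mul_one]
  have h1 : 0 < t ^ (3 / 2 : ℝ) := Real.rpow_pos_of_pos ht _
  have h2 : 0 < √2 / 3 * t ^ (3 / 2 : ℝ) := by positivity
  linarith

theorem mem_segment_conj {p z : ℂ} (hz : z ∈ segment ℝ p (conj p)) (hp : p.im ≤ 0) :
    z.re = p.re ∧ p.im ≤ z.im ∧ ‖z‖ ≤ ‖p‖ := by
  obtain ⟨a, b, ha, hb, hab, rfl⟩ := hz
  refine ⟨?_, ?_, ?_⟩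
  · simp only [Complex.add_re, Complex.real_smul, Complex.re_ofReal_mul, Complex.conj_re]
    rw [← add_mul, hab, one_mul]
  · simp only [Complex.add_im, Complex.real_smul, Complex.im_ofReal_mul, Complex.conj_im]
    nlinarith
  · refine (norm_add_le _ _).trans (le_of_eq ?_)
    rw [norm_smul, norm_smul, RCLike.norm_conj, Real.norm_of_nonneg ha, Real.norm_of_nonneg hb,
      ← add_mul, hab, one_mul]

/-- By the minimum principle, a component of `{u < -η}` reaches the circular part of the
boundary. -/
theorem IsVariationalSolution.exists_mem_component {ρp ρm : ℝ} {u : ℂ → ℝ} {g : ℂ → ℂ}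
    (hu : IsVariationalSolution ρp ρm 0 u g) {η M : ℝ} (hη : 0 < η) (hM : M < 1) {z₀ : ℂ}
    (hz₀ : z₀ ∈ {z | z ∈ halfBall 1 ∧ u z < -η}) :
    ∃ b ∈ connectedComponentIn {z | z ∈ halfBall 1 ∧ u z < -η} z₀, M < ‖b‖ := by
  by_contra hcon
  push Not at hcon
  set S : Set ℂ := {z | z ∈ halfBall 1 ∧ u z < -η} with hS
  set D := connectedComponentIn S z₀ with hD
  have hSo : IsOpen S := (hu.continuousOn.mono subset_union_left).isOpen_inter_preimage
    (isOpen_halfBall 1) isOpen_Iio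
  have hDo : IsOpen D := hSo.connectedComponentIn
  have hDS : D ⊆ S := connectedComponentIn_subset _ _
  have hmem : z₀ ∈ D := mem_connectedComponentIn hz₀
  have hcl : closure D ⊆ {z : ℂ | ‖z‖ ≤ M ∧ z.im ≤ 0} := by
    refine closure_minimal (fun z hz => ⟨hcon z hz, (hDS hz).1.2.le⟩) ?_
    exact (isClosed_le continuous_norm continuous_const).inter
      (isClosed_le Complex.continuous_im continuous_const)
  have hcl' : closure D ⊆ halfBall 1 ∪ lid := fun z hz => by
    obtain ⟨h1, h2⟩ := hcl hz
    rcases h2.lt_or_eq with h3 | h3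
    · exact Or.inl ⟨by linarith, h3⟩
    · exact Or.inr ⟨by linarith, h3⟩
  -- a frontier point with `u z < -η` would belong to the component
  have hfr : ∀ z ∈ frontier D, -η ≤ u z := by
    intro z hz
    by_contra hlt
    push Not at hlt
    have hzcl : z ∈ closure D := frontier_subset_closure hz
    have hzS : z ∈ S := by
      rcases hcl' hzcl with h | h
      · exact ⟨h, hlt⟩
      · rw [hu.eq_zero_on_lid z h] at hlt; linarith
    have hpre : IsPreconnected (insert z D) := isPreconnected_connectedComponentIn.subset_closure
      (subset_insert _ _) (insert_subset hzcl subset_closure)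
    have hsub : insert z D ⊆ D := hpre.subset_connectedComponentIn (mem_insert_of_mem _ hmem)
      (insert_subset hzS hDS)
    rw [hDo.frontier_eq] at hz
    exact hz.2 (hsub (mem_insert _ _))
  have hb : Bornology.IsBounded D := (Metric.isBounded_closedBall (x := (0 : ℂ)) (r := M)).subset
    fun z hz => mem_closedBall_zero_iff.2 (hcon z hz)
  have hhol : HolGrad u D := hu.holGrad.mono fun z hz =>
    ⟨(hDS hz).1, by linarith [(hDS hz).2]⟩
  exact not_lt.2 (hhol.le_of_frontier hDo hb (hu.continuousOn.mono hcl') hfr z₀ hmem) hz₀.2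

section

variable {ρp ρm δ C : ℝ} {u : ℂ → ℝ} {g : ℂ → ℂ}

/-- If all blowup limits are Stokes corners, then `u` is negative on the vertical axis. -/
theorem IsLocalSol.exists_axis_neg (hu : IsLocalSol ρp ρm δ C u g)
    (hΓ : FreeBoundaryLipschitzNearZero u) (hρ : ρp ≠ ρm)
    (hall : ∀ (r : ℕ → ℝ) (u₀ χp χm : ℂ → ℝ), IsBlowupLimit u g r u₀ χp χm →
      limitShape ρp ρm u₀ χp χm 2) :
    ∃ t₀ > 0, ∀ t : ℝ, 0 < t → t < t₀ → u ((t : ℂ) * -Complex.I) < 0 := by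
  by_contra hcon
  push Not at hcon
  choose t ht0 ht1 htu using fun n : ℕ => hcon (1 / ((n : ℝ) + 1)) (by positivity)
  have hlim : Tendsto t atTop (𝓝 0) := squeeze_zero (fun n => (ht0 n).le) (fun n => (ht1 n).le)
    tendsto_one_div_add_atTop_nhds_zero_nat
  obtain ⟨κ, -, u₀, χp, χm, h⟩ := hu.exists_isBlowupLimit hΓ ht0 hlim
  have hshape : IsProfile _ u₀ χp χm := hall _ _ _ _ h
  have hI : (-Complex.I).im ≤ 0 := by simp
  have h1 := (h.isHalfLimit hu).tendsto hI
  have h2 : 0 ≤ u₀ (-Complex.I) := ge_of_tendsto' h1 fun m =>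
    div_nonneg (htu _) (Real.rpow_nonneg (ht0 _).le _)
  rw [hshape.1 _ hI] at h2
  have h3 := stokesCorner_axis one_pos
  rw [Complex.ofReal_one, one_mul] at h3
  have h4 : 0 < √|ρp - ρm| := Real.sqrt_pos.2 (abs_pos.2 (sub_ne_zero.2 hρ))
  nlinarith

/-- Points of `Ω⁺` near a point of an open set in which the limit vanishes. -/
theorem exists_mem_phasePlus_of_isProfile {s u₀ χp χm : ℂ → ℝ} {r : ℕ → ℝ}
    (hr : ∀ m, 0 < r m) (hs : IsProfile s u₀ χp χm)
    (hae : ∀ᵐ z ∂(volume.restrict (halfBall 1)),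
      Tendsto (fun m => chiPlus (halfBall (1 / r m)) (rescale u (r m)) z) atTop (𝓝 (χp z)))
    {W : Set ℂ} (hW : IsOpen W) (hWn : W.Nonempty) (hsub : W ⊆ halfBall 1)
    (h0 : ∀ z ∈ W, 0 ≤ s z) :
    ∃ z ∈ W, ∀ᶠ m in atTop, (r m : ℂ) * z ∈ phasePlus (halfBall 1) u := by
  have h1 := (ae_restrict_iff' (isOpen_halfBall 1).measurableSet).1 hae
  have h2 := (ae_restrict_iff' measurableSet_lowerHalf).1 hs.2
  obtain ⟨z, hzW, hz1, hz2⟩ := (Measure.dense_of_ae (h1.and h2)).inter_open_nonempty W hW hWn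
  refine ⟨z, hzW, ?_⟩
  have hzP : z ∈ phasePlus lowerHalf s :=
    interior_maximal (show W ⊆ {z | z ∈ lowerHalf ∧ 0 ≤ s z} from
      fun y hy => ⟨(hsub hy).2, h0 y hy⟩) hW hzW
  have hlim := hz1 (hsub hzW)
  rw [(hz2 (hsub hzW).2).1, (chiPlus_eq_of_mem hzP).1] at hlim
  filter_upwards [hlim.eventually (lt_mem_nhds one_half_lt_one)] with m hm
  refine (mem_phasePlus_rescale (hr m)).1 ?_
  by_contra hn
  rw [chiPlus, indicator_of_notMem hn] at hm
  norm_num at hm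

/-- If `Ω⁺` is connected near the origin, then not all blowup limits are symmetric Stokes corners:
a curve in `Ω⁺` that joins the two sides of the corner would cut off the fluid in the corner from
the circular part of the boundary, against the minimum principle. -/
theorem IsVariationalSolution.not_forall_stokesCorner (hv : IsVariationalSolution ρp ρm 0 u g)
    (hu : IsLocalSol ρp ρm δ C u g) (hΓ : FreeBoundaryLipschitzNearZero u) (hρ : ρp ≠ ρm)
    (hN : ∃ N ∈ 𝓝 (0 : ℂ), IsConnected (phasePlus (halfBall 1) u ∩ N))
    (hall : ∀ (r : ℕ → ℝ) (u₀ χp χm : ℂ → ℝ), IsBlowupLimit u g r u₀ χp χm →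
      limitShape ρp ρm u₀ χp χm 2) : False := by
  obtain ⟨N, hN, hconn⟩ := hN
  obtain ⟨t₀, ht₀, haxis⟩ := hu.exists_axis_neg hΓ hρ hall
  have hc : 0 < √|ρp - ρm| := Real.sqrt_pos.2 (abs_pos.2 (sub_ne_zero.2 hρ))
  obtain ⟨κ₀, -, u₀, χp, χm, h₀⟩ := hu.exists_isBlowupLimit hΓ (r := fun m => 1 / ((m : ℝ) + 1))
    (fun m => by positivity) tendsto_one_div_add_atTop_nhds_zero_nat
  obtain ⟨κ, hκ, hae⟩ := h₀.exists_subseq_ae hu 1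
  have h := h₀.comp hκ
  set r : ℕ → ℝ := ((fun m : ℕ => 1 / ((m : ℝ) + 1)) ∘ κ₀) ∘ κ
  have hshape : IsProfile (fun z => √|ρp - ρm| * stokesCorner z) u₀ χp χm := hall _ _ _ _ h
  have hzero : ∀ z : ℂ, z.im ≤ 0 → -‖z‖ ≤ 2 * z.im → u₀ z = 0 := fun z hz h1 => by
    rw [hshape.1 z hz]
    exact mul_eq_zero_of_right _ (stokesCorner_eq_zero h1)
  -- points of `Ω⁺` on both sides of the corner
  have hside : ∀ σ : ℝ, |σ| = 1 → ∃ z : ℂ, (‖z‖ < 1 ∧ z.im < 0 ∧ 0 < σ * z.re ∧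
      -(2 * z.im) < σ * z.re) ∧ ∀ᶠ m in atTop, (r m : ℂ) * z ∈ phasePlus (halfBall 1) u := by
    intro σ hσ
    have hσ2 : σ * σ = 1 := by rw [← abs_mul_abs_self, hσ, one_mul]
    refine exists_mem_phasePlus_of_isProfile (W := {z : ℂ | ‖z‖ < 1 ∧ z.im < 0 ∧ 0 < σ * z.re ∧
      -(2 * z.im) < σ * z.re}) h.r_pos hshape (hae.mono fun z hz => hz.2.1) ?_ ?_ ?_ ?_
    · have hre : Continuous fun z : ℂ => σ * z.re := by fun_prop
      have him : Continuous fun z : ℂ => -(2 * z.im) := by fun_prop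
      exact (isOpen_lt continuous_norm continuous_const).inter
        ((isOpen_lt Complex.continuous_im continuous_const).inter
        ((isOpen_lt continuous_const hre).inter (isOpen_lt him hre)))
    · refine ⟨((σ / 2 : ℝ) : ℂ) + ((-(1 / 8) : ℝ) : ℂ) * Complex.I, ?_, ?_, ?_, ?_⟩
      · refine (norm_add_le _ _).trans_lt ?_
        rw [norm_mul, Complex.norm_I, mul_one, Complex.norm_real, Complex.norm_real,
          Real.norm_eq_abs, abs_div, hσ]
        norm_num
      · simp
      · simp only [Complex.add_re, Complex.ofReal_re, Complex.re_ofReal_mul, Complex.I_re, mul_zero,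
          add_zero]
        linarith
      · simp only [Complex.add_re, Complex.add_im, Complex.ofReal_re, Complex.ofReal_im,
          Complex.re_ofReal_mul, Complex.im_ofReal_mul, Complex.I_re, Complex.I_im, mul_zero,
          add_zero, zero_add, mul_one]
        linarith
    · exact fun z hz => ⟨hz.1, hz.2.1⟩
    · intro z hz
      rw [stokesCorner_eq_zero, mul_zero]
      have h1 : σ * z.re ≤ ‖z‖ := (le_abs_self _).trans (by
        rw [abs_mul, hσ, one_mul]; exact Complex.abs_re_le_norm z)
      linarith [hz.2.2.2]
  obtain ⟨zL, hzL, hevL⟩ := hside (-1) (by norm_num)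
  obtain ⟨zR, hzR, hevR⟩ := hside 1 (by norm_num)
  -- the level `-e`, between the values on the axis and outside the corner
  have hIim : (((1 / 2 : ℝ) : ℂ) * -Complex.I).im < 0 := by
    rw [Complex.im_ofReal_mul]; simp
  have hInorm : ‖((1 / 2 : ℝ) : ℂ) * -Complex.I‖ < 1 := by
    rw [norm_mul, norm_neg, Complex.norm_I, Complex.norm_real]; norm_num
  have hneg : u₀ (((1 / 2 : ℝ) : ℂ) * -Complex.I) < 0 := by
    rw [hshape.1 _ hIim.le]
    exact mul_neg_of_pos_of_neg hc (stokesCorner_axis (by norm_num))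
  set e := -u₀ (((1 / 2 : ℝ) : ℂ) * -Complex.I) / 2 with he
  have he0 : 0 < e := by rw [he]; linarith
  have hunif := Metric.tendstoUniformlyOn_iff.1 ((h.isHalfLimit hu).unif 1) e he0
  have hmulN : ∀ z : ℂ, ∀ᶠ m in atTop, (r m : ℂ) * z ∈ N := by
    intro z
    have h1 : Tendsto (fun m => (r m : ℂ) * z) atTop (𝓝 0) := by
      have := ((Complex.continuous_ofReal.tendsto 0).comp h.r_tendsto).mul_const z
      simpa [Function.comp_def] using this
    exact h1 hN
  obtain ⟨m, hpP, hqP, hpN, hqN, hclose, hrt, hr1⟩ := (hevL.and (hevR.and ((hmulN zL).and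
    ((hmulN zR).and (hunif.and ((h.r_tendsto.eventually_lt_const ht₀).and
      (h.r_tendsto.eventually_lt_const one_pos))))))).exists
  have hr0 := h.r_pos m
  set R := r m with hR
  have hclose' : ∀ y ∈ lidBall 1, |u₀ y - rescale u R y| < e := fun y hy => by
    have := hclose y hy
    rwa [Real.dist_eq] at this
  set p : ℂ := (R : ℂ) * zL with hp
  set q : ℂ := (R : ℂ) * zR with hq
  have hRpow : 0 < R ^ (3 / 2 : ℝ) := Real.rpow_pos_of_pos hr0 _
  set η := e * R ^ (3 / 2 : ℝ) with hη
  have hη0 : 0 < η := by positivity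
  have hupos : ∀ z ∈ phasePlus (halfBall 1) u, z ∈ halfBall 1 ∧ 0 ≤ u z := fun z hz =>
    show z ∈ {z | z ∈ halfBall 1 ∧ 0 ≤ u z} from interior_subset hz
  -- a curve in `Ω⁺` from `p` to `q`
  set V := connectedComponentIn (phasePlus (halfBall 1) u) p with hV
  have hVo : IsOpen V := isOpen_interior.connectedComponentIn
  have hVsub : V ⊆ phasePlus (halfBall 1) u := connectedComponentIn_subset _ _
  have hpV : p ∈ V := mem_connectedComponentIn hpP
  have hqV : q ∈ V := hconn.isPreconnected.subset_connectedComponentIn ⟨hpP, hpN⟩ inter_subset_left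
    ⟨hqP, hqN⟩
  have hVc : IsConnected V := ⟨⟨p, hpV⟩, isPreconnected_connectedComponentIn⟩
  obtain ⟨γ, hγ⟩ := (hVo.isConnected_iff_isPathConnected.1 hVc).joinedIn p hpV q hqV
  set β : Set ℂ := range γ with hβ
  have hβc : IsCompact β := isCompact_range γ.continuous
  have hpβ : p ∈ β := ⟨0, γ.source⟩
  have hqβ : q ∈ β := ⟨1, γ.target⟩
  have hβP : ∀ z ∈ β, z ∈ halfBall 1 ∧ 0 ≤ u z := by
    rintro _ ⟨s, rfl⟩
    exact hupos _ (hVsub (hγ s))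
  obtain ⟨zM, hzM, hmax⟩ := hβc.exists_isMaxOn ⟨p, hpβ⟩ continuous_norm.continuousOn
  -- the component of `{u < -η}` in the corner
  set z₀ : ℂ := (R : ℂ) * (((1 / 2 : ℝ) : ℂ) * -Complex.I) with hz₀
  set S : Set ℂ := {z | z ∈ halfBall 1 ∧ u z < -η} with hS
  have hz₀' : z₀ = ((R / 2 : ℝ) : ℂ) * -Complex.I := by rw [hz₀]; push_cast; ring
  have hz₀S : z₀ ∈ S := by
    refine ⟨⟨?_, ?_⟩, ?_⟩
    · rw [hz₀, norm_mul, Complex.norm_real, Real.norm_of_nonneg hr0.le]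
      nlinarith [norm_nonneg (((1 / 2 : ℝ) : ℂ) * -Complex.I)]
    · rw [hz₀, Complex.im_ofReal_mul]
      exact mul_neg_of_pos_of_neg hr0 hIim
    · have h1 := (abs_lt.1 (hclose' _ ⟨hInorm, hIim.le⟩)).1
      have h2 : rescale u R (((1 / 2 : ℝ) : ℂ) * -Complex.I) < -e := by linarith
      rw [rescale, div_lt_iff₀ hRpow] at h2
      rw [hη, ← neg_mul]
      exact h2
  obtain ⟨b, hbD, hbM⟩ := hv.exists_mem_component hη0 (hβP zM hzM).1.1 hz₀S
  have hDS : connectedComponentIn S z₀ ⊆ S := connectedComponentIn_subset _ _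
  set A : Set ℂ := (fun t : ℝ => (t : ℂ) * -Complex.I) '' Icc 0 (R / 2) with hA
  have hAc : IsPreconnected A :=
    isPreconnected_Icc.image _ (Continuous.continuousOn (by fun_prop))
  have hAprop : ∀ z ∈ A, z.re = 0 ∧ z.im ≤ 0 ∧ (z.im < 0 → u z < 0) := by
    rintro _ ⟨t, ht, rfl⟩
    refine ⟨by simp, by simpa using ht.1, fun him => haxis t ?_ (by linarith [ht.2])⟩
    simpa using him
  -- the vertical segments lie outside the corner, where the rescaled solution is almost zero
  have hvert : ∀ y : ℂ, ‖y‖ < 1 → y.im < 0 → y.re ≠ 0 → -(2 * y.im) < |y.re| →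
      ∀ z ∈ A ∪ connectedComponentIn S z₀,
        z ∉ segment ℝ ((R : ℂ) * y) (conj ((R : ℂ) * y)) := by
    intro y hy1 hy2 hy3 hy4 z hz hseg
    have him : ((R : ℂ) * y).im ≤ 0 := by
      rw [Complex.im_ofReal_mul]
      exact (mul_neg_of_pos_of_neg hr0 hy2).le
    obtain ⟨h1, h2, h3⟩ := mem_segment_conj hseg him
    rw [Complex.re_ofReal_mul] at h1
    rw [Complex.im_ofReal_mul] at h2
    rw [norm_mul, Complex.norm_real, Real.norm_of_nonneg hr0.le] at h3
    rcases hz with hz | hz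
    · exact mul_ne_zero hr0.ne' hy3 (by rw [← h1, (hAprop z hz).1])
    · have hzS := hDS hz
      set x : ℂ := ((R⁻¹ : ℝ) : ℂ) * z with hx
      have hxz : (R : ℂ) * x = z := by
        rw [hx, ← mul_assoc, ← Complex.ofReal_mul, mul_inv_cancel₀ hr0.ne', Complex.ofReal_one,
          one_mul]
      have hxre : x.re = y.re := by
        rw [hx, Complex.re_ofReal_mul, h1, inv_mul_cancel_left₀ hr0.ne']
      have hxim : y.im ≤ x.im := by
        rw [hx, Complex.im_ofReal_mul, le_inv_mul_iff₀ hr0]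
        exact h2
      have hxim' : x.im < 0 := by
        rw [hx, Complex.im_ofReal_mul]
        exact mul_neg_of_pos_of_neg (inv_pos.2 hr0) hzS.1.2
      have hxn : ‖x‖ < 1 := by
        rw [hx, norm_mul, Complex.norm_real, Real.norm_of_nonneg (inv_pos.2 hr0).le,
          inv_mul_lt_iff₀ hr0]
        nlinarith
      have h4 : |y.re| ≤ ‖x‖ := hxre ▸ Complex.abs_re_le_norm x
      have h5 := (abs_lt.1 (hclose' x ⟨hxn, hxim'.le⟩)).2
      rw [hzero x hxim'.le (by linarith)] at h5
      have h6 : -e < rescale u R x := by linarith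
      rw [rescale, hxz, lt_div_iff₀ hRpow] at h6
      have h7 := hzS.2
      rw [hη] at h7
      linarith
  have hpre : p.re < 0 := by
    rw [hp, Complex.re_ofReal_mul]
    exact mul_neg_of_pos_of_neg hr0 (by linarith [hzL.2.2.1])
  have hqre : 0 < q.re := by
    rw [hq, Complex.re_ofReal_mul]
    exact mul_pos hr0 (by linarith [hzR.2.2.1])
  have hzLre : zL.re < 0 := by linarith [hzL.2.2.1]
  have hzRre : 0 < zR.re := by linarith [hzR.2.2.1]
  refine not_disjoint_of_separating (T := A ∪ connectedComponentIn S z₀) hβc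
    (isPreconnected_range γ.continuous) (fun z hz => (hβP z hz).1.2) hpβ hqβ hpre hqre ?_ ?_ ?_
    (Or.inr hbD) (fun z hz => (hmax hz).trans_lt hbM) ?_
    (hvert zL hzL.1 hzL.2.1 hzLre.ne ?_) (hvert zR hzR.1 hzR.2.1 hzRre.ne' ?_)
  · exact IsPreconnected.union z₀ ⟨R / 2, ⟨by linarith, le_rfl⟩, hz₀'.symm⟩
      (mem_connectedComponentIn hz₀S) hAc isPreconnected_connectedComponentIn
  · rintro z (hz | hz)
    · exact (hAprop z hz).2.1
    · exact (hDS hz).1.2.le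
  · exact Or.inl ⟨0, ⟨le_rfl, by linarith⟩, by simp⟩
  · rintro z (hz | hz) hzβ
    · exact not_lt.2 (hβP z hzβ).2 ((hAprop z hz).2.2 (hβP z hzβ).1.2)
    · linarith [(hβP z hzβ).2, (hDS hz).2]
  · rw [abs_of_neg hzLre]; linarith [hzL.2.2.2]
  · rw [abs_of_pos hzRre]; linarith [hzR.2.2.2]

end

end GravityCurrent

end

theorem mainTheorem11 (ρp ρm : ℝ) (hρp : 0 ≤ ρp) (hρm : 0 ≤ ρm) (hρ : ρp ≠ ρm)
    (u : ℂ → ℝ) (g : ℂ → ℂ)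
    (hu : IsVariationalSolution ρp ρm 0 u g)
    (h0 : (0 : ℂ) ∈ freeBoundary u)
    (hdecay : LipschitzDecay u)
    (hΓ : FreeBoundaryLipschitzNearZero u)
    (hfill : PhasesFillNearZero u) :
    Function.Injective (density ρp ρm) ∧
    (∀ r : ℕ → ℝ, (∀ m, 0 < r m) → Tendsto r atTop (𝓝 0) →
      ∃ κ : ℕ → ℕ, StrictMono κ ∧ ∃ u₀ χp χm : ℂ → ℝ, IsBlowupLimit u g (r ∘ κ) u₀ χp χm) ∧
    (∀ (r : ℕ → ℝ) (u₀ χp χm : ℂ → ℝ), IsBlowupLimit u g r u₀ χp χm →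
      ∃! i : Fin 4, BlowupAlternative ρp ρm u g u₀ χp χm i) ∧
    ((∃ N ∈ 𝓝 (0 : ℂ), IsConnected (phasePlus (halfBall 1) u ∩ N)) →
      ∀ (r : ℕ → ℝ) (u₀ χp χm : ℂ → ℝ), IsBlowupLimit u g r u₀ χp χm →
        ¬ BlowupAlternative ρp ρm u g u₀ χp χm 2) := by
  obtain ⟨δ, C, hloc⟩ := hu.exists_isLocalSol hdecay hfill
  obtain ⟨i, hM, hshape⟩ := hloc.exists_limitShape hΓ hρ
  have huniq : ∀ {u₀ χp χm : ℂ → ℝ} {j : Fin 4},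
      BlowupAlternative ρp ρm u g u₀ χp χm j → j = i := fun h =>
    density_injective hρ (tendsto_nhds_unique h.1 hM)
  refine ⟨density_injective hρ, fun r hr hr0 => hloc.exists_isBlowupLimit hΓ hr hr0,
    fun r u₀ χp χm h => ⟨i, ⟨hM, hshape r u₀ χp χm h⟩, fun j hj => huniq hj⟩,
    fun hN r u₀ χp χm _ halt => ?_⟩
  have hi : 2 = i := huniq halt
  exact hu.not_forall_stokesCorner hloc hΓ hρ hN fun r u₀ χp χm h => hi ▸ hshape r u₀ χp χm h
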